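/- **Setting.** Let $1\le m\le 3$, $\lambda>0$, $r_1,\dots,r_m>0$ with $\sum_k r_k=1$, and for $\varepsilon\in(0,1)$, $1\le k\le m$ let $\gamma^\varepsilon_k,\tilde r^\varepsilon_k\in\mathbb R$ satisfy $$\gamma^\varepsilon_k=\lambda\Big(\frac{2}{r_k}\sum_{k'=k+1}^m\frac{k'-k}{k}\,r_{k'}+1\Big)+O(\varepsilon),\qquad \tilde r^\varepsilon_k=r_k+\varepsilon r^*_k+O(\varepsilon^{3/2}),$$ with real numbers $r^*_k$, where $O(\varepsilon^p)$ is a function of $\varepsilon\in(0,1)$ bounded by a constant times $\varepsilon^p$. Put $q^\varepsilon_{\pm k}=\frac12 r_k(1\mp\gamma^\varepsilon_k\varepsilon^{1/2})$, and consider only those $\varepsilon\in(0,1)$ for which all these rates are nonnegative. Let $Q^k_t(y)$, $k\in\{\pm1,\dots,\pm m\}$, $y\in\mathbb Z+\frac12$, be independent Poisson processes with rates $q^\varepsilon_k$. The exclusion process $\eta_t\in\{-1,1\}^{\mathbb Z+1/2}$ ($1$ for occupied, $-1$ for empty) starts from an arbitrary random configuration $\eta_0$ independent of the $Q^k(y)$;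 whenever $Q^k(y)$ jumps, a particle hops from $y$ to $y+k$ if $y$ is occupied and $y+k$ is empty just before, and nothing happens otherwise. Let $N(t)$ be the net number of particles that crossed $0$ from left to right during $(0,t]$, and for $x\in\mathbb Z$ let $$h_t(x)=-2N(t)+\begin{cases}\sum_{0<y<x}\eta_t(y),&x\ge0,\\-\sum_{x<y<0}\eta_t(y),&x<0,\end{cases}\qquad Z^\varepsilon_t(x)=\exp\big(-\lambda\varepsilon^{1/2}h_t(x)+\varepsilon\nu_\varepsilon t\big),$$ $$\nu_\varepsilon=\sum_{k=1}^m\frac{k\,r_k}{4}\big(\gamma^\varepsilon_k u(\varepsilon)-v(\varepsilon)\big)+\frac{\lambda^2}{2}\sum_{k=1}^m\tilde r^\varepsilon_k\Big(k+\frac{\varepsilon\lambda^2(6k^2-5k)}{12}\Big),$$ where $u(\varepsilon)=\varepsilon^{-1/2}\sinh(2\lambda\varepsilon^{1/2})$ and $v(\varepsilon)=\varepsilon^{-1}(\cosh(2\lambda\varepsilon^{1/2})-1)$. Write $\|X\|_l=(\mathbb E|X|^l)^{1/l}$, $|f|_{a,l}=\sup_{x\in\mathbb Z}\|f(x)\|_l\,e^{-a\varepsilon|x|}$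 and $$N_{a,l,v}=\sup_{x\ne x'}|\varepsilon(x-x')|^{-v}\,\|Z^\varepsilon_0(x)-Z^\varepsilon_0(x')\|_l\,e^{-a\varepsilon(|x|+|x'|)},$$ all with values in $[0,\infty]$. **Proposition.** Let $\tilde T>0$, $a\ge0$ and let $j\ge1$ be an integer. There is a finite constant $C(a)$, and for each $u\in(0,1)$ a finite constant $C(a,u)$, such that for all $\varepsilon$ as above, all initial laws, all $t,t'\in[0,\varepsilon^{-2}\tilde T]$ and all $x,x'\in\mathbb Z$, $$|Z^\varepsilon_t|_{a,2j}\le C(a)\,|Z^\varepsilon_0|_{a,2j},$$ $$\|Z^\varepsilon_t(x)-Z^\varepsilon_t(x')\|_{2j}\le C(a,u)\,(\varepsilon|x-x'|)^{u/2}\,e^{a\varepsilon(|x|+|x'|)}\big(|Z^\varepsilon_0|_{a,2j}+N_{a,2j,u/2}\big),$$ $$\|Z^\varepsilon_t(x)-Z^\varepsilon_{t'}(x)\|_{2j}\le C(a,u)\,\big(1\vee|t-t'|^{u/4}\big)\,\varepsilon^{u/2}\,e^{2a\varepsilon|x|}\big(|Z^\varepsilon_0|_{a,2j}+N_{a,2j,u/2}\big).$$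 The constants may also depend on $\tilde T$, $j$, $m$, $\lambda$, $(r_k)$, $(r^*_k)$ and the families $(\gamma^\varepsilon_k)$, $(\tilde r^\varepsilon_k)$, but not on $\varepsilon$, $t$, $t'$, $x$, $x'$ or the initial law. -/

import Mathlib

open MeasureTheory ProbabilityTheory Filter Set
open scoped NNReal ENNReal Topology

universe w

noncomputable section

namespace FiniteRangeExclusion

/-! ### Parameters

Families indexed by the hopping distance `k = 1, …, m` are functions `ℕ → ℝ` of which only the
values at `k ∈ Finset.Icc 1 m` matter. Families that also depend on `ε` take `ε` first. -/

/-- The signed hopping distances `k = ±1, …, ±m`. -/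
def jumps (m : ℕ) : Finset ℤ := (Finset.Icc (-(m : ℤ)) (m : ℤ)).erase 0

/-- The hopping rates `q_{±k} = (r_k / 2) (1 ∓ γ_k ε^{1/2})`, for `k ≥ 1`. -/
def hopRate (r γ : ℕ → ℝ) (ε : ℝ) (k : ℤ) : ℝ :=
  1 / 2 * r k.natAbs * (1 - (k.sign : ℝ) * γ k.natAbs * √ε)

/-- `u(ε) = ε^{-1/2} sinh (2 λ ε^{1/2})`. -/
def uFun (lam ε : ℝ) : ℝ := Real.sinh (2 * lam * √ε) / √ε

/-- `v(ε) = ε^{-1} (cosh (2 λ ε^{1/2}) - 1)`. -/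
def vFun (lam ε : ℝ) : ℝ := (Real.cosh (2 * lam * √ε) - 1) / ε

/-- The constant `ν_ε` of the exponential growth:
`ν_ε = ∑_k (k r_k / 4) (γ_k u(ε) - v(ε)) + (λ² / 2) ∑_k r̃_k (k + ε λ² (6 k² - 5 k) / 12)`. -/
def nu (m : ℕ) (lam : ℝ) (r γ rt : ℕ → ℝ) (ε : ℝ) : ℝ :=
  ∑ k ∈ Finset.Icc 1 m, 1 / 4 * (k : ℝ) * r k * (γ k * uFun lam ε - vFun lam ε)
    + lam ^ 2 / 2 * ∑ k ∈ Finset.Icc 1 m,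
        rt k * ((k : ℝ) + ε / 12 * (6 * (k : ℝ) ^ 2 - 5 * (k : ℝ)) * lam ^ 2)

/-- The leading value of `γ_k`: `λ ((2 / r_k) ∑_{k' = k+1}^m ((k' - k) / k) r_{k'} + 1)`. -/
def gammaLimit (m : ℕ) (lam : ℝ) (r : ℕ → ℝ) (k : ℕ) : ℝ :=
  lam * (2 / r k * ∑ k' ∈ Finset.Icc (k + 1) m, ((k' : ℝ) - (k : ℝ)) / (k : ℝ) * r k' + 1)

/-! ### Poisson clocks -/

/-- `Q i`, `i : ι`, are mutually independent Poisson processes of rates `rate i`, relative to the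
filtration `ℱ`: they are `ℱ`-adapted counting processes, and the increments over `(s, t]` are
Poisson distributed, mutually independent in `i`, and jointly independent of `ℱ s`. -/
structure IsPoissonClocks {Ω ι : Type*} {mΩ : MeasurableSpace Ω} (P : Measure Ω)
    (ℱ : Filtration ℝ≥0 mΩ) (rate : ι → ℝ≥0) (Q : ι → ℝ≥0 → Ω → ℕ) : Prop where
  adapted : ∀ i, Adapted ℱ (Q i)
  counting : ∀ᵐ ω ∂P, ∀ i, Q i 0 ω = 0 ∧ Monotone (fun t => Q i t ω) ∧
    ∀ t, ContinuousWithinAt (fun t => Q i t ω) (Ici t) t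
  law : ∀ i s t, s ≤ t →
    P.map (fun ω => Q i t ω - Q i s ω) = poissonMeasure (rate i * (t - s))
  indep : ∀ s t, s ≤ t → iIndepFun (fun i ω => Q i t ω - Q i s ω) P
  indep_past : ∀ s t, s ≤ t →
    Indep (ℱ s)
      (⨆ i, MeasurableSpace.comap (fun ω => Q i t ω - Q i s ω) inferInstance) P

/-- The counting path `q` jumps at time `s`. -/
def Rings (q : ℝ≥0 → ℕ) (s : ℝ≥0) : Prop := 0 < s ∧ ∀ s' < s, q s' < q s

/-! ### The exclusion process

The site `i + 1/2` of the half-integer lattice is represented by the integer `i`, so that the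
integer point `x` lies between the sites `x - 1` and `x`. A configuration is a map `ℤ → Bool`, with
`true` for an occupied site. -/

/-- The occupation variable in spin convention. -/
def spin (b : Bool) : ℤ := if b then 1 else -1

/-- The number of hops from site `i` to site `i + k` performed in `(0, t]`, when `q` is the path of
the clock for these attempts and `η` the path of configurations: the ringing times at which, just
before, site `i` was occupied and site `i + k` was empty. -/
def hopCount (q : ℝ≥0 → ℕ) (η : ℝ≥0 → ℤ → Bool) (k i : ℤ) (t : ℝ≥0) : ℕ :=
  Set.ncard {s : ℝ≥0 | s ≤ t ∧ Rings q s ∧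
    ∀ᶠ s' in 𝓝[<] s, η s' i = true ∧ η s' (i + k) = false}

/-- `η` is the exclusion process driven by the Poisson clocks `Q (k, i)`, which ring at the
attempted hops from site `i` to site `i + k`, at rate `rate k`. The initial configuration is
`ℱ 0`-measurable, hence independent of the clocks, and otherwise arbitrary. -/
structure IsExclusionProcess {Ω : Type*} {mΩ : MeasurableSpace Ω} (P : Measure Ω)
    (ℱ : Filtration ℝ≥0 mΩ) (m : ℕ) (rate : ℤ → ℝ≥0)
    (Q : jumps m × ℤ → ℝ≥0 → Ω → ℕ) (η : ℝ≥0 → Ω → ℤ → Bool) : Prop where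
  clocks : IsPoissonClocks P ℱ (fun c : jumps m × ℤ => rate c.1) Q
  adapted : Adapted ℱ η
  /-- Each hop into a site raises its spin by `2`, each hop out of it lowers the spin by `2`. -/
  dynamics : ∀ᵐ ω ∂P, ∀ (t : ℝ≥0) (i : ℤ),
    spin (η t ω i) = spin (η 0 ω i)
      + 2 * ∑ k : jumps m,
          ((hopCount (fun s => Q (k, i - k) s ω) (fun s => η s ω) k (i - k) t : ℤ)
            - (hopCount (fun s => Q (k, i) s ω) (fun s => η s ω) k i t : ℤ))

variable {Ω : Type*}

/-- The net number of particles that cross the point `0` during `(0, t]`, counting those that move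
to the right as positive. A hop from `i` to `i + k` crosses `0` from left to right if
`i < 0 ≤ i + k`, and from right to left if `i + k < 0 ≤ i`. -/
def netFlow {m : ℕ} (Q : jumps m × ℤ → ℝ≥0 → Ω → ℕ) (η : ℝ≥0 → Ω → ℤ → Bool)
    (t : ℝ≥0) (ω : Ω) : ℤ :=
  ∑ k : jumps m,
    (∑ i ∈ Finset.Ico (-(k : ℤ)) 0,
        (hopCount (fun s => Q (k, i) s ω) (fun s => η s ω) k i t : ℤ)
      - ∑ i ∈ Finset.Ico 0 (-(k : ℤ)),
        (hopCount (fun s => Q (k, i) s ω) (fun s => η s ω) k i t : ℤ))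

/-- The height function: `h_0(0) = 0`, the increment `h_t(x + 1) - h_t(x)` is the spin at the site
between, and a particle that crosses `x` from left to right lowers `h(x)` by `2`. -/
def height {m : ℕ} (Q : jumps m × ℤ → ℝ≥0 → Ω → ℕ) (η : ℝ≥0 → Ω → ℤ → Bool)
    (t : ℝ≥0) (x : ℤ) (ω : Ω) : ℤ :=
  -2 * netFlow Q η t ω
    + (∑ i ∈ Finset.Ico 0 x, spin (η t ω i) - ∑ i ∈ Finset.Ico x 0, spin (η t ω i))

/-- `Z_t(x) = exp (-λ ε^{1/2} h_t(x) + ε ν t)`. -/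
def Zfield {m : ℕ} (lam ε ν : ℝ) (Q : jumps m × ℤ → ℝ≥0 → Ω → ℕ)
    (η : ℝ≥0 → Ω → ℤ → Bool) (t : ℝ≥0) (x : ℤ) (ω : Ω) : ℝ :=
  Real.exp (-lam * √ε * (height Q η t x ω : ℝ) + ε * ν * (t : ℝ))

/-! ### Weighted norms, with values in `[0, ∞]` -/

/-- `|f|_{a,l} = sup_x ‖f(x)‖_l e^{-aε|x|}`. -/
def weightedNorm {mΩ : MeasurableSpace Ω} (P : Measure Ω) (ε a : ℝ) (l : ℝ≥0∞)
    (f : ℤ → Ω → ℝ) : ℝ≥0∞ :=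
  ⨆ x : ℤ, eLpNorm (f x) l P * ENNReal.ofReal (Real.exp (-(a * ε * |(x : ℝ)|)))

/-- `N_{a,l,v} = sup_{x ≠ x'} |ε (x - x')|^{-v} ‖f(x) - f(x')‖_l e^{-aε(|x| + |x'|)}`. -/
def holderNorm {mΩ : MeasurableSpace Ω} (P : Measure Ω) (ε a : ℝ) (l : ℝ≥0∞) (v : ℝ)
    (f : ℤ → Ω → ℝ) : ℝ≥0∞ :=
  ⨆ (x : ℤ) (x' : ℤ) (_ : x ≠ x'),
    ENNReal.ofReal (|ε * ((x : ℝ) - (x' : ℝ))| ^ (-v)) * eLpNorm (f x - f x') l P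
      * ENNReal.ofReal (Real.exp (-(a * ε * (|(x : ℝ)| + |(x' : ℝ)|))))

end FiniteRangeExclusion

end

/-! The field `Z` is a microscopic Hopf–Cole transform. A hop multiplies the values of `Z` at the
points that it crosses by `exp (±2θ)`, where `θ = λ √ε`. The prescribed `γ_k` make the drift of
`Z(y)`, in every configuration, equal to `L Z(y)`, plus the discrete gradient of a local quantity of
size `ε Z`, plus an error of size `ε² Z`; here `L` is `lop`, the generator of the symmetric walk
with weights `r_k`. Up to order `θ³` this is a finite identity between polynomials in six spins
(`mainTerm_sum`, `exists_drift_bound`), and `ν_ε` removes the constant part.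

Let `G_τ` solve the heat equation and consider `X_s = ∑_y G_{t-s}(y) Z_s(y)`. Summation by parts
cancels `L` against the time derivative of the kernel (`DriftBound.abs_pairing_le`). The drift of
`X` is then at most of order `∑ (ε |∇G| + ε² |G|) Z`. Single jumps of `Z` have size `√ε Z`, so the
quadratic variation grows at a rate of order `ε ∑ G² Z²`. For the heat kernel `∑ |∇G|` and `∑ G²`
decay like `τ^(-1/2)`; integrated over a time `ε⁻² T`, all contributions stay bounded.

Moments are controlled without stochastic integrals. In a window of length `h` at most one relevant
clock rings, up to an event of probability `O(h²)`, even with exponential weights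
(`moment_step_le`). A Taylor expansion then produces the generator of the even power `(X - Y)^p`
with an error `O(h²)` (`exists_moment_step`), and such errors disappear when the windows are refined
(`le_of_short_steps`). By Young's inequality the integrated generator is at most half the supremum
of `E (X - Y)^p`, which is absorbed, plus terms that involve only weighted moments of `Z`
(`DriftBound.moment_pairing_le`). That argument needs weights of finite support; the cutoff is
removed in `DriftBound.moment_kernel_le`.

Three kernels give the three estimates. The heat kernel seen from `x` bounds the weighted moments of
`Z` by their initial value plus a small multiple of themselves over a short macroscopic time, and
finitely many such intervals cover `[0, ε⁻² T]`. The difference of the kernels seen from `x` and `x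
+ d` gains a factor `(d / √τ)^v`, `v = u/2`, by interpolation; translation turns its initial term
into an average of initial increments, and the variation `τ^(-1/2-v)` is integrable because `v <
1/2`. For increments in time, the heat kernel is started at time `s` and `Y = Z_s(x)`; the initial
term is the average of `Z_s(y) - Z_s(x)` against the heat kernel, to which the spatial bound
applies.

The heat kernel is an exponential in the Banach algebra of operators on bounded functions.
Exponential weights are tilts of the generator, sums over space are bounded by operator norms, and
the gradient bound comes from the fluctuations of the Poisson number of unit hops, which is where
`r_1 > 0` enters. -/

noncomputable section

namespace FiniteRangeExclusion

/-! ### Counting paths -/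

/-- A counting path: monotone and right-continuous. -/
structure IsCountingPath (q : ℝ≥0 → ℕ) : Prop where
  mono : Monotone q
  rightCont : ∀ t, ContinuousWithinAt q (Ici t) t

theorem rings_strictMono {q : ℝ≥0 → ℕ} {s s' : ℝ≥0} (h : s < s') (hs' : Rings q s') :
    q s < q s' := hs'.2 s h

theorem ringSet_finite {q : ℝ≥0 → ℕ} (hq : Monotone q) (a b : ℝ≥0) :
    {s | a < s ∧ s ≤ b ∧ Rings q s}.Finite := by
  refine Set.Finite.of_finite_image ((Set.finite_Iic (q b)).subset ?_) ?_ (f := q)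
  · rintro _ ⟨s, ⟨-, h, -⟩, rfl⟩
    exact hq h
  · intro s hs s' hs' h
    rcases lt_trichotomy s s' with h' | h' | h'
    · exact absurd h (rings_strictMono h' hs'.2.2).ne
    · exact h'
    · exact absurd h (rings_strictMono h' hs.2.2).ne'

/-- The count is injective on ringing times, with values in `(q a, q b]`. Only an inequality holds,
since one ringing may raise the count by more than one. -/
theorem ncard_ringSet_le {q : ℝ≥0 → ℕ} (hq : Monotone q) {a b : ℝ≥0} :
    {s | a < s ∧ s ≤ b ∧ Rings q s}.ncard ≤ q b - q a := by
  have := Set.ncard_le_ncard_of_injOn (s := {s | a < s ∧ s ≤ b ∧ Rings q s})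
    (t := (↑(Finset.Ioc (q a) (q b)) : Set ℕ)) q ?_ ?_ (Finset.finite_toSet _)
  · rwa [Set.ncard_coe_finset, Nat.card_Ioc] at this
  · rintro s ⟨h1, h2, h3⟩
    simpa using ⟨rings_strictMono h1 h3, hq h2⟩
  · intro s hs s' hs' h
    rcases lt_trichotomy s s' with h' | h' | h'
    · exact absurd h (rings_strictMono h' hs'.2.2).ne
    · exact h'
    · exact absurd h (rings_strictMono h' hs.2.2).ne'

theorem IsCountingPath.exists_rings {q : ℝ≥0 → ℕ} (hq : IsCountingPath q) {a b : ℝ≥0}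
    (h : q a < q b) : ∃ s, a < s ∧ s ≤ b ∧ Rings q s := by
  set A : Set ℝ≥0 := {s | q a < q s} with hA
  have hbA : b ∈ A := h
  have hne : A.Nonempty := ⟨b, hbA⟩
  have hle : ∀ s ∈ A, a < s := fun s hs => by
    by_contra! hc
    exact absurd (hq.mono hc) (not_le.mpr hs)
  -- The first time at which the count exceeds `q a`: right continuity puts it into the set, and
  -- minimality makes it a ringing time.
  set σ := sInf A with hσ
  have hσA : σ ∈ A := by
    by_contra hc
    have h1 : ∀ᶠ s in 𝓝[≥] σ, q s = q σ :=
      (hq.rightCont σ).eventually (p := fun z => z = q σ) (by simp [nhds_discrete])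
    obtain ⟨u, hu, hu'⟩ := (mem_nhdsGE_iff_exists_Ico_subset.mp h1)
    obtain ⟨s, hs, hsu⟩ := exists_lt_of_csInf_lt hne (show sInf A < u from hu)
    have h2 : q s = q σ := hu' ⟨csInf_le (OrderBot.bddBelow _) hs, hsu⟩
    exact hc (show q a < q σ by rw [← h2]; exact hs)
  refine ⟨σ, hle _ hσA, csInf_le (OrderBot.bddBelow _) hbA, lt_of_le_of_lt (zero_le) (hle _ hσA), ?_⟩
  intro s' hs'
  have h3 : ¬ q a < q s' := fun hc => absurd (csInf_le (OrderBot.bddBelow A) (show s' ∈ A from hc)) (not_le.mpr hs')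
  exact lt_of_le_of_lt (not_lt.mp h3) hσA

/-! ### Hops in a time window -/

/-- Just before time `s`, site `i` is occupied and site `i + k` is empty. -/
def HopAllowed (η : ℝ≥0 → ℤ → Bool) (k i : ℤ) (s : ℝ≥0) : Prop :=
  ∀ᶠ s' in 𝓝[<] s, η s' i = true ∧ η s' (i + k) = false

/-- The number of hops from `i` to `i + k` performed in `(a, b]`. -/
def hopInc (q : ℝ≥0 → ℕ) (η : ℝ≥0 → ℤ → Bool) (k i : ℤ) (a b : ℝ≥0) : ℕ :=
  Set.ncard {s : ℝ≥0 | a < s ∧ s ≤ b ∧ Rings q s ∧ HopAllowed η k i s}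

/-- The two sets agree because `Rings` already demands `0 < s`. -/
theorem hopCount_eq_hopInc (q : ℝ≥0 → ℕ) (η : ℝ≥0 → ℤ → Bool) (k i : ℤ) (t : ℝ≥0) :
    hopCount q η k i t = hopInc q η k i 0 t := by
  unfold hopCount hopInc
  congr 1
  ext s
  simp only [Set.mem_ofPred_eq, HopAllowed, Rings]
  tauto

theorem hopInc_le {q : ℝ≥0 → ℕ} (hq : Monotone q) (η : ℝ≥0 → ℤ → Bool) (k i : ℤ) (a b : ℝ≥0) :
    hopInc q η k i a b ≤ q b - q a :=
  (Set.ncard_le_ncard (t := {s | a < s ∧ s ≤ b ∧ Rings q s})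
    (fun _ hs => ⟨hs.1, hs.2.1, hs.2.2.1⟩) (ringSet_finite hq a b)).trans (ncard_ringSet_le hq)

theorem hopInc_add {q : ℝ≥0 → ℕ} (hq : Monotone q) (η : ℝ≥0 → ℤ → Bool) (k i : ℤ)
    {a b c : ℝ≥0} (hab : a ≤ b) (hbc : b ≤ c) :
    hopInc q η k i a c = hopInc q η k i a b + hopInc q η k i b c := by
  unfold hopInc
  have hf : ∀ x y, {s : ℝ≥0 | x < s ∧ s ≤ y ∧ Rings q s ∧ HopAllowed η k i s}.Finite :=
    fun x y => (ringSet_finite hq x y).subset fun _ hs => ⟨hs.1, hs.2.1, hs.2.2.1⟩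
  rw [← Set.ncard_union_eq _ (hf a b) (hf b c)]
  · congr 1
    ext s
    simp only [Set.mem_ofPred_eq, Set.mem_union]
    constructor
    · rintro ⟨h1, h2, h3⟩
      rcases le_or_gt s b with h | h
      · exact Or.inl ⟨h1, h, h3⟩
      · exact Or.inr ⟨h, h2, h3⟩
    · rintro (⟨h1, h2, h3⟩ | ⟨h1, h2, h3⟩)
      · exact ⟨h1, h2.trans hbc, h3⟩
      · exact ⟨hab.trans_lt h1, h2, h3⟩
  · rw [Set.disjoint_left]
    rintro s ⟨-, h, -⟩ ⟨h', -⟩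
    exact absurd h (not_le.mpr h')

theorem hopInc_eq_zero {q : ℝ≥0 → ℕ} (η : ℝ≥0 → ℤ → Bool) (k i : ℤ) {a b : ℝ≥0}
    (h : ∀ s, a < s → s ≤ b → ¬ Rings q s) : hopInc q η k i a b = 0 := by
  unfold hopInc
  convert Set.ncard_empty ℝ≥0
  ext s
  simp only [Set.mem_ofPred_eq, Set.mem_empty_iff_false, iff_false]
  exact fun hs => h s hs.1 hs.2.1 hs.2.2.1

/-! ### Paths of the exclusion process -/

variable {m : ℕ}

/-- A path of clocks and configurations that obeys the rules of the exclusion process. -/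
structure IsExclusionPath (q : jumps m × ℤ → ℝ≥0 → ℕ) (η : ℝ≥0 → ℤ → Bool) : Prop where
  counting : ∀ c, IsCountingPath (q c)
  dynamics : ∀ (t : ℝ≥0) (i : ℤ), spin (η t i) = spin (η 0 i)
      + 2 * ∑ k : jumps m, ((hopCount (q (k, i - k)) η k (i - k) t : ℤ)
            - (hopCount (q (k, i)) η k i t : ℤ))

theorem spin_injective : Function.Injective spin := by
  intro a b; cases a <;> cases b <;> simp [spin]

theorem jumps_bounds (k : jumps m) : (k : ℤ) ≠ 0 ∧ -(m : ℤ) ≤ k ∧ (k : ℤ) ≤ m := by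
  have := k.2
  simpa [jumps] using this

namespace IsExclusionPath

variable {q : jumps m × ℤ → ℝ≥0 → ℕ} {η : ℝ≥0 → ℤ → Bool}

theorem hopCount_add (hp : IsExclusionPath q η) (c : jumps m × ℤ) {a b : ℝ≥0} (hab : a ≤ b) :
    hopCount (q c) η c.1 c.2 b = hopCount (q c) η c.1 c.2 a + hopInc (q c) η c.1 c.2 a b := by
  rw [hopCount_eq_hopInc, hopCount_eq_hopInc, hopInc_add (hp.counting c).mono _ _ _ zero_le hab]

/-- The configuration at a site does not change while no adjacent clock rings. -/
theorem config_eq (hp : IsExclusionPath q η) {a b : ℝ≥0} (hab : a ≤ b) {i : ℤ}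
    (h : ∀ k : jumps m, ∀ s, a < s → s ≤ b → ¬ Rings (q (k, i - k)) s ∧ ¬ Rings (q (k, i)) s) :
    η b i = η a i := by
  apply spin_injective
  rw [hp.dynamics b, hp.dynamics a]
  congr 2
  refine Finset.sum_congr rfl fun k _ => ?_
  rw [hp.hopCount_add (k, i - k) hab, hp.hopCount_add (k, i) hab,
    hopInc_eq_zero η k (i - k) fun s h1 h2 => (h k s h1 h2).1,
    hopInc_eq_zero η k i fun s h1 h2 => (h k s h1 h2).2]
  simp

/-- If all the clocks near a clock `c` that ring in `(a, b]` ring at the same time, then the number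
of hops at `c` is read off from the configuration at time `a`. -/
theorem hopInc_eq_ite (hp : IsExclusionPath q η) {a b : ℝ≥0} (c : jumps m × ℤ)
    (h : ∀ c' c'' : jumps m × ℤ, |c'.2 - c.2| ≤ 2 * m → |c''.2 - c.2| ≤ 2 * m → ∀ s s',
      a < s → s ≤ b → a < s' → s' ≤ b → Rings (q c') s → Rings (q c'') s' → s = s') :
    hopInc (q c) η c.1 c.2 a b
      = if q c a < q c b ∧ η a c.2 = true ∧ η a (c.2 + c.1) = false then 1 else 0 := by
  by_cases hq : q c a < q c b
  swap
  · rw [if_neg (fun h' => hq h'.1)]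
    have := hopInc_le (hp.counting c).mono η c.1 c.2 a b
    omega
  obtain ⟨σ, h1, h2, h3⟩ := (hp.counting c).exists_rings hq
  have hcc : |c.2 - c.2| ≤ 2 * (m : ℤ) := by simp
  have huniq : ∀ c' : jumps m × ℤ, |c'.2 - c.2| ≤ 2 * m → ∀ s, a < s → s ≤ b → Rings (q c') s →
      s = σ := fun c' hc' s hs hs' hr => h c' c hc' hcc s σ hs hs' h1 h2 hr h3
  -- The clocks that touch the target site `c.2 + c.1` sit up to `2 m` away from `c.2`; this is the
  -- radius in the hypothesis.
  have hconst : ∀ s, a ≤ s → s < σ → η s c.2 = η a c.2 ∧ η s (c.2 + c.1) = η a (c.2 + c.1) := by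
    intro s has hs
    have hk' := jumps_bounds c.1
    constructor
    · refine hp.config_eq has fun k s' hs1 hs2 => ⟨fun hr => ?_, fun hr => ?_⟩
      · have hk := jumps_bounds k
        have := huniq (k, c.2 - k) (by simp only [abs_le]; omega) s' hs1 ((hs2.trans hs.le).trans h2) hr
        exact absurd this (hs2.trans_lt hs).ne
      · have := huniq (k, c.2) (by simp) s' hs1 ((hs2.trans hs.le).trans h2) hr
        exact absurd this (hs2.trans_lt hs).ne
    · refine hp.config_eq has fun k s' hs1 hs2 => ⟨fun hr => ?_, fun hr => ?_⟩
      · have hk := jumps_bounds k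
        have := huniq (k, c.2 + c.1 - k) (by simp only [abs_le]; omega) s' hs1
          ((hs2.trans hs.le).trans h2) hr
        exact absurd this (hs2.trans_lt hs).ne
      · have := huniq (k, c.2 + c.1) (by simp only [abs_le]; omega) s' hs1
          ((hs2.trans hs.le).trans h2) hr
        exact absurd this (hs2.trans_lt hs).ne
  -- Both sites are frozen on `[a, σ)`, so the left limit at `σ` can be read off at time `a`.
  have hact : HopAllowed η c.1 c.2 σ ↔ η a c.2 = true ∧ η a (c.2 + c.1) = false := by
    have hev : ∀ᶠ s in 𝓝[<] σ, η s c.2 = η a c.2 ∧ η s (c.2 + c.1) = η a (c.2 + c.1) := by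
      filter_upwards [Ioo_mem_nhdsLT h1] with s hs using hconst s hs.1.le hs.2
    have : (𝓝[<] σ).NeBot := nhdsLT_neBot_of_exists_lt ⟨a, h1⟩
    unfold HopAllowed
    constructor
    · intro h'
      obtain ⟨s, hs, hs'⟩ := (h'.and hev).exists
      rw [← hs'.1, ← hs'.2]; exact hs
    · intro h'
      filter_upwards [hev] with s hs
      rw [hs.1, hs.2]; exact h'
  unfold hopInc
  by_cases hal : η a c.2 = true ∧ η a (c.2 + c.1) = false
  · rw [if_pos ⟨hq, hal⟩]
    convert Set.ncard_singleton σ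
    ext s
    simp only [Set.mem_ofPred_eq, Set.mem_singleton_iff]
    constructor
    · exact fun hs => huniq c hcc s hs.1 hs.2.1 hs.2.2.1
    · rintro rfl
      exact ⟨h1, h2, h3, hact.mpr hal⟩
  · rw [if_neg (fun h' => hal h'.2)]
    convert Set.ncard_empty ℝ≥0
    ext s
    simp only [Set.mem_ofPred_eq, Set.mem_empty_iff_false, iff_false]
    intro hs
    have := huniq c hcc s hs.1 hs.2.1 hs.2.2.1
    subst this
    exact hal (hact.mp hs.2.2.2)

end IsExclusionPath

/-! ### The height function -/

/-- `1` for clocks whose hops cross `x` from left to right, `-1` for those that cross it from right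
to left, and `0` otherwise. -/
def crossing (x : ℤ) (c : jumps m × ℤ) : ℤ :=
  if x - c.1 ≤ c.2 ∧ c.2 < x then 1 else if x ≤ c.2 ∧ c.2 < x - c.1 then -1 else 0

/-- The clocks located at the sites in `[-n, n]`. -/
def clocksIn (m n : ℕ) : Finset (jumps m × ℤ) := Finset.univ ×ˢ Finset.Icc (-(n : ℤ)) n

theorem mem_clocksIn {n : ℕ} {c : jumps m × ℤ} : c ∈ clocksIn m n ↔ |c.2| ≤ n := by
  simp [clocksIn, abs_le]

theorem crossing_ne_zero_bound {x : ℤ} {c : jumps m × ℤ} (h : crossing x c ≠ 0) :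
    |c.2 - x| ≤ m := by
  have := jumps_bounds c.1
  unfold crossing at h
  rw [abs_le]
  split_ifs at h <;> omega

theorem crossing_abs_le (x : ℤ) (c : jumps m × ℤ) : |crossing x c| ≤ 1 := by
  unfold crossing; split_ifs <;> simp

theorem sum_crossing_mul {n : ℕ} {x : ℤ} (hx : |x| + m ≤ n) (f : jumps m × ℤ → ℤ) :
    ∑ c ∈ clocksIn m n, crossing x c * f c
      = ∑ k : jumps m, (∑ i ∈ Finset.Ico (x - k) x, f (k, i) - ∑ i ∈ Finset.Ico x (x - k), f (k, i)) := by
  unfold clocksIn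
  rw [Finset.sum_product]
  refine Finset.sum_congr rfl fun k _ => ?_
  have hk := jumps_bounds k
  have hx' := abs_le.mp (show |x| ≤ (n : ℤ) - m by linarith)
  have e1 : Finset.Ico (x - k) x = (Finset.Icc (-(n : ℤ)) n).filter fun i => x - k ≤ i ∧ i < x := by
    ext i; simp only [Finset.mem_Ico, Finset.mem_filter, Finset.mem_Icc]; omega
  have e2 : Finset.Ico x (x - k) = (Finset.Icc (-(n : ℤ)) n).filter fun i => x ≤ i ∧ i < x - k := by
    ext i; simp only [Finset.mem_Ico, Finset.mem_filter, Finset.mem_Icc]; omega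
  rw [e1, e2, Finset.sum_filter, Finset.sum_filter, ← Finset.sum_sub_distrib]
  refine Finset.sum_congr rfl fun i _ => ?_
  unfold crossing
  simp only
  split_ifs <;> omega

/-- A discrete continuity equation. For hops over distance `k`, `crossing x - crossing (x + 1)` is
`1` for the clock at `x - k`, which feeds the site `x`, `-1` for the clock at `x`, which empties it,
and `0` for all others. -/
theorem IsExclusionPath.flow_sub {q : jumps m × ℤ → ℝ≥0 → ℕ} {η : ℝ≥0 → ℤ → Bool}
    (hp : IsExclusionPath q η) (t : ℝ≥0) (x : ℤ) {n : ℕ} (hx : |x| + m ≤ n) :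
    spin (η t x) = spin (η 0 x)
      + 2 * (∑ c ∈ clocksIn m n, crossing x c * (hopCount (q c) η c.1 c.2 t : ℤ)
        - ∑ c ∈ clocksIn m n, crossing (x + 1) c * (hopCount (q c) η c.1 c.2 t : ℤ)) := by
  rw [hp.dynamics, ← Finset.sum_sub_distrib, clocksIn, Finset.sum_product]
  congr 2
  refine Finset.sum_congr rfl fun k _ => ?_
  have hk := jumps_bounds k
  have hx' := abs_le.mp (show |x| ≤ (n : ℤ) - m by linarith)
  have hne : x - (k : ℤ) ≠ x := by omega
  rw [← Finset.sum_subset (s₁ := {x - (k : ℤ), x})]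
  · rw [Finset.sum_pair hne]
    have c1 : crossing x (k, x - (k : ℤ)) - crossing (x + 1) (k, x - (k : ℤ)) = 1 := by
      unfold crossing; simp only; split_ifs <;> omega
    have c2 : crossing x (k, x) - crossing (x + 1) (k, x) = -1 := by
      unfold crossing; simp only; split_ifs <;> omega
    rw [← sub_mul, ← sub_mul, c1, c2]
    ring
  · intro i hi
    simp only [Finset.mem_insert, Finset.mem_singleton] at hi
    rw [Finset.mem_Icc]
    omega
  · intro i _ hi
    simp only [Finset.mem_insert, Finset.mem_singleton, not_or] at hi
    rw [← sub_mul]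
    convert zero_mul _
    unfold crossing; simp only; split_ifs <;> omega

theorem height_zero_eq {Ω : Type*} (Q : jumps m × ℤ → ℝ≥0 → Ω → ℕ) (η : ℝ≥0 → Ω → ℤ → Bool)
    (x : ℤ) (ω : Ω) : height Q η 0 x ω
      = ∑ i ∈ Finset.Ico 0 x, spin (η 0 ω i) - ∑ i ∈ Finset.Ico x 0, spin (η 0 ω i) := by
  have h0 : ∀ (q : ℝ≥0 → ℕ) (η : ℝ≥0 → ℤ → Bool) (k i : ℤ), hopCount q η k i 0 = 0 := by
    intro q η k i
    rw [hopCount_eq_hopInc]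
    exact hopInc_eq_zero _ _ _ fun s h1 h2 => absurd h1 (not_lt.mpr h2)
  simp [height, netFlow, h0]

theorem height_succ {Ω : Type*} (Q : jumps m × ℤ → ℝ≥0 → Ω → ℕ) (η : ℝ≥0 → Ω → ℤ → Bool)
    (t : ℝ≥0) (x : ℤ) (ω : Ω) : height Q η t (x + 1) ω = height Q η t x ω + spin (η t ω x) := by
  unfold height
  rcases le_or_gt 0 x with h | h
  · have e1 : Finset.Ico 0 (x + 1) = insert x (Finset.Ico 0 x) := by
      ext i; simp only [Finset.mem_Ico, Finset.mem_insert]; omega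
    rw [e1, Finset.sum_insert (by simp), Finset.Ico_eq_empty (a := x + 1) (by omega),
      Finset.Ico_eq_empty (a := x) (by omega)]
    ring
  · have e1 : Finset.Ico x 0 = insert x (Finset.Ico (x + 1) 0) := by
      ext i; simp only [Finset.mem_Ico, Finset.mem_insert]; omega
    rw [e1, Finset.sum_insert (by simp), Finset.Ico_eq_empty (a := (0 : ℤ)) (by omega),
      Finset.Ico_eq_empty (a := (0 : ℤ)) (by omega)]
    ring

/-- The height at `x` changes by `-2` times the net flow across `x`. -/
theorem height_eq_flow {Ω : Type*} {Q : jumps m × ℤ → ℝ≥0 → Ω → ℕ} {η : ℝ≥0 → Ω → ℤ → Bool} {ω : Ω}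
    (hp : IsExclusionPath (fun c s => Q c s ω) (fun s => η s ω)) (t : ℝ≥0) {n : ℕ} {x : ℤ}
    (hx : |x| + m ≤ n) : height Q η t x ω = height Q η 0 x ω
      - 2 * ∑ c ∈ clocksIn m n,
          crossing x c * (hopCount (fun s => Q c s ω) (fun s => η s ω) c.1 c.2 t : ℤ) := by
  -- Induction on the distance from `0`, where the formula is the definition of `netFlow`; each
  -- further site is carried by `flow_sub`.
  have key : ∀ d : ℕ, d + m ≤ n → ∀ x : ℤ, x.natAbs = d → height Q η t x ω = height Q η 0 x ω
      - 2 * ∑ c ∈ clocksIn m n,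
          crossing x c * (hopCount (fun s => Q c s ω) (fun s => η s ω) c.1 c.2 t : ℤ) := by
    intro d
    induction d with
    | zero =>
      intro hd x hx
      have : x = 0 := by omega
      subst this
      rw [sum_crossing_mul (by simp; omega), height_zero_eq]
      simp [height, netFlow]
    | succ d ih =>
      intro hd x hx
      rcases le_or_gt 0 x with h | h
      · obtain ⟨z, rfl⟩ : ∃ z, x = z + 1 := ⟨x - 1, by ring⟩
        have h1 := ih (by omega) z (by omega)
        have h2 := hp.flow_sub t z (n := n) (by rw [abs_of_nonneg (by omega)]; omega)
        simp only [height_succ]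
        linarith
      · have h1 := ih (by omega) (x + 1) (by omega)
        have h2 := hp.flow_sub t x (n := n) (by rw [abs_of_neg h]; omega)
        simp only [height_succ] at h1
        linarith
  exact key x.natAbs (by zify; exact hx) x rfl

theorem height_eq_flow_inc {Ω : Type*} {Q : jumps m × ℤ → ℝ≥0 → Ω → ℕ} {η : ℝ≥0 → Ω → ℤ → Bool}
    {ω : Ω} (hp : IsExclusionPath (fun c s => Q c s ω) (fun s => η s ω)) {a b : ℝ≥0} (hab : a ≤ b)
    {n : ℕ} {x : ℤ} (hx : |x| + m ≤ n) : height Q η b x ω = height Q η a x ω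
      - 2 * ∑ c ∈ clocksIn m n,
          crossing x c * (hopInc (fun s => Q c s ω) (fun s => η s ω) c.1 c.2 a b : ℤ) := by
  rw [height_eq_flow hp b hx, height_eq_flow hp a hx, sub_sub, ← mul_add, ← Finset.sum_add_distrib]
  congr 2
  refine Finset.sum_congr rfl fun c _ => ?_
  rw [hp.hopCount_add c hab]
  push_cast
  ring

/-! ### Increments of the clocks -/

section Clocks

variable {Ω ι : Type*} {mΩ : MeasurableSpace Ω} {P : Measure Ω} {ℱ : Filtration ℝ≥0 mΩ}
  {rate : ι → ℝ≥0} {Q : ι → ℝ≥0 → Ω → ℕ}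

/-- The increments over `(s, t]` of the clocks in `S`. -/
def clockInc (Q : ι → ℝ≥0 → Ω → ℕ) (S : Finset ι) (s t : ℝ≥0) (ω : Ω) : S → ℕ :=
  fun c => Q c t ω - Q c s ω

/-- The total number of ringings. -/
def total {S : Finset ι} (x : S → ℕ) : ℕ := ∑ c, x c

/-- From `(1 - x) eˣ ≤ 1`, used twice: `eˣ - 1 - x ≤ x (eˣ - 1) ≤ x² eˣ`. -/
theorem one_add_mul_exp_bound {x : ℝ} (hx : 0 ≤ x) : Real.exp x - 1 - x ≤ x ^ 2 * Real.exp x := by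
  have h1 : (1 - x) * Real.exp x ≤ 1 := by
    have h := Real.add_one_le_exp (-x)
    rw [Real.exp_neg] at h
    have := Real.exp_pos x
    calc (1 - x) * Real.exp x ≤ (Real.exp x)⁻¹ * Real.exp x := by gcongr; linarith
      _ = 1 := inv_mul_cancel₀ this.ne'
  nlinarith

namespace IsPoissonClocks

theorem measurable_inc (h : IsPoissonClocks P ℱ rate Q) (c : ι) (s t : ℝ≥0) :
    Measurable (fun ω => Q c t ω - Q c s ω) :=
  ((h.adapted c t).mono (ℱ.le t) le_rfl).sub ((h.adapted c s).mono (ℱ.le s) le_rfl)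

theorem measurable_clockInc (h : IsPoissonClocks P ℱ rate Q) (S : Finset ι) (s t : ℝ≥0) :
    Measurable (clockInc Q S s t) :=
  measurable_pi_lambda _ fun c => h.measurable_inc c s t

theorem prob_inc_eq (h : IsPoissonClocks P ℱ rate Q) (c : ι) {s t : ℝ≥0} (hst : s ≤ t) (n : ℕ) :
    P {ω | Q c t ω - Q c s ω = n} = ENNReal.ofReal
      (Real.exp (-(rate c * (t - s) : ℝ)) * (rate c * (t - s) : ℝ) ^ n / n.factorial) := by
  have h1 : P {ω | Q c t ω - Q c s ω = n}
      = (P.map (fun ω => Q c t ω - Q c s ω)) {n} := by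
    rw [Measure.map_apply (h.measurable_inc c s t) (measurableSet_singleton n)]
    rfl
  rw [h1, h.law c s t hst, poissonMeasure_singleton]
  push_cast [NNReal.coe_sub hst]
  rfl

theorem mgf_poisson (r : ℝ≥0) (κ : ℝ) : Integrable (fun n : ℕ => Real.exp (κ * n)) (poissonMeasure r) ∧
    ∫ n : ℕ, Real.exp (κ * n) ∂poissonMeasure r = Real.exp (r * (Real.exp κ - 1)) := by
  have h2 : ∀ n : ℕ, Real.exp (-(r : ℝ)) * (r : ℝ) ^ n / n.factorial * Real.exp (κ * n)
      = Real.exp (-(r : ℝ)) * ((r * Real.exp κ) ^ n / n.factorial) := by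
    intro n
    rw [mul_comm κ, Real.exp_nat_mul, mul_pow]; ring
  have h1 : HasSum (fun n : ℕ => Real.exp (-(r : ℝ)) * (r : ℝ) ^ n / n.factorial * Real.exp (κ * n))
      (Real.exp (r * (Real.exp κ - 1))) := by
    simp_rw [h2]
    rw [show (r : ℝ) * (Real.exp κ - 1) = -r + r * Real.exp κ by ring, Real.exp_add]
    refine HasSum.mul_left _ ?_
    rw [Real.exp_eq_exp_ℝ]
    exact NormedSpace.expSeries_div_hasSum_exp (𝔸 := ℝ) (r * NormedSpace.exp κ)
  have hi : Integrable (fun n : ℕ => Real.exp (κ * n)) (poissonMeasure r) := by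
    rw [integrable_poissonMeasure_iff]
    simp only [Real.norm_eq_abs, Real.abs_exp]
    exact h1.summable
  refine ⟨hi, ?_⟩
  have h3 := hasSum_integral_poissonMeasure hi
  simp only [smul_eq_mul] at h3
  exact h3.unique h1

theorem integrable_exp_inc (h : IsPoissonClocks P ℱ rate Q) (c : ι) {s t : ℝ≥0} (hst : s ≤ t)
    (κ : ℝ) : Integrable (fun ω => Real.exp (κ * ((Q c t ω - Q c s ω : ℕ) : ℝ))) P := by
  have := (mgf_poisson (rate c * (t - s)) κ).1
  rw [← h.law c s t hst] at this
  exact this.comp_measurable (h.measurable_inc c s t)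

theorem integral_exp_inc (h : IsPoissonClocks P ℱ rate Q) (c : ι) {s t : ℝ≥0} (hst : s ≤ t)
    (κ : ℝ) : ∫ ω, Real.exp (κ * ((Q c t ω - Q c s ω : ℕ) : ℝ)) ∂P
      = Real.exp (rate c * (t - s) * (Real.exp κ - 1)) := by
  have := (mgf_poisson (rate c * (t - s)) κ).2
  rw [← h.law c s t hst, integral_map (h.measurable_inc c s t).aemeasurable
    (measurable_of_countable _).aestronglyMeasurable] at this
  rw [this]
  push_cast [NNReal.coe_sub hst]
  rfl


/-- The past is independent of functions of the increments. -/
theorem indepFun_past (h : IsPoissonClocks P ℱ rate Q) (S : Finset ι) {s t : ℝ≥0} (hst : s ≤ t)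
    {F : Ω → ℝ} (hF : AEStronglyMeasurable[ℱ s] F P) (φ : (S → ℕ) → ℝ) :
    IndepFun F (fun ω => φ (clockInc Q S s t ω)) P := by
  obtain ⟨F', hF', hFF⟩ := hF
  refine IndepFun.congr (f := F') ?_ hFF.symm (EventuallyEq.refl _ _)
  rw [IndepFun_iff_Indep]
  refine indep_of_indep_of_le_left (indep_of_indep_of_le_right (h.indep_past s t hst) ?_)
    hF'.measurable.comap_le
  refine Measurable.comap_le ?_
  set m' := ⨆ i, MeasurableSpace.comap (fun ω => Q i t ω - Q i s ω) inferInstance with hm'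
  have h1 : Measurable[m'] (clockInc Q S s t) := by
    refine @measurable_pi_lambda _ _ _ m' _ _ fun c => ?_
    exact (comap_measurable (fun ω => Q c t ω - Q c s ω)).mono
      (le_iSup (fun i => MeasurableSpace.comap (fun ω => Q i t ω - Q i s ω) inferInstance) c.1)
      le_rfl
  exact (measurable_of_countable φ).comp h1

theorem integral_mul_past (h : IsPoissonClocks P ℱ rate Q) (S : Finset ι) {s t : ℝ≥0}
    (hst : s ≤ t) {F : Ω → ℝ} (hF : AEStronglyMeasurable[ℱ s] F P) (φ : (S → ℕ) → ℝ) :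
    ∫ ω, F ω * φ (clockInc Q S s t ω) ∂P = (∫ ω, F ω ∂P) * ∫ ω, φ (clockInc Q S s t ω) ∂P :=
  (h.indepFun_past S hst hF φ).integral_fun_mul_eq_mul_integral (hF.mono (ℱ.le s))
    ((measurable_of_countable φ).comp (h.measurable_clockInc S s t)).aestronglyMeasurable

theorem integrable_mul_past (h : IsPoissonClocks P ℱ rate Q) (S : Finset ι) {s t : ℝ≥0}
    (hst : s ≤ t) {F : Ω → ℝ} (hF : AEStronglyMeasurable[ℱ s] F P) (hFi : Integrable F P)
    {φ : (S → ℕ) → ℝ} (hφ : Integrable (fun ω => φ (clockInc Q S s t ω)) P) :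
    Integrable (fun ω => F ω * φ (clockInc Q S s t ω)) P :=
  (h.indepFun_past S hst hF φ).integrable_mul hFi hφ

theorem real_inter_eq (h : IsPoissonClocks P ℱ rate Q) (S : Finset ι) {s t : ℝ≥0} (hst : s ≤ t)
    (x : S → ℕ) : P.real {ω | clockInc Q S s t ω = x} = ∏ c : S,
      (Real.exp (-(rate c * (t - s) : ℝ)) * (rate c * (t - s) : ℝ) ^ x c / (x c).factorial) := by
  have h1 := ((h.indep s t hst).precomp (g := fun c : S => (c : ι))
    Subtype.val_injective).measure_inter_preimage_eq_mul Finset.univ (sets := fun c => {x c})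
    (fun _ _ => measurableSet_singleton _)
  have h2 : {ω | clockInc Q S s t ω = x} = ⋂ c ∈ (Finset.univ : Finset S),
      (fun ω => Q c t ω - Q c s ω) ⁻¹' {x c} := by
    ext ω
    simp [clockInc, funext_iff]
  have hnn : (0 : ℝ) ≤ t - s := sub_nonneg.mpr (by exact_mod_cast hst)
  rw [Measure.real, h2]
  refine (congrArg ENNReal.toReal h1).trans ?_
  rw [ENNReal.toReal_prod]
  refine Finset.prod_congr rfl fun c _ => ?_
  have h3 := h.prob_inc_eq c hst (x c)
  refine (congrArg ENNReal.toReal h3).trans (ENNReal.toReal_ofReal ?_)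
  positivity

theorem real_zero (h : IsPoissonClocks P ℱ rate Q) (S : Finset ι) {s t : ℝ≥0} (hst : s ≤ t) :
    P.real {ω | clockInc Q S s t ω = 0} = Real.exp (-((∑ c ∈ S, (rate c : ℝ)) * (t - s))) := by
  rw [h.real_inter_eq S hst]
  simp only [Pi.zero_apply, pow_zero, mul_one, Nat.factorial_zero, Nat.cast_one, div_one]
  rw [← Real.exp_sum, Finset.sum_mul, ← Finset.sum_neg_distrib,
    Finset.sum_coe_sort S (fun c => -((rate c : ℝ) * (t - s)))]

theorem real_single [DecidableEq ι] (h : IsPoissonClocks P ℱ rate Q) (S : Finset ι) {s t : ℝ≥0} (hst : s ≤ t)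
    (c : S) : P.real {ω | clockInc Q S s t ω = Pi.single c 1}
      = rate c * (t - s) * Real.exp (-((∑ c ∈ S, (rate c : ℝ)) * (t - s))) := by
  rw [h.real_inter_eq S hst]
  have : ∀ c' : S, Real.exp (-(rate c' * (t - s) : ℝ)) * (rate c' * (t - s) : ℝ) ^
      (Pi.single c 1 : S → ℕ) c' / ((Pi.single c 1 : S → ℕ) c').factorial
      = Real.exp (-(rate c' * (t - s) : ℝ)) * (if c' = c then (rate c' * (t - s) : ℝ) else 1) := by
    intro c'
    by_cases hc : c' = c
    · subst hc; simp
    · simp [hc]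
  rw [Finset.prod_congr rfl fun c' _ => this c', Finset.prod_mul_distrib, ← Real.exp_sum,
    Finset.prod_ite_eq' Finset.univ c (fun c' => (rate c' * (t - s) : ℝ)), Finset.sum_mul, ← Finset.sum_neg_distrib,
    Finset.sum_coe_sort S (fun c => -((rate c : ℝ) * (t - s)))]
  simp
  ring

variable [IsProbabilityMeasure P]

theorem exp_total (h : IsPoissonClocks P ℱ rate Q) (S : Finset ι) {s t : ℝ≥0} (hst : s ≤ t)
    (κ : ℝ) : Integrable (fun ω => Real.exp (κ * total (clockInc Q S s t ω))) P ∧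
      ∫ ω, Real.exp (κ * total (clockInc Q S s t ω)) ∂P
        = Real.exp ((∑ c ∈ S, (rate c : ℝ)) * (t - s) * (Real.exp κ - 1)) := by
  set X : ι → Ω → ℝ := fun c ω => ((Q c t ω - Q c s ω : ℕ) : ℝ) with hX
  have hm : ∀ c, Measurable (X c) := fun c => (measurable_of_countable _).comp (h.measurable_inc c s t)
  have hind : iIndepFun X P := (h.indep s t hst).comp (fun _ n => (n : ℝ)) fun _ => measurable_of_countable _
  have e : ∀ ω, κ * (total (clockInc Q S s t ω) : ℝ) = κ * (∑ c ∈ S, X c) ω := by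
    intro ω
    simp only [total, clockInc, Finset.sum_apply, hX, Nat.cast_sum]
    rw [Finset.sum_coe_sort S (fun c => ((Q c t ω - Q c s ω : ℕ) : ℝ))]
  simp_rw [e]
  constructor
  · exact hind.integrable_exp_mul_sum hm fun c _ => h.integrable_exp_inc c hst κ
  · have := hind.mgf_sum hm (t := κ) S
    simp only [mgf] at this
    rw [this, Finset.sum_mul, Finset.sum_mul, Real.exp_sum]
    exact Finset.prod_congr rfl fun c _ => h.integral_exp_inc c hst κ

theorem total_eq_one_iff [DecidableEq ι] {S : Finset ι} (x : S → ℕ) : total x = 1 ↔ ∃ c, x = Pi.single c 1 := by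
  constructor
  · intro hx
    obtain ⟨c, hc, hc1⟩ : ∃ c ∈ Finset.univ, x c ≠ 0 := by
      by_contra! hcon
      have : total x = 0 := Finset.sum_eq_zero hcon
      omega
    refine ⟨c, ?_⟩
    have h2 : total x = x c + ∑ c' ∈ Finset.univ.erase c, x c' := (Finset.add_sum_erase _ _ hc).symm
    have h3 : ∑ c' ∈ Finset.univ.erase c, x c' = 0 := by omega
    have h4 := Finset.sum_eq_zero_iff.mp h3
    ext c'
    by_cases hcc : c' = c
    · subst hcc; simp; omega
    · simp [hcc, h4 c' (by simp [hcc])]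
  · rintro ⟨c, rfl⟩
    simp [total]

theorem total_eq_zero_iff {S : Finset ι} (x : S → ℕ) : total x = 0 ↔ x = 0 := by
  simp [total, funext_iff]

/-- Two or more ringings in a short time are unlikely, even with an exponential weight. -/
theorem integral_two_le [DecidableEq ι] (h : IsPoissonClocks P ℱ rate Q) (S : Finset ι) {s t : ℝ≥0} (hst : s ≤ t)
    (κ : ℝ) : Integrable (fun ω => if 2 ≤ total (clockInc Q S s t ω) then
        Real.exp (κ * total (clockInc Q S s t ω)) else 0) P ∧
      ∫ ω, (if 2 ≤ total (clockInc Q S s t ω) then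
        Real.exp (κ * total (clockInc Q S s t ω)) else 0) ∂P
      ≤ ((∑ c ∈ S, (rate c : ℝ)) * (t - s) * Real.exp κ) ^ 2
          * Real.exp ((∑ c ∈ S, (rate c : ℝ)) * (t - s) * Real.exp κ) := by
  set R : ℝ := ∑ c ∈ S, (rate c : ℝ) with hR
  have hR0 : 0 ≤ R := Finset.sum_nonneg fun c _ => (rate c).2
  have hts : (0 : ℝ) ≤ t - s := sub_nonneg.mpr (by exact_mod_cast hst)
  have hmeas : ∀ x : S → ℕ, MeasurableSet {ω | clockInc Q S s t ω = x} := fun x =>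
    h.measurable_clockInc S s t (measurableSet_singleton x)
  -- The weight on two or more ringings is the full exponential weight minus its parts on no ringing
  -- and on exactly one. All three have explicit expectations, which combine to `e^(-Rh) (eˣ - 1 -
  -- x)` with `R` the total rate, `h = t - s` and `x = R h e^κ`.
  have hpt : ∀ ω, (if 2 ≤ total (clockInc Q S s t ω) then
        Real.exp (κ * total (clockInc Q S s t ω)) else 0)
      = Real.exp (κ * total (clockInc Q S s t ω))
        - ({ω | clockInc Q S s t ω = 0}.indicator 1 ω
          + Real.exp κ * ∑ c : S, {ω | clockInc Q S s t ω = Pi.single c 1}.indicator 1 ω) := by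
    intro ω
    set x := clockInc Q S s t ω with hx
    by_cases h0 : x = 0
    · have : ∀ c : S, (0 : S → ℕ) ≠ Pi.single c 1 := fun c hc => by
        have := congrFun hc c
        simp at this
      simp [Set.indicator, ← hx, h0, total, this]
    by_cases h1 : total x = 1
    · obtain ⟨c, hc⟩ := (total_eq_one_iff x).mp h1
      have : ∀ c' : S, (Pi.single c 1 : S → ℕ) = Pi.single c' 1 ↔ c = c' := fun c' => by
        constructor
        · intro he
          by_contra hne
          have := congrFun he c
          simp [hne] at this
        · rintro rfl; rfl
      simp only [Set.indicator, Set.mem_ofPred_eq, ← hx, h1, h0, if_false, Pi.one_apply]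
      rw [hc]
      simp [this]
    · have h2 : 2 ≤ total x := by
        have : total x ≠ 0 := fun hc => h0 ((total_eq_zero_iff x).mp hc)
        omega
      have : ∀ c : S, x ≠ Pi.single c 1 := fun c hc => h1 ((total_eq_one_iff x).mpr ⟨c, hc⟩)
      simp [Set.indicator, ← hx, h0, h2, this]
  have hi0 : Integrable ({ω | clockInc Q S s t ω = 0}.indicator (1 : Ω → ℝ)) P :=
    (integrable_const (1 : ℝ)).indicator (hmeas 0)
  have hi1 : ∀ c : S, Integrable ({ω | clockInc Q S s t ω = Pi.single c 1}.indicator (1 : Ω → ℝ)) P :=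
    fun c => (integrable_const (1 : ℝ)).indicator (hmeas _)
  have hi2 : Integrable (fun ω => Real.exp κ * ∑ c : S,
      {ω | clockInc Q S s t ω = Pi.single c 1}.indicator (1 : Ω → ℝ) ω) P :=
    (integrable_finsetSum _ fun c _ => hi1 c).const_mul _
  obtain ⟨hi, hint⟩ := h.exp_total S hst κ
  simp_rw [hpt]
  refine ⟨hi.sub (hi0.add hi2), ?_⟩
  have e0 := integral_sub hi (hi0.add hi2)
  simp only [Pi.add_apply] at e0
  rw [e0, integral_add hi0 hi2, hint, integral_const_mul,
    integral_finsetSum _ fun c _ => hi1 c, integral_indicator_one (hmeas 0), h.real_zero S hst]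
  simp_rw [integral_indicator_one (hmeas _), h.real_single S hst]
  rw [← Finset.sum_mul, ← Finset.sum_mul, Finset.sum_coe_sort S (fun c => (rate c : ℝ)), ← hR]
  have key := one_add_mul_exp_bound (x := R * (t - s) * Real.exp κ) (by positivity)
  have e1 : Real.exp (R * (t - s) * (Real.exp κ - 1))
      = Real.exp (-(R * (t - s))) * Real.exp (R * (t - s) * Real.exp κ) := by
    rw [← Real.exp_add]; ring_nf
  rw [e1]
  have h3 : Real.exp (-(R * (t - s))) ≤ 1 := Real.exp_le_one_iff.mpr (by nlinarith)
  have h4 : 0 ≤ Real.exp (R * (t - s) * Real.exp κ) - 1 - R * (t - s) * Real.exp κ := by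
    linarith [Real.add_one_le_exp (R * (t - s) * Real.exp κ)]
  calc _ = Real.exp (-(R * (t - s))) * (Real.exp (R * (t - s) * Real.exp κ) - 1
        - R * (t - s) * Real.exp κ) := by ring
    _ ≤ 1 * (Real.exp (R * (t - s) * Real.exp κ) - 1 - R * (t - s) * Real.exp κ) := by gcongr
    _ ≤ _ := by linarith

end IsPoissonClocks

end Clocks

/-! ### Measurability of the height function -/

theorem aestronglyMeasurable_sum_of_le {Ω ι : Type*} {m mΩ : MeasurableSpace Ω} {P : Measure Ω}
    {f : ι → Ω → ℝ} (s : Finset ι) (hf : ∀ i ∈ s, AEStronglyMeasurable[m] (f i) P) :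
    AEStronglyMeasurable[m] (fun ω => ∑ i ∈ s, f i ω) P := by
  classical
  induction s using Finset.induction_on with
  | empty => simpa using aestronglyMeasurable_const
  | insert i s hi ih =>
    simp only [Finset.sum_insert hi]
    exact (hf i (Finset.mem_insert_self _ _)).add
      (ih fun j hj => hf j (Finset.mem_insert_of_mem hj))

section ClockMeasurability

variable {Ω : Type*} {mΩ : MeasurableSpace Ω} {P : Measure Ω} {ℱ : Filtration ℝ≥0 mΩ} {m : ℕ}
  {rate : ℤ → ℝ≥0} {Q : jumps m × ℤ → ℝ≥0 → Ω → ℕ} {η : ℝ≥0 → Ω → ℤ → Bool}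

theorem IsExclusionProcess.ae_path (h : IsExclusionProcess P ℱ m rate Q η) :
    ∀ᵐ ω ∂P, IsExclusionPath (fun c s => Q c s ω) (fun s => η s ω) := by
  filter_upwards [h.clocks.counting, h.dynamics] with ω h1 h2
  exact ⟨fun c => ⟨(h1 c).2.1, (h1 c).2.2⟩, h2⟩

/-- A discretization of the number of hops. -/
def discreteHops (q : ℝ≥0 → ℕ) (η : ℝ≥0 → ℤ → Bool) (k i : ℤ) (t : ℝ≥0) (n : ℕ) : ℕ :=
  ∑ l ∈ Finset.range n, if q (t * (l / n)) < q (t * ((l + 1) / n)) ∧ η (t * (l / n)) i = true ∧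
    η (t * (l / n)) (i + k) = false then 1 else 0

theorem exists_pos_separation (s : Set ℝ≥0) (hs : s.Finite) :
    ∃ δ > (0 : ℝ), ∀ x ∈ s, ∀ y ∈ s, |(x : ℝ) - y| < δ → x = y := by
  classical
  set D : Finset ℝ := ((hs.toFinset ×ˢ hs.toFinset).filter fun z => z.1 ≠ z.2).image
    fun z => |(z.1 : ℝ) - z.2| with hD
  have hpos : ∀ d ∈ D, 0 < d := by
    intro d hd
    simp only [hD, Finset.mem_image, Finset.mem_filter] at hd
    obtain ⟨z, ⟨-, hz⟩, rfl⟩ := hd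
    rw [abs_pos, sub_ne_zero]
    exact_mod_cast hz
  rcases D.eq_empty_or_nonempty with h0 | hne
  · refine ⟨1, one_pos, fun x hx y hy _ => ?_⟩
    by_contra hxy
    have : |(x : ℝ) - y| ∈ D := by
      simp only [hD, Finset.mem_image, Finset.mem_filter, Finset.mem_product, Set.Finite.mem_toFinset]
      exact ⟨(x, y), ⟨⟨hx, hy⟩, hxy⟩, rfl⟩
    rw [h0] at this
    simp at this
  · refine ⟨D.min' hne, hpos _ (D.min'_mem hne), fun x hx y hy hlt => ?_⟩
    by_contra hxy
    have : |(x : ℝ) - y| ∈ D := by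
      simp only [hD, Finset.mem_image, Finset.mem_filter, Finset.mem_product, Set.Finite.mem_toFinset]
      exact ⟨(x, y), ⟨⟨hx, hy⟩, hxy⟩, rfl⟩
    exact absurd (D.min'_le _ this) (not_le.mpr hlt)

/-- The number of hops counts an uncountable family of candidate times, so its measurability has to
come from a limit. Once the mesh is finer than the least distance between distinct ringing times
nearby, every window contains at most one such time, and `hopInc_eq_ite` reads the hop off the grid.
Simultaneous ringings do no harm, so the statement holds for every path that obeys the rules. -/
theorem IsExclusionPath.eventually_discreteHops_eq {q : jumps m × ℤ → ℝ≥0 → ℕ}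
    {η : ℝ≥0 → ℤ → Bool} (hp : IsExclusionPath q η) (c : jumps m × ℤ) (t : ℝ≥0) :
    ∀ᶠ n in atTop, discreteHops (q c) η c.1 c.2 t n = hopCount (q c) η c.1 c.2 t := by
  -- Large enough to contain all clocks within `2 m` of `c`, as `hopInc_eq_ite` requires.
  set n₀ : ℕ := (|c.2| + 2 * m).toNat with hn₀
  set A : Set ℝ≥0 := ⋃ c' ∈ clocksIn m n₀, {s | 0 < s ∧ s ≤ t ∧ Rings (q c') s} with hA
  have hAf : A.Finite := Set.Finite.biUnion (Finset.finite_toSet _) fun c' _ =>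
    ringSet_finite (hp.counting c').mono 0 t
  obtain ⟨δ, hδ, hsep⟩ := exists_pos_separation A hAf
  obtain ⟨N, hN⟩ := exists_nat_gt ((t : ℝ) / δ)
  filter_upwards [eventually_ge_atTop N, eventually_ge_atTop 1] with n hn hn1
  have hn0 : (0 : ℝ) < n := by exact_mod_cast hn1
  have hnn : (n : ℝ≥0) ≠ 0 := by exact_mod_cast hn0.ne'
  have hmesh : (t : ℝ) / n < δ := by
    rw [div_lt_iff₀ hn0]
    have : (t : ℝ) < N * δ := by rwa [div_lt_iff₀ hδ] at hN
    have h2 : (N : ℝ) * δ ≤ n * δ := by gcongr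
    linarith
  set p : ℕ → ℝ≥0 := fun l => t * (l / n) with hpdef
  have hpm : Monotone p := fun a b hab => by
    simp only [hpdef]
    gcongr
  have hsum : ∀ l : ℕ, hopInc (q c) η c.1 c.2 0 (p l)
      = ∑ l' ∈ Finset.range l, hopInc (q c) η c.1 c.2 (p l') (p (l' + 1)) := by
    intro l
    induction l with
    | zero =>
      have : p 0 = 0 := by simp [hpdef]
      rw [this]
      exact hopInc_eq_zero _ _ _ fun s h1 h2 => absurd h1 (not_lt.mpr h2)
    | succ l ih =>
      rw [Finset.sum_range_succ, ← ih]
      exact hopInc_add (hp.counting c).mono _ _ _ zero_le (hpm (Nat.le_succ l))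
  have hpn : p n = t := by simp [hpdef, div_self hnn]
  rw [hopCount_eq_hopInc, ← hpn, hsum, hpn]
  unfold discreteHops
  refine Finset.sum_congr rfl fun l hl => ?_
  have hln : l + 1 ≤ n := Finset.mem_range.mp hl
  have e1 : t * ((l + 1) / n) = p (l + 1) := by simp [hpdef]
  rw [e1]
  symm
  refine (hp.hopInc_eq_ite (a := p l) (b := p (l + 1)) c ?_).trans ?_
  rotate_left
  · simp only [hpdef]
  · intro c' c'' hc' hc'' s s' hs1 hs2 hs1' hs2' hr hr'
    have hmem : ∀ c' : jumps m × ℤ, |c'.2 - c.2| ≤ 2 * m → ∀ s, p l < s → s ≤ p (l + 1) →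
        Rings (q c') s → s ∈ A := by
      intro c' hc' s hs1 hs2 hr
      simp only [hA, Set.mem_iUnion, Set.mem_ofPred_eq]
      refine ⟨c', ?_, lt_of_le_of_lt zero_le hs1, hs2.trans ((hpm hln).trans hpn.le), hr⟩
      rw [mem_clocksIn, hn₀, Int.toNat_of_nonneg (by positivity)]
      have := abs_sub_abs_le_abs_sub c'.2 c.2
      linarith
    refine hsep s (hmem c' hc' s hs1 hs2 hr) s' (hmem c'' hc'' s' hs1' hs2' hr') ?_
    have hlen : (p (l + 1) : ℝ) - p l = t / n := by
      simp only [hpdef]; push_cast; field_simp; ring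
    have a1 : (p l : ℝ) < s := by exact_mod_cast hs1
    have a2 : (s : ℝ) ≤ p (l + 1) := by exact_mod_cast hs2
    have a3 : (p l : ℝ) < s' := by exact_mod_cast hs1'
    have a4 : (s' : ℝ) ≤ p (l + 1) := by exact_mod_cast hs2'
    rw [abs_lt]
    constructor <;> linarith

/-- The configuration at a site is measurable. -/
theorem IsExclusionProcess.measurable_site (h : IsExclusionProcess P ℱ m rate Q η) {s t : ℝ≥0}
    (hst : s ≤ t) (i : ℤ) : Measurable[ℱ t] (fun ω => η s ω i) :=
  (measurable_pi_apply i).comp ((h.adapted s).mono (ℱ.mono hst) le_rfl)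

theorem IsExclusionProcess.measurable_clock (h : IsExclusionProcess P ℱ m rate Q η) {s t : ℝ≥0}
    (hst : s ≤ t) (c : jumps m × ℤ) : Measurable[ℱ t] (Q c s) :=
  (h.clocks.adapted c s).mono (ℱ.mono hst) le_rfl

/-- The number of hops is measurable with respect to the past, up to a null set. -/
theorem IsExclusionProcess.aestronglyMeasurable_hopCount (h : IsExclusionProcess P ℱ m rate Q η)
    (c : jumps m × ℤ) (t : ℝ≥0) : AEStronglyMeasurable[ℱ t]
      (fun ω => (hopCount (fun s => Q c s ω) (fun s => η s ω) c.1 c.2 t : ℝ)) P := by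
  set A : ℕ → Ω → ℝ := fun n ω =>
    (discreteHops (fun s => Q c s ω) (fun s => η s ω) c.1 c.2 t n : ℝ) with hA
  have hmeas : ∀ n, Measurable[ℱ t] (A n) := by
    intro n
    simp only [hA, discreteHops, Nat.cast_sum]
    refine Finset.measurable_fun_sum _ fun l hl => ?_
    have hln : l + 1 ≤ n := Finset.mem_range.mp hl
    have hn0 : (0 : ℝ≥0) < n := by exact_mod_cast (Nat.succ_pos l).trans_le hln
    have t2 : t * (((l : ℝ≥0) + 1) / n) ≤ t :=
      mul_le_of_le_one_right zero_le (div_le_one_of_le₀ (by exact_mod_cast hln) hn0.le)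
    have t1 : t * ((l : ℝ≥0) / n) ≤ t :=
      mul_le_of_le_one_right zero_le (div_le_one_of_le₀ (by exact_mod_cast (Nat.le_succ l).trans hln) hn0.le)
    refine (measurable_of_countable (fun k : ℕ => (k : ℝ))).comp ?_
    refine Measurable.ite ?_ measurable_const measurable_const
    refine MeasurableSet.inter ?_ (MeasurableSet.inter ?_ ?_)
    · exact measurableSet_lt (h.measurable_clock t1 c) (h.measurable_clock t2 c)
    · exact h.measurable_site t1 c.2 (measurableSet_singleton true)
    · exact h.measurable_site t1 (c.2 + c.1) (measurableSet_singleton false)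
  -- The upper limit is measurable with no convergence assumed; almost surely the sequence is
  -- eventually constant.
  have hlim : Measurable[ℱ t] (fun ω => limsup (fun n => A n ω) atTop) := Measurable.limsup hmeas
  refine ⟨fun ω => limsup (fun n => A n ω) atTop, hlim.stronglyMeasurable, ?_⟩
  filter_upwards [h.ae_path] with ω hω
  have := hω.eventually_discreteHops_eq c t
  refine (Tendsto.limsup_eq ?_).symm
  refine tendsto_const_nhds.congr' ?_
  filter_upwards [this] with n hn
  simp only [hA]
  exact_mod_cast hn.symm

theorem IsExclusionProcess.aestronglyMeasurable_height (h : IsExclusionProcess P ℱ m rate Q η)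
    (t : ℝ≥0) (x : ℤ) : AEStronglyMeasurable[ℱ t] (fun ω => (height Q η t x ω : ℝ)) P := by
  have h0 : AEStronglyMeasurable[ℱ t] (fun ω => (height Q η 0 x ω : ℝ)) P := by
    refine (Measurable.stronglyMeasurable ?_).aestronglyMeasurable
    simp only [height_zero_eq]
    refine (measurable_of_countable (fun k : ℤ => (k : ℝ))).comp ?_
    refine Measurable.sub (Finset.measurable_fun_sum _ fun i _ => ?_)
      (Finset.measurable_fun_sum _ fun i _ => ?_)
    all_goals exact (measurable_of_countable spin).comp (h.measurable_site zero_le i)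
  have h1 : AEStronglyMeasurable[ℱ t] (fun ω => (height Q η 0 x ω : ℝ)
      - 2 * ∑ c ∈ clocksIn m (|x| + m).toNat, (crossing x c : ℝ) *
        (hopCount (fun s => Q c s ω) (fun s => η s ω) c.1 c.2 t : ℝ)) P := by
    refine h0.sub (AEStronglyMeasurable.const_mul ?_ 2)
    exact aestronglyMeasurable_sum_of_le _ fun c _ =>
      (h.aestronglyMeasurable_hopCount c t).const_mul _
  refine h1.congr ?_
  filter_upwards [h.ae_path] with ω hω
  rw [height_eq_flow hω t (n := (|x| + m).toNat) (by rw [Int.toNat_of_nonneg (by positivity)])]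
  push_cast
  rfl

end ClockMeasurability

/-! ### The exponential of the height over a time window -/

section Window

variable {Ω : Type*} {m : ℕ} {Q : jumps m × ℤ → ℝ≥0 → Ω → ℕ} {η : ℝ≥0 → Ω → ℤ → Bool}

/-- `exp (-θ h_t(x))`. -/
def expHeight (θ : ℝ) (Q : jumps m × ℤ → ℝ≥0 → Ω → ℕ) (η : ℝ≥0 → Ω → ℤ → Bool) (t : ℝ≥0) (x : ℤ)
    (ω : Ω) : ℝ := Real.exp (-θ * (height Q η t x ω : ℝ))

theorem expHeight_pos (θ : ℝ) (t : ℝ≥0) (x : ℤ) (ω : Ω) : 0 < expHeight θ Q η t x ω :=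
  Real.exp_pos _

theorem Zfield_eq_expHeight (lam ε ν : ℝ) (t : ℝ≥0) (x : ℤ) (ω : Ω) :
    Zfield lam ε ν Q η t x ω = Real.exp (ε * ν * t) * expHeight (lam * √ε) Q η t x ω := by
  unfold Zfield expHeight
  rw [← Real.exp_add]; ring_nf

/-- The relative change of `exp (-θ h(y))` when the clock `c` rings in the configuration `σ`. -/
def jumpFactor (θ : ℝ) (y : ℤ) (c : jumps m × ℤ) (σ : ℤ → Bool) : ℝ :=
  if σ c.2 = true ∧ σ (c.2 + c.1) = false then Real.exp (2 * θ * crossing y c) - 1 else 0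

theorem jumpFactor_of_crossing_eq_zero {θ : ℝ} {y : ℤ} {c : jumps m × ℤ} {σ : ℤ → Bool}
    (h : crossing y c = 0) : jumpFactor θ y c σ = 0 := by
  simp [jumpFactor, h]

theorem abs_exp_sub_one_le {x b : ℝ} (h : |x| ≤ b) : |Real.exp x - 1| ≤ b * Real.exp b := by
  have hb : 0 ≤ b := (abs_nonneg x).trans h
  obtain ⟨h1, h2⟩ := abs_le.mp h
  have e1 : Real.exp x - 1 ≤ b * Real.exp b := by
    have h3 : Real.exp x ≤ Real.exp b := Real.exp_le_exp.mpr h2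
    have h4 : 1 - b ≤ Real.exp (-b) := by linarith [Real.add_one_le_exp (-b)]
    have h5 : (1 - b) * Real.exp b ≤ 1 := by
      calc (1 - b) * Real.exp b ≤ Real.exp (-b) * Real.exp b := by gcongr
        _ = 1 := by rw [← Real.exp_add]; simp
    nlinarith
  have e2 : 1 - Real.exp x ≤ b * Real.exp b := by
    have h3 := Real.add_one_le_exp x
    have h4 : 1 ≤ Real.exp b := Real.one_le_exp hb
    nlinarith
  rw [abs_le]; constructor <;> linarith

theorem abs_jumpFactor_le {θ : ℝ} (hθ : 0 ≤ θ) (y : ℤ) (c : jumps m × ℤ) (σ : ℤ → Bool) :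
    |jumpFactor θ y c σ| ≤ 2 * θ * Real.exp (2 * θ) := by
  unfold jumpFactor
  split_ifs
  · refine abs_exp_sub_one_le ?_
    have : |(crossing y c : ℝ)| ≤ 1 := by exact_mod_cast crossing_abs_le y c
    rw [abs_mul, abs_of_nonneg (by positivity : 0 ≤ 2 * θ)]
    nlinarith
  · simp; positivity

variable {ω : Ω}

theorem expHeight_eq_mul (hp : IsExclusionPath (fun c s => Q c s ω) (fun s => η s ω))
    (θ : ℝ) {a b : ℝ≥0} (hab : a ≤ b) {n : ℕ} {x : ℤ} (hx : |x| + m ≤ n) :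
    expHeight θ Q η b x ω = expHeight θ Q η a x ω * Real.exp (2 * θ * ∑ c ∈ clocksIn m n,
      (crossing x c : ℝ) * (hopInc (fun s => Q c s ω) (fun s => η s ω) c.1 c.2 a b : ℝ)) := by
  unfold expHeight
  rw [← Real.exp_add, height_eq_flow_inc hp hab hx]
  push_cast
  ring_nf

theorem expHeight_le_mul (hp : IsExclusionPath (fun c s => Q c s ω) (fun s => η s ω))
    {θ : ℝ} (hθ : 0 ≤ θ) {a b : ℝ≥0} (hab : a ≤ b) {n : ℕ} {x : ℤ} (hx : |x| + m ≤ n) :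
    expHeight θ Q η b x ω ≤ expHeight θ Q η a x ω
      * Real.exp (2 * θ * total (clockInc Q (clocksIn m n) a b ω)) := by
  rw [expHeight_eq_mul hp θ hab hx]
  refine mul_le_mul_of_nonneg_left (Real.exp_le_exp.mpr ?_) (expHeight_pos _ _ _ _).le
  refine mul_le_mul_of_nonneg_left ?_ (by positivity)
  unfold total clockInc
  rw [Nat.cast_sum, Finset.sum_coe_sort (clocksIn m n) (fun c => ((Q c b ω - Q c a ω : ℕ) : ℝ))]
  refine Finset.sum_le_sum fun c _ => ?_
  have h1 : (crossing x c : ℝ) ≤ 1 := by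
    exact_mod_cast (abs_le.mp (crossing_abs_le x c)).2
  have h2 := hopInc_le (hp.counting c).mono (fun s => η s ω) c.1 c.2 a b
  calc (crossing x c : ℝ) * (hopInc (fun s => Q c s ω) (fun s => η s ω) c.1 c.2 a b : ℝ)
      ≤ 1 * (hopInc (fun s => Q c s ω) (fun s => η s ω) c.1 c.2 a b : ℝ) := by gcongr
    _ ≤ _ := by rw [one_mul]; exact_mod_cast h2

theorem expHeight_of_clockInc_eq_zero (hp : IsExclusionPath (fun c s => Q c s ω) (fun s => η s ω))
    (θ : ℝ) {a b : ℝ≥0} (hab : a ≤ b) {n : ℕ} {x : ℤ} (hx : |x| + m ≤ n)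
    (h : clockInc Q (clocksIn m n) a b ω = 0) :
    expHeight θ Q η b x ω = expHeight θ Q η a x ω := by
  rw [expHeight_eq_mul hp θ hab hx, Finset.sum_eq_zero]
  · simp
  intro c hc
  have h1 : Q c b ω - Q c a ω = 0 := congrFun h ⟨c, hc⟩
  have h2 := hopInc_le (hp.counting c).mono (fun s => η s ω) c.1 c.2 a b
  have h3 : hopInc (fun s => Q c s ω) (fun s => η s ω) c.1 c.2 a b = 0 := by omega
  simp [h3]

/-- The margin `3 m` is `m`, for the clocks that can cross `x`, plus `2 m`, for the clocks that
`hopInc_eq_ite` inspects around such a clock. -/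
theorem expHeight_of_clockInc_eq_single
    (hp : IsExclusionPath (fun c s => Q c s ω) (fun s => η s ω)) (θ : ℝ) {a b : ℝ≥0} (hab : a ≤ b)
    {n : ℕ} {x : ℤ} (hx : |x| + 3 * m ≤ n) (c : clocksIn m n)
    (h : clockInc Q (clocksIn m n) a b ω = Pi.single c 1) :
    expHeight θ Q η b x ω = expHeight θ Q η a x ω * (1 + jumpFactor θ x (c : jumps m × ℤ) (η a ω)) := by
  have hxm : |x| + (m : ℤ) ≤ n := by linarith [Int.natCast_nonneg m]
  rw [expHeight_eq_mul hp θ hab hxm]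
  congr 1
  have hother : ∀ c' ∈ clocksIn m n, c' ≠ c → Q c' b ω - Q c' a ω = 0 := by
    intro c' hc' hne
    have h1 : Q c' b ω - Q c' a ω = (Pi.single c 1 : clocksIn m n → ℕ) ⟨c', hc'⟩ :=
      congrFun h ⟨c', hc'⟩
    rw [h1, Pi.single_eq_of_ne]
    exact fun he => hne (by rw [← he])
  have hone : Q c b ω - Q c a ω = 1 := by
    have h1 : Q c b ω - Q c a ω = (Pi.single c 1 : clocksIn m n → ℕ) c := congrFun h c
    rw [h1, Pi.single_eq_same]
  rw [Finset.sum_eq_single (c : jumps m × ℤ)]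
  rotate_left
  · intro c' hc' hne
    have h1 := hother c' hc' hne
    have h2 := hopInc_le (hp.counting c').mono (fun s => η s ω) c'.1 c'.2 a b
    have h3 : hopInc (fun s => Q c' s ω) (fun s => η s ω) c'.1 c'.2 a b = 0 := by omega
    simp [h3]
  · exact fun hc => absurd c.2 hc
  by_cases hcr : crossing x (c : jumps m × ℤ) = 0
  · simp [jumpFactor_of_crossing_eq_zero hcr, hcr]
  have hnear := crossing_ne_zero_bound hcr
  have hmem : ∀ c' : jumps m × ℤ, |c'.2 - (c : jumps m × ℤ).2| ≤ 2 * m → c' ∈ clocksIn m n := by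
    intro c' hc'
    rw [mem_clocksIn]
    rw [abs_le] at *
    have h1 := le_abs_self x
    have h2 := neg_abs_le x
    constructor <;> omega
  rw [hp.hopInc_eq_ite (a := a) (b := b) c]
  · have hlt : Q c a ω < Q c b ω := by omega
    unfold jumpFactor
    by_cases hal : η a ω (c : jumps m × ℤ).2 = true ∧
        η a ω ((c : jumps m × ℤ).2 + (c : jumps m × ℤ).1) = false
    · rw [if_pos ⟨hlt, hal⟩, if_pos hal]; simp
    · rw [if_neg (fun h' => hal h'.2), if_neg hal]; simp
  · have hsing : ∀ c' : jumps m × ℤ, |c'.2 - (c : jumps m × ℤ).2| ≤ 2 * m → ∀ s, a < s → s ≤ b →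
        Rings (fun s => Q c' s ω) s → c' = c := by
      intro c' hc' s h1 h2 hr
      by_contra hne
      have h3 := hother c' (hmem c' hc') hne
      have h4 : Q c' a ω < Q c' s ω := hr.2 a h1
      have h5 : Q c' s ω ≤ Q c' b ω := (hp.counting c').mono h2
      omega
    intro c' c'' hc' hc'' s s' hs1 hs2 hs1' hs2' hr hr'
    have e1 := hsing c' hc' s hs1 hs2 hr
    have e2 := hsing c'' hc'' s' hs1' hs2' hr'
    subst e1
    rw [e2] at hr'
    -- Two distinct ringing times of `c` would raise its count by at least two.
    rcases lt_trichotomy s s' with hlt | heq | hlt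
    · have h4 := hr.2 a hs1
      have h5 := hr'.2 s hlt
      have h6 := (hp.counting c).mono hs2'
      simp only at h4 h5 h6
      omega
    · exact heq
    · have h4 := hr'.2 a hs1'
      have h5 := hr.2 s' hlt
      have h6 := (hp.counting c).mono hs2
      simp only at h4 h5 h6
      omega

end Window

/-! ### Crude moment bounds -/

section Crude

variable {Ω : Type*} {mΩ : MeasurableSpace Ω} {P : Measure Ω} {ℱ : Filtration ℝ≥0 mΩ} {m : ℕ}
  {rate : ℤ → ℝ≥0} {Q : jumps m × ℤ → ℝ≥0 → Ω → ℕ} {η : ℝ≥0 → Ω → ℤ → Bool}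

theorem IsExclusionProcess.aestronglyMeasurable_expHeight
    (h : IsExclusionProcess P ℱ m rate Q η) (θ : ℝ) (t : ℝ≥0) (x : ℤ) :
    AEStronglyMeasurable[ℱ t] (expHeight θ Q η t x) P := by
  unfold expHeight
  exact Real.continuous_exp.comp_aestronglyMeasurable
    ((h.aestronglyMeasurable_height t x).const_mul _)

/-- The total rate of the clocks in `[-n, n]`. -/
def totalRate (m : ℕ) (rate : ℤ → ℝ≥0) (n : ℕ) : ℝ := ∑ c ∈ clocksIn m n, (rate c.1 : ℝ)

theorem totalRate_nonneg (m : ℕ) (rate : ℤ → ℝ≥0) (n : ℕ) : 0 ≤ totalRate m rate n :=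
  Finset.sum_nonneg fun _ _ => NNReal.coe_nonneg _

end Crude

/-! ### Taylor estimates for powers -/

/-- Raising the power by one multiplies the remainder by `A + D` and adds `(q + 2) A^(q+1) D²`; the
constant survives because `(q + 2)² + (q + 2) ≤ (q + 3)²`. -/
theorem pow_taylor (q : ℕ) {A D B : ℝ} (hA : |A| ≤ B) (hAD : |A + D| ≤ B) :
    |(A + D) ^ (q + 2) - A ^ (q + 2) - (q + 2) * A ^ (q + 1) * D| ≤ (q + 2) ^ 2 * B ^ q * D ^ 2 := by
  have hB : 0 ≤ B := (abs_nonneg A).trans hA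
  induction q with
  | zero =>
    have : (A + D) ^ (0 + 2) - A ^ (0 + 2) - ((0 : ℕ) + 2) * A ^ (0 + 1) * D = D ^ 2 := by
      push_cast; ring
    rw [this, abs_of_nonneg (sq_nonneg D)]
    push_cast
    nlinarith [sq_nonneg D]
  | succ q ih =>
    have e : (A + D) ^ (q + 1 + 2) - A ^ (q + 1 + 2) - ((q + 1 : ℕ) + 2) * A ^ (q + 1 + 1) * D
        = (A + D) * ((A + D) ^ (q + 2) - A ^ (q + 2) - (q + 2) * A ^ (q + 1) * D)
          + (q + 2) * (A ^ (q + 1) * D ^ 2) := by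
      push_cast; ring
    rw [e]
    have h1 : |(A + D) * ((A + D) ^ (q + 2) - A ^ (q + 2) - (q + 2) * A ^ (q + 1) * D)|
        ≤ B * ((q + 2) ^ 2 * B ^ q * D ^ 2) := by
      rw [abs_mul]; gcongr
    have h2 : |((q : ℝ) + 2) * (A ^ (q + 1) * D ^ 2)| ≤ (q + 2) * (B ^ (q + 1) * D ^ 2) := by
      rw [abs_mul, abs_mul, abs_pow, abs_of_nonneg (sq_nonneg D),
        abs_of_nonneg (by positivity : (0 : ℝ) ≤ q + 2)]
      gcongr
    refine (abs_add_le _ _).trans ((add_le_add h1 h2).trans ?_)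
    have h3 : 0 ≤ B ^ (q + 1) * D ^ 2 := by positivity
    have h4 : B * ((q + 2) ^ 2 * B ^ q * D ^ 2) = (q + 2) ^ 2 * (B ^ (q + 1) * D ^ 2) := by ring
    have h5 : (((q + 1 : ℕ) : ℝ) + 2) ^ 2 * B ^ (q + 1) * D ^ 2
        = (q + 3) ^ 2 * (B ^ (q + 1) * D ^ 2) := by push_cast; ring
    rw [h4, h5, ← add_mul]
    gcongr
    nlinarith [(Nat.cast_nonneg q : (0 : ℝ) ≤ q)]

/-- Crude Lipschitz bound for powers. -/
theorem abs_pow_sub_pow_le' (q : ℕ) {A D B h : ℝ} (h0 : 0 ≤ h) (h1 : h ≤ 1) (hA : |A| ≤ B)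
    (hD : |D| ≤ 2 * h * B) :
    |(A + D) ^ (q + 2) - A ^ (q + 2)| ≤ (2 * (q + 2) + 4 * (q + 2) ^ 2 * 3 ^ q) * h * B ^ (q + 2) := by
  have hB : 0 ≤ B := (abs_nonneg A).trans hA
  have hD' : |D| ≤ 2 * B := hD.trans (by nlinarith)
  have hA3 : |A| ≤ 3 * B := hA.trans (by linarith)
  have hAD : |A + D| ≤ 3 * B := (abs_add_le _ _).trans (by linarith)
  have ht := pow_taylor q hA3 hAD
  have e1 : |((q : ℝ) + 2) * A ^ (q + 1) * D| ≤ (q + 2) * B ^ (q + 1) * (2 * h * B) := by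
    rw [abs_mul, abs_mul, abs_pow, abs_of_nonneg (by positivity : (0 : ℝ) ≤ q + 2)]
    gcongr
  have e2 : ((q : ℝ) + 2) ^ 2 * (3 * B) ^ q * D ^ 2 ≤ (q + 2) ^ 2 * (3 * B) ^ q * (4 * h * B ^ 2) := by
    have h3 : D ^ 2 ≤ (2 * h * B) ^ 2 := by rw [← sq_abs D]; gcongr
    have h4 : (2 * h * B) ^ 2 ≤ 4 * h * B ^ 2 := by nlinarith [mul_nonneg h0 (sq_nonneg B)]
    gcongr
    exact h3.trans h4
  have e3 : |(A + D) ^ (q + 2) - A ^ (q + 2)| ≤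
      |(A + D) ^ (q + 2) - A ^ (q + 2) - (q + 2) * A ^ (q + 1) * D| + |((q : ℝ) + 2) * A ^ (q + 1) * D| := by
    have := abs_add_le ((A + D) ^ (q + 2) - A ^ (q + 2) - (q + 2) * A ^ (q + 1) * D)
      (((q : ℝ) + 2) * A ^ (q + 1) * D)
    rwa [sub_add_cancel] at this
  refine e3.trans ((add_le_add (ht.trans e2) e1).trans (le_of_eq ?_))
  rw [mul_pow]; ring

/-- The constants of the Taylor expansion of one time step. -/
theorem exists_step_taylor (q : ℕ) (hq : Even q) (G J R : ℝ) (hG : 1 ≤ G) (hJ : 0 ≤ J) (hR : 0 ≤ R) :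
    ∃ K : ℝ, 0 ≤ K ∧ ∀ (ι : Type) (_ : Fintype ι) (ρ : ι → ℝ) (_ : ∀ c, 0 ≤ ρ c) (_ : ∑ c, ρ c = R)
      (h : ℝ) (_ : 0 ≤ h) (_ : h ≤ 1) (M X V X₀ : ℝ) (δ δ₀ : ι → ℝ) (_ : |X| ≤ G * M)
      (_ : |V| ≤ G * M) (_ : |X₀ - X - h * V| ≤ G * h ^ 2 * M) (_ : ∀ c, |δ c| ≤ G * J * M)
      (_ : ∀ c, |δ₀ c - δ c| ≤ 2 * h * (G * J * M)),
      Real.exp (-(R * h)) * X₀ ^ (q + 2)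
          + ∑ c, ρ c * h * Real.exp (-(R * h)) * (X₀ + δ₀ c) ^ (q + 2)
        ≤ X ^ (q + 2) + h * ((q + 2) * X ^ (q + 1) * V
            + ∑ c, ρ c * ((X + δ c) ^ (q + 2) - X ^ (q + 2))) + K * h ^ 2 * M ^ (q + 2) := by
  set k₀ : ℝ := 2 * (q + 2) + 4 * (q + 2) ^ 2 * 3 ^ q with hk₀
  have hk₀' : 0 ≤ k₀ := by positivity
  set B : ℝ := G * (1 + J) with hB
  have hBG : G ≤ B := by rw [hB]; nlinarith
  have hB0 : 0 ≤ B := by linarith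
  have hp : Even (q + 2) := hq.add even_two
  refine ⟨k₀ * B ^ (q + 2) + R * (k₀ * B ^ (q + 2)) + R ^ 2 * ((1 + k₀) * B ^ (q + 2))
    + R * (k₀ * B ^ (q + 2)), by positivity, ?_⟩
  intro ι _ ρ hρ hρR h h0 h1 M X V X₀ δ δ₀ hX hV hX₀ hδ hδ₀
  have hM : 0 ≤ M := by
    by_contra! hc
    have : G * M < 0 := mul_neg_of_pos_of_neg (by linarith) hc
    linarith [abs_nonneg X]
  have hGM : 0 ≤ G * M := by positivity
  have hBM : G * M ≤ B * M := by gcongr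
  have hXB : |X| ≤ B * M := hX.trans hBM
  set D := X₀ - X with hD
  have hX₀D : X₀ = X + D := by rw [hD]; ring
  have hDb : |D| ≤ 2 * h * (G * M) := by
    have e : D = (X₀ - X - h * V) + h * V := by rw [hD]; ring
    rw [e]
    refine (abs_add_le _ _).trans ?_
    rw [abs_mul, abs_of_nonneg h0]
    have e2 : h * |V| ≤ h * (G * M) := by gcongr
    have e3 : G * h ^ 2 * M ≤ h * (G * M) := by nlinarith [mul_nonneg h0 hGM]
    linarith
  have hDB : |D| ≤ 2 * h * (B * M) := hDb.trans (by gcongr)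
  -- first order expansion of the power of `X₀`
  have hA : |X₀ ^ (q + 2) - X ^ (q + 2)| ≤ k₀ * h * (B * M) ^ (q + 2) := by
    rw [hX₀D]; exact abs_pow_sub_pow_le' q h0 h1 hXB hDB
  have hA2 : X₀ ^ (q + 2) ≤ (1 + k₀) * (B * M) ^ (q + 2) := by
    have e1 : X ^ (q + 2) ≤ (B * M) ^ (q + 2) := by
      rw [← hp.pow_abs]; gcongr
    have e2 := (abs_le.mp hA).2
    have e3 : k₀ * h * (B * M) ^ (q + 2) ≤ k₀ * 1 * (B * M) ^ (q + 2) := by gcongr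
    linarith
  have hC : X₀ ^ (q + 2) ≤ X ^ (q + 2) + h * ((q + 2) * X ^ (q + 1) * V)
      + k₀ * h ^ 2 * (B * M) ^ (q + 2) := by
    have t1 : |X + D| ≤ 3 * (B * M) := (abs_add_le _ _).trans (by nlinarith [mul_nonneg hB0 hM])
    have t2 : |X| ≤ 3 * (B * M) := hXB.trans (by nlinarith [mul_nonneg hB0 hM])
    have t3 := (abs_le.mp (pow_taylor q t2 t1)).2
    have t4 : ((q : ℝ) + 2) ^ 2 * (3 * (B * M)) ^ q * D ^ 2
        ≤ (q + 2) ^ 2 * (3 * (B * M)) ^ q * (2 * h * (B * M)) ^ 2 := by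
      rw [← sq_abs D]; gcongr
    have t5 : ((q : ℝ) + 2) * X ^ (q + 1) * D - h * ((q + 2) * X ^ (q + 1) * V)
        ≤ (q + 2) * (B * M) ^ (q + 1) * (h ^ 2 * (B * M)) := by
      have e : ((q : ℝ) + 2) * X ^ (q + 1) * D - h * ((q + 2) * X ^ (q + 1) * V)
          = (q + 2) * X ^ (q + 1) * (X₀ - X - h * V) := by rw [hD]; ring
      rw [e]
      refine (le_abs_self _).trans ?_
      rw [abs_mul, abs_mul, abs_pow, abs_of_nonneg (by positivity : (0 : ℝ) ≤ q + 2)]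
      gcongr
      refine hX₀.trans ?_
      have : h ^ 2 * (G * M) ≤ h ^ 2 * (B * M) := by gcongr
      linarith
    have t6 : ((q : ℝ) + 2) ^ 2 * (3 * (B * M)) ^ q * (2 * h * (B * M)) ^ 2
        + (q + 2) * (B * M) ^ (q + 1) * (h ^ 2 * (B * M)) ≤ k₀ * h ^ 2 * (B * M) ^ (q + 2) := by
      rw [hk₀, mul_pow 3]
      have : 0 ≤ ((q : ℝ) + 2) * h ^ 2 * (B * M) ^ (q + 2) := by positivity
      have e : (2 * ((q : ℝ) + 2) + 4 * (q + 2) ^ 2 * 3 ^ q) * h ^ 2 * (B * M) ^ (q + 2)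
        = (q + 2) ^ 2 * (3 ^ q * (B * M) ^ q) * (2 * h * (B * M)) ^ 2
          + (q + 2) * (B * M) ^ (q + 1) * (h ^ 2 * (B * M)) + (q + 2) * h ^ 2 * (B * M) ^ (q + 2) := by
        ring
      linarith
    rw [hX₀D]
    linarith
  have hE : ∀ c, (X₀ + δ₀ c) ^ (q + 2) ≤ (X + δ c) ^ (q + 2) + k₀ * h * (B * M) ^ (q + 2) := by
    intro c
    have e1 : |X + δ c| ≤ B * M := (abs_add_le _ _).trans (by rw [hB]; nlinarith [hδ c])
    have e2 : |(X₀ + δ₀ c) - (X + δ c)| ≤ 2 * h * (B * M) := by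
      have : (X₀ + δ₀ c) - (X + δ c) = D + (δ₀ c - δ c) := by rw [hD]; ring
      rw [this]
      refine (abs_add_le _ _).trans ((add_le_add hDb (hδ₀ c)).trans (le_of_eq ?_))
      rw [hB]; ring
    have := (abs_le.mp (abs_pow_sub_pow_le' q h0 h1 e1 e2)).2
    rw [add_sub_cancel] at this
    linarith
  have hexp1 : Real.exp (-(R * h)) ≤ 1 := Real.exp_le_one_iff.mpr (by nlinarith)
  have hexp2 : Real.exp (-(R * h)) ≤ 1 - R * h + R ^ 2 * h ^ 2 := by
    have hx : 0 ≤ R * h := by positivity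
    have e1 : (1 + R * h) * Real.exp (-(R * h)) ≤ 1 := by
      calc (1 + R * h) * Real.exp (-(R * h)) ≤ Real.exp (R * h) * Real.exp (-(R * h)) := by
            gcongr; linarith [Real.add_one_le_exp (R * h)]
        _ = 1 := by rw [← Real.exp_add]; simp
    have e2 : (1 + R * h) * Real.exp (-(R * h)) ≤ (1 + R * h) * (1 - R * h + R ^ 2 * h ^ 2) := by
      have : (1 + R * h) * (1 - R * h + R ^ 2 * h ^ 2) = 1 + (R * h) ^ 3 := by ring
      rw [this]; have := pow_nonneg hx 3; linarith
    exact le_of_mul_le_mul_left e2 (by linarith)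
  -- The exponent is even, so the powers are nonnegative and the factor `e^(-Rh)` may be replaced by
  -- upper bounds: to second order here, and by `1` in the terms that already carry a factor `h`.
  have s1 : Real.exp (-(R * h)) * X₀ ^ (q + 2) ≤ (1 - R * h + R ^ 2 * h ^ 2) * X₀ ^ (q + 2) :=
    mul_le_mul_of_nonneg_right hexp2 (hp.pow_nonneg _)
  have s2 : ∑ c, ρ c * h * Real.exp (-(R * h)) * (X₀ + δ₀ c) ^ (q + 2)
      ≤ ∑ c, ρ c * h * ((X + δ c) ^ (q + 2) + k₀ * h * (B * M) ^ (q + 2)) := by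
    refine Finset.sum_le_sum fun c _ => ?_
    have hρh : 0 ≤ ρ c * h := mul_nonneg (hρ c) h0
    have e0 := hp.pow_nonneg (X₀ + δ₀ c)
    calc ρ c * h * Real.exp (-(R * h)) * (X₀ + δ₀ c) ^ (q + 2)
        ≤ ρ c * h * 1 * (X₀ + δ₀ c) ^ (q + 2) := by gcongr
      _ = ρ c * h * (X₀ + δ₀ c) ^ (q + 2) := by ring
      _ ≤ _ := by gcongr; exact hE c
  -- As the rates add up to `R`, the sum of powers produces `h R X^(q+2)`. This cancels the loss `-R
  -- h X₀^(q+2)` from the event of no ringing up to order `h²` and leaves the differences of the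
  -- generator.
  have s3 : ∑ c, ρ c * h * ((X + δ c) ^ (q + 2) + k₀ * h * (B * M) ^ (q + 2))
      = h * (∑ c, ρ c * ((X + δ c) ^ (q + 2) - X ^ (q + 2))) + h * R * X ^ (q + 2)
        + h * R * (k₀ * h * (B * M) ^ (q + 2)) := by
    rw [← hρR]
    simp only [Finset.mul_sum, Finset.sum_mul, ← Finset.sum_add_distrib]
    exact Finset.sum_congr rfl fun c _ => by ring
  have s4 : R * h * X ^ (q + 2) - R * h * X₀ ^ (q + 2) ≤ R * h * (k₀ * h * (B * M) ^ (q + 2)) := by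
    rw [← mul_sub]
    have := (abs_le.mp hA).1
    gcongr
    linarith
  have s5 : R ^ 2 * h ^ 2 * X₀ ^ (q + 2) ≤ R ^ 2 * h ^ 2 * ((1 + k₀) * (B * M) ^ (q + 2)) := by
    gcongr
  have e6 : (k₀ * B ^ (q + 2) + R * (k₀ * B ^ (q + 2)) + R ^ 2 * ((1 + k₀) * B ^ (q + 2))
      + R * (k₀ * B ^ (q + 2))) * h ^ 2 * M ^ (q + 2)
      = k₀ * h ^ 2 * (B * M) ^ (q + 2) + R * h * (k₀ * h * (B * M) ^ (q + 2))
        + R ^ 2 * h ^ 2 * ((1 + k₀) * (B * M) ^ (q + 2)) + h * R * (k₀ * h * (B * M) ^ (q + 2)) := by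
    rw [mul_pow B M]; ring
  rw [e6]
  linarith

/-! ### One time step -/

section Step

variable {Ω : Type*} {mΩ : MeasurableSpace Ω} {P : Measure Ω} {ℱ : Filtration ℝ≥0 mΩ} {m : ℕ}
  {rate : ℤ → ℝ≥0} {Q : jumps m × ℤ → ℝ≥0 → Ω → ℕ} {η : ℝ≥0 → Ω → ℤ → Bool}

/-- The linear functional `∑_{|y| ≤ n} g(y) E(y)`. -/
def pairing (n : ℕ) (g E : ℤ → ℝ) : ℝ := ∑ y ∈ Finset.Icc (-(n : ℤ)) n, g y * E y

theorem abs_pairing_le {n : ℕ} {g E : ℤ → ℝ} {G : ℝ} (hg : ∀ y, |g y| ≤ G) (hE : ∀ y, 0 ≤ E y) :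
    |pairing n g E| ≤ G * ∑ y ∈ Finset.Icc (-(n : ℤ)) n, E y := by
  unfold pairing
  rw [Finset.mul_sum]
  refine (Finset.abs_sum_le_sum_abs _ _).trans (Finset.sum_le_sum fun y _ => ?_)
  rw [abs_mul, abs_of_nonneg (hE y)]
  exact mul_le_mul_of_nonneg_right (hg y) (hE y)

theorem measurable_jumpFactor (h : IsExclusionProcess P ℱ m rate Q η) (θ : ℝ) (y : ℤ)
    (c : jumps m × ℤ) (t : ℝ≥0) : Measurable[ℱ t] (fun ω => jumpFactor θ y c (η t ω)) := by
  unfold jumpFactor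
  refine Measurable.ite (MeasurableSet.inter ?_ ?_) measurable_const measurable_const
  · exact h.measurable_site le_rfl c.2 (measurableSet_singleton true)
  · exact h.measurable_site le_rfl (c.2 + c.1) (measurableSet_singleton false)

/-- The total mass that dominates all linear functionals. -/
def mass (n : ℕ) (θ : ℝ) (Q : jumps m × ℤ → ℝ≥0 → Ω → ℕ) (η : ℝ≥0 → Ω → ℤ → Bool) (Y : Ω → ℝ)
    (t : ℝ≥0) (ω : Ω) : ℝ := ∑ y ∈ Finset.Icc (-(n : ℤ)) n, expHeight θ Q η t y ω + |Y ω|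

theorem mass_nonneg (n : ℕ) (θ : ℝ) (Y : Ω → ℝ) (t : ℝ≥0) (ω : Ω) : 0 ≤ mass n θ Q η Y t ω :=
  add_nonneg (Finset.sum_nonneg fun _ _ => (expHeight_pos _ _ _ _).le) (abs_nonneg _)

theorem integrable_pow_iff_memLp {f : Ω → ℝ} (hf : AEStronglyMeasurable f P) {p : ℕ} (hp : p ≠ 0) :
    Integrable (fun ω => |f ω| ^ p) P ↔ MemLp f p P := by
  have := integrable_norm_rpow_iff hf (p := (p : ℝ≥0∞)) (by simpa using hp) (by simp)
  simpa using this

theorem integrable_mass_pow (h : IsExclusionProcess P ℱ m rate Q η) (n : ℕ) (θ : ℝ) {Y : Ω → ℝ}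
    (t : ℝ≥0) {p : ℕ} (hp : p ≠ 0) (hY : MemLp Y p P)
    (hE : ∀ y : ℤ, |y| ≤ n → Integrable (fun ω => expHeight θ Q η t y ω ^ p) P) :
    Integrable (fun ω => mass n θ Q η Y t ω ^ p) P := by
  have hm : MemLp (mass n θ Q η Y t) p P := by
    unfold mass
    refine MemLp.add (memLp_finsetSum _ fun y hy => ?_) hY.abs
    have hme := (h.aestronglyMeasurable_expHeight θ t y).mono (ℱ.le t)
    refine (integrable_pow_iff_memLp hme hp).mp ?_
    simp only [abs_of_pos (expHeight_pos θ t y _)]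
    exact hE y (by rw [abs_le]; simpa using hy)
  have := (integrable_pow_iff_memLp hm.1 hp).mpr hm
  simpa only [abs_of_nonneg (mass_nonneg n θ Y t _)] using this

theorem integrable_of_le_mass {M : Ω → ℝ} {p : ℕ} (hM : Integrable (fun ω => M ω ^ p) P)
    {f : Ω → ℝ} (hf : AEStronglyMeasurable f P) {C : ℝ} (hC : ∀ ω, |f ω| ≤ C * M ω ^ p) :
    Integrable f P :=
  (hM.const_mul C).mono' hf (ae_of_all _ hC)

theorem aestronglyMeasurable_pairing (h : IsExclusionProcess P ℱ m rate Q η) (n : ℕ) (θ : ℝ)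
    (g : ℤ → ℝ) (t : ℝ≥0) :
    AEStronglyMeasurable[ℱ t] (fun ω => pairing n g fun y => expHeight θ Q η t y ω) P :=
  aestronglyMeasurable_sum_of_le _ fun y _ => (h.aestronglyMeasurable_expHeight θ t y).const_mul _

theorem aestronglyMeasurable_pairing_jump (h : IsExclusionProcess P ℱ m rate Q η) (n : ℕ) (θ : ℝ)
    (g : ℤ → ℝ) (c : jumps m × ℤ) (t : ℝ≥0) : AEStronglyMeasurable[ℱ t] (fun ω =>
      pairing n g fun y => expHeight θ Q η t y ω * jumpFactor θ y c (η t ω)) P :=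
  aestronglyMeasurable_sum_of_le _ fun y _ => ((h.aestronglyMeasurable_expHeight θ t y).mul
    (measurable_jumpFactor h θ y c t).stronglyMeasurable.aestronglyMeasurable).const_mul _

variable [IsProbabilityMeasure P]

set_option maxHeartbeats 1000000 in
/-- The moments after a short time are controlled by the events that no clock, exactly one clock or
more than one clock rings. -/
theorem moment_step_le (h : IsExclusionProcess P ℱ m rate Q η) {θ : ℝ} (hθ : 0 ≤ θ) (n : ℕ)
    {a b : ℝ≥0} (hab : a ≤ b) {q : ℕ} (hq : Even q) {Y : Ω → ℝ} (hYm : AEStronglyMeasurable[ℱ a] Y P)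
    (hY : MemLp Y (q + 2 : ℕ) P)
    (hE : ∀ y : ℤ, |y| ≤ n → Integrable (fun ω => expHeight θ Q η a y ω ^ (q + 2)) P)
    {g : ℤ → ℝ} {G : ℝ} (hG : 1 ≤ G) (hg : ∀ y, |g y| ≤ G) :
    Integrable (fun ω => (pairing n g (fun y => expHeight θ Q η b y ω) - Y ω) ^ (q + 2)) P ∧
    ∫ ω, (pairing n g (fun y => expHeight θ Q η b y ω) - Y ω) ^ (q + 2) ∂P
      ≤ ∫ ω, (Real.exp (-(totalRate m rate (n + 3 * m) * (b - a)))
            * (pairing n g (fun y => expHeight θ Q η a y ω) - Y ω) ^ (q + 2)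
          + ∑ c : clocksIn m (n + 3 * m), rate (c : jumps m × ℤ).1 * (b - a)
            * Real.exp (-(totalRate m rate (n + 3 * m) * (b - a)))
            * (pairing n g (fun y => expHeight θ Q η a y ω) - Y ω + pairing n g fun y =>
                expHeight θ Q η a y ω * jumpFactor θ y (c : jumps m × ℤ) (η a ω)) ^ (q + 2)) ∂P
        + G ^ (q + 2) * (∫ ω, mass n θ Q η Y a ω ^ (q + 2) ∂P)
          * ((totalRate m rate (n + 3 * m) * (b - a) * Real.exp (2 * θ * (q + 2 : ℕ))) ^ 2
          * Real.exp (totalRate m rate (n + 3 * m) * (b - a) * Real.exp (2 * θ * (q + 2 : ℕ)))) := by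
  set S := clocksIn m (n + 3 * m) with hS
  set R := totalRate m rate (n + 3 * m) with hR
  set p := q + 2 with hp
  have hpe : Even p := hq.add even_two
  set M : Ω → ℝ := mass n θ Q η Y a with hMdef
  have hM0 : ∀ ω, 0 ≤ M ω := fun ω => mass_nonneg n θ Y a ω
  have hMi : Integrable (fun ω => M ω ^ p) P := integrable_mass_pow h n θ a (by omega) hY hE
  have hMm : AEStronglyMeasurable[ℱ a] M P := by
    refine AEStronglyMeasurable.add (aestronglyMeasurable_sum_of_le _ fun y _ =>
      h.aestronglyMeasurable_expHeight θ a y) ?_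
    exact continuous_abs.comp_aestronglyMeasurable hYm
  set X₀ : Ω → ℝ := fun ω => pairing n g (fun y => expHeight θ Q η a y ω) - Y ω with hX₀
  set δ₀ : S → Ω → ℝ := fun c ω => pairing n g fun y =>
    expHeight θ Q η a y ω * jumpFactor θ y (c : jumps m × ℤ) (η a ω) with hδ₀
  have hX₀m : AEStronglyMeasurable[ℱ a] X₀ P := (aestronglyMeasurable_pairing h n θ g a).sub hYm
  have hδ₀m : ∀ c, AEStronglyMeasurable[ℱ a] (δ₀ c) P := fun c =>
    aestronglyMeasurable_pairing_jump h n θ g c a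
  have hbase : ∀ E : ℤ → ℝ, (∀ y, 0 ≤ E y) → ∀ r : ℝ,
      |pairing n g E - r| ≤ G * (∑ y ∈ Finset.Icc (-(n : ℤ)) n, E y + |r|) := by
    intro E hE0 r
    have h1 := abs_pairing_le (n := n) hg hE0
    have h2 : |r| ≤ G * |r| := le_mul_of_one_le_left (abs_nonneg _) hG
    calc |pairing n g E - r| ≤ |pairing n g E| + |r| := abs_sub _ _
      _ ≤ _ := by rw [mul_add]; linarith
  have hX₀M : ∀ ω, |X₀ ω| ≤ G * M ω := fun ω => hbase _ (fun y => (expHeight_pos _ _ _ _).le) _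
  have hδ₀M : ∀ c ω, |X₀ ω + δ₀ c ω| ≤ G * Real.exp (2 * θ) * M ω := by
    intro c ω
    have e : X₀ ω + δ₀ c ω = pairing n g (fun y => expHeight θ Q η a y ω *
        (1 + jumpFactor θ y (c : jumps m × ℤ) (η a ω))) - Y ω := by
      simp only [hX₀, hδ₀, pairing, mul_add, mul_one, Finset.sum_add_distrib]; ring
    have hf : ∀ y, 0 ≤ 1 + jumpFactor θ y (c : jumps m × ℤ) (η a ω) ∧
        1 + jumpFactor θ y (c : jumps m × ℤ) (η a ω) ≤ Real.exp (2 * θ) := by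
      intro y
      unfold jumpFactor
      split_ifs
      · refine ⟨by linarith [Real.exp_pos (2 * θ * crossing y (c : jumps m × ℤ))], ?_⟩
        rw [add_sub_cancel, Real.exp_le_exp]
        have : (crossing y (c : jumps m × ℤ) : ℝ) ≤ 1 := by
          exact_mod_cast (abs_le.mp (crossing_abs_le y _)).2
        nlinarith
      · simp; positivity
    rw [e]
    refine (hbase _ (fun y => mul_nonneg (expHeight_pos _ _ _ _).le (hf y).1) _).trans ?_
    rw [mul_assoc]
    refine mul_le_mul_of_nonneg_left ?_ (by linarith)
    simp only [hMdef, mass]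
    rw [mul_add, Finset.mul_sum]
    refine add_le_add (Finset.sum_le_sum fun y _ => ?_) ?_
    · rw [mul_comm]
      exact mul_le_mul_of_nonneg_right (hf y).2 (expHeight_pos _ _ _ _).le
    · exact le_mul_of_one_le_left (abs_nonneg _) (Real.one_le_exp (by positivity))
  have hpow : ∀ {f : Ω → ℝ} {C : ℝ}, AEStronglyMeasurable[ℱ a] f P → (∀ ω, |f ω| ≤ C * M ω) →
      Integrable (fun ω => f ω ^ p) P := by
    intro f C hf hC
    refine integrable_of_le_mass hMi ((hf.mono (ℱ.le a)).pow p) (C := C ^ p) fun ω => ?_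
    rw [abs_pow, ← mul_pow]
    exact pow_le_pow_left₀ (abs_nonneg _) (hC ω) p
  have hX₀i : Integrable (fun ω => X₀ ω ^ p) P := hpow hX₀m hX₀M
  have hδ₀i : ∀ c, Integrable (fun ω => (X₀ ω + δ₀ c ω) ^ p) P := fun c =>
    hpow (hX₀m.add (hδ₀m c)) (hδ₀M c)
  -- the three parts
  set φ₀ : (S → ℕ) → ℝ := fun x => if x = 0 then 1 else 0 with hφ₀
  set φ₁ : S → (S → ℕ) → ℝ := fun c x => if x = Pi.single c 1 then 1 else 0 with hφ₁
  set φ₂ : (S → ℕ) → ℝ := fun x => if 2 ≤ total x then Real.exp (2 * θ * p * total x) else 0 with hφ₂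
  set I : Ω → S → ℕ := clockInc Q S a b with hI
  have hIm : Measurable I := h.clocks.measurable_clockInc S a b
  have hind : ∀ x : S → ℕ, (fun ω => if I ω = x then (1 : ℝ) else 0) = {ω | I ω = x}.indicator 1 := by
    intro x; ext ω; simp [Set.indicator]
  have hφind : ∀ x : S → ℕ, Integrable (fun ω => if I ω = x then (1 : ℝ) else 0) P := by
    intro x
    rw [hind]
    exact (integrable_const (1 : ℝ)).indicator (hIm (measurableSet_singleton x))
  have hφint : ∀ x : S → ℕ, ∫ ω, (if I ω = x then (1 : ℝ) else 0) ∂P = P.real {ω | I ω = x} := by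
    intro x
    rw [hind]
    exact integral_indicator_one (hIm (measurableSet_singleton x))
  -- Each ringing changes `exp (-θ h)` by a factor at most `e^(2θ)`, hence its `p`-th power by at
  -- most `e^(2θp)`.
  have h2 := h.clocks.integral_two_le S hab (2 * θ * p)
  have i₀ : Integrable (fun ω => X₀ ω ^ p * φ₀ (I ω)) P :=
    h.clocks.integrable_mul_past S hab (hX₀m.pow p) hX₀i (φ := φ₀) (hφind 0)
  have i₁ : ∀ c, Integrable (fun ω => (X₀ ω + δ₀ c ω) ^ p * φ₁ c (I ω)) P := fun c =>
    h.clocks.integrable_mul_past S hab ((hX₀m.add (hδ₀m c)).pow p) (hδ₀i c) (φ := φ₁ c) (hφind _)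
  have i₂ : Integrable (fun ω => M ω ^ p * φ₂ (I ω)) P :=
    h.clocks.integrable_mul_past S hab (hMm.pow p) hMi (φ := φ₂) h2.1
  have v₀ : ∫ ω, X₀ ω ^ p * φ₀ (I ω) ∂P = (∫ ω, X₀ ω ^ p ∂P) * Real.exp (-(R * (b - a))) := by
    refine (h.clocks.integral_mul_past S hab (hX₀m.pow p) φ₀).trans ?_
    exact congrArg (_ * ·) ((hφint 0).trans (h.clocks.real_zero S hab))
  have v₁ : ∀ c, ∫ ω, (X₀ ω + δ₀ c ω) ^ p * φ₁ c (I ω) ∂P = (∫ ω, (X₀ ω + δ₀ c ω) ^ p ∂P)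
      * (rate (c : jumps m × ℤ).1 * (b - a) * Real.exp (-(R * (b - a)))) := by
    intro c
    refine (h.clocks.integral_mul_past S hab ((hX₀m.add (hδ₀m c)).pow p) (φ₁ c)).trans ?_
    exact congrArg (_ * ·) ((hφint _).trans (h.clocks.real_single S hab c))
  have v₂ : ∫ ω, M ω ^ p * φ₂ (I ω) ∂P ≤ (∫ ω, M ω ^ p ∂P)
      * ((R * (b - a) * Real.exp (2 * θ * p)) ^ 2 * Real.exp (R * (b - a) * Real.exp (2 * θ * p))) := by
    refine (h.clocks.integral_mul_past S hab (hMm.pow p) φ₂).le.trans ?_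
    have hnn : 0 ≤ ∫ ω, (M ^ p) ω ∂P := integral_nonneg fun ω => pow_nonneg (hM0 ω) p
    exact mul_le_mul_of_nonneg_left h2.2 hnn
  -- On each of the events of no, one and several ringings, the corresponding term dominates and the
  -- other two are nonnegative. In the first two cases the new value is known exactly; in the third
  -- it is bounded by the mass times the exponential weight.
  have hpt : ∀ᵐ ω ∂P, (pairing n g (fun y => expHeight θ Q η b y ω) - Y ω) ^ p
      ≤ X₀ ω ^ p * φ₀ (I ω) + ∑ c, (X₀ ω + δ₀ c ω) ^ p * φ₁ c (I ω)
        + G ^ p * (M ω ^ p * φ₂ (I ω)) := by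
    filter_upwards [h.ae_path] with ω hω
    have hmem : ∀ y ∈ Finset.Icc (-(n : ℤ)) n, |y| + (3 * m : ℤ) ≤ ((n + 3 * m : ℕ) : ℤ) := by
      intro y hy
      have : |y| ≤ (n : ℤ) := abs_le.mpr (by simpa using hy)
      push_cast; linarith
    have nn0 : 0 ≤ X₀ ω ^ p * φ₀ (I ω) := by
      refine mul_nonneg (hpe.pow_nonneg _) ?_
      simp only [hφ₀]; split_ifs <;> norm_num
    have nn1 : ∀ c ∈ Finset.univ, 0 ≤ (X₀ ω + δ₀ c ω) ^ p * φ₁ c (I ω) := by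
      intro c _
      refine mul_nonneg (hpe.pow_nonneg _) ?_
      simp only [hφ₁]; split_ifs <;> norm_num
    have nn2 : 0 ≤ G ^ p * (M ω ^ p * φ₂ (I ω)) := by
      refine mul_nonneg (by positivity) (mul_nonneg (pow_nonneg (hM0 ω) p) ?_)
      simp only [hφ₂]; split_ifs <;> positivity
    by_cases hz : I ω = 0
    · have e : pairing n g (fun y => expHeight θ Q η b y ω) - Y ω = X₀ ω := by
        simp only [hX₀, pairing]
        congr 1
        refine Finset.sum_congr rfl fun y hy => ?_
        rw [expHeight_of_clockInc_eq_zero hω θ hab (by linarith [hmem y hy, Int.natCast_nonneg m]) hz]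
      have e1 : φ₀ (I ω) = 1 := by simp [hφ₀, hz]
      have e2 := Finset.sum_nonneg nn1
      rw [e, e1] at *
      linarith
    by_cases ho : total (I ω) = 1
    · obtain ⟨c, hc⟩ := (IsPoissonClocks.total_eq_one_iff _).mp ho
      have e : pairing n g (fun y => expHeight θ Q η b y ω) - Y ω = X₀ ω + δ₀ c ω := by
        simp only [hX₀, hδ₀, pairing]
        rw [sub_add_eq_add_sub, ← Finset.sum_add_distrib]
        congr 1
        refine Finset.sum_congr rfl fun y hy => ?_
        rw [expHeight_of_clockInc_eq_single hω θ hab (hmem y hy) c (by rw [← hI, hc])]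
        ring
      have e1 : φ₁ c (I ω) = 1 := by simp [hφ₁, hc]
      have e2 := Finset.single_le_sum nn1 (Finset.mem_univ c)
      rw [e1] at e2
      rw [e]
      linarith
    · have ht : 2 ≤ total (I ω) := by
        have : total (I ω) ≠ 0 := fun hc => hz ((IsPoissonClocks.total_eq_zero_iff _).mp hc)
        omega
      have e1 : φ₂ (I ω) = Real.exp (2 * θ * p * total (I ω)) := by simp [hφ₂, ht]
      have e2 := Finset.sum_nonneg nn1
      have e3 : |pairing n g (fun y => expHeight θ Q η b y ω) - Y ω|
          ≤ G * (M ω * Real.exp (2 * θ * total (I ω))) := by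
        refine (hbase _ (fun y => (expHeight_pos _ _ _ _).le) _).trans ?_
        refine mul_le_mul_of_nonneg_left ?_ (by linarith)
        simp only [hMdef, mass, add_mul, Finset.sum_mul]
        refine add_le_add (Finset.sum_le_sum fun y hy => ?_) ?_
        · exact expHeight_le_mul hω hθ hab (by linarith [hmem y hy, Int.natCast_nonneg m])
        · exact le_mul_of_one_le_right (abs_nonneg _) (Real.one_le_exp (by positivity))
      have e4 : (pairing n g (fun y => expHeight θ Q η b y ω) - Y ω) ^ p
          ≤ G ^ p * (M ω ^ p * φ₂ (I ω)) := by
        rw [← hpe.pow_abs, e1]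
        refine (pow_le_pow_left₀ (abs_nonneg _) e3 p).trans (le_of_eq ?_)
        rw [mul_pow, mul_pow, ← Real.exp_nat_mul]
        ring_nf
      linarith
  have iR : Integrable (fun ω => X₀ ω ^ p * φ₀ (I ω) + ∑ c, (X₀ ω + δ₀ c ω) ^ p * φ₁ c (I ω)
        + G ^ p * (M ω ^ p * φ₂ (I ω))) P :=
    (i₀.add (integrable_finsetSum _ fun c _ => i₁ c)).add (i₂.const_mul _)
  have hbm : AEStronglyMeasurable
      (fun ω => (pairing n g (fun y => expHeight θ Q η b y ω) - Y ω) ^ p) P :=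
    (((aestronglyMeasurable_pairing h n θ g b).mono (ℱ.le b)).sub (hYm.mono (ℱ.le a))).pow p
  have iL : Integrable (fun ω => (pairing n g (fun y => expHeight θ Q η b y ω) - Y ω) ^ p) P := by
    refine iR.mono' hbm ?_
    filter_upwards [hpt] with ω hω
    rwa [Real.norm_of_nonneg (hpe.pow_nonneg _)]
  refine ⟨iL, (integral_mono_ae iL iR hpt).trans ?_⟩
  have e0 : ∫ ω, (X₀ ω ^ p * φ₀ (I ω) + ∑ c, (X₀ ω + δ₀ c ω) ^ p * φ₁ c (I ω)
        + G ^ p * (M ω ^ p * φ₂ (I ω))) ∂P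
      = (∫ ω, X₀ ω ^ p ∂P) * Real.exp (-(R * (b - a))) + ∑ c : S, (∫ ω, (X₀ ω + δ₀ c ω) ^ p ∂P)
      * (rate (c : jumps m × ℤ).1 * (b - a) * Real.exp (-(R * (b - a))))
      + G ^ p * ∫ ω, M ω ^ p * φ₂ (I ω) ∂P := by
    have i₀₁ : Integrable (fun ω => X₀ ω ^ p * φ₀ (I ω)
        + ∑ c, (X₀ ω + δ₀ c ω) ^ p * φ₁ c (I ω)) P :=
      i₀.add (integrable_finsetSum _ fun c _ => i₁ c)
    rw [integral_add i₀₁ (i₂.const_mul _),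
      integral_add i₀ (integrable_finsetSum _ fun c _ => i₁ c),
      integral_finsetSum _ fun c _ => i₁ c, integral_const_mul, v₀,
      Finset.sum_congr rfl fun c _ => v₁ c]
  have e1 : ∫ ω, (Real.exp (-(R * (b - a))) * X₀ ω ^ p + ∑ c : S, rate (c : jumps m × ℤ).1 * (b - a)
            * Real.exp (-(R * (b - a))) * (X₀ ω + δ₀ c ω) ^ p) ∂P
      = (∫ ω, X₀ ω ^ p ∂P) * Real.exp (-(R * (b - a))) + ∑ c : S, (∫ ω, (X₀ ω + δ₀ c ω) ^ p ∂P)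
      * (rate (c : jumps m × ℤ).1 * (b - a) * Real.exp (-(R * (b - a)))) := by
    rw [integral_add (hX₀i.const_mul _) (integrable_finsetSum _ fun c _ => (hδ₀i c).const_mul _),
      integral_finsetSum _ fun c _ => (hδ₀i c).const_mul _, integral_const_mul, mul_comm]
    congr 1
    refine Finset.sum_congr rfl fun c _ => ?_
    rw [integral_const_mul, mul_comm]
  rw [e0, e1]
  have e2 : G ^ p * ∫ ω, M ω ^ p * φ₂ (I ω) ∂P ≤ G ^ p * ((∫ ω, M ω ^ p ∂P)
      * ((R * (b - a) * Real.exp (2 * θ * p)) ^ 2 * Real.exp (R * (b - a) * Real.exp (2 * θ * p)))) :=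
    mul_le_mul_of_nonneg_left v₂ (by positivity)
  rw [← mul_assoc (G ^ p)] at e2
  linarith

end Step

/-! ### The generator -/

section Generator

variable {Ω : Type*} {mΩ : MeasurableSpace Ω} {P : Measure Ω} {ℱ : Filtration ℝ≥0 mΩ} {m : ℕ}
  {rate : ℤ → ℝ≥0} {Q : jumps m × ℤ → ℝ≥0 → Ω → ℕ} {η : ℝ≥0 → Ω → ℤ → Bool}

theorem abs_pairing_le_of_abs_le {n : ℕ} {g F E : ℤ → ℝ} {G J : ℝ} (hG : 0 ≤ G)
    (hg : ∀ y, |g y| ≤ G) (hF : ∀ y, |F y| ≤ J * E y) :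
    |pairing n g F| ≤ G * J * ∑ y ∈ Finset.Icc (-(n : ℤ)) n, E y := by
  unfold pairing
  rw [Finset.mul_sum]
  refine (Finset.abs_sum_le_sum_abs _ _).trans (Finset.sum_le_sum fun y _ => ?_)
  rw [abs_mul, mul_assoc]
  exact mul_le_mul (hg y) (hF y) (abs_nonneg _) hG

/-- The jump of `∑_y g(y) exp (-θ h(y))` at a ringing of the clock `c`. -/
def pairingJump (n : ℕ) (θ : ℝ) (g : ℤ → ℝ) (E : ℤ → ℝ) (σ : ℤ → Bool) (c : jumps m × ℤ) : ℝ :=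
  pairing n g fun y => E y * jumpFactor θ y c σ

/-- The generator of the exclusion process, applied to `(∑_y g(y) exp (-θ h(y)) - Y)^(q + 2)`, when
`g` changes at speed `g'`. -/
def powerGen (rate : ℤ → ℝ≥0) (n q : ℕ) (θ : ℝ) (g g' : ℤ → ℝ) (E : ℤ → ℝ) (σ : ℤ → Bool) (Y : ℝ) :
    ℝ :=
  (q + 2) * (pairing n g E - Y) ^ (q + 1) * pairing n g' E
    + ∑ c : clocksIn m (n + 3 * m), rate (c : jumps m × ℤ).1
      * ((pairing n g E - Y + pairingJump n θ g E σ (c : jumps m × ℤ)) ^ (q + 2)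
        - (pairing n g E - Y) ^ (q + 2))

theorem abs_jump_mul_le {θ : ℝ} (hθ : 0 ≤ θ) {E : ℤ → ℝ} (hE : ∀ y, 0 ≤ E y) (c : jumps m × ℤ)
    (σ : ℤ → Bool) (y : ℤ) :
    |E y * jumpFactor θ y c σ| ≤ 2 * θ * Real.exp (2 * θ) * E y := by
  rw [abs_mul, abs_of_nonneg (hE y), mul_comm]
  exact mul_le_mul_of_nonneg_right (abs_jumpFactor_le hθ y c σ) (hE y)

variable [IsProbabilityMeasure P]

-- The constant `K` is fixed before the time window, the weights and `Y`. It may depend on the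
-- spatial window `n` in any way, because the error is of second order in the length of the step and
-- vanishes when the steps are refined.
set_option maxHeartbeats 1000000 in
theorem exists_moment_step (h : IsExclusionProcess P ℱ m rate Q η) {θ : ℝ} (hθ : 0 ≤ θ) (n : ℕ)
    {q : ℕ} (hq : Even q) {G : ℝ} (hG : 1 ≤ G) :
    ∃ K : ℝ, 0 ≤ K ∧ ∀ (a b : ℝ≥0) (_ : a ≤ b) (_ : (b : ℝ) - a ≤ 1) (Y : Ω → ℝ)
      (_ : AEStronglyMeasurable[ℱ a] Y P) (_ : MemLp Y (q + 2 : ℕ) P)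
      (_ : ∀ y : ℤ, |y| ≤ n → Integrable (fun ω => expHeight θ Q η a y ω ^ (q + 2)) P)
      (g₀ g₁ g' : ℤ → ℝ) (_ : ∀ y, |g₀ y| ≤ G) (_ : ∀ y, |g' y| ≤ G)
      (_ : ∀ y, |g₁ y - g₀ y - (b - a) * g' y| ≤ G * (b - a) ^ 2),
      Integrable (fun ω => powerGen (m := m) rate n q θ g₀ g' (fun y => expHeight θ Q η a y ω)
        (η a ω) (Y ω)) P ∧
      ∫ ω, (pairing n g₁ (fun y => expHeight θ Q η b y ω) - Y ω) ^ (q + 2) ∂P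
        ≤ ∫ ω, (pairing n g₀ (fun y => expHeight θ Q η a y ω) - Y ω) ^ (q + 2) ∂P
          + (b - a) * ∫ ω, powerGen (m := m) rate n q θ g₀ g' (fun y => expHeight θ Q η a y ω)
              (η a ω) (Y ω) ∂P
          + K * (b - a) ^ 2 * ∫ ω, mass n θ Q η Y a ω ^ (q + 2) ∂P := by
  set R := totalRate m rate (n + 3 * m) with hR
  have hR0 : 0 ≤ R := totalRate_nonneg _ _ _
  set J : ℝ := 2 * θ * Real.exp (2 * θ) with hJ
  have hJ0 : 0 ≤ J := by positivity
  have hG0 : 0 ≤ G := by linarith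
  obtain ⟨K₁, hK₁, hK⟩ := exists_step_taylor q hq G J R hG hJ0 hR0
  set E2 : ℝ := Real.exp (2 * θ * (q + 2 : ℕ)) with hE2
  refine ⟨K₁ + (3 * G) ^ (q + 2) * ((R * E2) ^ 2 * Real.exp (R * E2)), by positivity, ?_⟩
  intro a b hab hab1 Y hYm hY hE g₀ g₁ g' hg₀ hg' hg₁
  have hh0 : (0 : ℝ) ≤ b - a := sub_nonneg.mpr (by exact_mod_cast hab)
  set t : ℝ := (b : ℝ) - a with ht
  have ht2 : t ^ 2 ≤ t := by nlinarith
  have hd : ∀ y, |g₁ y - g₀ y| ≤ 2 * t * G := by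
    intro y
    have e : g₁ y - g₀ y = (g₁ y - g₀ y - t * g' y) + t * g' y := by ring
    rw [e]
    refine (abs_add_le _ _).trans ?_
    rw [abs_mul, abs_of_nonneg hh0]
    have h1 := hg₁ y
    have h2 : t * |g' y| ≤ t * G := by gcongr; exact hg' y
    nlinarith
  have hg₁b : ∀ y, |g₁ y| ≤ 3 * G := by
    intro y
    have e : g₁ y = (g₁ y - g₀ y) + g₀ y := by ring
    rw [e]
    refine (abs_add_le _ _).trans ?_
    nlinarith [hd y, hg₀ y]
  -- The weight `g₁` is used at both ends of the step. The change from `g₀` to `g₁` thus takes place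
  -- at time `a` and becomes part of the Taylor expansion.
  have hstep := (moment_step_le h hθ n hab hq hYm hY hE (by linarith : 1 ≤ 3 * G) hg₁b).2
  set p := q + 2 with hp
  have hMi : Integrable (fun ω => mass n θ Q η Y a ω ^ p) P :=
    integrable_mass_pow h n θ a (by omega) hY hE
  have hEpos : ∀ ω y, 0 ≤ expHeight θ Q η a y ω := fun ω y => (expHeight_pos _ _ _ _).le
  have hsumM : ∀ ω, ∑ y ∈ Finset.Icc (-(n : ℤ)) n, expHeight θ Q η a y ω ≤ mass n θ Q η Y a ω :=
    fun ω => le_add_of_nonneg_right (abs_nonneg _)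
  have hYM : ∀ ω, |Y ω| + ∑ y ∈ Finset.Icc (-(n : ℤ)) n, expHeight θ Q η a y ω
      = mass n θ Q η Y a ω := fun ω => add_comm _ _
  have hXM : ∀ ω, |pairing n g₀ (fun y => expHeight θ Q η a y ω) - Y ω| ≤ G * mass n θ Q η Y a ω := by
    intro ω
    refine (abs_sub _ _).trans ?_
    rw [← hYM, mul_add]
    have h1 := abs_pairing_le (n := n) hg₀ (hEpos ω)
    have h2 : |Y ω| ≤ G * |Y ω| := le_mul_of_one_le_left (abs_nonneg _) hG
    linarith
  have hVM : ∀ ω, |pairing n g' (fun y => expHeight θ Q η a y ω)| ≤ G * mass n θ Q η Y a ω :=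
    fun ω => (abs_pairing_le (n := n) hg' (hEpos ω)).trans (mul_le_mul_of_nonneg_left (hsumM ω) hG0)
  have hδM : ∀ ω (c : clocksIn m (n + 3 * m)), |pairingJump n θ g₀ (fun y => expHeight θ Q η a y ω)
      (η a ω) (c : jumps m × ℤ)| ≤ G * J * mass n θ Q η Y a ω := by
    intro ω c
    refine (abs_pairing_le_of_abs_le hG0 hg₀ fun y => abs_jump_mul_le hθ (hEpos ω) _ _ y).trans ?_
    exact mul_le_mul_of_nonneg_left (hsumM ω) (by positivity)
  have hpt : ∀ ω, Real.exp (-(R * t)) * (pairing n g₁ (fun y => expHeight θ Q η a y ω) - Y ω) ^ p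
          + ∑ c : clocksIn m (n + 3 * m), rate (c : jumps m × ℤ).1 * t
            * Real.exp (-(R * t)) * (pairing n g₁ (fun y => expHeight θ Q η a y ω) - Y ω
              + pairing n g₁ fun y => expHeight θ Q η a y ω *
                  jumpFactor θ y (c : jumps m × ℤ) (η a ω)) ^ p
      ≤ (pairing n g₀ (fun y => expHeight θ Q η a y ω) - Y ω) ^ p
          + t * powerGen (m := m) rate n q θ g₀ g' (fun y => expHeight θ Q η a y ω) (η a ω) (Y ω)
          + K₁ * t ^ 2 * mass n θ Q η Y a ω ^ p := by
    intro ω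
    refine hK (clocksIn m (n + 3 * m)) inferInstance (fun c => rate (c : jumps m × ℤ).1)
      (fun c => NNReal.coe_nonneg _)
      (Finset.sum_coe_sort (clocksIn m (n + 3 * m)) fun c => (rate c.1 : ℝ)) t hh0 hab1
      (mass n θ Q η Y a ω) _ _ _ _ _ (hXM ω) (hVM ω) ?_ (hδM ω) ?_
    · have e : pairing n g₁ (fun y => expHeight θ Q η a y ω) - Y ω
          - (pairing n g₀ (fun y => expHeight θ Q η a y ω) - Y ω)
          - t * pairing n g' (fun y => expHeight θ Q η a y ω)
          = pairing n (fun y => g₁ y - g₀ y - t * g' y) (fun y => expHeight θ Q η a y ω) := by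
        simp only [pairing, sub_mul, Finset.sum_sub_distrib, Finset.mul_sum, mul_assoc]
        ring
      rw [e]
      exact (abs_pairing_le (n := n) hg₁ (hEpos ω)).trans
        (mul_le_mul_of_nonneg_left (hsumM ω) (by positivity))
    · intro c
      have e : (pairing n g₁ fun y => expHeight θ Q η a y ω *
                  jumpFactor θ y (c : jumps m × ℤ) (η a ω))
          - pairingJump n θ g₀ (fun y => expHeight θ Q η a y ω) (η a ω) (c : jumps m × ℤ)
          = pairing n (fun y => g₁ y - g₀ y) (fun y => expHeight θ Q η a y ω *
                  jumpFactor θ y (c : jumps m × ℤ) (η a ω)) := by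
        simp only [pairingJump, pairing, sub_mul, Finset.sum_sub_distrib]
      rw [e]
      refine (abs_pairing_le_of_abs_le (by positivity) hd fun y =>
        abs_jump_mul_le hθ (hEpos ω) _ _ y).trans ?_
      rw [← hJ]
      calc 2 * t * G * J * ∑ y ∈ Finset.Icc (-(n : ℤ)) n, expHeight θ Q η a y ω
          ≤ 2 * t * G * J * mass n θ Q η Y a ω := mul_le_mul_of_nonneg_left (hsumM ω) (by positivity)
        _ = _ := by ring
  -- integrability
  have mE : ∀ g : ℤ → ℝ, AEStronglyMeasurable
      (fun ω => pairing n g fun y => expHeight θ Q η a y ω) P :=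
    fun g => (aestronglyMeasurable_pairing h n θ g a).mono (ℱ.le a)
  have mY : AEStronglyMeasurable Y P := hYm.mono (ℱ.le a)
  have mJ : ∀ (g : ℤ → ℝ) (c : jumps m × ℤ), AEStronglyMeasurable (fun ω => pairingJump n θ g
      (fun y => expHeight θ Q η a y ω) (η a ω) c) P :=
    fun g c => (aestronglyMeasurable_pairing_jump h n θ g c a).mono (ℱ.le a)
  have hM0 : ∀ ω, 0 ≤ mass n θ Q η Y a ω := fun ω => mass_nonneg n θ Y a ω
  have hpw : ∀ {f : Ω → ℝ} {C : ℝ}, AEStronglyMeasurable f P →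
      (∀ ω, |f ω| ≤ C * mass n θ Q η Y a ω) → Integrable (fun ω => f ω ^ p) P := by
    intro f C hf hC
    refine integrable_of_le_mass hMi (hf.pow p) (C := C ^ p) fun ω => ?_
    rw [abs_pow, ← mul_pow]
    exact pow_le_pow_left₀ (abs_nonneg _) (hC ω) p
  have iX : ∀ g : ℤ → ℝ, ∀ G' : ℝ, 1 ≤ G' → (∀ y, |g y| ≤ G') →
      Integrable (fun ω => (pairing n g (fun y => expHeight θ Q η a y ω) - Y ω) ^ p) P := by
    intro g G' hG' hg
    refine hpw ((mE g).sub mY) (C := G') fun ω => ?_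
    refine (abs_sub _ _).trans ?_
    rw [← hYM, mul_add]
    have h1 := abs_pairing_le (n := n) hg (hEpos ω)
    have h2 : |Y ω| ≤ G' * |Y ω| := le_mul_of_one_le_left (abs_nonneg _) hG'
    linarith
  have iXJ : ∀ g : ℤ → ℝ, ∀ G' : ℝ, 1 ≤ G' → (∀ y, |g y| ≤ G') → ∀ c : jumps m × ℤ,
      Integrable (fun ω => (pairing n g (fun y => expHeight θ Q η a y ω) - Y ω
        + pairingJump n θ g (fun y => expHeight θ Q η a y ω) (η a ω) c) ^ p) P := by
    intro g G' hG' hg c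
    refine hpw (((mE g).sub mY).add (mJ g c)) (C := G' * (1 + J)) fun ω => ?_
    have h3 : |pairingJump n θ g (fun y => expHeight θ Q η a y ω) (η a ω) c|
        ≤ G' * J * mass n θ Q η Y a ω :=
      (abs_pairing_le_of_abs_le (by linarith) hg fun y => abs_jump_mul_le hθ (hEpos ω) _ _ y).trans
        (mul_le_mul_of_nonneg_left (hsumM ω) (by positivity))
    have h1 := abs_pairing_le (n := n) hg (hEpos ω)
    have h2 : |Y ω| ≤ G' * |Y ω| := le_mul_of_one_le_left (abs_nonneg _) hG'
    have h4 := abs_sub (pairing n g fun y => expHeight θ Q η a y ω) (Y ω)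
    refine (abs_add_le _ _).trans ?_
    have h5 : G' * mass n θ Q η Y a ω
        = G' * |Y ω| + G' * ∑ y ∈ Finset.Icc (-(n : ℤ)) n, expHeight θ Q η a y ω := by
      rw [← hYM, mul_add]
    linarith
  have igen : Integrable (fun ω => powerGen (m := m) rate n q θ g₀ g'
      (fun y => expHeight θ Q η a y ω) (η a ω) (Y ω)) P := by
    unfold powerGen
    refine Integrable.add ?_ (integrable_finsetSum _ fun c _ =>
      ((iXJ g₀ G hG hg₀ c).sub (iX g₀ G hG hg₀)).const_mul _)
    refine integrable_of_le_mass hMi (((((mE g₀).sub mY).pow (q + 1)).const_mul _).mul (mE g'))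
      (C := (q + 2) * G ^ p) fun ω => ?_
    rw [abs_mul, abs_mul, abs_pow, abs_of_nonneg (by positivity : (0 : ℝ) ≤ q + 2)]
    calc ((q : ℝ) + 2) * |pairing n g₀ (fun y => expHeight θ Q η a y ω) - Y ω| ^ (q + 1)
          * |pairing n g' fun y => expHeight θ Q η a y ω|
        ≤ (q + 2) * (G * mass n θ Q η Y a ω) ^ (q + 1) * (G * mass n θ Q η Y a ω) := by
          have := hXM ω
          have := hVM ω
          have := mul_nonneg hG0 (hM0 ω)
          gcongr
      _ = _ := by rw [hp]; ring
  refine ⟨igen, ?_⟩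
  have iL : Integrable (fun ω => Real.exp (-(R * t))
          * (pairing n g₁ (fun y => expHeight θ Q η a y ω) - Y ω) ^ p
          + ∑ c : clocksIn m (n + 3 * m), rate (c : jumps m × ℤ).1 * t
            * Real.exp (-(R * t)) * (pairing n g₁ (fun y => expHeight θ Q η a y ω) - Y ω
              + pairing n g₁ fun y => expHeight θ Q η a y ω *
                  jumpFactor θ y (c : jumps m × ℤ) (η a ω)) ^ p) P :=
    ((iX g₁ (3 * G) (by linarith) hg₁b).const_mul _).add (integrable_finsetSum _ fun c _ =>
      (iXJ g₁ (3 * G) (by linarith) hg₁b c).const_mul _)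
  have iA : Integrable (fun ω => (pairing n g₀ (fun y => expHeight θ Q η a y ω) - Y ω) ^ p
          + t * powerGen (m := m) rate n q θ g₀ g' (fun y => expHeight θ Q η a y ω) (η a ω) (Y ω)) P :=
    (iX g₀ G hG hg₀).add (igen.const_mul _)
  have hmono := integral_mono iL (iA.add (hMi.const_mul (K₁ * t ^ 2))) hpt
  have e : ∫ ω, ((pairing n g₀ (fun y => expHeight θ Q η a y ω) - Y ω) ^ p
          + t * powerGen (m := m) rate n q θ g₀ g' (fun y => expHeight θ Q η a y ω) (η a ω) (Y ω)
          + K₁ * t ^ 2 * mass n θ Q η Y a ω ^ p) ∂P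
      = ∫ ω, (pairing n g₀ (fun y => expHeight θ Q η a y ω) - Y ω) ^ p ∂P
        + t * ∫ ω, powerGen (m := m) rate n q θ g₀ g' (fun y => expHeight θ Q η a y ω)
            (η a ω) (Y ω) ∂P
        + K₁ * t ^ 2 * ∫ ω, mass n θ Q η Y a ω ^ p ∂P := by
    rw [integral_add iA (hMi.const_mul _), integral_add (iX g₀ G hG hg₀) (igen.const_mul _),
      integral_const_mul, integral_const_mul]
  have hmono' := hmono.trans e.le
  refine hstep.trans ?_
  have hMint : 0 ≤ ∫ ω, mass n θ Q η Y a ω ^ p ∂P := integral_nonneg fun ω => pow_nonneg (hM0 ω) p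
  have hlast : (R * t * E2) ^ 2 * Real.exp (R * t * E2) ≤ t ^ 2 * ((R * E2) ^ 2 * Real.exp (R * E2)) := by
    have e1 : (R * t * E2) ^ 2 = t ^ 2 * (R * E2) ^ 2 := by ring
    rw [e1, mul_assoc]
    have hRE : 0 ≤ R * E2 := by positivity
    have : R * t * E2 ≤ R * E2 := by nlinarith
    gcongr
  have hlast' : (3 * G) ^ p * (∫ ω, mass n θ Q η Y a ω ^ p ∂P)
      * ((R * t * E2) ^ 2 * Real.exp (R * t * E2))
      ≤ (3 * G) ^ p * (∫ ω, mass n θ Q η Y a ω ^ p ∂P)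
        * (t ^ 2 * ((R * E2) ^ 2 * Real.exp (R * E2))) := by gcongr
  calc _ ≤ _ := add_le_add hmono' hlast'
    _ = _ := by ring

end Generator

/-! ### Pointwise bounds for the generator -/

section GeneratorBound

variable {m : ℕ}

/-- The relative drift of `exp (-θ h(y))` in the configuration `σ`. -/
def relDrift (rate : ℤ → ℝ≥0) (N : ℕ) (θ : ℝ) (σ : ℤ → Bool) (y : ℤ) : ℝ :=
  ∑ c ∈ clocksIn m N, (rate c.1 : ℝ) * jumpFactor θ y c σ

theorem sum_rate_pairingJump (rate : ℤ → ℝ≥0) (n N : ℕ) (θ : ℝ) (g E : ℤ → ℝ) (σ : ℤ → Bool) :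
    ∑ c ∈ clocksIn m N, (rate c.1 : ℝ) * pairingJump n θ g E σ c
      = pairing n g fun y => E y * relDrift (m := m) rate N θ σ y := by
  simp only [pairingJump, pairing, relDrift, Finset.mul_sum]
  rw [Finset.sum_comm]
  exact Finset.sum_congr rfl fun y _ => Finset.sum_congr rfl fun c _ => by ring

/-- The Taylor remainder with `B = |X| + |δ|`, where `B^q ≤ 2^q (|X|^q + |δ|^q)` separates a
quadratic variation `|X|^q δ²` from a pure jump term `|δ|^(q+2)`. -/
theorem add_pow_sub_le (q : ℕ) (X δ : ℝ) : (X + δ) ^ (q + 2) - X ^ (q + 2)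
    ≤ (q + 2) * X ^ (q + 1) * δ + (q + 2) ^ 2 * 2 ^ q * (|X| ^ q * δ ^ 2 + |δ| ^ (q + 2)) := by
  have h := (abs_le.mp (pow_taylor q (A := X) (D := δ) (B := |X| + |δ|)
    (le_add_of_nonneg_right (abs_nonneg _)) (abs_add_le _ _))).2
  have h2 : (|X| + |δ|) ^ q ≤ 2 ^ q * (|X| ^ q + |δ| ^ q) := by
    rcases le_total |X| |δ| with hle | hle
    · calc (|X| + |δ|) ^ q ≤ (2 * |δ|) ^ q := by gcongr; linarith
        _ = 2 ^ q * |δ| ^ q := mul_pow _ _ _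
        _ ≤ _ := by gcongr; exact le_add_of_nonneg_left (by positivity)
    · calc (|X| + |δ|) ^ q ≤ (2 * |X|) ^ q := by gcongr; linarith
        _ = 2 ^ q * |X| ^ q := mul_pow _ _ _
        _ ≤ _ := by gcongr; exact le_add_of_nonneg_right (by positivity)
  have h3 : (q + 2 : ℝ) ^ 2 * (|X| + |δ|) ^ q * δ ^ 2
      ≤ (q + 2) ^ 2 * (2 ^ q * (|X| ^ q + |δ| ^ q)) * δ ^ 2 := by gcongr
  have h4 : |δ| ^ (q + 2) = |δ| ^ q * δ ^ 2 := by rw [pow_add, sq_abs]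
  rw [h4]
  linarith

/-- A combinatorial constant. -/
def jumpConst (m q : ℕ) : ℝ :=
  (2 * m + 1) ^ (q + 1) * (Fintype.card (jumps m) * (2 * m + 1))

theorem jumpConst_nonneg (m q : ℕ) : 0 ≤ jumpConst m q := by unfold jumpConst; positivity

/-- One clock moves the height at no more than `2 m + 1` points, so the power of the sum costs a
power of `2 m + 1`. Conversely each point is moved by at most `2 m + 1` positions for each hopping
distance. These two counts form `jumpConst`. -/
theorem sum_pairingJump_pow_le (rate : ℤ → ℝ≥0) (hrate : ∀ k : jumps m, rate k ≤ 1) (n N : ℕ) {θ : ℝ}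
    (hθ : 0 ≤ θ) (g E : ℤ → ℝ) (σ : ℤ → Bool) {k q : ℕ} (hkq : k ≤ q + 1) :
    ∑ c ∈ clocksIn m N, (rate c.1 : ℝ) * |pairingJump n θ g E σ c| ^ (k + 1)
      ≤ jumpConst m q * ∑ y ∈ Finset.Icc (-(n : ℤ)) n,
          (2 * θ * Real.exp (2 * θ) * |g y * E y|) ^ (k + 1) := by
  classical
  set J := 2 * θ * Real.exp (2 * θ) with hJ
  have hJ0 : 0 ≤ J := by positivity
  have hB : (1 : ℝ) ≤ 2 * m + 1 := by linarith [(Nat.cast_nonneg m : (0 : ℝ) ≤ m)]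
  have h1 : ∀ c ∈ clocksIn m N, (rate c.1 : ℝ) * |pairingJump n θ g E σ c| ^ (k + 1)
      ≤ (2 * m + 1 : ℝ) ^ (q + 1) * ∑ y ∈ Finset.Icc (-(n : ℤ)) n,
        if crossing y c ≠ 0 then (J * |g y * E y|) ^ (k + 1) else 0 := by
    intro c _
    have hr : (rate c.1 : ℝ) ≤ 1 := by exact_mod_cast hrate c.1
    set A := (Finset.Icc (-(n : ℤ)) n).filter fun y => crossing y c ≠ 0 with hA
    have hcard : (A.card : ℝ) ≤ 2 * m + 1 := by
      have hsub : A ⊆ Finset.Icc (c.2 - m) (c.2 + m) := by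
        intro y hy
        have := abs_le.mp (crossing_ne_zero_bound (Finset.mem_filter.mp hy).2)
        rw [Finset.mem_Icc]; constructor <;> linarith
      have := Finset.card_le_card hsub
      rw [Int.card_Icc] at this
      have h3 : A.card ≤ 2 * m + 1 := by omega
      exact_mod_cast h3
    have e1 : |pairingJump n θ g E σ c| ≤ ∑ y ∈ A, J * |g y * E y| := by
      unfold pairingJump pairing
      rw [hA, Finset.sum_filter]
      refine (Finset.abs_sum_le_sum_abs _ _).trans (Finset.sum_le_sum fun y _ => ?_)
      split_ifs with hc
      · rw [← mul_assoc, abs_mul, mul_comm]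
        exact mul_le_mul_of_nonneg_right (abs_jumpFactor_le hθ y c σ) (abs_nonneg _)
      · simp [jumpFactor_of_crossing_eq_zero (not_not.mp hc)]
    have e2 : (∑ y ∈ A, J * |g y * E y|) ^ (k + 1)
        ≤ (2 * m + 1 : ℝ) ^ (q + 1) * ∑ y ∈ A, (J * |g y * E y|) ^ (k + 1) := by
      rcases A.eq_empty_or_nonempty with h0 | hne
      · simp [h0]
      have hcpos : (0 : ℝ) < A.card := by exact_mod_cast Finset.card_pos.mpr hne
      have := pow_sum_div_card_le_sum_pow (s := A) (f := fun y => J * |g y * E y|) (n := k)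
        fun y _ => by positivity
      rw [div_le_iff₀ (by positivity)] at this
      refine this.trans ?_
      rw [mul_comm]
      refine mul_le_mul_of_nonneg_right ?_ (Finset.sum_nonneg fun y _ => by positivity)
      calc (A.card : ℝ) ^ k ≤ (2 * m + 1) ^ k := by gcongr
        _ ≤ _ := pow_le_pow_right₀ hB hkq
    rw [← Finset.sum_filter, ← hA]
    calc (rate c.1 : ℝ) * |pairingJump n θ g E σ c| ^ (k + 1)
        ≤ 1 * (∑ y ∈ A, J * |g y * E y|) ^ (k + 1) := by gcongr
      _ ≤ _ := by rw [one_mul]; exact e2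
  refine (Finset.sum_le_sum h1).trans ?_
  rw [← Finset.mul_sum, Finset.sum_comm, jumpConst, mul_assoc]
  refine mul_le_mul_of_nonneg_left ?_ (by positivity)
  rw [Finset.mul_sum]
  refine Finset.sum_le_sum fun y _ => ?_
  rw [← Finset.sum_filter, Finset.sum_const, nsmul_eq_mul]
  refine mul_le_mul_of_nonneg_right ?_ (by positivity)
  have hsub : (clocksIn m N).filter (fun c => crossing y c ≠ 0)
      ⊆ Finset.univ ×ˢ Finset.Icc (y - m) (y + m) := by
    intro c hc
    have := abs_le.mp (crossing_ne_zero_bound (Finset.mem_filter.mp hc).2)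
    simp only [Finset.mem_product, Finset.mem_univ, true_and, Finset.mem_Icc]
    constructor <;> linarith
  have h2 := Finset.card_le_card hsub
  rw [Finset.card_product, Int.card_Icc, Finset.card_univ] at h2
  have h3 : (y + m + 1 - (y - m)).toNat = 2 * m + 1 := by omega
  rw [h3] at h2
  exact_mod_cast h2

/-- The generator is bounded by the drift and by the quadratic variation. -/
theorem powerGen_le (rate : ℤ → ℝ≥0) (hrate : ∀ k : jumps m, rate k ≤ 1) (n q : ℕ) {θ : ℝ}
    (hθ : 0 ≤ θ) (g g' E : ℤ → ℝ) (σ : ℤ → Bool) (Y : ℝ) :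
    powerGen (m := m) rate n q θ g g' E σ Y
      ≤ (q + 2) * |pairing n g E - Y| ^ (q + 1)
          * |pairing n (fun y => g' y + g y * relDrift (m := m) rate (n + 3 * m) θ σ y) E|
        + (q + 2) ^ 2 * 2 ^ q * jumpConst m q * ∑ y ∈ Finset.Icc (-(n : ℤ)) n,
          (|pairing n g E - Y| ^ q * (2 * θ * Real.exp (2 * θ) * |g y * E y|) ^ 2
            + (2 * θ * Real.exp (2 * θ) * |g y * E y|) ^ (q + 2)) := by
  unfold powerGen
  set X := pairing n g E - Y with hX
  set δ : jumps m × ℤ → ℝ := fun c => pairingJump n θ g E σ c with hδ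
  rw [Finset.sum_coe_sort (clocksIn m (n + 3 * m)) fun c => (rate c.1 : ℝ) *
    ((X + δ c) ^ (q + 2) - X ^ (q + 2))]
  have h1 : ∑ c ∈ clocksIn m (n + 3 * m), (rate c.1 : ℝ) * ((X + δ c) ^ (q + 2) - X ^ (q + 2))
      ≤ ∑ c ∈ clocksIn m (n + 3 * m), (rate c.1 : ℝ) * ((q + 2) * X ^ (q + 1) * δ c
        + (q + 2) ^ 2 * 2 ^ q * (|X| ^ q * δ c ^ 2 + |δ c| ^ (q + 2))) :=
    Finset.sum_le_sum fun c _ => mul_le_mul_of_nonneg_left (add_pow_sub_le q X (δ c))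
      (NNReal.coe_nonneg _)
  have h2 : ∑ c ∈ clocksIn m (n + 3 * m), (rate c.1 : ℝ) * ((q + 2) * X ^ (q + 1) * δ c
        + (q + 2) ^ 2 * 2 ^ q * (|X| ^ q * δ c ^ 2 + |δ c| ^ (q + 2)))
      = (q + 2) * X ^ (q + 1) * (∑ c ∈ clocksIn m (n + 3 * m), (rate c.1 : ℝ) * δ c)
        + (q + 2) ^ 2 * 2 ^ q * (|X| ^ q * (∑ c ∈ clocksIn m (n + 3 * m), (rate c.1 : ℝ) * |δ c| ^ (1 + 1))
          + ∑ c ∈ clocksIn m (n + 3 * m), (rate c.1 : ℝ) * |δ c| ^ (q + 1 + 1)) := by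
    simp only [Finset.mul_sum, ← Finset.sum_add_distrib, mul_add]
    refine Finset.sum_congr rfl fun c _ => ?_
    rw [show |δ c| ^ (1 + 1) = δ c ^ 2 from sq_abs _]
    ring
  have h3 := sum_rate_pairingJump (m := m) rate n (n + 3 * m) θ g E σ
  have h4 := sum_pairingJump_pow_le (m := m) rate hrate n (n + 3 * m) hθ g E σ (k := 1) (q := q) (by omega)
  have h5 := sum_pairingJump_pow_le (m := m) rate hrate n (n + 3 * m) hθ g E σ (k := q + 1) (q := q) le_rfl
  -- The motion of the weight and the drift of the field are joined before absolute values are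
  -- taken; their cancellation is what makes the bound useful.
  have h6 : pairing n g' E + (pairing n g fun y => E y * relDrift (m := m) rate (n + 3 * m) θ σ y)
      = pairing n (fun y => g' y + g y * relDrift (m := m) rate (n + 3 * m) θ σ y) E := by
    simp only [pairing, add_mul, Finset.sum_add_distrib]
    congr 1
    exact Finset.sum_congr rfl fun y _ => by ring
  set D := pairing n (fun y => g' y + g y * relDrift (m := m) rate (n + 3 * m) θ σ y) E with hD
  have h7 : (q + 2) * X ^ (q + 1) * D ≤ (q + 2) * |X| ^ (q + 1) * |D| := by
    refine (le_abs_self _).trans (le_of_eq ?_)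
    rw [abs_mul, abs_mul, abs_pow, abs_of_nonneg (by positivity : (0 : ℝ) ≤ q + 2)]
  rw [Finset.sum_add_distrib, ← Finset.mul_sum]
  set A2 := ∑ y ∈ Finset.Icc (-(n : ℤ)) n, (2 * θ * Real.exp (2 * θ) * |g y * E y|) ^ 2 with hA2
  set Ap := ∑ y ∈ Finset.Icc (-(n : ℤ)) n, (2 * θ * Real.exp (2 * θ) * |g y * E y|) ^ (q + 2) with hAp
  have h8 : |X| ^ q * (∑ c ∈ clocksIn m (n + 3 * m), (rate c.1 : ℝ) * |δ c| ^ (1 + 1))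
      ≤ |X| ^ q * (jumpConst m q * A2) := mul_le_mul_of_nonneg_left h4 (by positivity)
  have h9 : ((q : ℝ) + 2) ^ 2 * 2 ^ q * (|X| ^ q * (∑ c ∈ clocksIn m (n + 3 * m), (rate c.1 : ℝ) * |δ c| ^ (1 + 1))
          + ∑ c ∈ clocksIn m (n + 3 * m), (rate c.1 : ℝ) * |δ c| ^ (q + 1 + 1))
      ≤ (q + 2) ^ 2 * 2 ^ q * (|X| ^ q * (jumpConst m q * A2) + jumpConst m q * Ap) :=
    mul_le_mul_of_nonneg_left (add_le_add h8 h5) (by positivity)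
  have h10 : (q + 2) * X ^ (q + 1) * pairing n g' E
      + (q + 2) * X ^ (q + 1) * (∑ c ∈ clocksIn m (n + 3 * m), (rate c.1 : ℝ) * δ c)
      = (q + 2) * X ^ (q + 1) * D := by
    rw [← mul_add, ← h6, ← h3]
  have h11 : ((q : ℝ) + 2) ^ 2 * 2 ^ q * (|X| ^ q * (jumpConst m q * A2) + jumpConst m q * Ap)
      = (q + 2) ^ 2 * 2 ^ q * jumpConst m q * (|X| ^ q * A2 + Ap) := by ring
  linarith

end GeneratorBound

/-! ### The drift identity -/

theorem exp_taylor_bound (x : ℝ) (n : ℕ) :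
    |Real.exp x - ∑ i ∈ Finset.range n, x ^ i / i.factorial| ≤ |x| ^ n * Real.exp |x| := by
  have := Complex.norm_exp_sub_sum_le_norm_mul_exp x n
  rw [← Real.norm_eq_abs, ← Real.norm_eq_abs, ← Complex.norm_real, ← Complex.norm_real]
  rw [Complex.norm_real x] at this ⊢
  push_cast
  exact this

theorem exp_taylor_four (x : ℝ) :
    |Real.exp x - (1 + x + x ^ 2 / 2 + x ^ 3 / 6)| ≤ |x| ^ 4 * Real.exp |x| := by
  have := exp_taylor_bound x 4
  simpa [Finset.sum_range_succ, Nat.factorial] using this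

theorem exp_taylor_two (x : ℝ) : |Real.exp x - (1 + x)| ≤ |x| ^ 2 * Real.exp |x| := by
  have := exp_taylor_bound x 2
  simpa [Finset.sum_range_succ] using this

theorem exp_taylor_one (x : ℝ) : |Real.exp x - 1| ≤ |x| * Real.exp |x| := by
  have := exp_taylor_bound x 1
  simpa [Finset.sum_range_succ] using this

theorem abs_mul_le_mul {x y A B : ℝ} (hx : |x| ≤ A) (hy : |y| ≤ B) : |x * y| ≤ A * B := by
  rw [abs_mul]
  exact mul_le_mul hx hy (abs_nonneg _) ((abs_nonneg _).trans hx)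

theorem abs_add_le_add {x y A B : ℝ} (hx : |x| ≤ A) (hy : |y| ≤ B) : |x + y| ≤ A + B :=
  (abs_add_le _ _).trans (add_le_add hx hy)

theorem abs_sub_le_add {x y A B : ℝ} (hx : |x| ≤ A) (hy : |y| ≤ B) : |x - y| ≤ A + B :=
  (abs_sub _ _).trans (add_le_add hx hy)

/-- The corrector whose discrete gradient compensates the second and third order of the drift; its
arguments are the spins at `y - 3, …, y + 1`. -/
def corrector (r₁ r₂ r₃ θ a b c d e : ℝ) : ℝ :=
  θ ^ 2 * (r₂ / 2 * (b * c - c * d)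
      + r₃ * (a * b / 2 + b * c - c * d - d * e / 2 + a * c / 2 - c * e / 2))
    + θ ^ 3 * (r₁ * c / 4 + r₂ * (b / 2 + 3 * c / 2)
      + r₃ * (3 * a / 4 + 3 * b / 2 + 15 * c / 4 + d / 2 + e / 4 + a * b * c / 2))

/-- The contribution of the hops over distance `k` to the relative drift: `P` is the sum of the
products of spins at distance `k` across `y`, and `M` the sum of their differences. -/
def hopDrift (k r G U V P M : ℝ) : ℝ :=
  1 / 4 * (r * V - G * U) * (k - P) + 1 / 4 * (r * U - G * V) * M

/-- The contribution of the distance `k` to the discrete Laplacian of `exp (-θ h)`. -/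
def lapTerm (r θ S S' : ℝ) : ℝ := r / 2 * (Real.exp (-θ * S) + Real.exp (-θ * S') - 2)

/-- The Taylor polynomial, up to the third order in `θ`, of `hopDrift - lapTerm` without the
constant term. -/
def mainTerm (r g θ P M S S' : ℝ) : ℝ :=
  1 / 4 * (2 * g - 2 * r) * θ ^ 2 * P + 1 / 4 * (r * (2 * θ + 4 / 3 * θ ^ 3) - 2 * g * θ ^ 3) * M
    - r / 2 * ((-θ * S + θ ^ 2 * S ^ 2 / 2 - θ ^ 3 * S ^ 3 / 6)
      + (-θ * S' + θ ^ 2 * S' ^ 2 / 2 - θ ^ 3 * S' ^ 3 / 6))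

-- Every function of `θ` is expanded up to `θ³`, so that the remainder `θ⁴` has the order `ε²`. The
-- numerical bounds are those available for at most three hopping distances: sums of up to three
-- spins, of up to three differences of spins, and the slopes. The factors `16 = 2⁴` and `81 = 3⁴`
-- come from the fourth order remainders of `exp (±2θ)` and `exp (-θ S)`, `|S| ≤ 3`.
set_option maxHeartbeats 1000000 in
theorem exists_hopDrift_bound (Θ K : ℝ) (hΘ : 0 ≤ Θ) (hK : 0 ≤ K) : ∃ C : ℝ, 0 ≤ C ∧
    ∀ (θ : ℝ), 0 ≤ θ → θ ≤ Θ → ∀ k r g G P M S S' : ℝ, |r| ≤ 1 → |g| ≤ 7 → |P| ≤ 6 → |M| ≤ 6 →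
      |S| ≤ 3 → |S'| ≤ 3 → |G - g * θ| ≤ K * θ ^ 3 →
      |hopDrift k r G (Real.sinh (2 * θ)) (Real.cosh (2 * θ) - 1) P M - lapTerm r θ S S'
        + 1 / 4 * k * (G * Real.sinh (2 * θ) - r * (Real.cosh (2 * θ) - 1))
        - mainTerm r g θ P M S S'| ≤ C * θ ^ 4 := by
  set A : ℝ := 16 * Real.exp (2 * Θ) with hA
  set B : ℝ := 81 * Real.exp (3 * Θ) with hB
  refine ⟨1 / 4 * (K * (2 + 2 * Θ ^ 2 + A * Θ ^ 3) + 7 * (2 * Θ * 0 + 2 + A * Θ) + A) * 6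
    + 1 / 4 * (A + K * (2 * Θ + A * Θ ^ 3) + 7 * A * Θ) * 6 + B, by positivity, ?_⟩
  intro θ h0 hθ k r g G P M S S' hr hg hP hM hS hS' hG
  have pow4 : 0 ≤ θ ^ 4 := by positivity
  have hexp : ∀ (s c : ℝ), |s| ≤ c → |Real.exp (-θ * s) - (1 + (-θ * s) + (-θ * s) ^ 2 / 2
      + (-θ * s) ^ 3 / 6)| ≤ c ^ 4 * Real.exp (c * Θ) * θ ^ 4 := by
    intro s c hs
    have hc : 0 ≤ c := (abs_nonneg _).trans hs
    refine (exp_taylor_four _).trans ?_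
    have e1 : |-θ * s| ≤ c * θ := by
      rw [abs_mul, abs_neg, abs_of_nonneg h0, mul_comm]; gcongr
    calc |-θ * s| ^ 4 * Real.exp |-θ * s| ≤ (c * θ) ^ 4 * Real.exp (c * Θ) := by
          gcongr; exact e1.trans (by gcongr)
      _ = _ := by ring
  set U := Real.sinh (2 * θ) with hU
  set V := Real.cosh (2 * θ) - 1 with hV
  have hp := hexp (-2) 2 (by norm_num)
  have hm := hexp 2 2 (by norm_num)
  have hA4 : (2 : ℝ) ^ 4 * Real.exp (2 * Θ) = A := by rw [hA]; norm_num
  rw [hA4] at hp hm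
  have e1 : U = (Real.exp (-θ * -2) - Real.exp (-θ * 2)) / 2 := by
    rw [hU, Real.sinh_eq]; ring_nf
  have e2 : V = (Real.exp (-θ * -2) + Real.exp (-θ * 2)) / 2 - 1 := by
    rw [hV, Real.cosh_eq]; ring_nf
  have hU4 : |U - (2 * θ + 4 / 3 * θ ^ 3)| ≤ A * θ ^ 4 := by
    rw [e1]
    obtain ⟨p1, p2⟩ := abs_le.mp hp
    obtain ⟨m1, m2⟩ := abs_le.mp hm
    rw [abs_le]; constructor <;> nlinarith
  have hV4 : |V - 2 * θ ^ 2| ≤ A * θ ^ 4 := by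
    rw [e2]
    obtain ⟨p1, p2⟩ := abs_le.mp hp
    obtain ⟨m1, m2⟩ := abs_le.mp hm
    rw [abs_le]; constructor <;> nlinarith
  have hA0 : 0 ≤ A := by positivity
  have hU3 : |U - 2 * θ| ≤ (2 + A * Θ) * θ ^ 3 := by
    have : U - 2 * θ = (U - (2 * θ + 4 / 3 * θ ^ 3)) + 4 / 3 * θ ^ 3 := by ring
    rw [this]
    refine (abs_add_le_add hU4 (le_of_eq (abs_of_nonneg (by positivity)))).trans ?_
    have : A * θ ^ 4 ≤ A * Θ * θ ^ 3 := by
      rw [show A * θ ^ 4 = A * θ * θ ^ 3 by ring]; gcongr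
    nlinarith [pow_nonneg h0 3]
  have hU1 : |U| ≤ (2 + 2 * Θ ^ 2 + A * Θ ^ 3) * θ := by
    have : U = (U - 2 * θ) + 2 * θ := by ring
    rw [this]
    refine (abs_add_le_add hU3 (le_of_eq (abs_of_nonneg (by positivity)))).trans ?_
    have : (2 + A * Θ) * θ ^ 3 ≤ (2 + A * Θ) * (Θ ^ 2 * θ) := by
      rw [show θ ^ 3 = θ ^ 2 * θ by ring]; gcongr
    linarith
  have hV2 : |V| ≤ (2 + A * Θ ^ 2) * θ ^ 2 := by
    have : V = (V - 2 * θ ^ 2) + 2 * θ ^ 2 := by ring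
    rw [this]
    refine (abs_add_le_add hV4 (le_of_eq (abs_of_nonneg (by positivity)))).trans ?_
    have : A * θ ^ 4 ≤ A * (Θ ^ 2 * θ ^ 2) := by
      rw [show θ ^ 4 = θ ^ 2 * θ ^ 2 by ring]; gcongr
    linarith
  have hgθ : |g * θ| ≤ 7 * θ := by rw [abs_mul, abs_of_nonneg h0]; gcongr
  have hSe := hexp S 3 hS
  have hSe' := hexp S' 3 hS'
  have hB4 : (3 : ℝ) ^ 4 * Real.exp (3 * Θ) = B := by rw [hB]; norm_num
  rw [hB4] at hSe hSe'
  have key : hopDrift k r G U V P M - lapTerm r θ S S' + 1 / 4 * k * (G * U - r * V)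
        - mainTerm r g θ P M S S'
      = 1 / 4 * ((G - g * θ) * U + (g * θ) * (U - 2 * θ) - r * (V - 2 * θ ^ 2)) * P
        + 1 / 4 * (r * (U - (2 * θ + 4 / 3 * θ ^ 3)) - (G - g * θ) * V - (g * θ) * (V - 2 * θ ^ 2)) * M
        - r / 2 * ((Real.exp (-θ * S) - (1 + (-θ * S) + (-θ * S) ^ 2 / 2 + (-θ * S) ^ 3 / 6))
          + (Real.exp (-θ * S') - (1 + (-θ * S') + (-θ * S') ^ 2 / 2 + (-θ * S') ^ 3 / 6))) := by
    unfold hopDrift lapTerm mainTerm; ring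
  rw [key]
  have q4 : |(1 / 4 : ℝ)| ≤ 1 / 4 := le_of_eq (abs_of_nonneg (by norm_num))
  have hr2 : |r / 2| ≤ 1 / 2 := by rw [abs_div, abs_two]; linarith
  have t1 := abs_mul_le_mul (abs_mul_le_mul q4 (abs_sub_le_add (abs_add_le_add (abs_mul_le_mul hG hU1)
    (abs_mul_le_mul hgθ hU3)) (abs_mul_le_mul hr hV4))) hP
  have t2 := abs_mul_le_mul (abs_mul_le_mul q4 (abs_sub_le_add (abs_sub_le_add (abs_mul_le_mul hr hU4)
    (abs_mul_le_mul hG hV2)) (abs_mul_le_mul hgθ hV4))) hM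
  have t3 := abs_mul_le_mul hr2 (abs_add_le_add hSe hSe')
  have t123 := abs_sub_le_add (abs_add_le_add t1 t2) t3
  refine t123.trans ?_
  have b1 : K * θ ^ 3 * ((2 + A * Θ ^ 2) * θ ^ 2) ≤ K * (2 * Θ + A * Θ ^ 3) * θ ^ 4 := by
    rw [show K * θ ^ 3 * ((2 + A * Θ ^ 2) * θ ^ 2) = K * ((2 + A * Θ ^ 2) * θ) * θ ^ 4 by ring]
    have : (2 + A * Θ ^ 2) * θ ≤ (2 + A * Θ ^ 2) * Θ := by gcongr
    have e : (2 + A * Θ ^ 2) * Θ = 2 * Θ + A * Θ ^ 3 := by ring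
    rw [e] at this
    gcongr
  have b2 : 7 * θ * (A * θ ^ 4) ≤ 7 * A * Θ * θ ^ 4 := by
    rw [show 7 * θ * (A * θ ^ 4) = 7 * A * θ * θ ^ 4 by ring]; gcongr
  generalize hc1 : (2 + 2 * Θ ^ 2 + A * Θ ^ 3) = c1
  generalize hc2 : (2 + A * Θ) = c2
  have c12 : 7 * (2 * Θ * 0 + 2 + A * Θ) = 7 * c2 := by rw [← hc2]; ring
  have b3 : K * θ ^ 3 * (c1 * θ) = K * c1 * θ ^ 4 := by ring
  have b4 : 7 * θ * (c2 * θ ^ 3) = 7 * c2 * θ ^ 4 := by ring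
  rw [c12, b3, b4]
  linarith [b1, b2]

/-- The cancellation behind the theorem. The letters `a, …, f` are the spins at `y - 3, …, y + 2`,
and the second arguments of `mainTerm` are the limits of `r_k γ_k / λ`. For these slopes the
expansion, with its constant added, is a discrete gradient of `corrector` up to one product. That
product is accounted for by `E(y + 1) = E(y) e^(-θ d)`: to leading order it is what turns the
gradient of the corrector times `E` into the gradient of their product. The identity is checked on
all `64` spin configurations. -/
theorem mainTerm_sum (r₁ r₂ r₃ θ a b c d e f : ℝ) (ha : a = 1 ∨ a = -1) (hb : b = 1 ∨ b = -1)
    (hc : c = 1 ∨ c = -1) (hd : d = 1 ∨ d = -1) (he : e = 1 ∨ e = -1) (hf : f = 1 ∨ f = -1) :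
    mainTerm r₁ (r₁ + 2 * r₂ + 4 * r₃) θ (c * d) (c - d) d (-c)
      + mainTerm r₂ (r₂ + r₃) θ (b * d + c * e) (b + c - d - e) (d + e) (-b - c)
      + mainTerm r₃ r₃ θ (a * d + b * e + c * f) (a + b + c - d - e - f) (d + e + f) (-a - b - c)
      + θ ^ 2 / 2 * (r₁ + 2 * r₂ + 3 * r₃)
      = corrector r₁ r₂ r₃ θ b c d e f - corrector r₁ r₂ r₃ θ a b c d e
        - θ * d * (θ ^ 2 * (r₂ / 2 * (c * d - d * e)
          + r₃ * (b * c / 2 + c * d - d * e - e * f / 2 + b * d / 2 - d * f / 2))) := by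
  unfold mainTerm corrector
  rcases ha with rfl | rfl <;> rcases hb with rfl | rfl <;> rcases hc with rfl | rfl <;>
    rcases hd with rfl | rfl <;> rcases he with rfl | rfl <;> rcases hf with rfl | rfl <;> ring

/-! ### The drift of the exponential of the height -/

section Drift

variable {m : ℕ}

/-- The generator of the symmetric random walk: the weighted sum of discrete Laplacians. -/
def lop (m : ℕ) (r : ℕ → ℝ) (f : ℤ → ℝ) (z : ℤ) : ℝ :=
  1 / 2 * ∑ k ∈ Finset.Icc 1 m, r k * (f (z + k) + f (z - k) - 2 * f z)

theorem sum_jumps (m : ℕ) (f : ℤ → ℝ) :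
    ∑ k ∈ jumps m, f k = ∑ k ∈ Finset.Icc 1 m, (f k + f (-(k : ℤ))) := by
  have h1 : jumps m = (Finset.Icc 1 m).image (fun k : ℕ => (k : ℤ))
      ∪ (Finset.Icc 1 m).image (fun k : ℕ => -(k : ℤ)) := by
    ext z
    simp only [jumps, Finset.mem_erase, Finset.mem_Icc, Finset.mem_union, Finset.mem_image]
    constructor
    · rintro ⟨h0, h1, h2⟩
      rcases lt_or_gt_of_ne h0 with h | h
      · right; exact ⟨(-z).toNat, by omega, by omega⟩
      · left; exact ⟨z.toNat, by omega, by omega⟩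
    · rintro (⟨k, hk, rfl⟩ | ⟨k, hk, rfl⟩) <;> omega
  rw [h1, Finset.sum_union, Finset.sum_image, Finset.sum_image, Finset.sum_add_distrib]
  · intro a _ b _ h; simpa using h
  · intro a _ b _ h; simpa using h
  · rw [Finset.disjoint_left]
    simp only [Finset.mem_image, Finset.mem_Icc]
    rintro z ⟨k, hk, rfl⟩ ⟨l, hl, h⟩
    omega

/-- The spin of a site, as a real number. -/
def rspin (σ : ℤ → Bool) (i : ℤ) : ℝ := (spin (σ i) : ℝ)

theorem rspin_eq (σ : ℤ → Bool) (i : ℤ) : rspin σ i = 1 ∨ rspin σ i = -1 := by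
  unfold rspin spin; split_ifs <;> simp

theorem abs_rspin (σ : ℤ → Bool) (i : ℤ) : |rspin σ i| = 1 := by
  rcases rspin_eq σ i with h | h <;> simp [h]

theorem indicator_hop (σ : ℤ → Bool) (i l : ℤ) (x : ℝ) :
    (if σ i = true ∧ σ l = false then x else 0)
      = 1 / 4 * (1 + rspin σ i) * (1 - rspin σ l) * x := by
  unfold rspin spin
  cases σ i <;> cases σ l <;> norm_num

theorem sum_clocksIn_crossing {n : ℕ} {x : ℤ} (hx : |x| + m ≤ n)
    (F : ℤ → jumps m × ℤ → ℝ) (hF : ∀ c, F 0 c = 0) :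
    ∑ c ∈ clocksIn m n, F (crossing x c) c = ∑ k : jumps m,
      (∑ i ∈ Finset.Ico (x - k) x, F 1 (k, i) + ∑ i ∈ Finset.Ico x (x - k), F (-1) (k, i)) := by
  unfold clocksIn
  rw [Finset.sum_product]
  refine Finset.sum_congr rfl fun k _ => ?_
  have hk := jumps_bounds k
  have hx' := abs_le.mp (show |x| ≤ (n : ℤ) - m by linarith)
  have e1 : Finset.Ico (x - k) x = (Finset.Icc (-(n : ℤ)) n).filter fun i => x - k ≤ i ∧ i < x := by
    ext i; simp only [Finset.mem_Ico, Finset.mem_filter, Finset.mem_Icc]; omega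
  have e2 : Finset.Ico x (x - k) = (Finset.Icc (-(n : ℤ)) n).filter fun i => x ≤ i ∧ i < x - k := by
    ext i; simp only [Finset.mem_Ico, Finset.mem_filter, Finset.mem_Icc]; omega
  rw [e1, e2, Finset.sum_filter, Finset.sum_filter, ← Finset.sum_add_distrib]
  refine Finset.sum_congr rfl fun i _ => ?_
  unfold crossing
  simp only
  by_cases h1 : x - k ≤ i ∧ i < x
  · rw [if_pos h1, if_pos h1, if_neg (by omega), add_zero]
  · by_cases h2 : x ≤ i ∧ i < x - k
    · rw [if_neg h1, if_pos h2, if_neg h1, if_pos h2, zero_add]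
    · rw [if_neg h1, if_neg h2, if_neg h1, if_neg h2, hF, add_zero]

/-- The sum of the products of spins at distance `k` across `y`. -/
def spinProd (σ : ℤ → Bool) (y : ℤ) (k : ℕ) : ℝ :=
  ∑ i ∈ Finset.Ico (y - k) y, rspin σ i * rspin σ (i + k)

/-- The sum of the differences of spins at distance `k` across `y`. -/
def spinDiff (σ : ℤ → Bool) (y : ℤ) (k : ℕ) : ℝ :=
  ∑ i ∈ Finset.Ico (y - k) y, (rspin σ i - rspin σ (i + k))

/-- The hop from `i` to `i + k` is paired with the reverse hop from `i + k` to `i`. They have rates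
`(r ∓ G) / 2` and relative jumps `e^(±2θ) - 1`; expanding the indicators in spins leaves only
products and differences. -/
theorem relDrift_eq {N : ℕ} {y : ℤ} (hy : |y| + m ≤ N) (rate : ℤ → ℝ≥0) (θ : ℝ) (σ : ℤ → Bool)
    (r G : ℕ → ℝ) (hr : ∀ k ∈ Finset.Icc 1 m, (rate k : ℝ) = 1 / 2 * (r k - G k))
    (hr' : ∀ k ∈ Finset.Icc 1 m, (rate (-(k : ℤ)) : ℝ) = 1 / 2 * (r k + G k)) :
    relDrift (m := m) rate N θ σ y = ∑ k ∈ Finset.Icc 1 m,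
      hopDrift k (r k) (G k) (Real.sinh (2 * θ)) (Real.cosh (2 * θ) - 1)
        (spinProd σ y k) (spinDiff σ y k) := by
  have h1 := sum_clocksIn_crossing hy (fun z c => (rate c.1 : ℝ) *
    (if σ c.2 = true ∧ σ (c.2 + c.1) = false then Real.exp (2 * θ * z) - 1 else 0))
    (fun c => by simp)
  have h2 : relDrift (m := m) rate N θ σ y = ∑ c ∈ clocksIn m N, (rate c.1 : ℝ) *
    (if σ c.2 = true ∧ σ (c.2 + c.1) = false then Real.exp (2 * θ * crossing y c) - 1 else 0) := rfl
  rw [h2, h1, Finset.sum_coe_sort (jumps m) fun k : ℤ =>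
      (∑ i ∈ Finset.Ico (y - k) y, (rate k : ℝ) *
        (if σ i = true ∧ σ (i + k) = false then Real.exp (2 * θ * (1 : ℤ)) - 1 else 0)
      + ∑ i ∈ Finset.Ico y (y - k), (rate k : ℝ) *
        (if σ i = true ∧ σ (i + k) = false then Real.exp (2 * θ * (-1 : ℤ)) - 1 else 0)), sum_jumps]
  refine Finset.sum_congr rfl fun k hk => ?_
  rw [Finset.Ico_eq_empty (a := y) (b := y - k) (by omega),
    Finset.Ico_eq_empty (a := y - -(k : ℤ)) (by omega), Finset.sum_empty, Finset.sum_empty, add_zero,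
    zero_add, hr k hk, hr' k hk]
  have e3 : Finset.Ico y (y - -(k : ℤ)) = (Finset.Ico (y - k) y).map (addRightEmbedding (k : ℤ)) := by
    rw [Finset.map_add_right_Ico]; congr 1 <;> ring
  rw [e3, Finset.sum_map, ← Finset.sum_add_distrib]
  have e4 : (k : ℝ) = ∑ i ∈ Finset.Ico (y - k) y, (1 : ℝ) := by
    simp
  unfold hopDrift spinProd spinDiff
  rw [e4, ← Finset.sum_sub_distrib, Finset.mul_sum, Finset.mul_sum, ← Finset.sum_add_distrib]
  refine Finset.sum_congr rfl fun i _ => ?_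
  simp only [addRightEmbedding_apply, indicator_hop, add_neg_cancel_right]
  rw [Real.sinh_eq, Real.cosh_eq]
  push_cast
  rw [mul_one, show 2 * θ * -1 = -(2 * θ) by ring]
  ring

theorem sum_Icc_one_eq_three (hm : m ≤ 3) (f : ℕ → ℝ) :
    ∑ k ∈ Finset.Icc 1 m, f k = ∑ k ∈ Finset.Icc 1 3, if k ≤ m then f k else 0 := by
  rw [← Finset.sum_filter]
  congr 1
  ext k; simp only [Finset.mem_Icc, Finset.mem_filter]; omega

theorem sum_Icc_one_three (f : ℕ → ℝ) : ∑ k ∈ Finset.Icc 1 3, f k = f 1 + f 2 + f 3 := by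
  rw [show Finset.Icc 1 3 = {1, 2, 3} from rfl]
  simp [add_assoc]

theorem ico_one (y : ℤ) : Finset.Ico (y - 1) y = {y - 1} := by
  ext i; simp only [Finset.mem_Ico, Finset.mem_singleton]; omega

theorem ico_two (y : ℤ) : Finset.Ico (y - 2) y = {y - 2, y - 1} := by
  ext i; simp only [Finset.mem_Ico, Finset.mem_singleton, Finset.mem_insert]; omega

theorem ico_three (y : ℤ) : Finset.Ico (y - 3) y = {y - 3, y - 2, y - 1} := by
  ext i; simp only [Finset.mem_Ico, Finset.mem_singleton, Finset.mem_insert]; omega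

theorem sum_ico_one (y : ℤ) (f : ℤ → ℝ) : ∑ i ∈ Finset.Ico (y - 1) y, f i = f (y - 1) := by
  rw [ico_one, Finset.sum_singleton]

theorem sum_ico_two (y : ℤ) (f : ℤ → ℝ) :
    ∑ i ∈ Finset.Ico (y - 2) y, f i = f (y - 2) + f (y - 1) := by
  rw [ico_two, Finset.sum_insert, Finset.sum_singleton]
  simp

theorem sum_ico_three (y : ℤ) (f : ℤ → ℝ) :
    ∑ i ∈ Finset.Ico (y - 3) y, f i = f (y - 3) + f (y - 2) + f (y - 1) := by
  rw [ico_three, Finset.sum_insert, Finset.sum_insert, Finset.sum_singleton]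
  · ring
  · simp
  · simp

/-- The increment of the height over the `k` sites to the right of `y`. -/
def riseRight (σ : ℤ → Bool) (y : ℤ) (k : ℕ) : ℝ := ∑ i ∈ Finset.Ico (y - k) y, rspin σ (i + k)

/-- The increment of the height over the `k` sites to the left of `y`, from right to left. -/
def riseLeft (σ : ℤ → Bool) (y : ℤ) (k : ℕ) : ℝ := -∑ i ∈ Finset.Ico (y - k) y, rspin σ i

theorem abs_sum_ico_le (y : ℤ) {k : ℕ} (f : ℤ → ℝ) {B : ℝ} (h : ∀ i, |f i| ≤ B) :
    |∑ i ∈ Finset.Ico (y - k) y, f i| ≤ k * B := by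
  refine (Finset.abs_sum_le_sum_abs _ _).trans ((Finset.sum_le_card_nsmul _ _ B fun i _ => h i).trans ?_)
  simp

theorem exp_ratio (σ : ℤ → Bool) {θ : ℝ} {E : ℤ → ℝ}
    (hE : ∀ y, E (y + 1) = E y * Real.exp (-θ * rspin σ y)) (y : ℤ) (k : ℕ) :
    E y = E (y - k) * Real.exp (-θ * ∑ i ∈ Finset.Ico (y - k) y, rspin σ i) := by
  induction k with
  | zero => simp
  | succ k ih =>
    have e : Finset.Ico (y - (k + 1 : ℕ)) y = insert (y - (k + 1 : ℕ)) (Finset.Ico (y - k) y) := by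
      ext i; simp only [Finset.mem_Ico, Finset.mem_insert]; push_cast; omega
    have h1 := hE (y - (k + 1 : ℕ))
    have h2 : y - ((k + 1 : ℕ) : ℤ) + 1 = y - k := by push_cast; ring
    rw [h2] at h1
    rw [e, Finset.sum_insert (by simp; omega), mul_add, Real.exp_add, ← mul_assoc, ← h1]
    exact ih

theorem lop_exp (σ : ℤ → Bool) {θ : ℝ} {E : ℤ → ℝ}
    (hE : ∀ y, E (y + 1) = E y * Real.exp (-θ * rspin σ y)) (r : ℕ → ℝ) (y : ℤ) :
    lop m r E y = E y * ∑ k ∈ Finset.Icc 1 m, lapTerm (r k) θ (riseRight σ y k) (riseLeft σ y k) := by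
  unfold lop
  rw [Finset.mul_sum, Finset.mul_sum]
  refine Finset.sum_congr rfl fun k _ => ?_
  have h1 := exp_ratio σ hE (y + k) k
  have h2 := exp_ratio σ hE y k
  rw [add_sub_cancel_right] at h1
  have h3 : ∑ i ∈ Finset.Ico y (y + k), rspin σ i = riseRight σ y k := by
    have e3 : Finset.Ico y (y + k) = (Finset.Ico (y - k) y).map (addRightEmbedding (k : ℤ)) := by
      rw [Finset.map_add_right_Ico]; congr 1; ring
    rw [e3, Finset.sum_map]; rfl
  rw [h3] at h1
  have h4 : E (y - k) = E y * Real.exp (-θ * riseLeft σ y k) := by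
    unfold riseLeft
    conv_rhs => rw [h2]
    rw [mul_assoc, ← Real.exp_add, show -θ * ∑ i ∈ Finset.Ico (y - ↑k) y, rspin σ i
      + -θ * -∑ i ∈ Finset.Ico (y - ↑k) y, rspin σ i = 0 by ring, Real.exp_zero, mul_one]
  rw [h1, h4]
  unfold lapTerm
  ring

end Drift

/-! ### Cancellation in the drift up to second order in ε. -/

section DriftIdentity

variable {m : ℕ}

/-- A rate of hopping, extended by `0` to the distances larger than `m`. -/
def extend (m : ℕ) (r : ℕ → ℝ) (k : ℕ) : ℝ := if k ≤ m then r k else 0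

/-- The corrector at `y` of the configuration `σ`. -/
def correctorAt (m : ℕ) (r : ℕ → ℝ) (θ : ℝ) (σ : ℤ → Bool) (y : ℤ) : ℝ :=
  corrector (extend m r 1) (extend m r 2) (extend m r 3) θ (rspin σ (y - 3)) (rspin σ (y - 2))
    (rspin σ (y - 1)) (rspin σ y) (rspin σ (y + 1))

/-- The second order part of the corrector at `y + 1`. -/
def correctorTwo (r₂ r₃ b c d e f : ℝ) : ℝ :=
  r₂ / 2 * (c * d - d * e)
    + r₃ * (b * c / 2 + c * d - d * e - e * f / 2 + b * d / 2 - d * f / 2)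

/-- The limit of `r_k γ_k / λ`. -/
def slope (r : ℕ → ℝ) (m k : ℕ) : ℝ :=
  2 * ∑ k' ∈ Finset.Icc (k + 1) m, ((k' : ℝ) - k) / k * r k' + r k

theorem mainTerm_zero (θ P M S S' : ℝ) : mainTerm 0 0 θ P M S S' = 0 := by
  unfold mainTerm; ring

/-- Extending the rates by zero reduces every `m ≤ 3` to three distances: the slopes at distances up
to `m` do not change, and those beyond `m` vanish together with their terms. -/
theorem sum_mainTerm (hm : m ≤ 3) (r : ℕ → ℝ) (θ : ℝ) (σ : ℤ → Bool) (y : ℤ) :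
    ∑ k ∈ Finset.Icc 1 m, mainTerm (r k) (slope r m k) θ (spinProd σ y k) (spinDiff σ y k)
        (riseRight σ y k) (riseLeft σ y k)
      + θ ^ 2 / 2 * ∑ k ∈ Finset.Icc 1 m, r k * k
      = correctorAt m r θ σ (y + 1) - correctorAt m r θ σ y
        - θ * rspin σ y * (θ ^ 2 * correctorTwo (extend m r 2) (extend m r 3) (rspin σ (y - 2))
          (rspin σ (y - 1)) (rspin σ y) (rspin σ (y + 1)) (rspin σ (y + 2))) := by
  have hext : ∀ k ∈ Finset.Icc 1 3, (if k ≤ m then mainTerm (r k) (slope r m k) θ (spinProd σ y k)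
        (spinDiff σ y k) (riseRight σ y k) (riseLeft σ y k) else 0)
      = mainTerm (extend m r k) (slope (extend m r) 3 k) θ (spinProd σ y k)
        (spinDiff σ y k) (riseRight σ y k) (riseLeft σ y k) := by
    intro k hk
    unfold extend
    split_ifs with h
    · congr 1
      unfold slope
      beta_reduce
      rw [if_pos h]
      congr 2
      rw [← Finset.sum_subset (Finset.Icc_subset_Icc_right hm)]
      · exact Finset.sum_congr rfl fun l hl => by rw [if_pos (Finset.mem_Icc.mp hl).2]
      · intro l hl hl'
        rw [if_neg, mul_zero]
        simp only [Finset.mem_Icc] at hl hl'; omega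
    · have : slope (fun k => if k ≤ m then r k else 0) 3 k = 0 := by
        unfold slope
        beta_reduce
        rw [if_neg h, Finset.sum_eq_zero]
        · ring
        · intro l hl
          rw [if_neg, mul_zero]
          simp only [Finset.mem_Icc] at hl; omega
      rw [this, mainTerm_zero]
  have hext2 : ∀ k ∈ Finset.Icc 1 3, (if k ≤ m then r k * (k : ℝ) else 0) = extend m r k * k := by
    intro k _; unfold extend; split_ifs <;> simp
  rw [sum_Icc_one_eq_three hm, sum_Icc_one_eq_three hm, Finset.sum_congr rfl hext,
    Finset.sum_congr rfl hext2, sum_Icc_one_three, sum_Icc_one_three]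
  unfold correctorAt
  generalize extend m r = R
  have s1 : slope R 3 1 = R 1 + 2 * R 2 + 4 * R 3 := by
    unfold slope
    rw [show Finset.Icc (1 + 1) 3 = {2, 3} from rfl, Finset.sum_pair (by norm_num)]
    push_cast; ring
  have s2 : slope R 3 2 = R 2 + R 3 := by
    unfold slope
    rw [show Finset.Icc (2 + 1) 3 = {3} from rfl, Finset.sum_singleton]
    push_cast; ring
  have s3 : slope R 3 3 = R 3 := by
    unfold slope
    rw [show Finset.Icc (3 + 1) 3 = ∅ from rfl, Finset.sum_empty]
    ring
  rw [s1, s2, s3]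
  unfold spinProd spinDiff riseRight riseLeft
  have c2 : ((2 : ℕ) : ℤ) = 2 := rfl
  have c3 : ((3 : ℕ) : ℤ) = 3 := rfl
  simp only [Nat.cast_one, c2, c3, sum_ico_one, sum_ico_two, sum_ico_three]
  rw [show y - 1 + 1 = y by ring, show y - 2 + 2 = y by ring, show y - 1 + 2 = y + 1 by ring,
    show y - 3 + 3 = y by ring, show y - 2 + 3 = y + 1 by ring, show y - 1 + 3 = y + 2 by ring,
    show y + 1 - 3 = y - 2 by ring, show y + 1 - 2 = y - 1 by ring, show y + 1 - 1 = y by ring,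
    show y + 1 + 1 = y + 2 by ring]
  have := mainTerm_sum (R 1) (R 2) (R 3) θ (rspin σ (y - 3)) (rspin σ (y - 2)) (rspin σ (y - 1))
    (rspin σ y) (rspin σ (y + 1)) (rspin σ (y + 2)) (rspin_eq _ _) (rspin_eq _ _) (rspin_eq _ _)
    (rspin_eq _ _) (rspin_eq _ _) (rspin_eq _ _)
  unfold correctorTwo
  rw [← this]
  simp only [Nat.cast_ofNat]
  rw [show -(rspin σ (y - 2) + rspin σ (y - 1)) = -rspin σ (y - 2) - rspin σ (y - 1) by ring,
    show -(rspin σ (y - 3) + rspin σ (y - 2) + rspin σ (y - 1))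
      = -rspin σ (y - 3) - rspin σ (y - 2) - rspin σ (y - 1) by ring,
    show rspin σ (y - 2) - rspin σ y + (rspin σ (y - 1) - rspin σ (y + 1))
      = rspin σ (y - 2) + rspin σ (y - 1) - rspin σ y - rspin σ (y + 1) by ring,
    show rspin σ (y - 3) - rspin σ y + (rspin σ (y - 2) - rspin σ (y + 1))
        + (rspin σ (y - 1) - rspin σ (y + 2))
      = rspin σ (y - 3) + rspin σ (y - 2) + rspin σ (y - 1) - rspin σ y - rspin σ (y + 1)
        - rspin σ (y + 2) by ring]
  ring

theorem abs_correctorTwo_le {r₂ r₃ b c d e f : ℝ} (h2 : |r₂| ≤ 1) (h3 : |r₃| ≤ 1) (hb : |b| ≤ 1)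
    (hc : |c| ≤ 1) (hd : |d| ≤ 1) (he : |e| ≤ 1) (hf : |f| ≤ 1) :
    |correctorTwo r₂ r₃ b c d e f| ≤ 5 := by
  have hh : |(2 : ℝ)| = 2 := abs_two
  have div2 : ∀ {x A : ℝ}, |x| ≤ A → |x / 2| ≤ A / 2 := fun h => by rw [abs_div, hh]; linarith
  unfold correctorTwo
  refine (abs_add_le_add (abs_mul_le_mul (div2 h2) (abs_sub_le_add (abs_mul_le_mul hc hd)
    (abs_mul_le_mul hd he))) (abs_mul_le_mul h3 (abs_sub_le_add (abs_add_le_add (abs_sub_le_add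
      (abs_sub_le_add (abs_add_le_add (div2 (abs_mul_le_mul hb hc)) (abs_mul_le_mul hc hd))
        (abs_mul_le_mul hd he)) (div2 (abs_mul_le_mul he hf))) (div2 (abs_mul_le_mul hb hd)))
      (div2 (abs_mul_le_mul hd hf))))).trans ?_
  norm_num

/-- The third order part of the corrector. -/
def correctorThree (r₁ r₂ r₃ a b c d e : ℝ) : ℝ :=
  r₁ * c / 4 + r₂ * (b / 2 + 3 * c / 2)
      + r₃ * (3 * a / 4 + 3 * b / 2 + 15 * c / 4 + d / 2 + e / 4 + a * b * c / 2)

theorem abs_correctorThree_le {r₁ r₂ r₃ a b c d e : ℝ} (h1 : |r₁| ≤ 1) (h2 : |r₂| ≤ 1)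
    (h3 : |r₃| ≤ 1) (ha : |a| ≤ 1) (hb : |b| ≤ 1) (hc : |c| ≤ 1) (hd : |d| ≤ 1) (he : |e| ≤ 1) :
    |correctorThree r₁ r₂ r₃ a b c d e| ≤ 10 := by
  have dv : ∀ {x A : ℝ} (n : ℝ), 0 < n → |x| ≤ A → |x / n| ≤ A / n := fun n hn h => by
    rw [abs_div, abs_of_pos hn]; gcongr
  have ml : ∀ {x A : ℝ} (n : ℝ), 0 < n → |x| ≤ A → |n * x| ≤ n * A := fun n hn h => by
    rw [abs_mul, abs_of_pos hn]; gcongr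
  unfold correctorThree
  refine (abs_add_le_add (abs_add_le_add (dv 4 (by norm_num) (abs_mul_le_mul h1 hc))
    (abs_mul_le_mul h2 (abs_add_le_add (dv 2 (by norm_num) hb)
      (dv 2 (by norm_num) (ml 3 (by norm_num) hc)))))
    (abs_mul_le_mul h3 (abs_add_le_add (abs_add_le_add (abs_add_le_add (abs_add_le_add (abs_add_le_add
      (dv 4 (by norm_num) (ml 3 (by norm_num) ha)) (dv 2 (by norm_num) (ml 3 (by norm_num) hb)))
      (dv 4 (by norm_num) (ml 15 (by norm_num) hc))) (dv 2 (by norm_num) hd)) (dv 4 (by norm_num) he))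
      (dv 2 (by norm_num) (abs_mul_le_mul (abs_mul_le_mul ha hb) hc))))).trans ?_
  norm_num

theorem correctorAt_succ_eq (r : ℕ → ℝ) (θ : ℝ) (σ : ℤ → Bool) (y : ℤ) :
    correctorAt m r θ σ (y + 1) = θ ^ 2 * correctorTwo (extend m r 2) (extend m r 3)
        (rspin σ (y - 2)) (rspin σ (y - 1)) (rspin σ y) (rspin σ (y + 1)) (rspin σ (y + 2))
      + θ ^ 3 * correctorThree (extend m r 1) (extend m r 2) (extend m r 3)
        (rspin σ (y - 2)) (rspin σ (y - 1)) (rspin σ y) (rspin σ (y + 1)) (rspin σ (y + 2)) := by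
  unfold correctorAt corrector correctorTwo correctorThree
  rw [show y + 1 - 3 = y - 2 by ring, show y + 1 - 2 = y - 1 by ring, show y + 1 - 1 = y by ring,
    show y + 1 + 1 = y + 2 by ring]

theorem sq_lam_sqrt {lam ε : ℝ} (hε : 0 ≤ ε) : (lam * √ε) ^ 2 = lam ^ 2 * ε := by
  rw [mul_pow, Real.sq_sqrt hε]

/-- The exponential growth rate `ε ν_ε` compensates the constant part of the drift up to `ε²`. -/
theorem abs_growth_sub_le (hm : m ≤ 3) (lam K : ℝ) (hK : 0 ≤ K) {ε : ℝ} (hε : ε ∈ Ioo (0 : ℝ) 1)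
    {r γ rt : ℕ → ℝ} (hr : ∀ k ∈ Finset.Icc 1 m, |r k| ≤ 1)
    (hrt : ∀ k ∈ Finset.Icc 1 m, |rt k - r k| ≤ K * ε) :
    |ε * nu m lam r γ rt ε - (∑ k ∈ Finset.Icc 1 m, 1 / 4 * (k : ℝ)
        * ((r k * γ k * √ε) * Real.sinh (2 * (lam * √ε)) - r k * (Real.cosh (2 * (lam * √ε)) - 1))
      + (lam * √ε) ^ 2 / 2 * ∑ k ∈ Finset.Icc 1 m, r k * k)|
      ≤ 3 * (lam ^ 2 / 2 * (3 * K + (1 + K) * (4 * lam ^ 2))) * ε ^ 2 := by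
  obtain ⟨h0, h1⟩ := hε
  have hs : 0 < √ε := Real.sqrt_pos.mpr h0
  have e1 : ε * uFun lam ε = √ε * Real.sinh (2 * (lam * √ε)) := by
    unfold uFun
    rw [← mul_assoc 2 lam, ← mul_div_assoc, mul_div_right_comm, Real.div_sqrt]
  have e2 : ε * vFun lam ε = Real.cosh (2 * (lam * √ε)) - 1 := by
    unfold vFun
    rw [← mul_assoc 2 lam]; field_simp
  -- Only two discrepancies remain, `r̃_k - r_k` and a term that carries an explicit `ε`; each is
  -- multiplied by `λ² ε / 2`.
  have e3 : ε * nu m lam r γ rt ε - (∑ k ∈ Finset.Icc 1 m, 1 / 4 * (k : ℝ)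
        * ((r k * γ k * √ε) * Real.sinh (2 * (lam * √ε)) - r k * (Real.cosh (2 * (lam * √ε)) - 1))
      + (lam * √ε) ^ 2 / 2 * ∑ k ∈ Finset.Icc 1 m, r k * k)
      = ∑ k ∈ Finset.Icc 1 m, (lam ^ 2 / 2 * ε) * ((rt k - r k) * k
          + rt k * (ε / 12 * (6 * (k : ℝ) ^ 2 - 5 * (k : ℝ)) * lam ^ 2)) := by
    unfold nu
    rw [← e2, sq_lam_sqrt h0.le, mul_add, Finset.mul_sum, Finset.mul_sum, Finset.mul_sum,
      Finset.mul_sum, add_sub_add_comm, ← Finset.sum_sub_distrib, ← Finset.sum_sub_distrib,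
      ← Finset.sum_add_distrib]
    refine Finset.sum_congr rfl fun k _ => ?_
    have : (r k * γ k * √ε) * Real.sinh (2 * (lam * √ε)) = r k * γ k * (ε * uFun lam ε) := by
      rw [e1]; ring
    rw [this]; ring
  rw [e3]
  have hterm : ∀ k ∈ Finset.Icc 1 m, |(lam ^ 2 / 2 * ε) * ((rt k - r k) * k
      + rt k * (ε / 12 * (6 * (k : ℝ) ^ 2 - 5 * (k : ℝ)) * lam ^ 2))|
      ≤ (lam ^ 2 / 2 * (3 * K + (1 + K) * (4 * lam ^ 2))) * ε ^ 2 := by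
    intro k hk
    have hk' := Finset.mem_Icc.mp hk
    have hk1 : (1 : ℝ) ≤ k := by exact_mod_cast hk'.1
    have hk3 : (k : ℝ) ≤ 3 := by exact_mod_cast hk'.2.trans hm
    have a1 : |(k : ℝ)| ≤ 3 := by rw [abs_of_nonneg (by linarith)]; exact hk3
    have a2 : |rt k| ≤ 1 + K := by
      have : rt k = r k + (rt k - r k) := by ring
      rw [this]
      refine (abs_add_le_add (hr k hk) (hrt k hk)).trans ?_
      nlinarith
    have a3 : |ε / 12 * (6 * (k : ℝ) ^ 2 - 5 * (k : ℝ)) * lam ^ 2| ≤ 4 * lam ^ 2 * ε := by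
      rw [abs_mul, abs_mul, abs_of_pos (by positivity : 0 < ε / 12), abs_of_nonneg (sq_nonneg lam),
        abs_of_nonneg (by nlinarith)]
      have : 6 * (k : ℝ) ^ 2 - 5 * k ≤ 48 := by nlinarith
      calc ε / 12 * (6 * (k : ℝ) ^ 2 - 5 * k) * lam ^ 2 ≤ ε / 12 * 48 * lam ^ 2 := by gcongr
        _ = _ := by ring
    have a4 : |lam ^ 2 / 2 * ε| ≤ lam ^ 2 / 2 * ε := le_of_eq (abs_of_nonneg (by positivity))
    refine (abs_mul_le_mul a4 (abs_add_le_add (abs_mul_le_mul (hrt k hk) a1)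
      (abs_mul_le_mul a2 a3))).trans (le_of_eq ?_)
    ring
  refine (Finset.abs_sum_le_sum_abs _ _).trans ((Finset.sum_le_card_nsmul _ _ _ hterm).trans ?_)
  rw [Nat.card_Icc, nsmul_eq_mul, mul_assoc 3]
  have : ((m + 1 - 1 : ℕ) : ℝ) ≤ 3 := by exact_mod_cast (by omega : m + 1 - 1 ≤ 3)
  exact mul_le_mul_of_nonneg_right this (by positivity)

theorem rate_le_one {r : ℕ → ℝ} (hr : ∀ k ∈ Finset.Icc 1 m, 0 < r k)
    (hr1 : ∑ k ∈ Finset.Icc 1 m, r k = 1) {k : ℕ} (hk : k ∈ Finset.Icc 1 m) : r k ≤ 1 := by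
  rw [← hr1]
  exact Finset.single_le_sum (f := r) (fun i hi => (hr i hi).le) hk

theorem abs_slope_le (hm : m ≤ 3) {r : ℕ → ℝ} (hr : ∀ k ∈ Finset.Icc 1 m, 0 < r k)
    (hr1 : ∑ k ∈ Finset.Icc 1 m, r k = 1) {k : ℕ} (hk : k ∈ Finset.Icc 1 m) : |slope r m k| ≤ 7 := by
  have hk' := Finset.mem_Icc.mp hk
  have hk1 : (1 : ℝ) ≤ k := by exact_mod_cast hk'.1
  have hsub : Finset.Icc (k + 1) m ⊆ Finset.Icc 1 m := Finset.Icc_subset_Icc_left (by omega)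
  have h1 : ∀ l ∈ Finset.Icc (k + 1) m, 0 ≤ ((l : ℝ) - k) / k * r l ∧
      ((l : ℝ) - k) / k * r l ≤ 2 * r l := by
    intro l hl
    have hr0 := (hr l (hsub hl)).le
    have hl' := Finset.mem_Icc.mp hl
    have hl1 : (k : ℝ) + 1 ≤ l := by exact_mod_cast hl'.1
    have hl3 : (l : ℝ) ≤ 3 := by exact_mod_cast hl'.2.trans hm
    refine ⟨mul_nonneg (div_nonneg (by linarith) (by linarith)) hr0, ?_⟩
    refine mul_le_mul_of_nonneg_right ?_ hr0
    rw [div_le_iff₀ (by linarith)]; linarith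
  have h2 : ∑ l ∈ Finset.Icc (k + 1) m, ((l : ℝ) - k) / k * r l ≤ 2 := by
    calc _ ≤ ∑ l ∈ Finset.Icc (k + 1) m, 2 * r l := Finset.sum_le_sum fun l hl => (h1 l hl).2
      _ = 2 * ∑ l ∈ Finset.Icc (k + 1) m, r l := by rw [Finset.mul_sum]
      _ ≤ 2 * ∑ l ∈ Finset.Icc 1 m, r l := by
          refine mul_le_mul_of_nonneg_left (Finset.sum_le_sum_of_subset_of_nonneg hsub
            fun i hi _ => (hr i hi).le) (by norm_num)
      _ = 2 := by rw [hr1, mul_one]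
  have h3 : 0 ≤ ∑ l ∈ Finset.Icc (k + 1) m, ((l : ℝ) - k) / k * r l :=
    Finset.sum_nonneg fun l hl => (h1 l hl).1
  have h4 := rate_le_one hr hr1 hk
  have h5 := hr k hk
  unfold slope
  rw [abs_of_nonneg (by linarith)]; linarith

theorem slope_eq_gammaLimit {lam : ℝ} {r : ℕ → ℝ} {k : ℕ} (hr : 0 < r k) :
    r k * gammaLimit m lam r k = lam * slope r m k := by
  unfold gammaLimit slope
  field_simp

/-- The condition `|γ_k| √ε ≤ 1` is the nonnegativity of both rates `q_{±k}`; it also bounds them by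
`r_k ≤ 1`. -/
theorem abs_hopRate_le {r γ : ℕ → ℝ} {ε : ℝ} {k : ℤ} (hr : 0 < r k.natAbs) (hr1 : r k.natAbs ≤ 1)
    (hγ : |γ k.natAbs| * √ε ≤ 1) : 0 ≤ hopRate r γ ε k ∧ hopRate r γ ε k ≤ 1 := by
  unfold hopRate
  have h1 : |(k.sign : ℝ) * γ k.natAbs * √ε| ≤ 1 := by
    have : |(k.sign : ℝ)| ≤ 1 := by
      rcases lt_trichotomy k 0 with h | h | h
      · simp [Int.sign_eq_neg_one_of_neg h]
      · simp [h]
      · simp [Int.sign_eq_one_of_pos h]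
    rw [abs_mul, abs_mul, abs_of_nonneg (Real.sqrt_nonneg _), mul_assoc]
    calc _ ≤ 1 * (|γ k.natAbs| * √ε) := by gcongr
      _ ≤ 1 := by rw [one_mul]; exact hγ
  obtain ⟨h2, h3⟩ := abs_le.mp h1
  constructor
  · exact mul_nonneg (by linarith) (by linarith)
  · calc 1 / 2 * r k.natAbs * (1 - (k.sign : ℝ) * γ k.natAbs * √ε) ≤ 1 / 2 * 1 * 2 := by
          gcongr
          · linarith
      _ = 1 := by norm_num

/-- The gradient is that of `E` times the corrector, and the corrector is of order `θ²`, hence of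
order `ε`. Four errors of order `θ⁴` or `ε²` add up: the Taylor remainders of drift and Laplacian,
the mismatch of `ν_ε`, the remainder of `e^(-θσ(y))` in the gradient, and the third order corrector
multiplied by `θ`. -/
theorem exists_drift_bound (hm : m ≤ 3) {lam : ℝ} (hlam : 0 < lam) {r : ℕ → ℝ}
    (hr : ∀ k ∈ Finset.Icc 1 m, 0 < r k) (hr1 : ∑ k ∈ Finset.Icc 1 m, r k = 1) {K : ℝ} (hK : 0 ≤ K) :
    ∃ C : ℝ, 0 ≤ C ∧ ∀ ε ∈ Ioo (0 : ℝ) 1, ∀ γ rt : ℕ → ℝ,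
      (∀ k ∈ Finset.Icc 1 m, |γ k - gammaLimit m lam r k| ≤ K * ε) →
      (∀ k ∈ Finset.Icc 1 m, |rt k - r k| ≤ K * ε) →
      (∀ k ∈ Finset.Icc 1 m, |γ k| * √ε ≤ 1) →
      ∀ (σ : ℤ → Bool) (E : ℤ → ℝ), (∀ y, 0 < E y) →
        (∀ y, E (y + 1) = E y * Real.exp (-(lam * √ε) * rspin σ y)) →
        (∀ y, |E y * correctorAt m r (lam * √ε) σ y| ≤ C * ε * E y) ∧
        ∀ (N : ℕ) (y : ℤ), |y| + m ≤ N →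
          |E y * (relDrift (m := m) (fun k => (hopRate r γ ε k).toNNReal) N (lam * √ε) σ y
              + ε * nu m lam r γ rt ε)
            - (lop m r E y + (E (y + 1) * correctorAt m r (lam * √ε) σ (y + 1)
              - E y * correctorAt m r (lam * √ε) σ y))| ≤ C * ε ^ 2 * E y := by
  -- With `θ = λ √ε`, the error `K ε √ε` of `r_k γ_k √ε` equals `(K / λ³) θ³`.
  obtain ⟨C1, hC1, hdrift⟩ := exists_hopDrift_bound lam (K / lam ^ 3) hlam.le (by positivity)
  set C2 := 3 * (lam ^ 2 / 2 * (3 * K + (1 + K) * (4 * lam ^ 2))) with hC2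
  set C3 := Real.exp lam * (5 + lam * 10) + 10 with hC3
  have hC3' : 0 ≤ C3 := by positivity
  have hC2' : 0 ≤ C2 := by positivity
  refine ⟨lam ^ 2 * (5 + lam * 10) + (3 * C1 * lam ^ 4 + C2 + C3 * lam ^ 4), by positivity, ?_⟩
  intro ε hε γ rt hγ hrt hpos σ E hE0 hE
  set θ := lam * √ε with hθ
  have h0 := hε.1
  have hsq0 : 0 ≤ √ε := Real.sqrt_nonneg _
  have hsq1 : √ε ≤ 1 := Real.sqrt_le_one.mpr hε.2.le
  have hθ0 : 0 ≤ θ := by positivity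
  have hθl : θ ≤ lam := mul_le_of_le_one_right hlam.le hsq1
  have hθ2 : θ ^ 2 = lam ^ 2 * ε := sq_lam_sqrt h0.le
  have hθ4 : θ ^ 4 = lam ^ 4 * ε ^ 2 := by
    rw [show θ ^ 4 = (θ ^ 2) ^ 2 by ring, hθ2]; ring
  have hr' : ∀ k ∈ Finset.Icc 1 m, |r k| ≤ 1 := fun k hk => by
    rw [abs_of_pos (hr k hk)]; exact rate_le_one hr hr1 hk
  have hext : ∀ k, 1 ≤ k → |extend m r k| ≤ 1 := by
    intro k hk
    unfold extend
    split_ifs with h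
    · exact hr' k (Finset.mem_Icc.mpr ⟨hk, h⟩)
    · simp
  have hs : ∀ y, |rspin σ y| ≤ 1 := fun y => (abs_rspin σ y).le
  have two_le : ∀ y, |correctorTwo (extend m r 2) (extend m r 3) (rspin σ (y - 2))
      (rspin σ (y - 1)) (rspin σ y) (rspin σ (y + 1)) (rspin σ (y + 2))| ≤ 5 := fun y =>
    abs_correctorTwo_le (hext 2 (by norm_num)) (hext 3 (by norm_num)) (hs _) (hs _) (hs _) (hs _) (hs _)
  have three_le : ∀ y, |correctorThree (extend m r 1) (extend m r 2) (extend m r 3) (rspin σ (y - 2))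
      (rspin σ (y - 1)) (rspin σ y) (rspin σ (y + 1)) (rspin σ (y + 2))| ≤ 10 := fun y =>
    abs_correctorThree_le (hext 1 le_rfl) (hext 2 (by norm_num)) (hext 3 (by norm_num)) (hs _) (hs _)
      (hs _) (hs _) (hs _)
  have abs_θ : ∀ n : ℕ, |θ ^ n| ≤ θ ^ n := fun n => le_of_eq (abs_of_nonneg (by positivity))
  have corr_le : ∀ y, |correctorAt m r θ σ (y + 1)| ≤ θ ^ 2 * (5 + lam * 10) := by
    intro y
    rw [correctorAt_succ_eq]
    refine (abs_add_le_add (abs_mul_le_mul (abs_θ 2) (two_le y))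
      (abs_mul_le_mul (abs_θ 3) (three_le y))).trans ?_
    rw [show θ ^ 2 * 5 + θ ^ 3 * 10 = θ ^ 2 * (5 + θ * 10) by ring]
    gcongr
  refine ⟨fun y => ?_, fun N y hy => ?_⟩
  · have := corr_le (y - 1)
    rw [sub_add_cancel] at this
    rw [abs_mul, abs_of_pos (hE0 y), mul_comm]
    refine mul_le_mul_of_nonneg_right (this.trans ?_) (hE0 y).le
    rw [hθ2]
    have : 0 ≤ (3 * C1 * lam ^ 4 + C2 + C3 * lam ^ 4) * ε := by positivity
    linarith
  have hrate : ∀ k ∈ Finset.Icc 1 m, (((hopRate r γ ε k).toNNReal : ℝ≥0) : ℝ)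
      = 1 / 2 * (r k - r k * γ k * √ε) := by
    intro k hk
    have hk1 := (Finset.mem_Icc.mp hk).1
    rw [Real.coe_toNNReal _ (abs_hopRate_le (by simpa using hr k hk) (by simpa using rate_le_one hr hr1 hk)
      (by simpa using hpos k hk)).1]
    unfold hopRate
    rw [Int.sign_eq_one_of_pos (by exact_mod_cast hk1), Int.natAbs_natCast]
    push_cast; ring
  have hrate' : ∀ k ∈ Finset.Icc 1 m, (((hopRate r γ ε (-(k : ℤ))).toNNReal : ℝ≥0) : ℝ)
      = 1 / 2 * (r k + r k * γ k * √ε) := by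
    intro k hk
    have hk1 := (Finset.mem_Icc.mp hk).1
    rw [Real.coe_toNNReal _ (abs_hopRate_le (by simpa using hr k hk) (by simpa using rate_le_one hr hr1 hk)
      (by simpa using hpos k hk)).1]
    unfold hopRate
    rw [Int.sign_eq_neg_one_of_neg (by omega), Int.natAbs_neg, Int.natAbs_natCast]
    push_cast; ring
  have hG : ∀ k ∈ Finset.Icc 1 m, |r k * γ k * √ε - slope r m k * θ| ≤ K / lam ^ 3 * θ ^ 3 := by
    intro k hk
    have e : r k * γ k * √ε - slope r m k * θ = r k * √ε * (γ k - gammaLimit m lam r k) := by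
      have := slope_eq_gammaLimit (m := m) (lam := lam) (hr k hk)
      rw [hθ, show slope r m k * (lam * √ε) = (lam * slope r m k) * √ε by ring, ← this]; ring
    rw [e]
    have a1 : |√ε| ≤ √ε := le_of_eq (abs_of_nonneg hsq0)
    refine (abs_mul_le_mul (abs_mul_le_mul (hr' k hk) a1) (hγ k hk)).trans (le_of_eq ?_)
    have e3 : θ ^ 3 = lam ^ 3 * (ε * √ε) := by
      rw [show θ ^ 3 = θ ^ 2 * θ by ring, hθ2, hθ]; ring
    rw [e3]; field_simp
  set U := Real.sinh (2 * θ) with hU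
  set V := Real.cosh (2 * θ) - 1 with hV
  have hrel := relDrift_eq (m := m) hy (fun k => (hopRate r γ ε k).toNNReal) θ σ r
    (fun k => r k * γ k * √ε) hrate hrate'
  have hlop := lop_exp (m := m) σ hE r y
  have hnu := abs_growth_sub_le hm lam K hK hε (γ := γ) hr' hrt
  rw [← hθ, ← hU, ← hV, ← hC2] at hnu
  have hmain := sum_mainTerm hm r θ σ y
  rw [hrel, hlop, hE y]
  set X := ∑ k ∈ Finset.Icc 1 m, 1 / 4 * (k : ℝ) * ((r k * γ k * √ε) * U - r k * V) with hX
  set c2 := correctorTwo (extend m r 2) (extend m r 3) (rspin σ (y - 2))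
      (rspin σ (y - 1)) (rspin σ y) (rspin σ (y + 1)) (rspin σ (y + 2)) with hc2
  set c3 := correctorThree (extend m r 1) (extend m r 2) (extend m r 3) (rspin σ (y - 2))
      (rspin σ (y - 1)) (rspin σ y) (rspin σ (y + 1)) (rspin σ (y + 2)) with hc3
  have hsum : |∑ k ∈ Finset.Icc 1 m, (hopDrift k (r k) (r k * γ k * √ε) U V (spinProd σ y k)
        (spinDiff σ y k) - lapTerm (r k) θ (riseRight σ y k) (riseLeft σ y k)
        + 1 / 4 * k * ((r k * γ k * √ε) * U - r k * V)
        - mainTerm (r k) (slope r m k) θ (spinProd σ y k) (spinDiff σ y k) (riseRight σ y k)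
          (riseLeft σ y k))| ≤ 3 * C1 * θ ^ 4 := by
    refine (Finset.abs_sum_le_sum_abs _ _).trans ((Finset.sum_le_card_nsmul _ _ (C1 * θ ^ 4)
      fun k hk => ?_).trans ?_)
    · have hk3 : (k : ℝ) ≤ 3 := by exact_mod_cast (Finset.mem_Icc.mp hk).2.trans hm
      refine hdrift θ hθ0 hθl k (r k) (slope r m k) _ _ _ _ _ (hr' k hk) (abs_slope_le hm hr hr1 hk)
        ?_ ?_ ?_ ?_ (hG k hk)
      · refine (abs_sum_ico_le y (B := 1) _ fun i => ?_).trans (by linarith)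
        rw [abs_mul, abs_rspin, abs_rspin, one_mul]
      · refine (abs_sum_ico_le y (B := 2) _ fun i => ?_).trans (by linarith)
        exact (abs_sub_le_add (hs _) (hs _)).trans (by norm_num)
      · exact (abs_sum_ico_le y (B := 1) _ fun i => hs _).trans (by linarith)
      · rw [riseLeft, abs_neg]
        exact (abs_sum_ico_le y (B := 1) _ fun i => hs _).trans (by linarith)
    · rw [Nat.card_Icc, nsmul_eq_mul, mul_assoc]
      have : ((m + 1 - 1 : ℕ) : ℝ) ≤ 3 := by exact_mod_cast (by omega : m + 1 - 1 ≤ 3)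
      exact mul_le_mul_of_nonneg_right this (by positivity)
  rw [Finset.sum_sub_distrib, Finset.sum_add_distrib, Finset.sum_sub_distrib, ← hX] at hsum
  -- Replacing `E(y + 1) / E(y)` by `1 - θσ(y)`, only the second order part of the corrector matters
  -- in the product with `θσ(y)`.
  have hrem : |Real.exp (-θ * rspin σ y) * correctorAt m r θ σ (y + 1) - correctorAt m r θ σ (y + 1)
      + θ * rspin σ y * (θ ^ 2 * c2)| ≤ C3 * θ ^ 4 := by
    have e : Real.exp (-θ * rspin σ y) * correctorAt m r θ σ (y + 1) - correctorAt m r θ σ (y + 1)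
      + θ * rspin σ y * (θ ^ 2 * c2)
      = (Real.exp (-θ * rspin σ y) - (1 + -θ * rspin σ y)) * correctorAt m r θ σ (y + 1)
        - θ * rspin σ y * (θ ^ 3 * c3) := by
      rw [correctorAt_succ_eq, ← hc2, ← hc3]; ring
    rw [e]
    have a0 : |-θ * rspin σ y| = θ := by rw [abs_mul, abs_rspin, mul_one, abs_neg, abs_of_nonneg hθ0]
    have a1 := exp_taylor_two (-θ * rspin σ y)
    rw [a0] at a1
    have a2 : |θ * rspin σ y| ≤ θ := by rw [abs_mul, abs_rspin, mul_one, abs_of_nonneg hθ0]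
    refine (abs_sub_le_add (abs_mul_le_mul a1 (corr_le y)) (abs_mul_le_mul a2
      (abs_mul_le_mul (abs_θ 3) (three_le y)))).trans ?_
    have : Real.exp θ ≤ Real.exp lam := Real.exp_le_exp.mpr hθl
    calc θ ^ 2 * Real.exp θ * (θ ^ 2 * (5 + lam * 10)) + θ * (θ ^ 3 * 10)
        ≤ θ ^ 2 * Real.exp lam * (θ ^ 2 * (5 + lam * 10)) + θ * (θ ^ 3 * 10) := by gcongr
      _ = C3 * θ ^ 4 := by rw [hC3]; ring
  generalize (∑ k ∈ Finset.Icc 1 m, hopDrift k (r k) (r k * γ k * √ε) U V (spinProd σ y k)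
        (spinDiff σ y k)) = S1 at hsum ⊢
  generalize (∑ k ∈ Finset.Icc 1 m, lapTerm (r k) θ (riseRight σ y k) (riseLeft σ y k)) = S2 at hsum ⊢
  generalize (∑ k ∈ Finset.Icc 1 m, mainTerm (r k) (slope r m k) θ (spinProd σ y k) (spinDiff σ y k)
    (riseRight σ y k) (riseLeft σ y k)) = S3 at hsum hmain
  generalize (∑ k ∈ Finset.Icc 1 m, r k * (k : ℝ)) = S4 at hnu hmain
  generalize Real.exp (-θ * rspin σ y) = ed at hrem ⊢
  generalize correctorAt m r θ σ (y + 1) = f1 at hrem hmain ⊢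
  generalize correctorAt m r θ σ y = f0 at hmain ⊢
  generalize ε * nu m lam r γ rt ε = en at hnu ⊢
  -- The exact identity for the expansion eliminates `S3`; what is left inside the bracket are the
  -- errors bounded above.
  have hfin : E y * (S1 + en) - (E y * S2 + (E y * ed * f1 - E y * f0))
      = E y * ((S1 - S2 + X - S3) + (en - (X + θ ^ 2 / 2 * S4))
        - (ed * f1 - f1 + θ * rspin σ y * (θ ^ 2 * c2))) := by
    have : S3 = f1 - f0 - θ * rspin σ y * (θ ^ 2 * c2) - θ ^ 2 / 2 * S4 := by linarith
    rw [this]; ring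
  rw [hfin, abs_mul, abs_of_pos (hE0 y), mul_comm]
  refine mul_le_mul_of_nonneg_right ?_ (hE0 y).le
  refine (abs_sub_le_add (abs_add_le_add hsum hnu) hrem).trans ?_
  rw [hθ4]
  have : 0 ≤ lam ^ 2 * (5 + lam * 10) * ε ^ 2 := by positivity
  linarith

end DriftIdentity

/-! ### The drift of linear functionals -/

section DriftPairing

variable {m : ℕ}

/-- The relative drift of `exp (-θ h)`, with the growth rate `ν`, is that of the symmetric random
walk with rates `r`, up to a discrete gradient of order `ε` and an error of order `ε²`. -/
structure DriftBound (m : ℕ) (rate : ℤ → ℝ≥0) (r : ℕ → ℝ) (θ ε ν C : ℝ) : Prop where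
  rate_le : ∀ k : jumps m, rate k ≤ 1
  bound : ∀ (σ : ℤ → Bool) (E : ℤ → ℝ), (∀ y, 0 < E y) →
    (∀ y, E (y + 1) = E y * Real.exp (-θ * rspin σ y)) →
    ∃ H : ℤ → ℝ, (∀ y, |H y| ≤ C * ε * E y) ∧ ∀ (N : ℕ) (y : ℤ), |y| + m ≤ N →
      |E y * (relDrift (m := m) rate N θ σ y + ν) - (lop m r E y + (H (y + 1) - H y))|
        ≤ C * ε ^ 2 * E y

theorem exists_driftBound (hm : m ≤ 3) {lam : ℝ} (hlam : 0 < lam) {r : ℕ → ℝ}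
    (hr : ∀ k ∈ Finset.Icc 1 m, 0 < r k) (hr1 : ∑ k ∈ Finset.Icc 1 m, r k = 1) {K : ℝ} (hK : 0 ≤ K) :
    ∃ C : ℝ, 0 ≤ C ∧ ∀ ε ∈ Ioo (0 : ℝ) 1, ∀ γ rt : ℕ → ℝ,
      (∀ k ∈ Finset.Icc 1 m, |γ k - gammaLimit m lam r k| ≤ K * ε) →
      (∀ k ∈ Finset.Icc 1 m, |rt k - r k| ≤ K * ε) →
      (∀ k ∈ Finset.Icc 1 m, |γ k| * √ε ≤ 1) →
      DriftBound m (fun k => (hopRate r γ ε k).toNNReal) r (lam * √ε) ε (ε * nu m lam r γ rt ε) C := by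
  obtain ⟨C, hC, h⟩ := exists_drift_bound hm hlam hr hr1 hK
  refine ⟨C, hC, fun ε hε γ rt hγ hrt hpos => ⟨fun k => ?_, fun σ E hE0 hE => ?_⟩⟩
  · have hk := jumps_bounds k
    have hk' : (k : ℤ).natAbs ∈ Finset.Icc 1 m := by rw [Finset.mem_Icc]; omega
    have := (abs_hopRate_le (hr _ hk') (rate_le_one hr hr1 hk') (hpos _ hk')).2
    rw [Real.toNNReal_le_iff_le_coe]
    exact_mod_cast this
  · obtain ⟨h1, h2⟩ := h ε hε γ rt hγ hrt hpos σ E hE0 hE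
    exact ⟨_, h1, h2⟩

/-- The weight vanishes in a margin of width `l ≥ |k|` along the boundary, so both sums are sums
over all integers and a translation gives the equality without boundary terms. -/
theorem sum_Icc_shift {n : ℕ} {l k : ℤ} (hk : |k| ≤ l) {g : ℤ → ℝ} (hg : ∀ y, n < |y| + l → g y = 0)
    (f : ℤ → ℝ) : ∑ y ∈ Finset.Icc (-(n : ℤ)) n, g y * f (y + k)
      = ∑ y ∈ Finset.Icc (-(n : ℤ)) n, g (y - k) * f y := by
  have hl : 0 ≤ l := (abs_nonneg k).trans hk
  have hout : ∀ y : ℤ, y ∉ Finset.Icc (-(n : ℤ)) n → n < |y| := fun y hy => by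
    rw [Finset.mem_Icc, ← abs_le] at hy; exact not_le.mp hy
  have e1 : ∑' y, g y * f (y + k) = ∑ y ∈ Finset.Icc (-(n : ℤ)) n, g y * f (y + k) :=
    tsum_eq_sum fun y hy => by
      have h1 := hout y hy
      rw [hg _ (by linarith), zero_mul]
  have e2 : ∑' y, g (y - k) * f y = ∑ y ∈ Finset.Icc (-(n : ℤ)) n, g (y - k) * f y :=
    tsum_eq_sum fun y hy => by
      have h1 := hout y hy
      have h2 := abs_sub_abs_le_abs_sub y k
      rw [hg _ (by linarith), zero_mul]
  rw [← e1, ← e2, ← (Equiv.addRight k).tsum_eq (fun y => g (y - k) * f y)]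
  simp

/-- The weight of the site `y` in the drift of `∑_y g(y) Z(y)`. -/
def driftWeight (m : ℕ) (r : ℕ → ℝ) (C ε : ℝ) (g g' : ℤ → ℝ) (y : ℤ) : ℝ :=
  |g' y + lop m r g y| + C * (ε * |g y - g (y - 1)| + ε ^ 2 * |g y|)

theorem driftWeight_nonneg (r : ℕ → ℝ) {C ε : ℝ} (hC : 0 ≤ C) (hε : 0 ≤ ε) (g g' : ℤ → ℝ) (y : ℤ) :
    0 ≤ driftWeight m r C ε g g' y := by unfold driftWeight; positivity

/-- The walk is symmetric, so its generator is self-adjoint. -/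
theorem pairing_lop {n : ℕ} {g : ℤ → ℝ} (hg : ∀ y : ℤ, n < |y| + (m + 1) → g y = 0) (r : ℕ → ℝ)
    (Z : ℤ → ℝ) : pairing n g (lop m r Z) = pairing n (lop m r g) Z := by
  unfold pairing lop
  have h1 : ∀ k ∈ Finset.Icc 1 m, ∑ y ∈ Finset.Icc (-(n : ℤ)) n,
      g y * (Z (y + k) + Z (y - k) - 2 * Z y) = ∑ y ∈ Finset.Icc (-(n : ℤ)) n,
      (g (y + k) + g (y - k) - 2 * g y) * Z y := by
    intro k hk
    have hk' := Finset.mem_Icc.mp hk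
    have a1 := sum_Icc_shift (k := k) (l := m + 1) (by rw [abs_of_nonneg] <;> omega) hg Z
    have a2 := sum_Icc_shift (k := -(k : ℤ)) (l := m + 1) (by rw [abs_neg, abs_of_nonneg] <;> omega) hg Z
    simp only [sub_neg_eq_add, ← sub_eq_add_neg] at a2
    simp only [mul_sub, mul_add, sub_mul, add_mul, Finset.sum_add_distrib, Finset.sum_sub_distrib]
    rw [a1, a2]
    have a3 : ∑ y ∈ Finset.Icc (-(n : ℤ)) n, g y * (2 * Z y)
        = ∑ y ∈ Finset.Icc (-(n : ℤ)) n, 2 * g y * Z y :=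
      Finset.sum_congr rfl fun y _ => by ring
    rw [a3]; ring
  calc ∑ y ∈ Finset.Icc (-(n : ℤ)) n,
        g y * (1 / 2 * ∑ k ∈ Finset.Icc 1 m, r k * (Z (y + k) + Z (y - k) - 2 * Z y))
      = ∑ k ∈ Finset.Icc 1 m, 1 / 2 * r k * ∑ y ∈ Finset.Icc (-(n : ℤ)) n,
        g y * (Z (y + k) + Z (y - k) - 2 * Z y) := by
        simp only [Finset.mul_sum]
        rw [Finset.sum_comm]
        exact Finset.sum_congr rfl fun k _ => Finset.sum_congr rfl fun y _ => by ring
    _ = ∑ k ∈ Finset.Icc 1 m, 1 / 2 * r k * ∑ y ∈ Finset.Icc (-(n : ℤ)) n,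
        (g (y + k) + g (y - k) - 2 * g y) * Z y :=
        Finset.sum_congr rfl fun k hk => by rw [h1 k hk]
    _ = _ := by
        simp only [Finset.mul_sum, Finset.sum_mul]
        rw [Finset.sum_comm]
        exact Finset.sum_congr rfl fun k _ => Finset.sum_congr rfl fun y _ => by ring

/-- Summation by parts moves both `lop` and the discrete gradient onto the weight. If the weight
solves the backward heat equation, `g' + lop g` vanishes and only `ε |∇g|` and `ε² |g|` are left. -/
theorem DriftBound.abs_pairing_le {rate : ℤ → ℝ≥0} {r : ℕ → ℝ} {θ ε ν C : ℝ}
    (hD : DriftBound m rate r θ ε ν C) {σ : ℤ → Bool} {Z : ℤ → ℝ}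
    (hZ0 : ∀ y, 0 < Z y) (hZ : ∀ y, Z (y + 1) = Z y * Real.exp (-θ * rspin σ y)) {n : ℕ} {g g' : ℤ → ℝ}
    (hg : ∀ y : ℤ, n < |y| + (m + 1) → g y = 0) :
    |pairing n (fun y => g' y + g y * (relDrift (m := m) rate (n + 3 * m) θ σ y + ν)) Z|
      ≤ ∑ y ∈ Finset.Icc (-(n : ℤ)) n, driftWeight m r C ε g g' y * Z y := by
  obtain ⟨H, hH, hb⟩ := hD.bound σ Z hZ0 hZ
  set err : ℤ → ℝ := fun y => Z y * (relDrift (m := m) rate (n + 3 * m) θ σ y + ν)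
    - (lop m r Z y + (H (y + 1) - H y)) with herr
  have hsplit : pairing n (fun y => g' y + g y * (relDrift (m := m) rate (n + 3 * m) θ σ y + ν)) Z
      = ∑ y ∈ Finset.Icc (-(n : ℤ)) n, ((g' y + lop m r g y) * Z y + (g (y - 1) - g y) * H y
        + g y * err y) := by
    have e1 : pairing n (fun y => g' y + g y * (relDrift (m := m) rate (n + 3 * m) θ σ y + ν)) Z
        = pairing n g' Z + pairing n g (lop m r Z)
          + (∑ y ∈ Finset.Icc (-(n : ℤ)) n, g y * H (y + 1) - ∑ y ∈ Finset.Icc (-(n : ℤ)) n, g y * H y)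
          + ∑ y ∈ Finset.Icc (-(n : ℤ)) n, g y * err y := by
      simp only [pairing, ← Finset.sum_add_distrib, ← Finset.sum_sub_distrib]
      refine Finset.sum_congr rfl fun y _ => ?_
      simp only [herr]; ring
    rw [e1, pairing_lop hg, sum_Icc_shift (k := 1) (l := m + 1) (by simp) hg]
    simp only [pairing, ← Finset.sum_add_distrib, ← Finset.sum_sub_distrib]
    exact Finset.sum_congr rfl fun y _ => by ring
  rw [hsplit]
  refine (Finset.abs_sum_le_sum_abs _ _).trans (Finset.sum_le_sum fun y hy => ?_)
  have h1 : |(g' y + lop m r g y) * Z y| = |g' y + lop m r g y| * Z y := by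
    rw [abs_mul, abs_of_pos (hZ0 y)]
  have h2 : |(g (y - 1) - g y) * H y| ≤ |g y - g (y - 1)| * (C * ε * Z y) := by
    rw [abs_mul, abs_sub_comm]
    exact mul_le_mul_of_nonneg_left (hH y) (abs_nonneg _)
  have h3 : |g y * err y| ≤ |g y| * (C * ε ^ 2 * Z y) := by
    rw [abs_mul]
    refine mul_le_mul_of_nonneg_left (hb _ y ?_) (abs_nonneg _)
    have : |y| ≤ n := by rw [abs_le]; simpa using hy
    push_cast
    linarith [Int.natCast_nonneg m]
  refine (abs_add_le_add (abs_add_le_add h1.le h2) h3).trans (le_of_eq ?_)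
  unfold driftWeight; ring

end DriftPairing

/-! ### Telescoping and scalar inequalities -/

/-- Over `N` equal steps the quadratic errors add up to `K (t - s)² / N`, which tends to `0`. -/
theorem le_of_short_steps {F Φ : ℝ≥0 → ℝ} {s t : ℝ≥0} (hst : s ≤ t) {K : ℝ}
    (hstep : ∀ a b : ℝ≥0, s ≤ a → a ≤ b → b ≤ t → (b : ℝ) - a ≤ 1 →
      F b ≤ F a + (Φ b - Φ a) + K * (b - a) ^ 2) : F t ≤ F s + (Φ t - Φ s) := by
  have key : ∀ N : ℕ, (t - s : ℝ≥0) ≤ N → 0 < N →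
      F t ≤ F s + (Φ t - Φ s) + K * ((t : ℝ) - s) ^ 2 * (1 / (N : ℝ)) := by
    intro N hN hN0
    have hN0' : (0 : ℝ≥0) < N := by exact_mod_cast hN0
    set h : ℝ≥0 := (t - s) / N with hh
    have hNh : (N : ℝ≥0) * h = t - s := by rw [hh]; field_simp
    have hN1 : h ≤ 1 := by rw [hh]; exact div_le_one_of_le₀ hN (by positivity)
    have hind : ∀ k : ℕ, k ≤ N →
        F (s + k * h) ≤ F s + (Φ (s + k * h) - Φ s) + K * (h : ℝ) ^ 2 * k := by
      intro k
      induction k with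
      | zero => intro _; simp
      | succ k ih =>
        intro hk
        have h1 := ih (by omega)
        have hle : s + ((k + 1 : ℕ) : ℝ≥0) * h ≤ t := by
          calc s + ((k + 1 : ℕ) : ℝ≥0) * h ≤ s + N * h := by gcongr
            _ = t := by rw [hNh]; exact add_tsub_cancel_of_le hst
        have hd : ((s + ((k + 1 : ℕ) : ℝ≥0) * h : ℝ≥0) : ℝ) - (s + (k : ℝ≥0) * h : ℝ≥0) = h := by
          push_cast; ring
        have h2 := hstep (s + k * h) (s + ((k + 1 : ℕ) : ℝ≥0) * h) (by simp)
          (by gcongr; simp) hle (by rw [hd]; exact_mod_cast hN1)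
        rw [hd] at h2
        push_cast at h2 ⊢
        linarith
    have h3 := hind N le_rfl
    rw [hNh, add_tsub_cancel_of_le hst] at h3
    have h4 : (N : ℝ) * h = t - s := by
      have := congrArg (fun x : ℝ≥0 => (x : ℝ)) hNh
      simpa [NNReal.coe_sub hst] using this
    have h5 : K * ((t : ℝ) - s) ^ 2 * (1 / (N : ℝ)) = K * (h : ℝ) ^ 2 * N := by
      have : (0 : ℝ) < N := by exact_mod_cast hN0
      rw [← h4]; field_simp
    rw [h5]; exact h3
  have hlim : Tendsto (fun N : ℕ => F s + (Φ t - Φ s) + K * ((t : ℝ) - s) ^ 2 * (1 / (N : ℝ))) atTop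
      (𝓝 (F s + (Φ t - Φ s) + K * ((t : ℝ) - s) ^ 2 * 0)) :=
    tendsto_const_nhds.add (tendsto_one_div_atTop_nhds_zero_nat.const_mul _)
  rw [mul_zero, add_zero] at hlim
  obtain ⟨N₀, hN₀⟩ := exists_nat_ge (t - s)
  refine ge_of_tendsto hlim ?_
  filter_upwards [eventually_ge_atTop (max N₀ 1)] with N hN
  have h1 : N₀ ≤ N := (le_max_left _ _).trans hN
  have h2 : 1 ≤ N := (le_max_right _ _).trans hN
  exact key N (hN₀.trans (by exact_mod_cast h1)) (by omega)

/-- The improvement is applied to the supremum of `F`. The bound `A₀` does not enter the conclusion;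
it only makes the supremum finite. -/
theorem le_two_mul_of_self_improving {ι : Type*} {F : ι → ℝ} {A₀ c : ℝ} (hc : 0 ≤ c)
    (h0 : ∀ i, F i ≤ A₀) (h : ∀ A, 0 < A → (∀ i, F i ≤ A) → ∀ i, F i ≤ c + A / 2) (i : ι) :
    F i ≤ 2 * c := by
  have hne : Nonempty ι := ⟨i⟩
  have hb : BddAbove (Set.range F) := ⟨A₀, by rintro _ ⟨j, rfl⟩; exact h0 j⟩
  have h1 : ∀ j, F j ≤ ⨆ j, F j := le_ciSup hb
  rcases le_or_gt (⨆ j, F j) 0 with hs | hs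
  · linarith [h1 i]
  · have h2 := ciSup_le (h _ hs h1)
    linarith [h1 i]

/-- Young's inequality with unoptimized constants, by comparing `z` with `μ x`. -/
theorem pow_succ_mul_le (q : ℕ) {x z μ : ℝ} (hx : 0 ≤ x) (hz : 0 ≤ z) (hμ : 0 < μ) :
    x ^ (q + 1) * z ≤ μ * x ^ (q + 2) + (μ⁻¹) ^ (q + 1) * z ^ (q + 2) := by
  rcases le_total z (μ * x) with h | h
  · calc x ^ (q + 1) * z ≤ x ^ (q + 1) * (μ * x) := by gcongr
      _ = μ * x ^ (q + 2) := by ring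
      _ ≤ _ := le_add_of_nonneg_right (by positivity)
  · have h' : x ≤ μ⁻¹ * z := by rw [inv_mul_eq_div, le_div_iff₀ hμ]; linarith
    calc x ^ (q + 1) * z ≤ (μ⁻¹ * z) ^ (q + 1) * z := by gcongr
      _ = (μ⁻¹) ^ (q + 1) * z ^ (q + 2) := by rw [mul_pow]; ring
      _ ≤ _ := le_add_of_nonneg_left (by positivity)

theorem pow_two_mul_sq_le (i : ℕ) {x z μ : ℝ} (hμ : 0 < μ) :
    x ^ (2 * i) * z ^ 2 ≤ μ * x ^ (2 * i + 2) + (μ⁻¹) ^ i * z ^ (2 * i + 2) := by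
  have e : ∀ w : ℝ, w ^ (2 * i) = (w ^ 2) ^ i := fun w => pow_mul w 2 i
  have e2 : ∀ w : ℝ, w ^ (2 * i + 2) = (w ^ 2) ^ i * w ^ 2 := fun w => by rw [pow_add, e]
  rw [e, e2, e2]
  rcases le_total (z ^ 2) (μ * x ^ 2) with h | h
  · calc (x ^ 2) ^ i * z ^ 2 ≤ (x ^ 2) ^ i * (μ * x ^ 2) := by gcongr
      _ = μ * ((x ^ 2) ^ i * x ^ 2) := by ring
      _ ≤ _ := le_add_of_nonneg_right (by positivity)
  · have h' : x ^ 2 ≤ μ⁻¹ * z ^ 2 := by rw [inv_mul_eq_div, le_div_iff₀ hμ]; linarith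
    calc (x ^ 2) ^ i * z ^ 2 ≤ (μ⁻¹ * z ^ 2) ^ i * z ^ 2 := by gcongr
      _ = (μ⁻¹) ^ i * ((z ^ 2) ^ i * z ^ 2) := by rw [mul_pow]; ring
      _ ≤ _ := le_add_of_nonneg_left (by positivity)

/-! ### Moments of linear functionals -/

section Moments

variable {Ω : Type*} {mΩ : MeasurableSpace Ω} {P : Measure Ω} {ℱ : Filtration ℝ≥0 mΩ} {m : ℕ}
  {rate : ℤ → ℝ≥0} {Q : jumps m × ℤ → ℝ≥0 → Ω → ℕ} {η : ℝ≥0 → Ω → ℤ → Bool}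

/-- `exp (ν t - θ h_t(y))`. -/
def grown (θ ν : ℝ) (Q : jumps m × ℤ → ℝ≥0 → Ω → ℕ) (η : ℝ≥0 → Ω → ℤ → Bool) (t : ℝ≥0) (y : ℤ)
    (ω : Ω) : ℝ := Real.exp (ν * t) * expHeight θ Q η t y ω

theorem grown_pos (θ ν : ℝ) (t : ℝ≥0) (y : ℤ) (ω : Ω) : 0 < grown θ ν Q η t y ω :=
  mul_pos (Real.exp_pos _) (expHeight_pos _ _ _ _)

theorem Zfield_eq_grown (lam ε ν : ℝ) :
    Zfield lam ε ν Q η = grown (lam * √ε) (ε * ν) Q η := by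
  funext t y ω; exact Zfield_eq_expHeight lam ε ν t y ω

theorem grown_succ (θ ν : ℝ) (t : ℝ≥0) (y : ℤ) (ω : Ω) : grown θ ν Q η t (y + 1) ω
    = grown θ ν Q η t y ω * Real.exp (-θ * rspin (η t ω) y) := by
  unfold grown expHeight rspin
  rw [height_succ, mul_assoc (Real.exp _)]
  congr 1
  rw [← Real.exp_add]
  push_cast; ring_nf

theorem IsExclusionProcess.aestronglyMeasurable_grown (h : IsExclusionProcess P ℱ m rate Q η)
    (θ ν : ℝ) (t : ℝ≥0) (y : ℤ) : AEStronglyMeasurable[ℱ t] (grown θ ν Q η t y) P :=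
  (h.aestronglyMeasurable_expHeight θ t y).const_mul _

theorem pow_sum_le_card_pow_mul {ι : Type*} (S : Finset ι) {f : ι → ℝ} (hf : ∀ i ∈ S, 0 ≤ f i) (n : ℕ) :
    (∑ i ∈ S, f i) ^ (n + 1) ≤ (S.card : ℝ) ^ n * ∑ i ∈ S, f i ^ (n + 1) := by
  rcases S.eq_empty_or_nonempty with h0 | hne
  · simp [h0]
  have hcpos : (0 : ℝ) < S.card := by exact_mod_cast Finset.card_pos.mpr hne
  have := pow_sum_div_card_le_sum_pow (s := S) (f := f) (n := n) hf
  rw [div_le_iff₀ (by positivity)] at this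
  linarith

/-- The pointwise bound of the generator, after the Young inequality. -/
theorem DriftBound.powerGen_le {r : ℕ → ℝ} {θ ε ν C : ℝ} (hD : DriftBound m rate r θ ε ν C)
    (hε : 0 ≤ ε) (hC : 0 ≤ C) (hθ : 0 ≤ θ) {J : ℝ} (hJ : 2 * θ * Real.exp (2 * θ) ≤ J * √ε)
    {n : ℕ} (i : ℕ) {g g' : ℤ → ℝ} (hg : ∀ y : ℤ, n < |y| + (m + 1) → g y = 0) {W : ℤ → ℝ}
    (hW : ∀ y, 0 < W y) {μ₁ μ₂ : ℝ} (hμ₁ : 0 < μ₁) (hμ₂ : 0 < μ₂) (t : ℝ≥0) (ω : Ω) (y₀ : ℝ) :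
    powerGen (m := m) rate n (2 * i) θ (fun y => Real.exp (ν * t) * g y)
        (fun y => Real.exp (ν * t) * (g' y + ν * g y)) (fun y => expHeight θ Q η t y ω) (η t ω) y₀
      ≤ ∑ y ∈ Finset.Icc (-(n : ℤ)) n,
        ((2 * i + 2) * (driftWeight m r C ε g g' y * W y)
            * (μ₁ * (pairing n g (fun y => grown θ ν Q η t y ω) - y₀) ^ (2 * i + 2)
              + μ₁⁻¹ ^ (2 * i + 1) * (grown θ ν Q η t y ω / W y) ^ (2 * i + 2))
          + (2 * i + 2) ^ 2 * 2 ^ (2 * i) * jumpConst m (2 * i)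
            * (J ^ 2 * (ε * (g y * W y) ^ 2)
              * (μ₂ * (pairing n g (fun y => grown θ ν Q η t y ω) - y₀) ^ (2 * i + 2)
                + μ₂⁻¹ ^ i * (grown θ ν Q η t y ω / W y) ^ (2 * i + 2))
              + J ^ (2 * i + 2) * (ε * (g y * W y) ^ 2) ^ (i + 1)
                * (grown θ ν Q η t y ω / W y) ^ (2 * i + 2))) := by
  set e := Real.exp (ν * t) with he
  set Z : ℤ → ℝ := fun y => grown θ ν Q η t y ω with hZ
  have hZ0 : ∀ y, 0 < Z y := fun y => grown_pos θ ν t y ω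
  have hZE : ∀ y, e * expHeight θ Q η t y ω = Z y := fun y => rfl
  -- The factor `e^(νt)` in the weights turns `expHeight` into `grown`, and its time derivative adds
  -- `ν` to the relative drift.
  have h1 := FiniteRangeExclusion.powerGen_le (m := m) rate hD.rate_le n (2 * i) hθ
    (fun y => e * g y) (fun y => e * (g' y + ν * g y)) (fun y => expHeight θ Q η t y ω) (η t ω) y₀
  have e1 : pairing n (fun y => e * g y) (fun y => expHeight θ Q η t y ω) = pairing n g Z :=
    Finset.sum_congr rfl fun y _ => by rw [← hZE]; ring
  have e2 : pairing n (fun y => e * (g' y + ν * g y)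
        + e * g y * relDrift (m := m) rate (n + 3 * m) θ (η t ω) y) (fun y => expHeight θ Q η t y ω)
      = pairing n (fun y => g' y + g y * (relDrift (m := m) rate (n + 3 * m) θ (η t ω) y + ν)) Z :=
    Finset.sum_congr rfl fun y _ => by rw [← hZE]; ring
  have e3 : ∀ y, e * g y * expHeight θ Q η t y ω = g y * Z y := fun y => by rw [← hZE]; ring
  simp only [e1, e2, e3] at h1
  set X := pairing n g Z - y₀ with hX
  have h2 := hD.abs_pairing_le (g' := g') hZ0 (fun y => grown_succ θ ν t y ω) hg
  have habs : X ^ (2 * i + 2) = |X| ^ (2 * i + 2) := by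
    rw [show 2 * i + 2 = 2 * (i + 1) by ring, pow_mul, pow_mul, sq_abs]
  push_cast at h1
  refine h1.trans ?_
  conv_rhs => rw [Finset.sum_add_distrib, ← Finset.mul_sum]
  refine add_le_add ?_ (mul_le_mul_of_nonneg_left (Finset.sum_le_sum fun y _ => ?_)
    (mul_nonneg (by positivity) (jumpConst_nonneg _ _)))
  · refine (mul_le_mul_of_nonneg_left h2 (by positivity)).trans ?_
    rw [Finset.mul_sum]
    refine Finset.sum_le_sum fun y _ => ?_
    have hy := pow_succ_mul_le (2 * i) (abs_nonneg X) (div_pos (hZ0 y) (hW y)).le hμ₁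
    have hk := driftWeight_nonneg (m := m) r hC hε g g' y
    calc (2 * (i : ℝ) + 2) * |X| ^ (2 * i + 1) * (driftWeight m r C ε g g' y * Z y)
        = (2 * i + 2) * (driftWeight m r C ε g g' y * W y) * (|X| ^ (2 * i + 1) * (Z y / W y)) := by
          have := (hW y).ne'
          field_simp
      _ ≤ (2 * i + 2) * (driftWeight m r C ε g g' y * W y) * (μ₁ * |X| ^ (2 * i + 2)
            + μ₁⁻¹ ^ (2 * i + 1) * (Z y / W y) ^ (2 * i + 2)) := by
          have := (hW y).le
          gcongr
      _ = _ := by rw [habs]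
  · have hJ2 : (2 * θ * Real.exp (2 * θ) * |g y * Z y|) ^ 2
        ≤ J ^ 2 * (ε * (g y * W y) ^ 2) * (Z y / W y) ^ 2 := by
      have hw := (hW y).ne'
      calc (2 * θ * Real.exp (2 * θ) * |g y * Z y|) ^ 2 ≤ (J * √ε * |g y * Z y|) ^ 2 := by gcongr
        _ = J ^ 2 * √ε ^ 2 * |g y * Z y| ^ 2 := by ring
        _ = J ^ 2 * ε * (g y * Z y) ^ 2 := by rw [Real.sq_sqrt hε, sq_abs]
        _ = _ := by field_simp
    refine add_le_add ?_ ?_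
    · have hy := pow_two_mul_sq_le i (x := |X|) (z := Z y / W y) hμ₂
      calc |X| ^ (2 * i) * (2 * θ * Real.exp (2 * θ) * |g y * Z y|) ^ 2
          ≤ |X| ^ (2 * i) * (J ^ 2 * (ε * (g y * W y) ^ 2) * (Z y / W y) ^ 2) := by gcongr
        _ = J ^ 2 * (ε * (g y * W y) ^ 2) * (|X| ^ (2 * i) * (Z y / W y) ^ 2) := by ring
        _ ≤ J ^ 2 * (ε * (g y * W y) ^ 2) * (μ₂ * |X| ^ (2 * i + 2)
            + μ₂⁻¹ ^ i * (Z y / W y) ^ (2 * i + 2)) := by gcongr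
        _ = _ := by rw [habs]
    · calc (2 * θ * Real.exp (2 * θ) * |g y * Z y|) ^ (2 * i + 2)
          = ((2 * θ * Real.exp (2 * θ) * |g y * Z y|) ^ 2) ^ (i + 1) := by
            rw [← pow_mul]; ring_nf
        _ ≤ (J ^ 2 * (ε * (g y * W y) ^ 2) * (Z y / W y) ^ 2) ^ (i + 1) := by gcongr
        _ = _ := by rw [mul_pow, mul_pow, ← pow_mul, ← pow_mul]; rfl

/-- The constant in front of the quadratic variation. -/
def varConst (m i : ℕ) : ℝ := (2 * i + 2) ^ 2 * 2 ^ (2 * i) * jumpConst m (2 * i)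

theorem varConst_nonneg (m i : ℕ) : 0 ≤ varConst m i :=
  mul_nonneg (by positivity) (jumpConst_nonneg _ _)

theorem memLp_grown (h : IsExclusionProcess P ℱ m rate Q η) {θ ν : ℝ} {t : ℝ≥0} {y : ℤ} {p : ℕ}
    (hp : p ≠ 0) (hi : Integrable (fun ω => grown θ ν Q η t y ω ^ p) P) :
    MemLp (grown θ ν Q η t y) p P := by
  refine (integrable_pow_iff_memLp ((h.aestronglyMeasurable_grown θ ν t y).mono (ℱ.le t)) hp).mp ?_
  simpa only [abs_of_pos (grown_pos θ ν t y _)] using hi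

theorem memLp_pairing (h : IsExclusionProcess P ℱ m rate Q η) {θ ν : ℝ} {t : ℝ≥0} {p : ℕ} (hp : p ≠ 0)
    {n : ℕ} (hi : ∀ y : ℤ, |y| ≤ n → Integrable (fun ω => grown θ ν Q η t y ω ^ p) P) (g : ℤ → ℝ)
    {Y : Ω → ℝ} (hY : MemLp Y p P) :
    MemLp (fun ω => pairing n g (fun y => grown θ ν Q η t y ω) - Y ω) p P := by
  refine MemLp.sub ?_ hY
  refine memLp_finsetSum _ fun y hy => ?_
  exact (memLp_grown h hp (hi y (by rw [abs_le]; simpa using hy))).const_mul _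

/-- After division by `W` each site has `p`-th moment at most `1`, so only the sums of the weights
remain. The moment of the functional itself enters linearly, through `A`, with the small factors
`μ₁` and `μ₂`; this is what allows it to be absorbed. -/
theorem DriftBound.integral_powerGen_le (h : IsExclusionProcess P ℱ m rate Q η)
    {r : ℕ → ℝ} {θ ε ν C : ℝ} (hD : DriftBound m rate r θ ε ν C)
    (hε : 0 ≤ ε) (hC : 0 ≤ C) (hθ : 0 ≤ θ) {J : ℝ} (hJ0 : 0 ≤ J)
    (hJ : 2 * θ * Real.exp (2 * θ) ≤ J * √ε) {n : ℕ} (i : ℕ) {g g' : ℤ → ℝ}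
    (hg : ∀ y : ℤ, n < |y| + (m + 1) → g y = 0) {W : ℤ → ℝ} (hW : ∀ y, 0 < W y) {μ₁ μ₂ : ℝ}
    (hμ₁ : 0 < μ₁) (hμ₂ : 0 < μ₂) {t : ℝ≥0} {Y : Ω → ℝ} (hY : MemLp Y (2 * i + 2 : ℕ) P)
    (hi : ∀ y : ℤ, |y| ≤ n → Integrable (fun ω => grown θ ν Q η t y ω ^ (2 * i + 2)) P)
    (hZW : ∀ y : ℤ, |y| ≤ n → ∫ ω, grown θ ν Q η t y ω ^ (2 * i + 2) ∂P ≤ W y ^ (2 * i + 2))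
    {A B₀ : ℝ} (hA : ∫ ω, (pairing n g (fun y => grown θ ν Q η t y ω) - Y ω) ^ (2 * i + 2) ∂P ≤ A)
    (hB₀ : ∑ y ∈ Finset.Icc (-(n : ℤ)) n, ε * (g y * W y) ^ 2 ≤ B₀)
    (hpi : Integrable (fun ω => powerGen (m := m) rate n (2 * i) θ (fun y => Real.exp (ν * t) * g y)
        (fun y => Real.exp (ν * t) * (g' y + ν * g y)) (fun y => expHeight θ Q η t y ω) (η t ω) (Y ω)) P) :
    ∫ ω, powerGen (m := m) rate n (2 * i) θ (fun y => Real.exp (ν * t) * g y)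
        (fun y => Real.exp (ν * t) * (g' y + ν * g y)) (fun y => expHeight θ Q η t y ω) (η t ω) (Y ω) ∂P
      ≤ (∑ y ∈ Finset.Icc (-(n : ℤ)) n, driftWeight m r C ε g g' y * W y)
          * ((2 * i + 2) * (μ₁ * A + μ₁⁻¹ ^ (2 * i + 1)))
        + (∑ y ∈ Finset.Icc (-(n : ℤ)) n, ε * (g y * W y) ^ 2)
          * (varConst m i * (J ^ 2 * (μ₂ * A + μ₂⁻¹ ^ i) + J ^ (2 * i + 2) * B₀ ^ i)) := by
  set X : Ω → ℝ := fun ω => pairing n g (fun y => grown θ ν Q η t y ω) - Y ω with hX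
  have hXi : Integrable (fun ω => X ω ^ (2 * i + 2)) P := by
    have hm := memLp_pairing h (by omega) hi g hY
    have := (integrable_pow_iff_memLp hm.1 (by omega)).mpr hm
    refine this.congr (ae_of_all _ fun ω => ?_)
    rw [show 2 * i + 2 = 2 * (i + 1) by ring]
    beta_reduce
    rw [pow_mul, sq_abs, ← pow_mul]
  have hmem : ∀ y ∈ Finset.Icc (-(n : ℤ)) n, |y| ≤ n := fun y hy => by
    rw [abs_le]; simpa using hy
  have hzi : ∀ y ∈ Finset.Icc (-(n : ℤ)) n,
      Integrable (fun ω => (grown θ ν Q η t y ω / W y) ^ (2 * i + 2)) P := by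
    intro y hy
    simp only [div_pow]
    exact (hi y (hmem y hy)).div_const _
  have hz1 : ∀ y ∈ Finset.Icc (-(n : ℤ)) n,
      ∫ ω, (grown θ ν Q η t y ω / W y) ^ (2 * i + 2) ∂P ≤ 1 := by
    intro y hy
    simp only [div_pow]
    rw [integral_div, div_le_one (pow_pos (hW y) _)]
    exact hZW y (hmem y hy)
  have hpw := fun ω => hD.powerGen_le (Q := Q) (η := η) hε hC hθ hJ i (g' := g') hg hW hμ₁ hμ₂ t ω (Y ω)
  have hterm : ∀ (a b d : ℝ) (y : ℤ), y ∈ Finset.Icc (-(n : ℤ)) n → 0 ≤ a → 0 ≤ b → 0 ≤ d →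
      Integrable (fun ω => a * (μ₁ * X ω ^ (2 * i + 2)
          + μ₁⁻¹ ^ (2 * i + 1) * (grown θ ν Q η t y ω / W y) ^ (2 * i + 2))
        + varConst m i * (b * (μ₂ * X ω ^ (2 * i + 2)
          + μ₂⁻¹ ^ i * (grown θ ν Q η t y ω / W y) ^ (2 * i + 2))
          + d * (grown θ ν Q η t y ω / W y) ^ (2 * i + 2))) P ∧
      ∫ ω, (a * (μ₁ * X ω ^ (2 * i + 2)
          + μ₁⁻¹ ^ (2 * i + 1) * (grown θ ν Q η t y ω / W y) ^ (2 * i + 2))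
        + varConst m i * (b * (μ₂ * X ω ^ (2 * i + 2)
          + μ₂⁻¹ ^ i * (grown θ ν Q η t y ω / W y) ^ (2 * i + 2))
          + d * (grown θ ν Q η t y ω / W y) ^ (2 * i + 2))) ∂P
        ≤ a * (μ₁ * A + μ₁⁻¹ ^ (2 * i + 1)) + varConst m i * (b * (μ₂ * A + μ₂⁻¹ ^ i) + d) := by
    intro a b d y hy ha hb hd
    have hv := varConst_nonneg m i
    have e : (fun ω => a * (μ₁ * X ω ^ (2 * i + 2)
          + μ₁⁻¹ ^ (2 * i + 1) * (grown θ ν Q η t y ω / W y) ^ (2 * i + 2))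
        + varConst m i * (b * (μ₂ * X ω ^ (2 * i + 2)
          + μ₂⁻¹ ^ i * (grown θ ν Q η t y ω / W y) ^ (2 * i + 2))
          + d * (grown θ ν Q η t y ω / W y) ^ (2 * i + 2)))
        = fun ω => (a * μ₁ + varConst m i * (b * μ₂)) * X ω ^ (2 * i + 2)
          + (a * μ₁⁻¹ ^ (2 * i + 1) + varConst m i * (b * μ₂⁻¹ ^ i + d))
            * (grown θ ν Q η t y ω / W y) ^ (2 * i + 2) := by
      funext ω; ring
    rw [e]
    have i1 := hXi.const_mul (a * μ₁ + varConst m i * (b * μ₂))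
    have i2 := (hzi y hy).const_mul (a * μ₁⁻¹ ^ (2 * i + 1) + varConst m i * (b * μ₂⁻¹ ^ i + d))
    refine ⟨i1.add i2, ?_⟩
    rw [integral_add i1 i2, integral_const_mul, integral_const_mul]
    calc _ ≤ (a * μ₁ + varConst m i * (b * μ₂)) * A
          + (a * μ₁⁻¹ ^ (2 * i + 1) + varConst m i * (b * μ₂⁻¹ ^ i + d)) * 1 := by
          refine add_le_add (mul_le_mul_of_nonneg_left hA (by positivity))
            (mul_le_mul_of_nonneg_left (hz1 y hy) (by positivity))
      _ = _ := by ring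
  have ha0 : ∀ y, 0 ≤ (2 * i + 2 : ℝ) * (driftWeight m r C ε g g' y * W y) := fun y =>
    mul_nonneg (by positivity) (mul_nonneg (driftWeight_nonneg r hC hε g g' y) (hW y).le)
  have hT := fun y hy => hterm ((2 * i + 2) * (driftWeight m r C ε g g' y * W y))
    (J ^ 2 * (ε * (g y * W y) ^ 2)) (J ^ (2 * i + 2) * (ε * (g y * W y) ^ 2) ^ (i + 1)) y hy
    (ha0 y) (by positivity) (by positivity)
  refine (integral_mono hpi (integrable_finsetSum _ fun y hy => (hT y hy).1) hpw).trans ?_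
  rw [integral_finsetSum _ fun y hy => (hT y hy).1, Finset.sum_mul, Finset.sum_mul,
    ← Finset.sum_add_distrib]
  refine Finset.sum_le_sum fun y hy => (hT y hy).2.trans ?_
  have hv := varConst_nonneg m i
  have hle : ε * (g y * W y) ^ 2 ≤ B₀ :=
    (Finset.single_le_sum (f := fun y => ε * (g y * W y) ^ 2) (fun z _ => by positivity) hy).trans hB₀
  -- The pure jump term has the power `i + 1` of a summand of the variation. All but one factor are
  -- bounded by `B₀`, so that it too is integrated in time like the variation.
  have : J ^ (2 * i + 2) * (ε * (g y * W y) ^ 2) ^ (i + 1)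
      ≤ J ^ (2 * i + 2) * (B₀ ^ i * (ε * (g y * W y) ^ 2)) := by
    rw [pow_succ (ε * (g y * W y) ^ 2)]; gcongr
  calc _ ≤ (2 * i + 2) * (driftWeight m r C ε g g' y * W y) * (μ₁ * A + μ₁⁻¹ ^ (2 * i + 1))
        + varConst m i * (J ^ 2 * (ε * (g y * W y) ^ 2) * (μ₂ * A + μ₂⁻¹ ^ i)
          + J ^ (2 * i + 2) * (B₀ ^ i * (ε * (g y * W y) ^ 2))) := by gcongr
    _ = _ := by ring

end Moments

/-! ### Closing the moment inequality for weights of finite support. -/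

section MomentBound

variable {Ω : Type*} {mΩ : MeasurableSpace Ω} {P : Measure Ω} {ℱ : Filtration ℝ≥0 mΩ} {m : ℕ}
  {rate : ℤ → ℝ≥0} {Q : jumps m × ℤ → ℝ≥0 → Ω → ℕ} {η : ℝ≥0 → Ω → ℤ → Bool}

/-- The product rule for `e^(νs) g_s`, with an explicit second order remainder. -/
theorem abs_exp_smul_taylor {ν a b T G u v w : ℝ} (ha : 0 ≤ a) (hab : a ≤ b) (hb : b ≤ T)
    (hab1 : b - a ≤ 1) (hu : |u| ≤ G) (hv : |v| ≤ G)
    (hw : |w - u - (b - a) * v| ≤ G * (b - a) ^ 2) :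
    |Real.exp (ν * b) * w - Real.exp (ν * a) * u - (b - a) * (Real.exp (ν * a) * (v + ν * u))|
      ≤ Real.exp (|ν| * T) * G * (1 + |ν| * Real.exp |ν| + ν ^ 2 * Real.exp |ν|) * (b - a) ^ 2 := by
  set h := b - a with hh
  have h0 : 0 ≤ h := sub_nonneg.mpr hab
  have hexp : ∀ s, 0 ≤ s → s ≤ T → |Real.exp (ν * s)| ≤ Real.exp (|ν| * T) := by
    intro s hs hsT
    rw [abs_of_pos (Real.exp_pos _), Real.exp_le_exp]
    calc ν * s ≤ |ν| * s := mul_le_mul_of_nonneg_right (le_abs_self _) hs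
      _ ≤ _ := by gcongr
  have hb' : Real.exp (ν * b) = Real.exp (ν * a) * Real.exp (ν * h) := by
    rw [← Real.exp_add, hh]; ring_nf
  have hνh : |ν * h| ≤ |ν| := by
    rw [abs_mul, abs_of_nonneg h0]; exact mul_le_of_le_one_right (abs_nonneg _) hab1
  have e2 := exp_taylor_two (ν * h)
  have e1 := exp_taylor_one (ν * h)
  have e2' : |Real.exp (ν * h) - (1 + ν * h)| ≤ ν ^ 2 * Real.exp |ν| * h ^ 2 := by
    refine e2.trans ?_
    calc |ν * h| ^ 2 * Real.exp |ν * h| ≤ |ν * h| ^ 2 * Real.exp |ν| := by gcongr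
      _ = _ := by rw [sq_abs]; ring
  have e1' : |Real.exp (ν * h) - 1| ≤ |ν| * Real.exp |ν| * h := by
    refine e1.trans ?_
    calc |ν * h| * Real.exp |ν * h| ≤ |ν * h| * Real.exp |ν| := by gcongr
      _ = _ := by rw [abs_mul, abs_of_nonneg h0]; ring
  have key : Real.exp (ν * b) * w - Real.exp (ν * a) * u - h * (Real.exp (ν * a) * (v + ν * u))
      = Real.exp (ν * b) * (w - u - h * v) + Real.exp (ν * a) * ((Real.exp (ν * h) - (1 + ν * h)) * u)
        + Real.exp (ν * a) * ((Real.exp (ν * h) - 1) * (h * v)) := by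
    rw [hb']; ring
  rw [key]
  have hv' : |h * v| ≤ h * G := by rw [abs_mul, abs_of_nonneg h0]; gcongr
  refine (abs_add_le_add (abs_add_le_add (abs_mul_le_mul (hexp b (ha.trans hab) hb) hw)
    (abs_mul_le_mul (hexp a ha (hab.trans hb)) (abs_mul_le_mul e2' hu)))
    (abs_mul_le_mul (hexp a ha (hab.trans hb)) (abs_mul_le_mul e1' hv'))).trans (le_of_eq ?_)
  ring

/-- A crude bound that depends on the window. It shows that the moments are bounded in time, so that
they may be absorbed, and that the second order errors of the steps are uniform; its size does not
reach the final estimate. -/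
theorem integral_pow_le_of_abs_le_mass {θ ν : ℝ} {n p : ℕ}
    {t : ℝ≥0} {Y : Ω → ℝ} (hY : MemLp Y (p + 1 : ℕ) P) {W : ℤ → ℝ}
    (hi : ∀ y : ℤ, |y| ≤ n → Integrable (fun ω => grown θ ν Q η t y ω ^ (p + 1)) P)
    (hZW : ∀ y : ℤ, |y| ≤ n → ∫ ω, grown θ ν Q η t y ω ^ (p + 1) ∂P ≤ W y ^ (p + 1)) {f : Ω → ℝ} {c : ℝ}
    (hp : Even (p + 1))
    (hf : ∀ ω, |f ω| ≤ c * (∑ y ∈ Finset.Icc (-(n : ℤ)) n, grown θ ν Q η t y ω + |Y ω|)) :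
    ∫ ω, f ω ^ (p + 1) ∂P ≤ |c| ^ (p + 1) * (2 ^ p * (((Finset.Icc (-(n : ℤ)) n).card : ℝ) ^ p
      * (∑ y ∈ Finset.Icc (-(n : ℤ)) n, W y ^ (p + 1)) + ∫ ω, |Y ω| ^ (p + 1) ∂P)) := by
  set S := Finset.Icc (-(n : ℤ)) n with hS
  have hmem : ∀ y ∈ S, |y| ≤ n := fun y hy => by rw [abs_le]; simpa [hS] using hy
  have hYi : Integrable (fun ω => |Y ω| ^ (p + 1)) P := (integrable_pow_iff_memLp hY.1 (by omega)).mpr hY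
  have hsi : Integrable (fun ω => ∑ y ∈ S, grown θ ν Q η t y ω ^ (p + 1)) P :=
    integrable_finsetSum _ fun y hy => hi y (hmem y hy)
  have hdom : Integrable (fun ω => |c| ^ (p + 1) * (2 ^ p * ((S.card : ℝ) ^ p
      * (∑ y ∈ S, grown θ ν Q η t y ω ^ (p + 1)) + |Y ω| ^ (p + 1)))) P :=
    (((hsi.const_mul _).add hYi).const_mul _).const_mul _
  have hle : ∀ ω, f ω ^ (p + 1) ≤ |c| ^ (p + 1) * (2 ^ p * ((S.card : ℝ) ^ p
      * (∑ y ∈ S, grown θ ν Q η t y ω ^ (p + 1)) + |Y ω| ^ (p + 1))) := by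
    intro ω
    have h0 : 0 ≤ ∑ y ∈ S, grown θ ν Q η t y ω :=
      Finset.sum_nonneg fun y _ => (grown_pos θ ν t y ω).le
    have h1 := add_pow_le h0 (abs_nonneg (Y ω)) (p + 1)
    rw [Nat.add_sub_cancel] at h1
    have h2 := pow_sum_le_card_pow_mul S (fun y _ => (grown_pos (Q := Q) (η := η) θ ν t y ω).le) p
    have h3 : |f ω| ≤ |c| * (∑ y ∈ S, grown θ ν Q η t y ω + |Y ω|) :=
      (hf ω).trans (mul_le_mul_of_nonneg_right (le_abs_self c) (add_nonneg h0 (abs_nonneg _)))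
    calc f ω ^ (p + 1) = |f ω| ^ (p + 1) := (hp.pow_abs _).symm
      _ ≤ (|c| * (∑ y ∈ S, grown θ ν Q η t y ω + |Y ω|)) ^ (p + 1) := by gcongr
      _ = |c| ^ (p + 1) * (∑ y ∈ S, grown θ ν Q η t y ω + |Y ω|) ^ (p + 1) := mul_pow _ _ _
      _ ≤ |c| ^ (p + 1) * (2 ^ p * ((∑ y ∈ S, grown θ ν Q η t y ω) ^ (p + 1) + |Y ω| ^ (p + 1))) := by
          gcongr
      _ ≤ _ := by gcongr
  refine (integral_mono_of_nonneg (ae_of_all _ fun ω => hp.pow_nonneg _) hdom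
    (ae_of_all _ hle)).trans ?_
  rw [integral_const_mul, integral_const_mul, integral_add (hsi.const_mul _) hYi, integral_const_mul,
    integral_finsetSum _ fun y hy => hi y (hmem y hy)]
  have := Finset.sum_le_sum fun y hy => hZW y (hmem y hy)
  gcongr

variable [IsProbabilityMeasure P]

set_option maxHeartbeats 1000000 in
/-- Moments of linear functionals of the exponential of the height, for weights with finite
support. -/
theorem DriftBound.moment_pairing_le (h : IsExclusionProcess P ℱ m rate Q η)
    {r : ℕ → ℝ} {θ ε ν C : ℝ} (hD : DriftBound m rate r θ ε ν C)
    (hε : 0 ≤ ε) (hC : 0 ≤ C) (hθ : 0 ≤ θ) {J : ℝ} (hJ0 : 0 ≤ J)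
    (hJ : 2 * θ * Real.exp (2 * θ) ≤ J * √ε) {n : ℕ} (i : ℕ) {t₀ t₁ : ℝ≥0} (ht : t₀ ≤ t₁)
    {Y : Ω → ℝ} (hYm : AEStronglyMeasurable[ℱ t₀] Y P) (hY : MemLp Y (2 * i + 2 : ℕ) P)
    {W : ℤ → ℝ} (hW : ∀ y, 0 < W y)
    (hi : ∀ s, t₀ ≤ s → s ≤ t₁ → ∀ y : ℤ, |y| ≤ n →
      Integrable (fun ω => grown θ ν Q η s y ω ^ (2 * i + 2)) P)
    (hZW : ∀ s, t₀ ≤ s → s ≤ t₁ → ∀ y : ℤ, |y| ≤ n →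
      ∫ ω, grown θ ν Q η s y ω ^ (2 * i + 2) ∂P ≤ W y ^ (2 * i + 2))
    {g g' : ℝ≥0 → ℤ → ℝ} (hg : ∀ s, ∀ y : ℤ, n < |y| + (m + 1) → g s y = 0) {G : ℝ}
    (hgG : ∀ s, t₀ ≤ s → s ≤ t₁ → ∀ y, |g s y| ≤ G) (hg'G : ∀ s, t₀ ≤ s → s ≤ t₁ → ∀ y, |g' s y| ≤ G)
    (hg2 : ∀ a b : ℝ≥0, t₀ ≤ a → a ≤ b → b ≤ t₁ → ∀ y,
      |g b y - g a y - ((b : ℝ) - a) * g' a y| ≤ G * ((b : ℝ) - a) ^ 2)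
    {Φ Ψ : ℝ≥0 → ℝ} {B D B₀ : ℝ} (hB : 0 < B) (hD0 : 0 < D) (hB₀0 : 0 ≤ B₀)
    (hΦ : ∀ a b : ℝ≥0, t₀ ≤ a → a ≤ b → b ≤ t₁ → ((b : ℝ) - a)
      * ∑ y ∈ Finset.Icc (-(n : ℤ)) n, driftWeight m r C ε (g a) (g' a) y * W y ≤ Φ b - Φ a)
    (hΨ : ∀ a b : ℝ≥0, t₀ ≤ a → a ≤ b → b ≤ t₁ → ((b : ℝ) - a)
      * ∑ y ∈ Finset.Icc (-(n : ℤ)) n, ε * (g a y * W y) ^ 2 ≤ Ψ b - Ψ a)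
    (hB₀ : ∀ a : ℝ≥0, t₀ ≤ a → a ≤ t₁ →
      ∑ y ∈ Finset.Icc (-(n : ℤ)) n, ε * (g a y * W y) ^ 2 ≤ B₀)
    (hΦB : Φ t₁ - Φ t₀ ≤ B) (hΨD : Ψ t₁ - Ψ t₀ ≤ D) :
    ∫ ω, (pairing n (g t₁) (fun y => grown θ ν Q η t₁ y ω) - Y ω) ^ (2 * i + 2) ∂P
      ≤ 2 * (∫ ω, (pairing n (g t₀) (fun y => grown θ ν Q η t₀ y ω) - Y ω) ^ (2 * i + 2) ∂P
        + (4 * (2 * i + 2) * B) ^ (2 * i + 2)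
        + (4 * (varConst m i * J ^ 2 + 1) * D) ^ (i + 1)
        + varConst m i * J ^ (2 * i + 2) * B₀ ^ i * D) := by
  have hV := varConst_nonneg m i
  set p := 2 * i + 2 with hp
  have hpe : Even p := ⟨i + 1, by omega⟩
  set F : ℝ≥0 → ℝ := fun s =>
    ∫ ω, (pairing n (g s) (fun y => grown θ ν Q η s y ω) - Y ω) ^ p ∂P with hF
  have hG0 : 0 ≤ G := (abs_nonneg _).trans (hgG t₀ le_rfl ht 0)
  set M : ℝ := 2 ^ (2 * i + 1) * (((Finset.Icc (-(n : ℤ)) n).card : ℝ) ^ (2 * i + 1)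
      * (∑ y ∈ Finset.Icc (-(n : ℤ)) n, W y ^ (2 * i + 1 + 1)) + ∫ ω, |Y ω| ^ (2 * i + 1 + 1) ∂P) with hM
  have hM0 : 0 ≤ M := by
    have : 0 ≤ ∫ ω, |Y ω| ^ (2 * i + 1 + 1) ∂P := integral_nonneg fun ω => by positivity
    have : 0 ≤ ∑ y ∈ Finset.Icc (-(n : ℤ)) n, W y ^ (2 * i + 1 + 1) :=
      Finset.sum_nonneg fun y _ => pow_nonneg (hW y).le _
    positivity
  have hmass : ∀ s, t₀ ≤ s → s ≤ t₁ → ∀ (f : Ω → ℝ) (c : ℝ), (∀ ω, |f ω| ≤ c *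
      (∑ y ∈ Finset.Icc (-(n : ℤ)) n, grown θ ν Q η s y ω + |Y ω|)) →
      ∫ ω, f ω ^ p ∂P ≤ |c| ^ p * M := fun s h0 h1 f c hf =>
    integral_pow_le_of_abs_le_mass (p := 2 * i + 1) hY (hi s h0 h1) (hZW s h0 h1) hpe hf
  -- The a priori bound without which the self-improving inequality would be void.
  have hFA : ∀ s : {s : ℝ≥0 // t₀ ≤ s ∧ s ≤ t₁}, F s ≤ |max G 1| ^ p * M := by
    rintro ⟨s, h0, h1⟩
    refine hmass s h0 h1 _ _ fun ω => ?_
    have e1 := FiniteRangeExclusion.abs_pairing_le (n := n) (hgG s h0 h1)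
      (fun y => (grown_pos (Q := Q) (η := η) θ ν s y ω).le)
    have e2 : 0 ≤ ∑ y ∈ Finset.Icc (-(n : ℤ)) n, grown θ ν Q η s y ω :=
      Finset.sum_nonneg fun y _ => (grown_pos θ ν s y ω).le
    calc _ ≤ |pairing n (g s) (fun y => grown θ ν Q η s y ω)| + |Y ω| := abs_sub _ _
      _ ≤ max G 1 * (∑ y ∈ Finset.Icc (-(n : ℤ)) n, grown θ ν Q η s y ω) + max G 1 * |Y ω| := by
          refine add_le_add (e1.trans ?_) ?_
          · exact mul_le_mul_of_nonneg_right (le_max_left _ _) e2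
          · exact le_mul_of_one_le_left (abs_nonneg _) (le_max_right _ _)
      _ = _ := by ring
  set E₁ := Real.exp (|ν| * t₁) with hE₁
  set G' := max 1 (E₁ * G * (1 + |ν| * Real.exp |ν| + ν ^ 2 * Real.exp |ν| + |ν|)) with hG'
  have hcG : E₁ * G ≤ G' ∧ E₁ * G * (1 + |ν|) ≤ G' ∧
      E₁ * G * (1 + |ν| * Real.exp |ν| + ν ^ 2 * Real.exp |ν|) ≤ G' := by
    have hE0 : 0 ≤ E₁ * G := by positivity
    refine ⟨le_trans ?_ (le_max_right _ _), le_trans ?_ (le_max_right _ _), le_trans ?_ (le_max_right _ _)⟩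
    · refine le_mul_of_one_le_right hE0 ?_
      have : 0 ≤ |ν| * Real.exp |ν| + ν ^ 2 * Real.exp |ν| + |ν| := by positivity
      linarith
    · refine mul_le_mul_of_nonneg_left ?_ hE0
      have : 0 ≤ |ν| * Real.exp |ν| + ν ^ 2 * Real.exp |ν| := by positivity
      linarith
    · exact mul_le_mul_of_nonneg_left (le_add_of_nonneg_right (abs_nonneg _)) hE0
  have hexpE : ∀ s : ℝ≥0, s ≤ t₁ → ∀ z : ℝ, |z| ≤ |ν| → Real.exp (z * s) ≤ E₁ := by
    intro s hs z hz
    rw [hE₁, Real.exp_le_exp]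
    have hs' : (s : ℝ) ≤ t₁ := by exact_mod_cast hs
    calc z * (s : ℝ) ≤ |ν| * s := mul_le_mul_of_nonneg_right ((le_abs_self _).trans hz) s.2
      _ ≤ _ := by gcongr
  obtain ⟨K, hK, hstep⟩ := exists_moment_step h hθ n (q := 2 * i) (even_two_mul i)
    (G := G') (le_max_left _ _)
  have hexpi : ∀ s, t₀ ≤ s → s ≤ t₁ → ∀ y : ℤ, |y| ≤ n →
      Integrable (fun ω => expHeight θ Q η s y ω ^ (2 * i + 2)) P := by
    intro s h0 h1 y hy
    refine ((hi s h0 h1 y hy).const_mul (Real.exp (ν * s) ^ (2 * i + 2))⁻¹).congr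
      (ae_of_all _ fun ω => ?_)
    have := (Real.exp_pos (ν * s)).ne'
    simp only [grown, mul_pow, hp]; field_simp
  have hpair : ∀ (s : ℝ≥0) (ω : Ω), pairing n (fun y => Real.exp (ν * s) * g s y) (fun y => expHeight θ Q η s y ω)
      = pairing n (g s) (fun y => grown θ ν Q η s y ω) := fun s ω =>
    Finset.sum_congr rfl fun y _ => by unfold grown; ring
  have himp : ∀ A, (∀ s : {s : ℝ≥0 // t₀ ≤ s ∧ s ≤ t₁}, F s ≤ A) →
      ∀ s : {s : ℝ≥0 // t₀ ≤ s ∧ s ≤ t₁}, F s ≤ (F t₀ + (4 * (2 * i + 2) * B) ^ p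
        + (4 * (varConst m i * J ^ 2 + 1) * D) ^ (i + 1)
        + varConst m i * J ^ p * B₀ ^ i * D) + A / 2 := by
    intro A hA ⟨s, hs0, hs1⟩
    have hA0 : 0 ≤ A := (integral_nonneg fun ω => hpe.pow_nonneg _).trans (hA ⟨t₀, le_rfl, ht⟩)
    -- Chosen so that drift and variation each contribute at most `A / 4`, in total the `A / 2` that
    -- can be absorbed. The summand `1` in `μ₂` guards against a vanishing coefficient.
    set μ₁ : ℝ := (4 * (2 * i + 2) * B)⁻¹ with hμ₁
    set μ₂ : ℝ := (4 * (varConst m i * J ^ 2 + 1) * D)⁻¹ with hμ₂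
    have hμ₁0 : 0 < μ₁ := by positivity
    have hμ₂0 : 0 < μ₂ := by positivity
    set c₁ : ℝ := (2 * i + 2) * (μ₁ * A + μ₁⁻¹ ^ (2 * i + 1)) with hc₁
    set c₂ : ℝ := varConst m i * (J ^ 2 * (μ₂ * A + μ₂⁻¹ ^ i) + J ^ (2 * i + 2) * B₀ ^ i) with hc₂
    have hc₁0 : 0 ≤ c₁ := by positivity
    have hc₂0 : 0 ≤ c₂ := by positivity
    -- The generator bound is constant in time except for the weight sums, which `Φ` and `Ψ`
    -- dominate; `c₁ Φ + c₂ Ψ` is therefore a potential for the telescoping.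
    have hF1 : F s ≤ F t₀ + ((c₁ * Φ s + c₂ * Ψ s) - (c₁ * Φ t₀ + c₂ * Ψ t₀)) := by
      refine le_of_short_steps (F := F) (Φ := fun s => c₁ * Φ s + c₂ * Ψ s) hs0
        (K := K * (|E₁| ^ p * M)) ?_
      intro a b ha hab hbs hab1
      have hb1 := hbs.trans hs1
      have ha1 := hab.trans hb1
      have hab' : (a : ℝ) ≤ b := by exact_mod_cast hab
      have hb1' : (b : ℝ) ≤ t₁ := by exact_mod_cast hb1
      have hg'' : ∀ y, |Real.exp (ν * a) * (g' a y + ν * g a y)| ≤ E₁ * G * (1 + |ν|) := by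
        intro y
        rw [abs_mul, abs_of_pos (Real.exp_pos _)]
        have e1 := abs_add_le_add (hg'G a ha ha1 y) (abs_mul_le_mul (le_refl |ν|) (hgG a ha ha1 y))
        calc _ ≤ E₁ * (G + |ν| * G) := by
              gcongr; exact hexpE a ha1 ν le_rfl
          _ = _ := by ring
      obtain ⟨hint, hle⟩ := hstep a b hab hab1 Y (hYm.mono (ℱ.mono ha)) hY (hexpi a ha ha1)
        (fun y => Real.exp (ν * a) * g a y) (fun y => Real.exp (ν * b) * g b y)
        (fun y => Real.exp (ν * a) * (g' a y + ν * g a y))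
        (fun y => by
          rw [abs_mul, abs_of_pos (Real.exp_pos _)]
          refine le_trans ?_ hcG.1
          have := hexpE a ha1 ν le_rfl
          have := hgG a ha ha1 y
          gcongr)
        (fun y => (hg'' y).trans hcG.2.1)
        (fun y => (abs_exp_smul_taylor a.2 hab' hb1' hab1 (hgG a ha ha1 y) (hg'G a ha ha1 y)
          (hg2 a b ha hab hb1 y)).trans (mul_le_mul_of_nonneg_right hcG.2.2 (sq_nonneg _)))
      simp only [hpair] at hle
      have hgen := hD.integral_powerGen_le h hε hC hθ hJ0 hJ i (g' := g' a) (hg a) hW hμ₁0 hμ₂0 hY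
        (hi a ha ha1) (hZW a ha ha1) (hA ⟨a, ha, ha1⟩) (hB₀ a ha ha1) hint
      have hms : ∫ ω, mass n θ Q η Y a ω ^ (2 * i + 2) ∂P ≤ |E₁| ^ p * M := by
        refine hmass a ha ha1 _ _ fun ω => ?_
        rw [abs_of_nonneg (mass_nonneg _ _ _ _ _)]
        unfold mass
        rw [mul_add, Finset.mul_sum]
        refine add_le_add (Finset.sum_le_sum fun y _ => ?_) ?_
        · have e1 := hexpE a ha1 (-ν) (abs_neg ν).le
          have e2 : expHeight θ Q η a y ω = Real.exp (-ν * a) * grown θ ν Q η a y ω := by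
            unfold grown
            rw [← mul_assoc, ← Real.exp_add]; simp
          rw [e2]
          exact mul_le_mul_of_nonneg_right e1 (grown_pos _ _ _ _ _).le
        · refine le_mul_of_one_le_left (abs_nonneg _) ?_
          rw [hE₁]; exact Real.one_le_exp (by positivity)
      have hh0 : 0 ≤ (b : ℝ) - a := sub_nonneg.mpr hab'
      have i1 := mul_le_mul_of_nonneg_left hgen hh0
      have i2 := mul_le_mul_of_nonneg_left hms (by positivity : 0 ≤ K * ((b : ℝ) - a) ^ 2)
      have i3 := mul_le_mul_of_nonneg_right (hΦ a b ha hab hb1) hc₁0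
      have i4 := mul_le_mul_of_nonneg_right (hΨ a b ha hab hb1) hc₂0
      simp only [hF]
      linarith
    have hmono : ∀ Θ' : ℝ≥0 → ℝ, (∀ a b : ℝ≥0, t₀ ≤ a → a ≤ b → b ≤ t₁ → 0 ≤ Θ' b - Θ' a) →
        Θ' s - Θ' t₀ ≤ Θ' t₁ - Θ' t₀ := fun Θ' hΘ => by
      have := hΘ s t₁ hs0 hs1 le_rfl; linarith
    have hΦs := (hmono Φ fun a b ha hab hb => le_trans (mul_nonneg (sub_nonneg.mpr (by exact_mod_cast hab))
      (Finset.sum_nonneg fun y _ => mul_nonneg (driftWeight_nonneg r hC hε _ _ y) (hW y).le))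
      (hΦ a b ha hab hb)).trans hΦB
    have hΨs := (hmono Ψ fun a b ha hab hb => le_trans (mul_nonneg (sub_nonneg.mpr (by exact_mod_cast hab))
      (Finset.sum_nonneg fun y _ => by positivity)) (hΨ a b ha hab hb)).trans hΨD
    have j1 := mul_le_mul_of_nonneg_left hΦs hc₁0
    have j2 := mul_le_mul_of_nonneg_left hΨs hc₂0
    have k1 : c₁ * B = A / 4 + (2 * i + 2) * B * (4 * (2 * i + 2) * B) ^ (2 * i + 1) := by
      rw [hc₁, hμ₁, inv_inv]; field_simp
    have k1' : (2 * i + 2) * B * (4 * (2 * i + 2) * B) ^ (2 * i + 1) ≤ (4 * (2 * i + 2) * B) ^ p := by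
      rw [hp, pow_succ _ (2 * i + 1), mul_comm]
      refine mul_le_mul_of_nonneg_left ?_ (by positivity)
      have : 0 ≤ (2 * i + 2) * B := by positivity
      linarith
    have k2 : c₂ * D ≤ A / 4 + (4 * (varConst m i * J ^ 2 + 1) * D) ^ (i + 1)
        + varConst m i * J ^ p * B₀ ^ i * D := by
      have e0 : 0 ≤ varConst m i * J ^ 2 := by positivity
      have e1 : c₂ * D = (varConst m i * J ^ 2 * D) * μ₂ * A + (varConst m i * J ^ 2 * D) * μ₂⁻¹ ^ i
          + varConst m i * J ^ p * B₀ ^ i * D := by rw [hc₂]; ring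
      have e2 : (varConst m i * J ^ 2 * D) * μ₂ ≤ 1 / 4 := by
        rw [hμ₂, ← div_eq_mul_inv, div_le_iff₀ (by positivity)]
        linarith
      have e3 : (varConst m i * J ^ 2 * D) * μ₂⁻¹ ^ i ≤ (4 * (varConst m i * J ^ 2 + 1) * D) ^ (i + 1) := by
        rw [hμ₂, inv_inv, pow_succ, mul_comm]
        refine mul_le_mul_of_nonneg_left ?_ (by positivity)
        have : 0 ≤ varConst m i * J ^ 2 * D := by positivity
        linarith
      have e4 := mul_le_mul_of_nonneg_right e2 hA0
      linarith
    change F s ≤ _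
    linarith
  have hF0 : 0 ≤ F t₀ := integral_nonneg fun ω => hpe.pow_nonneg _
  exact le_two_mul_of_self_improving (by positivity) hFA (fun A _ => himp A) ⟨t₁, ht, le_rfl⟩

end MomentBound

/-! ### Exponentials in Banach algebras -/

section BanachExp

variable {A : Type*} [NormedRing A] [NormedAlgebra ℝ A] [NormOneClass A]

theorem norm_exp_term_le (x : A) (n : ℕ) :
    ‖((n.factorial : ℝ)⁻¹) • x ^ n‖ ≤ ‖x‖ ^ n / n.factorial := by
  rw [norm_smul, norm_inv, Real.norm_natCast, inv_mul_eq_div]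
  gcongr
  exact norm_pow_le x n

variable [CompleteSpace A]

theorem hasSum_real_exp (x : ℝ) : HasSum (fun n : ℕ => x ^ n / n.factorial) (Real.exp x) := by
  rw [Real.exp_eq_exp_ℝ]; exact NormedSpace.expSeries_div_hasSum_exp x

theorem norm_banachExp_le (x : A) : ‖NormedSpace.exp x‖ ≤ Real.exp ‖x‖ :=
  (NormedSpace.exp_series_hasSum_exp' (𝕂 := ℝ) x).norm_le_of_bounded (hasSum_real_exp ‖x‖)
    fun n => norm_exp_term_le x n

theorem norm_banachExp_sub_one_sub_le (x : A) :
    ‖NormedSpace.exp x - 1 - x‖ ≤ ‖x‖ ^ 2 * Real.exp ‖x‖ := by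
  have h := (hasSum_nat_add_iff' 2).mpr (NormedSpace.exp_series_hasSum_exp' (𝕂 := ℝ) x)
  have e : NormedSpace.exp x - ∑ i ∈ Finset.range 2, ((i.factorial : ℝ)⁻¹) • x ^ i
      = NormedSpace.exp x - 1 - x := by
    simp [Finset.sum_range_succ, sub_add_eq_sub_sub]
  rw [e] at h
  refine h.norm_le_of_bounded ((hasSum_real_exp ‖x‖).mul_left (‖x‖ ^ 2)) fun n => ?_
  refine (norm_exp_term_le x (n + 2)).trans ?_
  rw [pow_add, mul_comm, mul_div_assoc]
  gcongr
  omega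

theorem hasSum_mul_exp (x : ℝ) :
    HasSum (fun n : ℕ => (n : ℝ) * (x ^ n / n.factorial)) (x * Real.exp x) := by
  rw [← hasSum_nat_add_iff' 1]
  simp only [Finset.range_one, Finset.sum_singleton, CharP.cast_eq_zero, zero_mul, sub_zero]
  refine ((hasSum_real_exp x).mul_left x).congr_fun fun n => ?_
  rw [Nat.factorial_succ]; push_cast; field_simp; ring

theorem hasSum_sq_mul_exp (x : ℝ) :
    HasSum (fun n : ℕ => (n : ℝ) ^ 2 * (x ^ n / n.factorial)) ((x ^ 2 + x) * Real.exp x) := by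
  rw [← hasSum_nat_add_iff' 1]
  simp only [Finset.range_one, Finset.sum_singleton, CharP.cast_eq_zero, zero_mul, sub_zero, ne_eq,
    OfNat.ofNat_ne_zero, not_false_eq_true, zero_pow]
  have := ((hasSum_mul_exp x).add (hasSum_real_exp x)).mul_left x
  rw [show x * (x * Real.exp x + Real.exp x) = (x ^ 2 + x) * Real.exp x by ring] at this
  refine this.congr_fun fun n => ?_
  rw [Nat.factorial_succ]; push_cast; field_simp; ring

theorem hasSum_variance_exp (x : ℝ) :
    HasSum (fun n : ℕ => ((n : ℝ) - x) ^ 2 * (x ^ n / n.factorial)) (x * Real.exp x) := by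
  have := ((hasSum_sq_mul_exp x).sub ((hasSum_mul_exp x).mul_left (2 * x))).add
    ((hasSum_real_exp x).mul_left (x ^ 2))
  rw [show (x ^ 2 + x) * Real.exp x - 2 * x * (x * Real.exp x) + x ^ 2 * Real.exp x
    = x * Real.exp x by ring] at this
  exact this.congr_fun fun n => by ring

/-- The gradient estimate for the Poisson distribution. -/
theorem norm_gradient_banachExp_le {S : A} (hS : ‖S‖ ≤ 1) {c β : ℝ} (hc : 0 < c) (hβ : 0 < β) :
    ‖(β • S - 1) * NormedSpace.exp ((c * β) • S)‖
      ≤ (√(c * β) / c + |β - 1|) * Real.exp (c * β) := by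
  set x := c * β with hx
  have hx0 : 0 < x := by positivity
  have hsx : 0 < √x := Real.sqrt_pos.mpr hx0
  have hE := NormedSpace.exp_series_hasSum_exp' (𝕂 := ℝ) (x • S)
  -- Multiplication by `β S` shifts the exponential series, which multiplies its `n`-th coefficient
  -- by `n / c`. Subtracting the series leaves `n / c - 1`: up to `β - 1`, the deviation of a
  -- Poisson variable from its mean `x`, divided by `c`.
  have h1 : HasSum (fun n : ℕ => ((n : ℝ) / c * (x ^ n / n.factorial)) • S ^ n)
      ((β • S) * NormedSpace.exp (x • S)) := by
    rw [← hasSum_nat_add_iff' 1]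
    simp only [Finset.range_one, Finset.sum_singleton, CharP.cast_eq_zero, zero_mul, sub_zero,
      zero_div, zero_smul]
    refine (hE.mul_left (β • S)).congr_fun fun n => ?_
    rw [smul_pow, smul_smul, smul_mul_smul_comm, ← pow_succ']
    congr 1
    rw [Nat.factorial_succ, pow_succ, hx]; push_cast; field_simp
  have h2 : HasSum (fun n : ℕ => (((n : ℝ) / c - 1) * (x ^ n / n.factorial)) • S ^ n)
      ((β • S - 1) * NormedSpace.exp (x • S)) := by
    rw [sub_mul, one_mul]
    refine (h1.sub hE).congr_fun fun n => ?_
    rw [smul_pow, smul_smul, ← sub_smul]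
    congr 1
    ring
  have h3 : HasSum (fun n : ℕ => (√x / (2 * c) + |β - 1|) * (x ^ n / n.factorial)
      + (1 / (2 * c * √x)) * (((n : ℝ) - x) ^ 2 * (x ^ n / n.factorial)))
      ((√x / c + |β - 1|) * Real.exp x) := by
    have := ((hasSum_real_exp x).mul_left (√x / (2 * c) + |β - 1|)).add
      ((hasSum_variance_exp x).mul_left (1 / (2 * c * √x)))
    have hxx : x = √x * √x := (Real.mul_self_sqrt hx0.le).symm
    have e : 1 / (2 * c * √x) * (x * Real.exp x) = √x / (2 * c) * Real.exp x := by
      rw [show x * Real.exp x = √x * √x * Real.exp x by rw [← hxx]]; field_simp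
    rw [e, show (√x / (2 * c) + |β - 1|) * Real.exp x + √x / (2 * c) * Real.exp x
      = (√x / c + |β - 1|) * Real.exp x by ring] at this
    exact this
  refine h2.norm_le_of_bounded h3 fun n => ?_
  rw [norm_smul, Real.norm_eq_abs, abs_mul, abs_of_nonneg (by positivity : 0 ≤ x ^ n / n.factorial)]
  have hn : ‖S ^ n‖ ≤ 1 := (norm_pow_le S n).trans (pow_le_one₀ (norm_nonneg _) hS)
  -- Since `|n - x| ≤ √x / 2 + (n - x)² / (2 √x)` and the variance is `x`, the mean deviation is at
  -- most `√x`.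
  have h4 : |(n : ℝ) / c - 1| ≤ √x / (2 * c) + |β - 1| + 1 / (2 * c * √x) * ((n : ℝ) - x) ^ 2 := by
    have e1 : (n : ℝ) / c - 1 = ((n : ℝ) - x) / c + (β - 1) := by rw [hx]; field_simp; ring
    rw [e1]
    refine (abs_add_le _ _).trans ?_
    rw [abs_div, abs_of_pos hc]
    have e2 : |(n : ℝ) - x| / c ≤ √x / (2 * c) + 1 / (2 * c * √x) * ((n : ℝ) - x) ^ 2 := by
      have e3 : √x / (2 * c) + 1 / (2 * c * √x) * ((n : ℝ) - x) ^ 2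
          = ((√x) ^ 2 + |(n : ℝ) - x| ^ 2) / (2 * √x) / c := by
        rw [sq_abs]; field_simp
      rw [e3]
      gcongr
      rw [le_div_iff₀ (by positivity)]
      nlinarith [sq_nonneg (√x - |(n : ℝ) - x|)]
    linarith
  calc |(n : ℝ) / c - 1| * (x ^ n / n.factorial) * ‖S ^ n‖
      ≤ (√x / (2 * c) + |β - 1| + 1 / (2 * c * √x) * ((n : ℝ) - x) ^ 2) * (x ^ n / n.factorial) * 1 := by
        gcongr
    _ = _ := by ring

end BanachExp

/-! ### The heat semigroup -/

section HeatSemigroup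

/-- Bounded functions on the integers. -/
def BddFun : Type := BoundedContinuousFunction ℤ ℝ

instance : NormedAddCommGroup BddFun := inferInstanceAs (NormedAddCommGroup (BoundedContinuousFunction ℤ ℝ))

instance : NormedSpace ℝ BddFun := inferInstanceAs (NormedSpace ℝ (BoundedContinuousFunction ℤ ℝ))

instance : CompleteSpace BddFun := inferInstanceAs (CompleteSpace (BoundedContinuousFunction ℤ ℝ))

instance : FunLike BddFun ℤ ℝ := inferInstanceAs (FunLike (BoundedContinuousFunction ℤ ℝ) ℤ ℝ)

instance : Nontrivial BddFun := by
  refine ⟨⟨BoundedContinuousFunction.const ℤ (0 : ℝ), BoundedContinuousFunction.const ℤ (1 : ℝ), fun h => ?_⟩⟩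
  exact zero_ne_one (congrArg (fun f : BoundedContinuousFunction ℤ ℝ => f 0) h)

theorem BddFun.ext {f g : BddFun} (h : ∀ z, f z = g z) : f = g := BoundedContinuousFunction.ext h

theorem BddFun.norm_le {f : BddFun} {C : ℝ} (hC : 0 ≤ C) : ‖f‖ ≤ C ↔ ∀ z, |f z| ≤ C :=
  BoundedContinuousFunction.norm_le hC

theorem BddFun.abs_le_norm (f : BddFun) (z : ℤ) : |f z| ≤ ‖f‖ :=
  BoundedContinuousFunction.norm_coe_le_norm f z

/-- Evaluation at `z`. -/
def BddFun.eval (z : ℤ) : BddFun →L[ℝ] ℝ := BoundedContinuousFunction.evalCLM ℝ z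

theorem BddFun.add_apply (f g : BddFun) (z : ℤ) : (f + g) z = f z + g z := rfl

theorem BddFun.smul_apply (a : ℝ) (f : BddFun) (z : ℤ) : (a • f) z = a * f z := rfl

theorem BddFun.sum_apply {ι : Type*} (S : Finset ι) (f : ι → BddFun) (z : ℤ) :
    (∑ i ∈ S, f i) z = ∑ i ∈ S, f i z := map_sum (BddFun.eval z) f S

theorem banachExp_add {A : Type*} [NormedRing A] [NormedAlgebra ℝ A] [CompleteSpace A] {x y : A}
    (h : Commute x y) : NormedSpace.exp (x + y) = NormedSpace.exp x * NormedSpace.exp y := by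
  let _ := NormedAlgebra.restrictScalars ℚ ℝ A
  exact NormedSpace.exp_add_of_commute h

/-- The shift of bounded functions. -/
def shiftOp (k : ℤ) : BddFun →L[ℝ] BddFun :=
  LinearMap.mkContinuous
    { toFun := fun f => BoundedContinuousFunction.compContinuous f ⟨fun z => z + k, continuous_of_discreteTopology⟩
      map_add' := fun _ _ => rfl
      map_smul' := fun _ _ => rfl } 1 fun f => by
    rw [one_mul]
    exact (BddFun.norm_le (norm_nonneg _)).mpr fun z => BddFun.abs_le_norm f _

theorem shiftOp_apply (k : ℤ) (f : BddFun) (z : ℤ) : shiftOp k f z = f (z + k) := rfl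

theorem norm_shiftOp_le (k : ℤ) : ‖shiftOp k‖ ≤ 1 := LinearMap.mkContinuous_norm_le _ zero_le_one _

theorem shiftOp_mul (k l : ℤ) : shiftOp k * shiftOp l = shiftOp (k + l) := by
  refine ContinuousLinearMap.ext fun f => BddFun.ext fun z => ?_
  change f (z + k + l) = f (z + (k + l))
  rw [add_assoc]

theorem commute_shiftOp (k l : ℤ) : Commute (shiftOp k) (shiftOp l) := by
  rw [Commute, SemiconjBy, shiftOp_mul, shiftOp_mul, add_comm]

variable {m : ℕ}

/-- The generating operator of the hops of the random walk, tilted by `exp (α z)`. -/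
def hopOp (m : ℕ) (r : ℕ → ℝ) (α : ℝ) : BddFun →L[ℝ] BddFun :=
  ∑ k ∈ Finset.Icc 1 m, (1 / 2 * r k) • (Real.exp (-α * k) • shiftOp k + Real.exp (α * k) • shiftOp (-k))

theorem hopOp_apply (r : ℕ → ℝ) (α : ℝ) (f : BddFun) (z : ℤ) : hopOp m r α f z
    = ∑ k ∈ Finset.Icc 1 m, (1 / 2 * r k) * (Real.exp (-α * k) * f (z + k)
      + Real.exp (α * k) * f (z - k)) := by
  unfold hopOp
  rw [_root_.sum_apply, BddFun.sum_apply]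
  rfl

theorem commute_shiftOp_hopOp (l : ℤ) (r : ℕ → ℝ) (α : ℝ) : Commute (shiftOp l) (hopOp m r α) := by
  unfold hopOp
  refine Commute.sum_right _ _ _ fun k _ => ?_
  refine Commute.smul_right (Commute.add_right ?_ ?_) _
  · exact (commute_shiftOp _ _).smul_right _
  · exact (commute_shiftOp _ _).smul_right _

/-- The heat semigroup, tilted by `exp (α z)`. -/
def heatOp (m : ℕ) (r : ℕ → ℝ) (α s : ℝ) : BddFun →L[ℝ] BddFun :=
  NormedSpace.exp (s • (hopOp m r α - 1))

theorem heatOp_zero (r : ℕ → ℝ) (α : ℝ) : heatOp m r α 0 = 1 := by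
  unfold heatOp; rw [zero_smul, NormedSpace.exp_zero]

theorem heatOp_add (r : ℕ → ℝ) (α s t : ℝ) :
    heatOp m r α (s + t) = heatOp m r α s * heatOp m r α t := by
  unfold heatOp
  rw [add_smul]
  exact banachExp_add (((Commute.refl _).smul_left s).smul_right t)

theorem heatOp_eq (r : ℕ → ℝ) (α s : ℝ) :
    heatOp m r α s = Real.exp (-s) • NormedSpace.exp (s • hopOp m r α) := by
  unfold heatOp
  have e : s • (hopOp m r α - 1) = (-s) • (1 : BddFun →L[ℝ] BddFun) + s • hopOp m r α := by
    rw [smul_sub, neg_smul]; abel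
  have e2 : NormedSpace.exp ((-s) • (1 : BddFun →L[ℝ] BddFun)) = Real.exp (-s) • 1 := by
    have := NormedSpace.algebraMap_exp_comm (𝕂 := ℝ) (𝔸 := BddFun →L[ℝ] BddFun) (-s)
    rw [← Real.exp_eq_exp_ℝ, Algebra.algebraMap_eq_smul_one, Algebra.algebraMap_eq_smul_one] at this
    exact this.symm
  rw [e, banachExp_add ((Commute.one_left _).smul_left _), e2, smul_mul_assoc, one_mul]

theorem commute_shiftOp_heatOp (l : ℤ) (r : ℕ → ℝ) (α s : ℝ) :
    Commute (shiftOp l) (heatOp m r α s) := by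
  unfold heatOp
  exact (((commute_shiftOp_hopOp l r α).sub_right (Commute.one_right _)).smul_right s).exp_right

/-- The exponential moment of the hops. -/
def hopMgf (m : ℕ) (r : ℕ → ℝ) (α : ℝ) : ℝ := ∑ k ∈ Finset.Icc 1 m, r k * Real.cosh (α * k)

theorem norm_hop_term_le {r : ℕ → ℝ} {k : ℕ} (hr : 0 ≤ r k) (α : ℝ) :
    ‖(1 / 2 * r k) • (Real.exp (-α * k) • shiftOp k + Real.exp (α * k) • shiftOp (-k))‖
      ≤ r k * Real.cosh (α * k) := by
  have h : ∀ (b : ℝ) (l : ℤ), 0 ≤ b → ‖b • shiftOp l‖ ≤ b := fun b l hb => by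
    rw [norm_smul, Real.norm_of_nonneg hb]
    exact mul_le_of_le_one_right hb (norm_shiftOp_le l)
  rw [norm_smul, Real.norm_of_nonneg (by positivity)]
  calc _ ≤ 1 / 2 * r k * (Real.exp (-α * k) + Real.exp (α * k)) := by
        gcongr
        exact (norm_add_le _ _).trans (add_le_add (h _ _ (Real.exp_pos _).le) (h _ _ (Real.exp_pos _).le))
    _ = _ := by rw [Real.cosh_eq, neg_mul]; ring

theorem norm_hopOp_le {r : ℕ → ℝ} (hr : ∀ k ∈ Finset.Icc 1 m, 0 < r k) (α : ℝ) :
    ‖hopOp m r α‖ ≤ hopMgf m r α :=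
  (norm_sum_le _ _).trans (Finset.sum_le_sum fun k hk => norm_hop_term_le (hr k hk).le α)

theorem norm_heatOp_le {r : ℕ → ℝ} (hr : ∀ k ∈ Finset.Icc 1 m, 0 < r k) (α : ℝ) {s : ℝ} (hs : 0 ≤ s) :
    ‖heatOp m r α s‖ ≤ Real.exp (s * (hopMgf m r α - 1)) := by
  rw [heatOp_eq, norm_smul, Real.norm_of_nonneg (Real.exp_pos _).le]
  calc _ ≤ Real.exp (-s) * Real.exp (s * hopMgf m r α) := by
        refine mul_le_mul_of_nonneg_left ((norm_banachExp_le _).trans (Real.exp_le_exp.mpr ?_))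
          (Real.exp_pos _).le
        rw [norm_smul, Real.norm_of_nonneg hs]
        exact mul_le_mul_of_nonneg_left (norm_hopOp_le hr α) hs
    _ = _ := by rw [← Real.exp_add]; ring_nf

theorem one_le_of_sum_eq_one {r : ℕ → ℝ} (hr1 : ∑ k ∈ Finset.Icc 1 m, r k = 1) : 1 ≤ m := by
  rcases Nat.eq_zero_or_pos m with h | h
  · subst h; simp at hr1
  · exact h

/-- The unit hops to the right commute with all other hops, so the exponential factorizes. The
gradient estimate is spent on the first factor, whose rate is proportional to `r 1 > 0`; the second
is bounded by the exponential of its norm. The two exponents recombine to `s (hopMgf - 1)`. -/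
theorem norm_gradient_heatOp_le {r : ℕ → ℝ} (hr : ∀ k ∈ Finset.Icc 1 m, 0 < r k) (hm : 1 ≤ m) (α : ℝ)
    {s : ℝ} (hs : 0 < s) : ‖(Real.exp (-α) • shiftOp 1 - 1) * heatOp m r α s‖
      ≤ (√(s * r 1 / 2 * Real.exp (-α)) / (s * r 1 / 2) + |Real.exp (-α) - 1|)
        * Real.exp (s * (hopMgf m r α - 1)) := by
  have hr1 : 0 < r 1 := hr 1 (Finset.mem_Icc.mpr ⟨le_rfl, hm⟩)
  set β := Real.exp (-α) with hβ
  set c := s * r 1 / 2 with hc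
  have hc0 : 0 < c := by positivity
  have hβ0 : 0 < β := Real.exp_pos _
  have hIcc : Finset.Icc 1 m = insert 1 (Finset.Icc 2 m) := by
    ext k; simp only [Finset.mem_Icc, Finset.mem_insert]; omega
  set R : BddFun →L[ℝ] BddFun := s • ((1 / 2 * r 1 * Real.exp α) • shiftOp (-1)
    + ∑ k ∈ Finset.Icc 2 m, (1 / 2 * r k) • (Real.exp (-α * k) • shiftOp k
      + Real.exp (α * k) • shiftOp (-k))) with hR
  have hsplit : s • hopOp m r α = (c * β) • shiftOp 1 + R := by
    unfold hopOp
    rw [hIcc, Finset.sum_insert (by simp), hR]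
    generalize ∑ k ∈ Finset.Icc 2 m, (1 / 2 * r k) • (Real.exp (-α * k) • shiftOp k
      + Real.exp (α * k) • shiftOp (-k)) = B
    simp only [Nat.cast_one, mul_one, smul_add, smul_smul, ← add_assoc]
    congr 3
    · rw [hc, hβ]; ring
  have hcomm : Commute ((c * β) • shiftOp 1) R := by
    refine Commute.smul_left (Commute.smul_right (Commute.add_right ?_ ?_) _) _
    · exact (commute_shiftOp _ _).smul_right _
    · refine Commute.sum_right _ _ _ fun k _ => ?_
      refine Commute.smul_right (Commute.add_right ?_ ?_) _
      · exact (commute_shiftOp _ _).smul_right _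
      · exact (commute_shiftOp _ _).smul_right _
  have hRn : ‖R‖ ≤ s * hopMgf m r α - c * β := by
    rw [hR, norm_smul, Real.norm_of_nonneg hs.le]
    have h1 : ‖(1 / 2 * r 1 * Real.exp α) • shiftOp (-1)‖ ≤ 1 / 2 * r 1 * Real.exp α := by
      rw [norm_smul, Real.norm_of_nonneg (by positivity)]
      exact mul_le_of_le_one_right (by positivity) (norm_shiftOp_le _)
    have h2 := (norm_sum_le (Finset.Icc 2 m) fun k => (1 / 2 * r k) • (Real.exp (-α * k) • shiftOp k
      + Real.exp (α * k) • shiftOp (-k))).trans (Finset.sum_le_sum fun k hk =>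
        norm_hop_term_le (hr k (by rw [hIcc]; exact Finset.mem_insert_of_mem hk)).le α)
    have h3 : hopMgf m r α = r 1 * Real.cosh α + ∑ k ∈ Finset.Icc 2 m, r k * Real.cosh (α * k) := by
      unfold hopMgf
      rw [hIcc, Finset.sum_insert (by simp)]; simp
    have h4 : r 1 * Real.cosh α = 1 / 2 * r 1 * Real.exp α + 1 / 2 * r 1 * β := by
      rw [Real.cosh_eq, hβ]; ring
    have h5 : s * hopMgf m r α - c * β = s * (1 / 2 * r 1 * Real.exp α
        + ∑ k ∈ Finset.Icc 2 m, r k * Real.cosh (α * k)) := by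
      rw [h3, h4, hc]; ring
    rw [h5]
    exact mul_le_mul_of_nonneg_left ((norm_add_le _ _).trans (add_le_add h1 h2)) hs.le
  rw [heatOp_eq, hsplit, banachExp_add hcomm, mul_smul_comm, ← mul_assoc, norm_smul,
    Real.norm_of_nonneg (Real.exp_pos _).le]
  have hg := norm_gradient_banachExp_le (norm_shiftOp_le 1) hc0 hβ0
  calc _ ≤ Real.exp (-s) * (((√(c * β) / c + |β - 1|) * Real.exp (c * β))
        * Real.exp (s * hopMgf m r α - c * β)) := by
        refine mul_le_mul_of_nonneg_left ((norm_mul_le _ _).trans ?_) (Real.exp_pos _).le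
        exact mul_le_mul hg ((norm_banachExp_le _).trans (Real.exp_le_exp.mpr hRn)) (norm_nonneg _)
          (by positivity)
    _ = (√(c * β) / c + |β - 1|) * (Real.exp (-s) * (Real.exp (c * β)
          * Real.exp (s * hopMgf m r α - c * β))) := by ring
    _ = _ := by rw [← Real.exp_add, ← Real.exp_add]; ring_nf

/-- The unit mass at `0`. -/
def unitMass : BddFun :=
  BoundedContinuousFunction.ofNormedAddCommGroupDiscrete (fun z : ℤ => if z = 0 then (1 : ℝ) else 0) 1
    fun z => by split_ifs <;> simp

theorem unitMass_apply (z : ℤ) : unitMass z = if z = 0 then 1 else 0 := rfl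

/-- Duality between summable and bounded functions: by translation invariance, `T` applied to the
reflected sign pattern of its kernel takes at `0` the value of the sum. -/
theorem sum_abs_le_norm {T : BddFun →L[ℝ] BddFun} (hT : ∀ k, Commute (shiftOp k) T) (F : Finset ℤ) :
    ∑ z ∈ F, |T unitMass z| ≤ ‖T‖ := by
  set f : BddFun := ∑ z ∈ F, (SignType.sign (T unitMass z) : ℝ) • shiftOp z unitMass with hf
  have hcomm : ∀ z, T (shiftOp z unitMass) = shiftOp z (T unitMass) := fun z =>
    (congrArg (fun B : BddFun →L[ℝ] BddFun => B unitMass) (hT z).eq).symm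
  have h1 : T f 0 = ∑ z ∈ F, |T unitMass z| := by
    rw [hf, map_sum, BddFun.sum_apply]
    refine Finset.sum_congr rfl fun z _ => ?_
    rw [map_smul, hcomm, BddFun.smul_apply, shiftOp_apply, zero_add]
    exact sign_mul_self _
  have h2 : ‖f‖ ≤ 1 := by
    refine (BddFun.norm_le zero_le_one).mpr fun w => ?_
    rw [hf, BddFun.sum_apply]
    have hterm : ∀ z ∈ F, z ≠ -w → ((SignType.sign (T unitMass z) : ℝ) • shiftOp z unitMass) w = 0 := by
      intro z _ hz
      rw [BddFun.smul_apply, shiftOp_apply, unitMass_apply, if_neg (by omega), mul_zero]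
    by_cases hw : -w ∈ F
    · rw [Finset.sum_eq_single_of_mem _ hw hterm, BddFun.smul_apply, shiftOp_apply,
        unitMass_apply, if_pos (by ring), mul_one]
      rcases SignType.sign (T unitMass (-w)) with _ | _ | _ <;> simp
    · rw [Finset.sum_eq_zero fun z hz => hterm z hz fun h => hw (h ▸ hz)]; simp
  calc ∑ z ∈ F, |T unitMass z| = T f 0 := h1.symm
    _ ≤ |T f 0| := le_abs_self _
    _ ≤ ‖T f‖ := (T f).abs_le_norm 0
    _ ≤ ‖T‖ * ‖f‖ := T.le_opNorm f
    _ ≤ ‖T‖ := mul_le_of_le_one_right (norm_nonneg _) h2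

/-- The heat kernel. -/
def heat (m : ℕ) (r : ℕ → ℝ) (s : ℝ) (z : ℤ) : ℝ := heatOp m r 0 s unitMass z

theorem hasSum_heatOp (r : ℕ → ℝ) (α s : ℝ) (z : ℤ) :
    HasSum (fun n : ℕ => Real.exp (-s) * (s ^ n / n.factorial * (hopOp m r α ^ n) unitMass z))
      (heatOp m r α s unitMass z) := by
  have h := NormedSpace.exp_series_hasSum_exp' (𝕂 := ℝ) (s • hopOp m r α)
  have h2 := h.mapL ((BddFun.eval z).comp
    (ContinuousLinearMap.apply ℝ BddFun unitMass))
  rw [heatOp_eq]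
  refine (h2.mul_left (Real.exp (-s))).congr_fun fun n => ?_
  congr 1
  simp only [smul_pow, smul_smul]
  change _ = ((n.factorial : ℝ)⁻¹ * s ^ n) * (hopOp m r α ^ n) unitMass z
  ring

/-- The tilt is conjugation by multiplication with `exp (α z)`. That multiplication is unbounded, so
the conjugation is carried out on the powers applied to the unit mass, which it fixes. -/
theorem hopOp_pow_apply (r : ℕ → ℝ) (α : ℝ) (n : ℕ) (z : ℤ) :
    (hopOp m r α ^ n) unitMass z = Real.exp (α * z) * (hopOp m r 0 ^ n) unitMass z := by
  induction n generalizing z with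
  | zero =>
    simp only [pow_zero, one_apply_eq_self, unitMass_apply]
    split_ifs with h
    · simp [h]
    · simp
  | succ n ih =>
    rw [pow_succ', pow_succ', mul_apply_eq_comp, mul_apply_eq_comp, hopOp_apply,
      hopOp_apply, Finset.mul_sum]
    refine Finset.sum_congr rfl fun k _ => ?_
    rw [ih, ih]
    push_cast
    rw [mul_add α, mul_sub α, Real.exp_add, Real.exp_sub, neg_mul, Real.exp_neg]
    have := (Real.exp_pos (α * k)).ne'
    simp only [neg_zero, zero_mul, Real.exp_zero, one_mul]
    field_simp

theorem heatOp_unitMass (r : ℕ → ℝ) (α s : ℝ) (z : ℤ) :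
    heatOp m r α s unitMass z = Real.exp (α * z) * heat m r s z := by
  refine (hasSum_heatOp r α s z).unique (((hasSum_heatOp r 0 s z).mul_left _).congr_fun fun n => ?_)
  rw [hopOp_pow_apply]; ring

theorem heat_nonneg {r : ℕ → ℝ} (hr : ∀ k ∈ Finset.Icc 1 m, 0 < r k) {s : ℝ} (hs : 0 ≤ s) (z : ℤ) :
    0 ≤ heat m r s z := by
  have h : ∀ (n : ℕ) (z : ℤ), 0 ≤ (hopOp m r 0 ^ n) unitMass z := by
    intro n
    induction n with
    | zero =>
      intro z
      simp only [pow_zero, one_apply_eq_self, unitMass_apply]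
      split_ifs <;> norm_num
    | succ n ih =>
      intro z
      rw [pow_succ', mul_apply_eq_comp, hopOp_apply]
      refine Finset.sum_nonneg fun k hk => ?_
      have := hr k hk
      have := ih (z + k)
      have := ih (z - k)
      positivity
  exact (hasSum_heatOp r 0 s z).nonneg fun n => by have := h n z; positivity

theorem heat_zero (r : ℕ → ℝ) (z : ℤ) : heat m r 0 z = if z = 0 then 1 else 0 := by
  unfold heat; rw [heatOp_zero, one_apply_eq_self, unitMass_apply]

end HeatSemigroup

/-! ### Estimates of the heat kernel -/

section HeatKernel

variable {m : ℕ} {r : ℕ → ℝ}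

/-- By `cosh x ≤ exp (x² / 2)`; there is no term linear in `α`, so tilts of size `1 / √s` cost only
a constant up to time `s`. -/
theorem hopMgf_sub_one_le (hr : ∀ k ∈ Finset.Icc 1 m, 0 < r k) (hr1 : ∑ k ∈ Finset.Icc 1 m, r k = 1)
    {K α : ℝ} (hα : |α| ≤ K) :
    hopMgf m r α - 1 ≤ (m : ℝ) ^ 2 / 2 * Real.exp ((m : ℝ) ^ 2 * K ^ 2 / 2) * α ^ 2 := by
  have h1 : hopMgf m r α ≤ Real.exp ((m : ℝ) ^ 2 * α ^ 2 / 2) := by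
    unfold hopMgf
    calc _ ≤ ∑ k ∈ Finset.Icc 1 m, r k * Real.exp ((m : ℝ) ^ 2 * α ^ 2 / 2) := by
          refine Finset.sum_le_sum fun k hk => mul_le_mul_of_nonneg_left ?_ (hr k hk).le
          refine (Real.cosh_le_exp_half_sq _).trans (Real.exp_le_exp.mpr ?_)
          have : (k : ℝ) ≤ m := by exact_mod_cast (Finset.mem_Icc.mp hk).2
          have h2 : (k : ℝ) ^ 2 ≤ (m : ℝ) ^ 2 := by gcongr
          rw [mul_pow, mul_comm]
          gcongr
      _ = _ := by rw [← Finset.sum_mul, hr1, one_mul]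
  have h2 : α ^ 2 ≤ K ^ 2 := sq_le_sq' (by linarith [(abs_le.mp hα).1]) (abs_le.mp hα).2
  set x := (m : ℝ) ^ 2 * α ^ 2 / 2 with hx
  have h3 : Real.exp x ≤ 1 + x * Real.exp x := by
    have e1 := Real.add_one_le_exp (-x)
    have e2 : Real.exp (-x) * Real.exp x = 1 := by rw [← Real.exp_add]; simp
    nlinarith [Real.exp_pos x]
  have h4 : x * Real.exp x ≤ x * Real.exp ((m : ℝ) ^ 2 * K ^ 2 / 2) := by
    refine mul_le_mul_of_nonneg_left (Real.exp_le_exp.mpr ?_) (by positivity)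
    rw [hx]; gcongr
  calc _ ≤ x * Real.exp ((m : ℝ) ^ 2 * K ^ 2 / 2) := by linarith
    _ = _ := by rw [hx]; ring

/-- Bounds of the tilted semigroup and of its gradient, on the diffusive scale. -/
theorem exists_norm_heatOp_le (hr : ∀ k ∈ Finset.Icc 1 m, 0 < r k)
    (hr1 : ∑ k ∈ Finset.Icc 1 m, r k = 1) {K : ℝ} (hK : 0 ≤ K) :
    ∃ C : ℝ, 1 ≤ C ∧ ∀ s α : ℝ, 0 ≤ s → |α| ≤ K → s * α ^ 2 ≤ K → ‖heatOp m r α s‖ ≤ C ∧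
      (0 < s → ‖(Real.exp (-α) • shiftOp 1 - 1) * heatOp m r α s‖ ≤ C / √s) := by
  have hm := one_le_of_sum_eq_one hr1
  have hr0 : 0 < r 1 := hr 1 (Finset.mem_Icc.mpr ⟨le_rfl, hm⟩)
  set M := (m : ℝ) ^ 2 / 2 * Real.exp ((m : ℝ) ^ 2 * K ^ 2 / 2) with hM
  have hM0 : 0 ≤ M := by positivity
  set C₁ := Real.exp (M * K) with hC₁
  have hC₁1 : 1 ≤ C₁ := Real.one_le_exp (by positivity)
  set D := √(Real.exp K) / √(r 1 / 2) + √K * Real.exp K with hD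
  have hD0 : 0 ≤ D := by positivity
  refine ⟨C₁ + D * C₁, by nlinarith, fun s α hs hα hsα => ?_⟩
  have h1 : Real.exp (s * (hopMgf m r α - 1)) ≤ C₁ := by
    rw [hC₁, Real.exp_le_exp]
    calc s * (hopMgf m r α - 1) ≤ s * (M * α ^ 2) := by
          gcongr; exact hopMgf_sub_one_le hr hr1 hα
      _ = M * (s * α ^ 2) := by ring
      _ ≤ M * K := by gcongr
  refine ⟨(norm_heatOp_le hr α hs).trans (h1.trans (le_add_of_nonneg_right (by positivity))), fun hs0 => ?_⟩
  refine (norm_gradient_heatOp_le hr hm α hs0).trans ?_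
  have hss : 0 < √s := Real.sqrt_pos.mpr hs0
  have h2 : √(s * r 1 / 2 * Real.exp (-α)) / (s * r 1 / 2) ≤ √(Real.exp K) / √(r 1 / 2) / √s := by
    have e1 : √(s * r 1 / 2 * Real.exp (-α)) = √s * √(r 1 / 2) * √(Real.exp (-α)) := by
      rw [mul_div_assoc, Real.sqrt_mul (by positivity), Real.sqrt_mul hs]
    have e2 : s * r 1 / 2 = √s * √s * (√(r 1 / 2) * √(r 1 / 2)) := by
      rw [Real.mul_self_sqrt hs, Real.mul_self_sqrt (by positivity)]; ring
    have hr2 : 0 < √(r 1 / 2) := Real.sqrt_pos.mpr (by positivity)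
    have e3 : √(Real.exp (-α)) ≤ √(Real.exp K) := by
      refine Real.sqrt_le_sqrt (Real.exp_le_exp.mpr ?_)
      linarith [(abs_le.mp hα).1]
    rw [e1, e2]
    have e4 : √s * √(r 1 / 2) * √(Real.exp (-α)) / (√s * √s * (√(r 1 / 2) * √(r 1 / 2)))
        = √(Real.exp (-α)) / √(r 1 / 2) / √s := by field_simp
    rw [e4]; gcongr
  have h3 : |Real.exp (-α) - 1| ≤ √K * Real.exp K / √s := by
    have e1 := exp_taylor_one (-α)
    rw [abs_neg] at e1
    -- This is where the diffusive condition `s α² ≤ K` turns the tilt of the gradient into the same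
    -- decay `1 / √s`.
    have e2 : |α| ≤ √K / √s := by
      rw [← Real.sqrt_div' _ hs]
      refine Real.le_sqrt_of_sq_le ?_
      rw [sq_abs, le_div_iff₀ hs0]; linarith
    calc _ ≤ |α| * Real.exp |α| := e1
      _ ≤ √K / √s * Real.exp K := by gcongr
      _ = _ := by ring
  calc _ ≤ (√(Real.exp K) / √(r 1 / 2) / √s + √K * Real.exp K / √s) * C₁ := by gcongr
    _ = D * C₁ / √s := by rw [hD]; ring
    _ ≤ _ := by gcongr; linarith

theorem commute_shiftOp_gradient (l : ℤ) (α s : ℝ) :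
    Commute (shiftOp l) ((Real.exp (-α) • shiftOp 1 - 1) * heatOp m r α s) :=
  ((((commute_shiftOp l 1).smul_right _).sub_right (Commute.one_right _))).mul_right
    (commute_shiftOp_heatOp l r α s)

/-- The factor `exp (-α)` makes this operator the tilted form of the ordinary discrete gradient. -/
theorem gradient_apply (T : BddFun →L[ℝ] BddFun) (α : ℝ) (f : ℤ → ℝ)
    (hf : ∀ z, T unitMass z = Real.exp (α * z) * f z) (z : ℤ) :
    ((Real.exp (-α) • shiftOp 1 - 1) * T) unitMass z = Real.exp (α * z) * (f (z + 1) - f z) := by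
  change Real.exp (-α) * T unitMass (z + 1) - T unitMass z = _
  rw [hf, hf, ← mul_assoc, ← Real.exp_add]
  push_cast
  rw [show -α + α * ((z : ℝ) + 1) = α * z by ring]
  ring

theorem exp_mul_abs_le (b : ℝ) (z : ℤ) :
    Real.exp (b * |(z : ℝ)|) ≤ Real.exp (b * z) + Real.exp (-b * z) := by
  rcases le_total 0 (z : ℝ) with h | h
  · rw [abs_of_nonneg h]; exact le_add_of_nonneg_right (Real.exp_pos _).le
  · rw [abs_of_nonpos h, mul_neg, ← neg_mul]; exact le_add_of_nonneg_left (Real.exp_pos _).le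

theorem sum_mul_exp_abs_le {f : ℤ → ℝ} {C : ℝ} {b : ℝ} (F : Finset ℤ)
    (h1 : ∑ z ∈ F, |Real.exp (b * z) * f z| ≤ C) (h2 : ∑ z ∈ F, |Real.exp (-b * z) * f z| ≤ C) :
    ∑ z ∈ F, |f z| * Real.exp (b * |(z : ℝ)|) ≤ 2 * C := by
  calc _ ≤ ∑ z ∈ F, (|Real.exp (b * z) * f z| + |Real.exp (-b * z) * f z|) := by
        refine Finset.sum_le_sum fun z _ => ?_
        rw [abs_mul, abs_mul, Real.abs_exp, Real.abs_exp, ← add_mul, mul_comm]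
        exact mul_le_mul_of_nonneg_right (exp_mul_abs_le b z) (abs_nonneg _)
    _ ≤ 2 * C := by rw [Finset.sum_add_distrib]; linarith

/-- The heat kernel has total mass `1`. -/
theorem hasSum_heat (hr : ∀ k ∈ Finset.Icc 1 m, 0 < r k) (hr1 : ∑ k ∈ Finset.Icc 1 m, r k = 1)
    {s : ℝ} (hs : 0 ≤ s) : HasSum (heat m r s) 1 := by
  have hn0 : ∀ (n : ℕ) (z : ℤ), 0 ≤ (hopOp m r 0 ^ n) unitMass z := by
    intro n
    induction n with
    | zero =>
      intro z
      simp only [pow_zero, one_apply_eq_self, unitMass_apply]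
      split_ifs <;> norm_num
    | succ n ih =>
      intro z
      rw [pow_succ', mul_apply_eq_comp, hopOp_apply]
      refine Finset.sum_nonneg fun k hk => ?_
      have := hr k hk
      have := ih (z + k)
      have := ih (z - k)
      positivity
  have hmass : ∀ n : ℕ, HasSum (fun z => (hopOp m r 0 ^ n) unitMass z) 1 := by
    intro n
    induction n with
    | zero =>
      simp only [pow_zero, one_apply_eq_self, unitMass_apply]
      exact hasSum_ite_eq 0 1
    | succ n ih =>
      simp only [pow_succ', mul_apply_eq_comp, hopOp_apply]
      have h1 : ∀ k ∈ Finset.Icc 1 m, HasSum (fun z : ℤ => (1 / 2 * r k) * (Real.exp (-0 * k)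
          * (hopOp m r 0 ^ n) unitMass (z + k) + Real.exp (0 * k) * (hopOp m r 0 ^ n) unitMass (z - k)))
          (r k) := by
        intro k _
        have a1 : HasSum (fun z : ℤ => (hopOp m r 0 ^ n) unitMass (z + k)) 1 :=
          (Equiv.addRight (k : ℤ)).hasSum_iff.mpr ih
        have a2 : HasSum (fun z : ℤ => (hopOp m r 0 ^ n) unitMass (z - k)) 1 :=
          (Equiv.subRight (k : ℤ)).hasSum_iff.mpr ih
        have := (a1.add a2).mul_left (1 / 2 * r k)
        simp only [neg_zero, zero_mul, Real.exp_zero, one_mul]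
        rwa [show 1 / 2 * r k * (1 + 1) = r k by ring] at this
      have := hasSum_sum h1
      rwa [hr1] at this
  -- The heat kernel is a Poisson mixture of the laws of the walk after `n` hops, each of mass one;
  -- the nonnegative double series may be summed in either order.
  set f : ℕ × ℤ → ℝ := fun x =>
    Real.exp (-s) * (s ^ x.1 / x.1.factorial * (hopOp m r 0 ^ x.1) unitMass x.2) with hf
  have hrow : ∀ n, HasSum (fun z => f (n, z)) (Real.exp (-s) * (s ^ n / n.factorial)) := fun n => by
    have := ((hmass n).mul_left (s ^ n / n.factorial)).mul_left (Real.exp (-s))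
    rwa [mul_one] at this
  have htot : HasSum (fun n : ℕ => Real.exp (-s) * (s ^ n / n.factorial)) 1 := by
    have := (hasSum_real_exp s).mul_left (Real.exp (-s))
    rwa [← Real.exp_add, neg_add_cancel, Real.exp_zero] at this
  have hsm : Summable f := by
    rw [summable_prod_of_nonneg fun x => by have := hn0 x.1 x.2; positivity]
    refine ⟨fun n => (hrow n).summable, ?_⟩
    simp only [(hrow _).tsum_eq]
    exact htot.summable
  have hf1 : HasSum f 1 := by
    have := hsm.hasSum.prod_fiberwise hrow
    have e := htot.unique this
    rw [e]
    exact hsm.hasSum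
  have hswap := (Equiv.prodComm ℤ ℕ).hasSum_iff.mpr hf1
  exact hswap.prod_fiberwise fun z => hasSum_heatOp r 0 s z

/-- The weight `exp (b |z|)` is bounded by the sum of the tilts by `b` and `-b`, and each tilted sum
by an operator norm. -/
theorem exists_heat_bounds (hr : ∀ k ∈ Finset.Icc 1 m, 0 < r k)
    (hr1 : ∑ k ∈ Finset.Icc 1 m, r k = 1) {K : ℝ} (hK : 0 ≤ K) :
    ∃ C : ℝ, 1 ≤ C ∧ ∀ s b : ℝ, 0 ≤ s → 0 ≤ b → b ≤ K → s * b ^ 2 ≤ K →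
      (∀ F : Finset ℤ, ∑ z ∈ F, heat m r s z * Real.exp (b * |(z : ℝ)|) ≤ C) ∧
      (0 < s → ∀ F : Finset ℤ,
        ∑ z ∈ F, |heat m r s (z + 1) - heat m r s z| * Real.exp (b * |(z : ℝ)|) ≤ C / √s) ∧
      (0 < s → ∀ F : Finset ℤ, ∑ z ∈ F, |heat m r s (z + 2) - 2 * heat m r s (z + 1) + heat m r s z|
        * Real.exp (b * |(z : ℝ)|) ≤ C / s) ∧
      (0 < s → ∀ z, heat m r s z * Real.exp (b * |(z : ℝ)|) ≤ C / √s) := by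
  obtain ⟨C, hC1, hC⟩ := exists_norm_heatOp_le hr hr1 hK
  have hC0 : 0 ≤ C := by linarith
  refine ⟨4 * C ^ 2, by nlinarith, fun s b hs hb hbK hsb => ?_⟩
  have hb1 : |b| ≤ K := by rwa [abs_of_nonneg hb]
  have hb2 : |(-b)| ≤ K := by rwa [abs_neg, abs_of_nonneg hb]
  have hsb2 : s * (-b) ^ 2 ≤ K := by rwa [neg_sq]
  have hCC : 2 * C ≤ 4 * C ^ 2 := by nlinarith
  have hgrad : 0 < s → ∀ α, |α| ≤ K → s * α ^ 2 ≤ K → ∀ F : Finset ℤ,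
      ∑ z ∈ F, |Real.exp (α * z) * (heat m r s (z + 1) - heat m r s z)| ≤ C / √s := by
    intro hs0 α h1 h2 F
    have := (sum_abs_le_norm (fun k => commute_shiftOp_gradient (m := m) (r := r) k α s) F).trans
      ((hC s α hs h1 h2).2 hs0)
    simpa only [gradient_apply _ _ _ (heatOp_unitMass r α s)] using this
  refine ⟨fun F => ?_, fun hs0 F => ?_, fun hs0 F => ?_, fun hs0 z => ?_⟩
  · have h : ∀ α, |α| ≤ K → s * α ^ 2 ≤ K → ∑ z ∈ F, |Real.exp (α * z) * heat m r s z| ≤ C := by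
      intro α h1 h2
      have := (sum_abs_le_norm (fun k => commute_shiftOp_heatOp (m := m) k r α s) F).trans
        (hC s α hs h1 h2).1
      simpa only [heatOp_unitMass] using this
    have := sum_mul_exp_abs_le F (h b hb1 hsb) (h (-b) hb2 hsb2)
    simp only [abs_of_nonneg (heat_nonneg hr hs _)] at this
    exact this.trans hCC
  · refine (sum_mul_exp_abs_le F (hgrad hs0 b hb1 hsb F) (hgrad hs0 (-b) hb2 hsb2 F)).trans ?_
    rw [← mul_div_assoc]; gcongr
  · have h : ∀ α, |α| ≤ K → s * α ^ 2 ≤ K → ∑ z ∈ F, |Real.exp (α * z) * (heat m r s (z + 2)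
        - 2 * heat m r s (z + 1) + heat m r s z)| ≤ 2 * C ^ 2 / s := by
      intro α h1 h2
      set D := Real.exp (-α) • shiftOp 1 - (1 : BddFun →L[ℝ] BddFun) with hD
      have hcomm : Commute D (heatOp m r α (s / 2)) :=
        ((commute_shiftOp_heatOp 1 r α (s / 2)).smul_left _).sub_left (Commute.one_left _)
      -- Each half of the time interval pays for one gradient.
      have e1 : D * (D * heatOp m r α s) = (D * heatOp m r α (s / 2)) * (D * heatOp m r α (s / 2)) := by
        have : heatOp m r α s = heatOp m r α (s / 2) * heatOp m r α (s / 2) := by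
          rw [← heatOp_add, add_halves]
        rw [this, mul_assoc D (heatOp m r α (s / 2)), ← mul_assoc (heatOp m r α (s / 2)) D,
          ← hcomm.eq, mul_assoc]
      have e2 : ‖D * (D * heatOp m r α s)‖ ≤ 2 * C ^ 2 / s := by
        rw [e1]
        have hh := (hC (s / 2) α (by positivity) h1 (by nlinarith [sq_nonneg α])).2 (by positivity)
        calc _ ≤ ‖D * heatOp m r α (s / 2)‖ * ‖D * heatOp m r α (s / 2)‖ := norm_mul_le _ _
          _ ≤ C / √(s / 2) * (C / √(s / 2)) := mul_le_mul hh hh (norm_nonneg _) (by positivity)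
          _ = C ^ 2 / (√(s / 2) * √(s / 2)) := by rw [div_mul_div_comm]; ring
          _ = 2 * C ^ 2 / s := by rw [Real.mul_self_sqrt (by positivity)]; field_simp
      have hc2 : ∀ l, Commute (shiftOp l) (D * (D * heatOp m r α s)) := fun l =>
        (((commute_shiftOp l 1).smul_right _).sub_right (Commute.one_right _)).mul_right
          (commute_shiftOp_gradient l α s)
      have := (sum_abs_le_norm hc2 F).trans e2
      refine (le_of_eq (Finset.sum_congr rfl fun z _ => ?_)).trans this
      rw [gradient_apply _ α (fun z => heat m r s (z + 1) - heat m r s z)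
        (gradient_apply _ _ _ (heatOp_unitMass r α s)), show z + 1 + 1 = z + 2 by ring]
      congr 2
      ring
    refine (sum_mul_exp_abs_le F (h b hb1 hsb) (h (-b) hb2 hsb2)).trans (le_of_eq ?_)
    ring
  -- The pointwise bound sums the gradient from `z` out to infinity, where the kernel vanishes: to
  -- the right with the weight `exp (b z)` and to the left with `exp (-b z)`, so that the weights
  -- along the way only increase.
  · have hlim : Tendsto (heat m r s) cofinite (𝓝 0) := (hasSum_heat hr hr1 hs).summable.tendsto_cofinite_zero
    have hup : Real.exp (b * z) * heat m r s z ≤ C / √s := by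
      have key : ∀ N : ℕ, Real.exp (b * z) * heat m r s z
          ≤ C / √s + Real.exp (b * z) * heat m r s (z + N) := by
        intro N
        have e1 : heat m r s z = heat m r s (z + N) - ∑ i ∈ Finset.range N,
            (heat m r s (z + i + 1) - heat m r s (z + i)) := by
          have : ∑ i ∈ Finset.range N, (heat m r s (z + i + 1) - heat m r s (z + i))
              = heat m r s (z + N) - heat m r s z := by
            clear hgrad
            induction N with
            | zero => simp
            | succ N ih =>
              rw [Finset.sum_range_succ, ih, Nat.cast_succ, ← add_assoc]; ring
          rw [this]; ring
        have e2 : ∑ i ∈ Finset.range N, Real.exp (b * z) * |heat m r s (z + i + 1) - heat m r s (z + i)|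
            ≤ C / √s := by
          have h1 := hgrad hs0 b hb1 hsb ((Finset.range N).map ⟨fun i : ℕ => z + i, fun i j h => by simpa using h⟩)
          rw [Finset.sum_map] at h1
          refine le_trans (Finset.sum_le_sum fun i _ => ?_) h1
          change _ ≤ |Real.exp (b * ((z + i : ℤ) : ℝ)) * (heat m r s (z + i + 1) - heat m r s (z + i))|
          rw [abs_mul, Real.abs_exp]
          refine mul_le_mul_of_nonneg_right (Real.exp_le_exp.mpr ?_) (abs_nonneg _)
          push_cast
          nlinarith [(Nat.cast_nonneg i : (0 : ℝ) ≤ i)]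
        have e3 : -(∑ i ∈ Finset.range N, (heat m r s (z + i + 1) - heat m r s (z + i)))
            ≤ ∑ i ∈ Finset.range N, |heat m r s (z + i + 1) - heat m r s (z + i)| :=
          (neg_le_abs _).trans (Finset.abs_sum_le_sum_abs _ _)
        rw [← Finset.mul_sum] at e2
        have e4 := mul_le_mul_of_nonneg_left e3 (Real.exp_pos (b * z)).le
        rw [e1, mul_sub]
        rw [mul_neg] at e4
        linarith
      have hN : Tendsto (fun N : ℕ => heat m r s (z + N)) atTop (𝓝 0) := by
        have : Tendsto (fun N : ℕ => z + (N : ℤ)) atTop cofinite := by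
          rw [← Nat.cofinite_eq_atTop]
          exact Function.Injective.tendsto_cofinite fun i j h => by simpa using h
        exact hlim.comp this
      have := (hN.const_mul (Real.exp (b * z))).const_add (C / √s)
      rw [mul_zero, add_zero] at this
      exact ge_of_tendsto' this key
    have hdn : Real.exp (-b * z) * heat m r s z ≤ C / √s := by
      have key : ∀ N : ℕ, Real.exp (-b * z) * heat m r s z
          ≤ C / √s + Real.exp (-b * z) * heat m r s (z - N) := by
        intro N
        have e1 : heat m r s z = heat m r s (z - N) - ∑ i ∈ Finset.range N,
            (heat m r s (z - i - 1) - heat m r s (z - i - 1 + 1)) := by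
          have : ∑ i ∈ Finset.range N, (heat m r s (z - i - 1) - heat m r s (z - i - 1 + 1))
              = heat m r s (z - N) - heat m r s z := by
            clear hgrad
            induction N with
            | zero => simp
            | succ N ih =>
              rw [Finset.sum_range_succ, ih, Nat.cast_succ, sub_add_cancel, ← sub_sub]; ring
          rw [this]; ring
        have e2 : ∑ i ∈ Finset.range N,
            Real.exp (-b * z) * |heat m r s (z - i - 1) - heat m r s (z - i - 1 + 1)| ≤ C / √s := by
          have h1 := hgrad hs0 (-b) hb2 hsb2 ((Finset.range N).map ⟨fun i : ℕ => z - i - 1, fun i j h => by simpa using h⟩)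
          rw [Finset.sum_map] at h1
          refine le_trans (Finset.sum_le_sum fun i _ => ?_) h1
          change _ ≤ |Real.exp (-b * ((z - i - 1 : ℤ) : ℝ)) * (heat m r s (z - i - 1 + 1) - heat m r s (z - i - 1))|
          rw [abs_mul, Real.abs_exp, abs_sub_comm]
          refine mul_le_mul_of_nonneg_right (Real.exp_le_exp.mpr ?_) (abs_nonneg _)
          push_cast
          nlinarith [(Nat.cast_nonneg i : (0 : ℝ) ≤ i)]
        have e3 : -(∑ i ∈ Finset.range N, (heat m r s (z - i - 1) - heat m r s (z - i - 1 + 1)))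
            ≤ ∑ i ∈ Finset.range N, |heat m r s (z - i - 1) - heat m r s (z - i - 1 + 1)| :=
          (neg_le_abs _).trans (Finset.abs_sum_le_sum_abs _ _)
        rw [← Finset.mul_sum] at e2
        have e4 := mul_le_mul_of_nonneg_left e3 (Real.exp_pos (-b * z)).le
        rw [e1, mul_sub]
        rw [mul_neg] at e4
        linarith
      have hN : Tendsto (fun N : ℕ => heat m r s (z - N)) atTop (𝓝 0) := by
        have : Tendsto (fun N : ℕ => z - (N : ℤ)) atTop cofinite := by
          rw [← Nat.cofinite_eq_atTop]
          exact Function.Injective.tendsto_cofinite fun i j h => by simpa using h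
        exact hlim.comp this
      have := (hN.const_mul (Real.exp (-b * z))).const_add (C / √s)
      rw [mul_zero, add_zero] at this
      exact ge_of_tendsto' this key
    calc heat m r s z * Real.exp (b * |(z : ℝ)|)
        ≤ heat m r s z * (Real.exp (b * z) + Real.exp (-b * z)) :=
          mul_le_mul_of_nonneg_left (exp_mul_abs_le b z) (heat_nonneg hr hs z)
      _ ≤ C / √s + C / √s := by linarith
      _ = 2 * C / √s := by ring
      _ ≤ _ := by gcongr

theorem lop_heat (hr1 : ∑ k ∈ Finset.Icc 1 m, r k = 1) (s : ℝ) (z : ℤ) :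
    lop m r (heat m r s) z = ((hopOp m r 0 - 1) * heatOp m r 0 s) unitMass z := by
  change _ = hopOp m r 0 (heatOp m r 0 s unitMass) z - heatOp m r 0 s unitMass z
  rw [hopOp_apply]
  change _ = _ - heat m r s z
  have : heat m r s z = ∑ k ∈ Finset.Icc 1 m, r k * heat m r s z := by
    rw [← Finset.sum_mul, hr1, one_mul]
  unfold lop
  conv_rhs => rw [this]
  rw [Finset.mul_sum, ← Finset.sum_sub_distrib]
  refine Finset.sum_congr rfl fun k _ => ?_
  simp only [neg_zero, zero_mul, Real.exp_zero, one_mul]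
  change _ = 1 / 2 * r k * (heat m r s (z + k) + heat m r s (z - k)) - r k * heat m r s z
  ring

theorem norm_unitMass_le : ‖unitMass‖ ≤ 1 :=
  (BddFun.norm_le zero_le_one).mpr fun z => by rw [unitMass_apply]; split_ifs <;> simp

theorem hopMgf_zero (hr1 : ∑ k ∈ Finset.Icc 1 m, r k = 1) : hopMgf m r 0 = 1 := by
  unfold hopMgf; simpa using hr1

theorem norm_heatOp_zero_le (hr : ∀ k ∈ Finset.Icc 1 m, 0 < r k) (hr1 : ∑ k ∈ Finset.Icc 1 m, r k = 1)
    {s : ℝ} (hs : 0 ≤ s) : ‖heatOp m r 0 s‖ ≤ 1 := by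
  have := norm_heatOp_le hr 0 hs
  rwa [hopMgf_zero hr1, sub_self, mul_zero, Real.exp_zero] at this

theorem abs_apply_unitMass_le (T : BddFun →L[ℝ] BddFun) (z : ℤ) : |T unitMass z| ≤ ‖T‖ :=
  (BddFun.abs_le_norm _ z).trans ((T.le_opNorm _).trans
    (mul_le_of_le_one_right (norm_nonneg _) norm_unitMass_le))

theorem heat_le_one (hr : ∀ k ∈ Finset.Icc 1 m, 0 < r k) (hr1 : ∑ k ∈ Finset.Icc 1 m, r k = 1)
    {s : ℝ} (hs : 0 ≤ s) (z : ℤ) : heat m r s z ≤ 1 :=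
  (le_abs_self _).trans ((abs_apply_unitMass_le _ z).trans (norm_heatOp_zero_le hr hr1 hs))

theorem norm_hopOp_sub_one_le (hr : ∀ k ∈ Finset.Icc 1 m, 0 < r k)
    (hr1 : ∑ k ∈ Finset.Icc 1 m, r k = 1) : ‖hopOp m r 0 - 1‖ ≤ 2 := by
  have h1 := norm_hopOp_le hr 0
  rw [hopMgf_zero hr1] at h1
  have h2 : ‖(1 : BddFun →L[ℝ] BddFun)‖ = 1 := norm_one
  calc _ ≤ ‖hopOp m r 0‖ + ‖(1 : BddFun →L[ℝ] BddFun)‖ := norm_sub_le _ _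
    _ ≤ 2 := by rw [h2]; linarith

theorem abs_lop_heat_le (hr : ∀ k ∈ Finset.Icc 1 m, 0 < r k) (hr1 : ∑ k ∈ Finset.Icc 1 m, r k = 1)
    {s : ℝ} (hs : 0 ≤ s) (z : ℤ) : |lop m r (heat m r s) z| ≤ 2 := by
  rw [lop_heat hr1]
  refine (abs_apply_unitMass_le _ z).trans ((norm_mul_le _ _).trans ?_)
  nlinarith [norm_hopOp_sub_one_le hr hr1, norm_heatOp_zero_le hr hr1 hs, norm_nonneg (hopOp m r 0 - 1),
    norm_nonneg (heatOp m r 0 s)]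

theorem norm_heatOp_sub_one_sub_le (hr : ∀ k ∈ Finset.Icc 1 m, 0 < r k)
    (hr1 : ∑ k ∈ Finset.Icc 1 m, r k = 1) {h : ℝ} (hh : 0 ≤ h) :
    ‖heatOp m r 0 h - 1 - h • (hopOp m r 0 - 1)‖ ≤ 4 * Real.exp (2 * h) * h ^ 2 := by
  unfold heatOp
  refine (norm_banachExp_sub_one_sub_le _).trans ?_
  have h1 : ‖h • (hopOp m r 0 - 1)‖ ≤ 2 * h := by
    rw [norm_smul, Real.norm_of_nonneg hh, mul_comm]
    exact mul_le_mul_of_nonneg_right (norm_hopOp_sub_one_le hr hr1) hh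
  calc _ ≤ (2 * h) ^ 2 * Real.exp (2 * h) := by gcongr
    _ = _ := by ring

/-- The heat kernel solves the heat equation backward in time, with a second order error. -/
theorem abs_heat_backward_le (hr : ∀ k ∈ Finset.Icc 1 m, 0 < r k) (hr1 : ∑ k ∈ Finset.Icc 1 m, r k = 1)
    {s h : ℝ} (hs : 0 ≤ s) (hh : 0 ≤ h) (z : ℤ) :
    |heat m r s z - heat m r (s + h) z + h * lop m r (heat m r (s + h)) z|
      ≤ (4 + 12 * Real.exp (2 * h) + 8 * h * Real.exp (2 * h)) * h ^ 2 := by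
  -- With `H` the semigroup at time `h` and `H = 1 + h L + R`, one has `1 - H + h L H = h L R + h²
  -- L² - R`, and all three terms are of second order.
  have e : heat m r s z - heat m r (s + h) z + h * lop m r (heat m r (s + h)) z
      = ((h • ((hopOp m r 0 - 1) * (heatOp m r 0 h - 1 - h • (hopOp m r 0 - 1)))
          + (h ^ 2) • ((hopOp m r 0 - 1) * (hopOp m r 0 - 1))
          - (heatOp m r 0 h - 1 - h • (hopOp m r 0 - 1))) * heatOp m r 0 s) unitMass z := by
    rw [lop_heat hr1]
    unfold heat
    rw [show s + h = h + s from add_comm s h, heatOp_add, ← mul_assoc]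
    set H := heatOp m r 0 h
    set S := heatOp m r 0 s
    set L := hopOp m r 0 - 1
    have : (h • (L * (H - 1 - h • L)) + (h ^ 2) • (L * L) - (H - 1 - h • L)) * S
        = S - H * S + h • (L * H * S) := by
      rw [mul_sub, mul_sub, mul_one, mul_smul_comm, smul_sub, smul_sub, smul_smul, ← sq]
      have : h • (L * H) - h • L - h ^ 2 • (L * L) + h ^ 2 • (L * L) - (H - 1 - h • L)
          = 1 - H + h • (L * H) := by abel
      rw [this, add_mul, sub_mul, one_mul, smul_mul_assoc]
    rw [this]
    rfl
  rw [e]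
  have hL := norm_hopOp_sub_one_le hr hr1
  have hR := norm_heatOp_sub_one_sub_le hr hr1 hh
  set L := hopOp m r 0 - 1
  set R := heatOp m r 0 h - 1 - h • L
  have h1 : ‖h • (L * R) + (h ^ 2) • (L * L) - R‖
      ≤ h * (2 * (4 * Real.exp (2 * h) * h ^ 2)) + h ^ 2 * (2 * 2) + 4 * Real.exp (2 * h) * h ^ 2 := by
    refine (norm_sub_le _ _).trans (add_le_add ((norm_add_le _ _).trans (add_le_add ?_ ?_)) hR)
    · rw [norm_smul, Real.norm_of_nonneg hh]
      exact mul_le_mul_of_nonneg_left ((norm_mul_le _ _).trans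
        (mul_le_mul hL hR (norm_nonneg _) (by norm_num))) hh
    · rw [norm_smul, Real.norm_of_nonneg (sq_nonneg h)]
      exact mul_le_mul_of_nonneg_left ((norm_mul_le _ _).trans
        (mul_le_mul hL hL (norm_nonneg _) (by norm_num))) (sq_nonneg h)
  refine (abs_apply_unitMass_le _ z).trans ((norm_mul_le _ _).trans ?_)
  refine (mul_le_of_le_one_right (norm_nonneg _) (norm_heatOp_zero_le hr hr1 hs)).trans (h1.trans ?_)
  have : 0 ≤ Real.exp (2 * h) * h ^ 2 := by positivity
  linarith

end HeatKernel

/-! ### A priori moment bounds, uniform in space. -/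

section UniformGrowth

variable {Ω : Type*} {mΩ : MeasurableSpace Ω} {P : Measure Ω} {ℱ : Filtration ℝ≥0 mΩ} {m : ℕ}
  {rate : ℤ → ℝ≥0} {Q : jumps m × ℤ → ℝ≥0 → Ω → ℕ} {η : ℝ≥0 → Ω → ℤ → Bool} {ω : Ω}

/-- The clocks whose hops may cross `x`. -/
def clocksNear (m : ℕ) (x : ℤ) : Finset (jumps m × ℤ) := Finset.univ ×ˢ Finset.Icc (x - m) (x + m)

theorem crossing_eq_zero {x : ℤ} {c : jumps m × ℤ} (hc : c ∉ clocksNear m x) : crossing x c = 0 := by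
  have hk := (Finset.mem_erase.mp c.1.2).2
  rw [Finset.mem_Icc] at hk
  simp only [clocksNear, Finset.mem_product, Finset.mem_univ, true_and, Finset.mem_Icc] at hc
  unfold crossing
  rw [if_neg, if_neg] <;> omega

/-- Only the clocks close to `x` are used. Their total rate does not depend on `x`, whereas that of
a window around the origin would grow with it. -/
theorem expHeight_le_mul_near (hp : IsExclusionPath (fun c s => Q c s ω) (fun s => η s ω))
    {θ : ℝ} (hθ : 0 ≤ θ) {a b : ℝ≥0} (hab : a ≤ b) (x : ℤ) :
    expHeight θ Q η b x ω ≤ expHeight θ Q η a x ω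
      * Real.exp (2 * θ * total (clockInc Q (clocksNear m x) a b ω)) := by
  obtain ⟨n, hn⟩ : ∃ n : ℕ, |x| + m ≤ n := ⟨(|x| + m).toNat, Int.self_le_toNat _⟩
  have hsub : clocksNear m x ⊆ clocksIn m n := by
    intro c hc
    simp only [clocksNear, Finset.mem_product, Finset.mem_univ, true_and, Finset.mem_Icc] at hc
    rw [mem_clocksIn, abs_le]
    have h1 := le_abs_self x
    have h2 := neg_abs_le x
    constructor <;> linarith
  rw [expHeight_eq_mul hp θ hab hn, ← Finset.sum_subset hsub fun c _ hc => by
    rw [crossing_eq_zero hc]; simp]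
  refine mul_le_mul_of_nonneg_left (Real.exp_le_exp.mpr ?_) (expHeight_pos _ _ _ _).le
  refine mul_le_mul_of_nonneg_left ?_ (by positivity)
  unfold total clockInc
  rw [Nat.cast_sum, Finset.sum_coe_sort (clocksNear m x) (fun c => ((Q c b ω - Q c a ω : ℕ) : ℝ))]
  refine Finset.sum_le_sum fun c _ => ?_
  have h1 : (crossing x c : ℝ) ≤ 1 := by
    exact_mod_cast (abs_le.mp (crossing_abs_le x c)).2
  have h2 := hopInc_le (hp.counting c).mono (fun s => η s ω) c.1 c.2 a b
  calc (crossing x c : ℝ) * (hopInc (fun s => Q c s ω) (fun s => η s ω) c.1 c.2 a b : ℝ)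
      ≤ 1 * (hopInc (fun s => Q c s ω) (fun s => η s ω) c.1 c.2 a b : ℝ) := by gcongr
    _ ≤ _ := by rw [one_mul]; exact_mod_cast h2

theorem sum_rate_clocksNear_le (hrate : ∀ k : jumps m, rate k ≤ 1) (x : ℤ) :
    ∑ c ∈ clocksNear m x, (rate c.1 : ℝ) ≤ (Fintype.card (jumps m) : ℝ) * (2 * m + 1) := by
  refine (Finset.sum_le_card_nsmul _ _ 1 fun c _ => by exact_mod_cast hrate c.1).trans ?_
  rw [nsmul_one, clocksNear, Finset.card_product, Int.card_Icc, Finset.card_univ, Nat.cast_mul]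
  have : (x + m + 1 - (x - m)).toNat = 2 * m + 1 := by omega
  rw [this]
  push_cast
  exact le_rfl

variable [IsProbabilityMeasure P]

/-- The moments of the exponential of the height grow at most exponentially, uniformly in space. -/
theorem IsExclusionProcess.grown_moment_le (h : IsExclusionProcess P ℱ m rate Q η)
    (hrate : ∀ k : jumps m, rate k ≤ 1) {θ : ℝ} (hθ : 0 ≤ θ) (ν : ℝ)
    {a b : ℝ≥0} (hab : a ≤ b) (x : ℤ) (p : ℕ)
    (hi : Integrable (fun ω => grown θ ν Q η a x ω ^ p) P) :
    Integrable (fun ω => grown θ ν Q η b x ω ^ p) P ∧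
      ∫ ω, grown θ ν Q η b x ω ^ p ∂P ≤ (∫ ω, grown θ ν Q η a x ω ^ p ∂P)
        * Real.exp (((Fintype.card (jumps m) : ℝ) * (2 * m + 1) * (Real.exp (2 * θ * p) - 1) + p * |ν|)
          * (b - a)) := by
  set S := clocksNear m x with hS
  have hF := (h.aestronglyMeasurable_grown θ ν a x).pow p
  have hE := h.clocks.exp_total S hab (2 * θ * p)
  have hi2 := (h.clocks.integrable_mul_past S hab hF hi
    (φ := fun x => Real.exp (2 * θ * p * total x)) hE.1).mul_const (Real.exp (p * |ν| * (b - a)))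
  have hint := h.clocks.integral_mul_past S hab hF
    (φ := fun x => Real.exp (2 * θ * p * total x))
  have hba : (0 : ℝ) ≤ b - a := sub_nonneg.mpr hab
  have hle : ∀ᵐ ω ∂P, grown θ ν Q η b x ω ^ p ≤ grown θ ν Q η a x ω ^ p *
      Real.exp (2 * θ * p * total (clockInc Q S a b ω)) * Real.exp (p * |ν| * (b - a)) := by
    filter_upwards [h.ae_path] with ω hω
    have h1 := expHeight_le_mul_near hω hθ hab x
    have h2 : Real.exp (ν * b) ≤ Real.exp (ν * a) * Real.exp (|ν| * (b - a)) := by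
      rw [← Real.exp_add, Real.exp_le_exp]
      nlinarith [le_abs_self ν]
    calc grown θ ν Q η b x ω ^ p ≤ ((Real.exp (ν * a) * Real.exp (|ν| * (b - a)))
        * (expHeight θ Q η a x ω * Real.exp (2 * θ * total (clockInc Q S a b ω)))) ^ p := by
          unfold grown
          have := (expHeight_pos (Q := Q) (η := η) θ b x ω).le
          gcongr
      _ = (grown θ ν Q η a x ω) ^ p * Real.exp (2 * θ * total (clockInc Q S a b ω)) ^ p
          * Real.exp (|ν| * (b - a)) ^ p := by unfold grown; ring
      _ = _ := by rw [← Real.exp_nat_mul, ← Real.exp_nat_mul]; ring_nf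
  have hib : Integrable (fun ω => grown θ ν Q η b x ω ^ p) P := by
    refine hi2.mono' (((h.aestronglyMeasurable_grown θ ν b x).mono (ℱ.le b)).pow p) ?_
    filter_upwards [hle] with ω hω
    rw [Real.norm_of_nonneg (pow_nonneg (grown_pos _ _ _ _ _).le _)]
    exact hω
  refine ⟨hib, (integral_mono_ae hib hi2 hle).trans ?_⟩
  rw [integral_mul_const]
  refine (mul_le_mul_of_nonneg_right hint.le (Real.exp_pos _).le).trans ?_
  rw [hE.2, mul_assoc, ← Real.exp_add]
  refine mul_le_mul_of_nonneg_left (Real.exp_le_exp.mpr ?_)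
    (integral_nonneg fun ω => pow_nonneg (grown_pos _ _ _ _ _).le _)
  have h1 := sum_rate_clocksNear_le hrate x
  have h2 : 0 ≤ Real.exp (2 * θ * p) - 1 := by
    linarith [Real.add_one_le_exp (2 * θ * p), (by positivity : 0 ≤ 2 * θ * p)]
  calc _ ≤ (Fintype.card (jumps m) : ℝ) * (2 * m + 1) * (b - a) * (Real.exp (2 * θ * p) - 1)
      + p * |ν| * (b - a) := by gcongr
    _ = _ := by ring

end UniformGrowth

/-! ### Cutoff functions and integrals of power singularities. -/

section Cutoff

/-- A cutoff function that equals `1` on `[-n, n]` and vanishes outside `[-2n, 2n]`. -/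
def cutoff (n : ℕ) (y : ℤ) : ℝ := min 1 (max 0 (2 - |(y : ℝ)| / n))

theorem cutoff_nonneg (n : ℕ) (y : ℤ) : 0 ≤ cutoff n y := le_min zero_le_one (le_max_left _ _)

theorem cutoff_le_one (n : ℕ) (y : ℤ) : cutoff n y ≤ 1 := min_le_left _ _

theorem abs_cutoff_le_one (n : ℕ) (y : ℤ) : |cutoff n y| ≤ 1 := by
  rw [abs_of_nonneg (cutoff_nonneg n y)]; exact cutoff_le_one n y

theorem cutoff_eq_one {n : ℕ} {y : ℤ} (h : |y| ≤ n) : cutoff n y = 1 := by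
  unfold cutoff
  have : |(y : ℝ)| ≤ n := by exact_mod_cast h
  have h2 : |(y : ℝ)| / n ≤ 1 := div_le_one_of_le₀ this (Nat.cast_nonneg n)
  rw [max_eq_right (by linarith), min_eq_left (by linarith)]

theorem cutoff_eq_zero {n : ℕ} (hn : 0 < n) {y : ℤ} (h : 2 * (n : ℤ) ≤ |y|) : cutoff n y = 0 := by
  unfold cutoff
  have : 2 * (n : ℝ) ≤ |(y : ℝ)| := by exact_mod_cast h
  have h2 : 2 ≤ |(y : ℝ)| / n := by rw [le_div_iff₀ (by exact_mod_cast hn)]; exact this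
  rw [max_eq_left (by linarith), min_eq_right zero_le_one]

theorem abs_cutoff_sub_le (n : ℕ) (y z : ℤ) : |cutoff n y - cutoff n z| ≤ |(y : ℝ) - z| / n := by
  unfold cutoff
  refine (abs_min_sub_min_le_max _ _ _ _).trans (max_le (by simp; positivity) ?_)
  refine (abs_max_sub_max_le_max _ _ _ _).trans (max_le (by simp; positivity) ?_)
  rw [show (2 - |(y : ℝ)| / n) - (2 - |(z : ℝ)| / n) = (|(z : ℝ)| - |(y : ℝ)|) / n by ring, abs_div,
    Nat.abs_cast, abs_sub_comm]
  exact div_le_div_of_nonneg_right (abs_abs_sub_abs_le (y : ℝ) z) (Nat.cast_nonneg n)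

/-- The right side is the integral of `(T - s)^(-e)` over `[a, b]`, whose integrand is smallest at
`a`. Bernoulli's inequality gives this without integration and also covers the singular end `b = T`.
-/
theorem mul_rpow_neg_le {e a b T : ℝ} (he0 : 0 ≤ e) (he : e < 1) (hb : b ≤ T) (haT : a < T) :
    (b - a) * (T - a) ^ (-e) ≤ -(T - b) ^ (1 - e) / (1 - e) - -(T - a) ^ (1 - e) / (1 - e) := by
  have h0 : 0 < T - a := sub_pos.mpr haT
  have h1 := rpow_one_add_le_one_add_mul_self (s := -((b - a) / (T - a))) (p := 1 - e)
    (by rw [neg_le_neg_iff]; exact div_le_one_of_le₀ (by linarith) h0.le) (by linarith) (by linarith)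
  have e1 : 1 + -((b - a) / (T - a)) = (T - b) / (T - a) := by field_simp; ring
  rw [e1, Real.div_rpow (by linarith) h0.le, div_le_iff₀ (by positivity)] at h1
  have e2 : (T - a) ^ (1 - e) = (T - a) * (T - a) ^ (-e) := by
    rw [sub_eq_add_neg 1 e, Real.rpow_add h0, Real.rpow_one]
  have h2 : (1 + (1 - e) * -((b - a) / (T - a))) * (T - a) ^ (1 - e)
      = (T - a) ^ (1 - e) - (1 - e) * ((b - a) * (T - a) ^ (-e)) := by
    rw [e2]; field_simp; ring
  rw [h2] at h1
  rw [← sub_div, le_div_iff₀ (by linarith)]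
  linarith

end Cutoff

/-! ### Weighted sums for kernels that are cut off. -/

section KernelSums

variable {m : ℕ} {r : ℕ → ℝ}

theorem exp_mul_abs_le_of_add {b : ℝ} (hb : 0 ≤ b) (y k : ℤ) :
    Real.exp (b * |(y : ℝ)|) ≤ Real.exp (b * |(k : ℝ)|) * Real.exp (b * |((y + k : ℤ) : ℝ)|) := by
  rw [← Real.exp_add, ← mul_add, Real.exp_le_exp]
  refine mul_le_mul_of_nonneg_left ?_ hb
  push_cast
  calc |(y : ℝ)| = |(-k + (y + k) : ℝ)| := by ring_nf
    _ ≤ _ := (abs_add_le _ _).trans (by rw [abs_neg])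

theorem sum_shift_mul_exp_le {b : ℝ} (hb : 0 ≤ b) {f : ℤ → ℝ} {α : ℝ} (hf : ∀ y, 0 ≤ f y)
    (hα : ∀ F : Finset ℤ, ∑ y ∈ F, f y * Real.exp (b * |(y : ℝ)|) ≤ α) (k : ℤ) (F : Finset ℤ) :
    ∑ y ∈ F, f (y + k) * Real.exp (b * |(y : ℝ)|) ≤ Real.exp (b * |(k : ℝ)|) * α := by
  have h1 := hα (F.map (Equiv.addRight k).toEmbedding)
  rw [Finset.sum_map] at h1
  refine le_trans ?_ (mul_le_mul_of_nonneg_left h1 (Real.exp_pos _).le)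
  rw [Finset.mul_sum]
  refine Finset.sum_le_sum fun y _ => ?_
  change f (y + k) * _ ≤ Real.exp (b * |(k : ℝ)|) * (f (y + k) * Real.exp (b * |((y + k : ℤ) : ℝ)|))
  calc _ ≤ f (y + k) * (Real.exp (b * |(k : ℝ)|) * Real.exp (b * |((y + k : ℤ) : ℝ)|)) :=
        mul_le_mul_of_nonneg_left (exp_mul_abs_le_of_add hb y k) (hf _)
    _ = _ := by ring

/-- The commutator of the generator with the cutoff: hops have length at most `m` and the cutoff is
Lipschitz with constant `1 / n`. -/
theorem abs_lop_cutoff_sub_le (hr : ∀ k ∈ Finset.Icc 1 m, 0 < r k) (n : ℕ) (G : ℤ → ℝ) (y : ℤ) :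
    |lop m r (fun y => cutoff n y * G y) y - cutoff n y * lop m r G y|
      ≤ m / n * (1 / 2 * ∑ k ∈ Finset.Icc 1 m, r k * (|G (y + k)| + |G (y - k)|)) := by
  have e : lop m r (fun y => cutoff n y * G y) y - cutoff n y * lop m r G y
      = 1 / 2 * ∑ k ∈ Finset.Icc 1 m, r k * ((cutoff n (y + k) - cutoff n y) * G (y + k)
        + (cutoff n (y - k) - cutoff n y) * G (y - k)) := by
    unfold lop
    rw [mul_left_comm (cutoff n y) (1 / 2), ← mul_sub, Finset.mul_sum, ← Finset.sum_sub_distrib]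
    congr 1
    refine Finset.sum_congr rfl fun k _ => ?_
    ring
  rw [e, abs_mul, abs_of_pos (by norm_num : (0 : ℝ) < 1 / 2), mul_left_comm, Finset.mul_sum]
  refine mul_le_mul_of_nonneg_left ((Finset.abs_sum_le_sum_abs _ _).trans
    (Finset.sum_le_sum fun k hk => ?_)) (by norm_num)
  have hk' : (k : ℝ) ≤ m := by exact_mod_cast (Finset.mem_Icc.mp hk).2
  have h1 : |cutoff n (y + k) - cutoff n y| ≤ m / n := by
    refine (abs_cutoff_sub_le n _ _).trans (div_le_div_of_nonneg_right ?_ (Nat.cast_nonneg n))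
    push_cast
    simpa using hk'
  have h2 : |cutoff n (y - k) - cutoff n y| ≤ m / n := by
    refine (abs_cutoff_sub_le n _ _).trans (div_le_div_of_nonneg_right ?_ (Nat.cast_nonneg n))
    push_cast
    simpa using hk'
  rw [abs_mul, abs_of_pos (hr k hk), mul_left_comm]
  refine mul_le_mul_of_nonneg_left ?_ (hr k hk).le
  rw [mul_add]
  refine abs_add_le_add ?_ ?_ <;> rw [abs_mul] <;> gcongr

/-- The two bounds `α` and `α'` of the same sums play different roles: `α` may carry a power of the
time, while `α'`, uniform in time in the application, enters only with the factor `1 / n` of the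
cutoff. -/
theorem sum_driftWeight_cutoff_le (hr : ∀ k ∈ Finset.Icc 1 m, 0 < r k)
    (hr1 : ∑ k ∈ Finset.Icc 1 m, r k = 1) {C ε b A α α' β : ℝ} (hC : 0 ≤ C) (hε : 0 ≤ ε) (hb : 0 ≤ b)
    (hA : 0 ≤ A) {G : ℤ → ℝ} (hα : ∀ F : Finset ℤ, ∑ y ∈ F, |G y| * Real.exp (b * |(y : ℝ)|) ≤ α)
    (hα' : ∀ F : Finset ℤ, ∑ y ∈ F, |G y| * Real.exp (b * |(y : ℝ)|) ≤ α')
    (hβ : ∀ F : Finset ℤ, ∑ y ∈ F, |G y - G (y - 1)| * Real.exp (b * |(y : ℝ)|) ≤ β)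
    (n : ℕ) (F : Finset ℤ) :
    ∑ y ∈ F, driftWeight m r C ε (fun y => cutoff n y * G y) (fun y => -(cutoff n y * lop m r G y)) y
        * (A * Real.exp (b * |(y : ℝ)|))
      ≤ A * (C * (ε * β + ε ^ 2 * α) + (m * Real.exp (b * m) + C * ε * Real.exp b) * α' / n) := by
  have hα'0 : 0 ≤ α' := by simpa using hα' ∅
  have h1 : ∑ y ∈ F, m / n * (1 / 2 * ∑ k ∈ Finset.Icc 1 m, r k * (|G (y + k)| + |G (y - k)|))
      * Real.exp (b * |(y : ℝ)|) ≤ m * Real.exp (b * m) * α' / n := by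
    have e : ∑ y ∈ F, m / n * (1 / 2 * ∑ k ∈ Finset.Icc 1 m, r k * (|G (y + k)| + |G (y - k)|))
        * Real.exp (b * |(y : ℝ)|) = m / n * (1 / 2 * ∑ k ∈ Finset.Icc 1 m, r k *
          (∑ y ∈ F, |G (y + k)| * Real.exp (b * |(y : ℝ)|)
            + ∑ y ∈ F, |G (y + -k)| * Real.exp (b * |(y : ℝ)|))) := by
      simp only [← Finset.sum_add_distrib, Finset.mul_sum, Finset.sum_mul]
      rw [Finset.sum_comm]
      refine Finset.sum_congr rfl fun k _ => Finset.sum_congr rfl fun y _ => ?_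
      rw [← sub_eq_add_neg]; ring
    rw [e]
    have h2 : ∑ k ∈ Finset.Icc 1 m, r k * (∑ y ∈ F, |G (y + k)| * Real.exp (b * |(y : ℝ)|)
            + ∑ y ∈ F, |G (y + -k)| * Real.exp (b * |(y : ℝ)|))
        ≤ ∑ k ∈ Finset.Icc 1 m, r k * (2 * (Real.exp (b * m) * α')) := by
      refine Finset.sum_le_sum fun k hk => mul_le_mul_of_nonneg_left ?_ (hr k hk).le
      have hk' : (k : ℝ) ≤ m := by exact_mod_cast (Finset.mem_Icc.mp hk).2
      have a1 := sum_shift_mul_exp_le hb (fun y => abs_nonneg (G y)) hα' (k : ℤ) F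
      have a2 := sum_shift_mul_exp_le hb (fun y => abs_nonneg (G y)) hα' (-(k : ℤ)) F
      have a3 : Real.exp (b * k) * α' ≤ Real.exp (b * m) * α' := by gcongr
      simp only [Int.cast_neg, Int.cast_natCast, abs_neg, Nat.abs_cast] at a1 a2
      linarith
    rw [← Finset.sum_mul, hr1] at h2
    calc _ ≤ (m : ℝ) / n * (1 / 2 * (1 * (2 * (Real.exp (b * m) * α')))) := by gcongr
      _ = _ := by ring
  have h2 := sum_shift_mul_exp_le hb (fun y => abs_nonneg (G y)) hα' (-1) F
  have h3 : ∀ y, |cutoff n y * G y - cutoff n (y - 1) * G (y - 1)|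
      ≤ |G y - G (y - 1)| + 1 / n * |G (y + -1)| := by
    intro y
    have e : cutoff n y * G y - cutoff n (y - 1) * G (y - 1)
        = cutoff n y * (G y - G (y - 1)) + (cutoff n y - cutoff n (y - 1)) * G (y - 1) := by ring
    have := abs_cutoff_sub_le n y (y - 1)
    push_cast at this
    rw [sub_sub_cancel, abs_one] at this
    rw [e, ← sub_eq_add_neg]
    refine abs_add_le_add ?_ ?_
    · rw [abs_mul]; exact mul_le_of_le_one_left (abs_nonneg _) (abs_cutoff_le_one n y)
    · rw [abs_mul]; exact mul_le_mul_of_nonneg_right this (abs_nonneg _)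
  have h4 : ∀ y, driftWeight m r C ε (fun y => cutoff n y * G y)
      (fun y => -(cutoff n y * lop m r G y)) y
      ≤ m / n * (1 / 2 * ∑ k ∈ Finset.Icc 1 m, r k * (|G (y + k)| + |G (y - k)|))
        + C * (ε * (|G y - G (y - 1)| + 1 / n * |G (y + -1)|) + ε ^ 2 * |G y|) := by
    intro y
    unfold driftWeight
    refine add_le_add ?_ (mul_le_mul_of_nonneg_left (add_le_add
      (mul_le_mul_of_nonneg_left (h3 y) hε) (mul_le_mul_of_nonneg_left ?_ (sq_nonneg ε))) hC)
    · rw [neg_add_eq_sub]; exact abs_lop_cutoff_sub_le hr n G y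
    · rw [abs_mul]; exact mul_le_of_le_one_left (abs_nonneg _) (abs_cutoff_le_one n y)
  calc _ ≤ ∑ y ∈ F, A * ((m / n * (1 / 2 * ∑ k ∈ Finset.Icc 1 m, r k * (|G (y + k)| + |G (y - k)|))
        * Real.exp (b * |(y : ℝ)|)) + C * (ε * (|G y - G (y - 1)| * Real.exp (b * |(y : ℝ)|)
          + 1 / n * (|G (y + -1)| * Real.exp (b * |(y : ℝ)|)))
          + ε ^ 2 * (|G y| * Real.exp (b * |(y : ℝ)|)))) := by
        refine Finset.sum_le_sum fun y _ => (mul_le_mul_of_nonneg_right (h4 y) (by positivity)).trans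
          (le_of_eq ?_)
        ring
    _ = A * (∑ y ∈ F, m / n * (1 / 2 * ∑ k ∈ Finset.Icc 1 m, r k * (|G (y + k)| + |G (y - k)|))
        * Real.exp (b * |(y : ℝ)|) + C * (ε * (∑ y ∈ F, |G y - G (y - 1)| * Real.exp (b * |(y : ℝ)|)
          + 1 / n * ∑ y ∈ F, |G (y + -1)| * Real.exp (b * |(y : ℝ)|))
          + ε ^ 2 * ∑ y ∈ F, |G y| * Real.exp (b * |(y : ℝ)|))) := by
        rw [← Finset.mul_sum, Finset.sum_add_distrib, ← Finset.mul_sum, Finset.sum_add_distrib,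
          ← Finset.mul_sum, ← Finset.mul_sum, Finset.sum_add_distrib, ← Finset.mul_sum]
    _ ≤ A * (m * Real.exp (b * m) * α' / n + C * (ε * (β + 1 / n * (Real.exp b * α')) + ε ^ 2 * α)) := by
        have := hβ F
        have := hα F
        simp only [Int.cast_neg, Int.cast_one, abs_neg, abs_one, mul_one] at h2
        gcongr
    _ = _ := by ring

theorem sum_sq_mul_le {ε A b ρ : ℝ} (hε : 0 ≤ ε) {G : ℤ → ℝ}
    (hρ : ∀ F : Finset ℤ, ∑ y ∈ F, (G y * Real.exp (b * |(y : ℝ)|)) ^ 2 ≤ ρ) (n : ℕ) (F : Finset ℤ) :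
    ∑ y ∈ F, ε * (cutoff n y * G y * (A * Real.exp (b * |(y : ℝ)|))) ^ 2 ≤ ε * (A ^ 2 * ρ) := by
  calc _ ≤ ∑ y ∈ F, ε * (A ^ 2 * (G y * Real.exp (b * |(y : ℝ)|)) ^ 2) := by
        refine Finset.sum_le_sum fun y _ => mul_le_mul_of_nonneg_left ?_ hε
        have : cutoff n y ^ 2 ≤ 1 := pow_le_one₀ (cutoff_nonneg n y) (cutoff_le_one n y)
        calc _ = cutoff n y ^ 2 * (A ^ 2 * (G y * Real.exp (b * |(y : ℝ)|)) ^ 2) := by ring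
          _ ≤ _ := mul_le_of_le_one_left (by positivity) this
    _ ≤ _ := by
        rw [← Finset.mul_sum, ← Finset.mul_sum]
        have := hρ F
        gcongr

theorem sum_sq_le_sq {ι : Type*} (F : Finset ι) {f : ι → ℝ} {M : ℝ} (h : ∑ y ∈ F, |f y| ≤ M) :
    ∑ y ∈ F, f y ^ 2 ≤ M ^ 2 := by
  have h1 := Finset.sum_sq_le_sq_sum_of_nonneg (s := F) (f := fun y => |f y|) fun y _ => abs_nonneg _
  simp only [sq_abs] at h1
  have h0 : 0 ≤ ∑ y ∈ F, |f y| := Finset.sum_nonneg fun y _ => abs_nonneg _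
  exact h1.trans (pow_le_pow_left₀ h0 h 2)

end KernelSums

/-! ### Moments of functionals given by kernels of infinite support. -/

section KernelMoment

variable {Ω : Type*} {mΩ : MeasurableSpace Ω} {P : Measure Ω} {ℱ : Filtration ℝ≥0 mΩ} {m : ℕ}
  {rate : ℤ → ℝ≥0} {Q : jumps m × ℤ → ℝ≥0 → Ω → ℕ} {η : ℝ≥0 → Ω → ℤ → Bool}

/-- A family of kernels `G τ` that solves the heat equation, together with bounds, up to the time
`L`, of its weighted norms. -/
structure KernelBound (m : ℕ) (r : ℕ → ℝ) (b L v M M₀ : ℝ) (G : ℝ → ℤ → ℝ) : Prop where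
  bounded : ∃ K : ℝ, ∀ τ, 0 ≤ τ → τ ≤ L → ∀ y, |G τ y| ≤ K ∧ |lop m r (G τ) y| ≤ K
  heat_eq : ∃ K : ℝ, ∀ τ h, 0 ≤ τ → 0 ≤ h → τ + h ≤ L → ∀ y,
    |G τ y - G (τ + h) y + h * lop m r (G (τ + h)) y| ≤ K * h ^ 2
  sum_le : ∀ τ, 0 ≤ τ → τ ≤ L → ∀ F : Finset ℤ, ∑ y ∈ F, |G τ y| * Real.exp (b * |(y : ℝ)|) ≤ M₀
  sum_decay : ∀ τ, 0 < τ → τ ≤ L → ∀ F : Finset ℤ,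
    ∑ y ∈ F, |G τ y| * Real.exp (b * |(y : ℝ)|) ≤ M * τ ^ (-(v / 2))
  gradient_decay : ∀ τ, 0 < τ → τ ≤ L → ∀ F : Finset ℤ,
    ∑ y ∈ F, |G τ y - G τ (y - 1)| * Real.exp (b * |(y : ℝ)|) ≤ M * τ ^ (-(1 / 2 + v / 2))
  sq_decay : ∀ τ, 0 < τ → τ ≤ L → ∀ F : Finset ℤ,
    ∑ y ∈ F, (G τ y * Real.exp (b * |(y : ℝ)|)) ^ 2 ≤ M ^ 2 * τ ^ (-(1 / 2 + v))

variable [IsProbabilityMeasure P]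

-- The finite estimate is applied to the weights `cutoff n * G (t₁ - s)`, and `n` tends to infinity.
-- Nothing has to be justified in the limit at the final time, where the cut-off functional is
-- assumed to be eventually equal to `X`; at the initial time a limit of bounds suffices.
set_option maxHeartbeats 1000000 in
theorem DriftBound.moment_kernel_le (h : IsExclusionProcess P ℱ m rate Q η)
    {r : ℕ → ℝ} (hr : ∀ k ∈ Finset.Icc 1 m, 0 < r k)
    (hr1 : ∑ k ∈ Finset.Icc 1 m, r k = 1) {θ ε ν C : ℝ} (hD : DriftBound m rate r θ ε ν C)
    (hε : 0 ≤ ε) (hC : 0 ≤ C) (hθ : 0 ≤ θ) {J : ℝ} (hJ0 : 0 ≤ J)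
    (hJ : 2 * θ * Real.exp (2 * θ) ≤ J * √ε) (i : ℕ) {t₀ t₁ : ℝ≥0} (ht : t₀ ≤ t₁)
    {Y : Ω → ℝ} (hYm : AEStronglyMeasurable[ℱ t₀] Y P) (hY : MemLp Y (2 * i + 2 : ℕ) P)
    {A b : ℝ} (hA : 0 < A) (hb : 0 ≤ b)
    (hi : ∀ s, t₀ ≤ s → s ≤ t₁ → ∀ y : ℤ, Integrable (fun ω => grown θ ν Q η s y ω ^ (2 * i + 2)) P)
    (hZ : ∀ s, t₀ ≤ s → s ≤ t₁ → ∀ y : ℤ,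
      ∫ ω, grown θ ν Q η s y ω ^ (2 * i + 2) ∂P ≤ (A * Real.exp (b * |(y : ℝ)|)) ^ (2 * i + 2))
    {v M M₀ : ℝ} (hv : 0 ≤ v) (hv2 : v < 1 / 2) (hM : 0 ≤ M) {G : ℝ → ℤ → ℝ}
    (hG : KernelBound m r b ((t₁ : ℝ) - t₀) v M M₀ G) {X : Ω → ℝ}
    (hX : ∀ᶠ n : ℕ in atTop, ∀ ω, pairing (2 * n + m + 1) (fun y => cutoff n y * G 0 y)
      (fun y => grown θ ν Q η t₁ y ω) = X ω) {I : ℝ} {I' : ℕ → ℝ} (hI' : Tendsto I' atTop (𝓝 I))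
    (hI : ∀ᶠ n : ℕ in atTop, ∫ ω, (pairing (2 * n + m + 1)
      (fun y => cutoff n y * G ((t₁ : ℝ) - t₀) y) (fun y => grown θ ν Q η t₀ y ω) - Y ω) ^ (2 * i + 2) ∂P
        ≤ I' n ^ (2 * i + 2)) :
    ∫ ω, (X ω - Y ω) ^ (2 * i + 2) ∂P ≤ 2 * (I ^ (2 * i + 2)
      + (4 * (2 * i + 2) * (A * (C * (ε * (M * (((t₁ : ℝ) - t₀) ^ (1 - (1 / 2 + v / 2)) / (1 - (1 / 2 + v / 2))))
          + ε ^ 2 * (M * (((t₁ : ℝ) - t₀) ^ (1 - v / 2) / (1 - v / 2))))))) ^ (2 * i + 2)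
      + (4 * (varConst m i * J ^ 2 + 1)
        * (ε * (A ^ 2 * (M ^ 2 * (((t₁ : ℝ) - t₀) ^ (1 - (1 / 2 + v)) / (1 - (1 / 2 + v))))))) ^ (i + 1)
      + varConst m i * J ^ (2 * i + 2) * (ε * (A ^ 2 * M₀ ^ 2)) ^ i
        * (ε * (A ^ 2 * (M ^ 2 * (((t₁ : ℝ) - t₀) ^ (1 - (1 / 2 + v)) / (1 - (1 / 2 + v))))))) := by
  set L : ℝ := (t₁ : ℝ) - t₀ with hL
  have hL0 : 0 ≤ L := sub_nonneg.mpr ht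
  set B : ℝ := A * (C * (ε * (M * (L ^ (1 - (1 / 2 + v / 2)) / (1 - (1 / 2 + v / 2))))
          + ε ^ 2 * (M * (L ^ (1 - v / 2) / (1 - v / 2))))) with hB
  set D : ℝ := ε * (A ^ 2 * (M ^ 2 * (L ^ (1 - (1 / 2 + v)) / (1 - (1 / 2 + v))))) with hDd
  have hd1 : 0 < 1 - (1 / 2 + v / 2) := by linarith
  have hd2 : 0 < 1 - v / 2 := by linarith
  have hd3 : 0 < 1 - (1 / 2 + v) := by linarith
  have hB0 : 0 ≤ B := by positivity
  have hD0 : 0 ≤ D := by positivity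
  have hM₀ : 0 ≤ M₀ := by simpa using hG.sum_le 0 le_rfl hL0 ∅
  set R : ℝ := (m * Real.exp (b * m) + C * ε * Real.exp b) * M₀ with hR
  have hR0 : 0 ≤ R := by positivity
  obtain ⟨K₁, hK₁⟩ := hG.bounded
  obtain ⟨K₂, hK₂⟩ := hG.heat_eq
  have hinv : Tendsto (fun n : ℕ => 1 / (n : ℝ)) atTop (𝓝 0) := tendsto_one_div_atTop_nhds_zero_nat
  -- `A R L / n` is the total cost of the cutoff. The further `1 / n`, here and for `D`, only makes
  -- the constants positive, as `moment_pairing_le` requires.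
  have hlimB : Tendsto (fun n : ℕ => B + (A * R * L + 1) * (1 / (n : ℝ))) atTop (𝓝 B) := by
    simpa using (hinv.const_mul (A * R * L + 1)).const_add B
  have hlimD : Tendsto (fun n : ℕ => D + 1 / (n : ℝ)) atTop (𝓝 D) := by
    simpa using hinv.const_add D
  have hlim := ((((hI'.pow (2 * i + 2)).add ((hlimB.const_mul (4 * (2 * (i : ℝ) + 2))).pow (2 * i + 2))).add
    ((hlimD.const_mul (4 * (varConst m i * J ^ 2 + 1))).pow (i + 1))).add
    (hlimD.const_mul (varConst m i * J ^ (2 * i + 2) * (ε * (A ^ 2 * M₀ ^ 2)) ^ i))).const_mul 2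
  refine ge_of_tendsto hlim ?_
  filter_upwards [hX, hI, eventually_gt_atTop 0] with n hXn hIn hn
  have hn' : (0 : ℝ) < n := by exact_mod_cast hn
  have hτ : ∀ a : ℝ≥0, t₀ ≤ a → a ≤ t₁ → 0 ≤ (t₁ : ℝ) - a ∧ (t₁ : ℝ) - a ≤ L := fun a h0 h1 =>
    ⟨sub_nonneg.mpr h1, by rw [hL]; linarith [(NNReal.coe_le_coe.mpr h0 : (t₀ : ℝ) ≤ a)]⟩
  have hzero : ∀ e : ℝ, 0 < 1 - e → (0 : ℝ) ^ (1 - e) = 0 := fun e he => Real.zero_rpow he.ne'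
  have key := hD.moment_pairing_le h hε hC hθ hJ0 hJ (n := 2 * n + m + 1) i ht hYm hY
    (W := fun y => A * Real.exp (b * |(y : ℝ)|)) (fun y => by positivity)
    (fun s h0 h1 y _ => hi s h0 h1 y) (fun s h0 h1 y _ => hZ s h0 h1 y)
    (g := fun s y => cutoff n y * G ((t₁ : ℝ) - s) y)
    (g' := fun s y => -(cutoff n y * lop m r (G ((t₁ : ℝ) - s)) y))
    (fun s y hy => by
      rw [cutoff_eq_zero hn (by push_cast at hy; omega), zero_mul])
    (G := max K₁ K₂)
    (fun s h0 h1 y => by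
      obtain ⟨a1, a2⟩ := hτ s h0 h1
      rw [abs_mul]
      exact (mul_le_of_le_one_left (abs_nonneg _) (abs_cutoff_le_one n y)).trans
        ((hK₁ _ a1 a2 y).1.trans (le_max_left _ _)))
    (fun s h0 h1 y => by
      obtain ⟨a1, a2⟩ := hτ s h0 h1
      rw [abs_neg, abs_mul]
      exact (mul_le_of_le_one_left (abs_nonneg _) (abs_cutoff_le_one n y)).trans
        ((hK₁ _ a1 a2 y).2.trans (le_max_left _ _)))
    (fun a c h0 h1 h2 y => by
      have h3 := hK₂ ((t₁ : ℝ) - c) ((c : ℝ) - a) (sub_nonneg.mpr h2) (sub_nonneg.mpr h1)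
        (by rw [sub_add_sub_cancel]; exact (hτ a h0 (h1.trans h2)).2) y
      rw [sub_add_sub_cancel] at h3
      have e : cutoff n y * G ((t₁ : ℝ) - c) y - cutoff n y * G ((t₁ : ℝ) - a) y
          - ((c : ℝ) - a) * -(cutoff n y * lop m r (G ((t₁ : ℝ) - a)) y)
          = cutoff n y * (G ((t₁ : ℝ) - c) y - G ((t₁ : ℝ) - a) y
            + ((c : ℝ) - a) * lop m r (G ((t₁ : ℝ) - a)) y) := by ring
      rw [e, abs_mul]
      refine (mul_le_of_le_one_left (abs_nonneg _) (abs_cutoff_le_one n y)).trans (h3.trans ?_)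
      gcongr
      exact le_max_right _ _)
    -- Primitives of the decay rates of the kernel, which are singular but integrable at the final
    -- time.
    (Φ := fun s => A * (C * (ε * (M * (-((t₁ : ℝ) - s) ^ (1 - (1 / 2 + v / 2)) / (1 - (1 / 2 + v / 2))))
      + ε ^ 2 * (M * (-((t₁ : ℝ) - s) ^ (1 - v / 2) / (1 - v / 2)))) + R / n * s))
    (Ψ := fun s => ε * (A ^ 2 * (M ^ 2 * (-((t₁ : ℝ) - s) ^ (1 - (1 / 2 + v)) / (1 - (1 / 2 + v))))))
    (B := B + (A * R * L + 1) * (1 / (n : ℝ))) (D := D + 1 / (n : ℝ))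
    (B₀ := ε * (A ^ 2 * M₀ ^ 2)) (by positivity) (by positivity) (by positivity)
    (fun a c h0 h1 h2 => by
      rcases eq_or_lt_of_le (h1.trans h2) with hat | hat
      · obtain rfl : a = c := le_antisymm h1 (hat ▸ h2)
        simp
      have hat' : (a : ℝ) < t₁ := hat
      have hca : (0 : ℝ) ≤ (c : ℝ) - a := sub_nonneg.mpr h1
      obtain ⟨a1, a2⟩ := hτ a h0 (h1.trans h2)
      have a0 : 0 < (t₁ : ℝ) - a := sub_pos.mpr hat'
      have s1 := sum_driftWeight_cutoff_le hr hr1 hC hε hb hA.le (hG.sum_decay _ a0 a2)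
        (hG.sum_le _ a1 a2) (hG.gradient_decay _ a0 a2) n
        (Finset.Icc (-((2 * n + m + 1 : ℕ) : ℤ)) (2 * n + m + 1 : ℕ))
      have q1 := mul_rpow_neg_le (e := 1 / 2 + v / 2) (a := a) (b := c) (T := t₁) (by linarith)
        (by linarith) h2 hat'
      have q2 := mul_rpow_neg_le (e := v / 2) (a := a) (b := c) (T := t₁) (by linarith)
        (by linarith) h2 hat'
      refine (mul_le_mul_of_nonneg_left s1 hca).trans ?_
      calc _ = A * (C * (ε * (M * (((c : ℝ) - a) * ((t₁ : ℝ) - a) ^ (-(1 / 2 + v / 2))))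
            + ε ^ 2 * (M * (((c : ℝ) - a) * ((t₁ : ℝ) - a) ^ (-(v / 2))))) + R / n * ((c : ℝ) - a)) := by
            rw [hR]; ring
        _ ≤ A * (C * (ε * (M * (-((t₁ : ℝ) - c) ^ (1 - (1 / 2 + v / 2)) / (1 - (1 / 2 + v / 2))
              - -((t₁ : ℝ) - a) ^ (1 - (1 / 2 + v / 2)) / (1 - (1 / 2 + v / 2))))
            + ε ^ 2 * (M * (-((t₁ : ℝ) - c) ^ (1 - v / 2) / (1 - v / 2)
              - -((t₁ : ℝ) - a) ^ (1 - v / 2) / (1 - v / 2)))) + R / n * ((c : ℝ) - a)) := by gcongr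
        _ = _ := by ring)
    (fun a c h0 h1 h2 => by
      rcases eq_or_lt_of_le (h1.trans h2) with hat | hat
      · obtain rfl : a = c := le_antisymm h1 (hat ▸ h2)
        simp
      have hat' : (a : ℝ) < t₁ := hat
      have hca : (0 : ℝ) ≤ (c : ℝ) - a := sub_nonneg.mpr h1
      obtain ⟨a1, a2⟩ := hτ a h0 (h1.trans h2)
      have a0 : 0 < (t₁ : ℝ) - a := sub_pos.mpr hat'
      have s1 := sum_sq_mul_le (A := A) hε (hG.sq_decay _ a0 a2) n
        (Finset.Icc (-((2 * n + m + 1 : ℕ) : ℤ)) (2 * n + m + 1 : ℕ))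
      have q1 := mul_rpow_neg_le (e := 1 / 2 + v) (a := a) (b := c) (T := t₁) (by linarith)
        (by linarith) h2 hat'
      refine (mul_le_mul_of_nonneg_left s1 hca).trans ?_
      calc _ = ε * (A ^ 2 * (M ^ 2 * (((c : ℝ) - a) * ((t₁ : ℝ) - a) ^ (-(1 / 2 + v))))) := by ring
        _ ≤ ε * (A ^ 2 * (M ^ 2 * (-((t₁ : ℝ) - c) ^ (1 - (1 / 2 + v)) / (1 - (1 / 2 + v))
              - -((t₁ : ℝ) - a) ^ (1 - (1 / 2 + v)) / (1 - (1 / 2 + v))))) := by gcongr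
        _ = _ := by ring)
    (fun a h0 h1 => by
      obtain ⟨a1, a2⟩ := hτ a h0 h1
      refine sum_sq_mul_le hε (fun F => sum_sq_le_sq F ?_) n _
      have := hG.sum_le _ a1 a2 F
      refine (le_of_eq (Finset.sum_congr rfl fun y _ => ?_)).trans this
      rw [abs_mul, Real.abs_exp])
    (by
      simp only [sub_self]
      rw [hzero _ hd1, hzero _ hd2, ← hL]
      refine le_of_sub_nonneg ?_
      have : B + (A * R * L + 1) * (1 / (n : ℝ)) - (A * (C * (ε * (M * (-0 / (1 - (1 / 2 + v / 2))))
        + ε ^ 2 * (M * (-0 / (1 - v / 2)))) + R / n * t₁)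
        - A * (C * (ε * (M * (-L ^ (1 - (1 / 2 + v / 2)) / (1 - (1 / 2 + v / 2))))
        + ε ^ 2 * (M * (-L ^ (1 - v / 2) / (1 - v / 2)))) + R / n * t₀)) = 1 / n := by
        rw [hB, hL]; ring
      rw [this]
      positivity)
    (by
      simp only [sub_self]
      rw [hzero _ hd3, ← hL]
      refine le_of_sub_nonneg ?_
      have : D + 1 / (n : ℝ) - (ε * (A ^ 2 * (M ^ 2 * (-0 / (1 - (1 / 2 + v)))))
        - ε * (A ^ 2 * (M ^ 2 * (-L ^ (1 - (1 / 2 + v)) / (1 - (1 / 2 + v)))))) = 1 / n := by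
        rw [hDd]; ring
      rw [this]
      positivity)
  simp only [sub_self, ← hL] at key
  simp only [hXn] at key
  refine key.trans ?_
  gcongr

end KernelMoment

/-! ### The heat kernel seen from a point, and its increments. -/

section HeatKernelBounds

variable {m : ℕ} {r : ℕ → ℝ}

/-- Gaussian type bounds of the heat kernel, for the exponential weights of slope `b` at times `s`
such that `b` and `s b²` are at most `K`. -/
def HeatBounds (m : ℕ) (r : ℕ → ℝ) (K C : ℝ) : Prop :=
  ∀ s b : ℝ, 0 ≤ s → 0 ≤ b → b ≤ K → s * b ^ 2 ≤ K →
    (∀ F : Finset ℤ, ∑ z ∈ F, heat m r s z * Real.exp (b * |(z : ℝ)|) ≤ C) ∧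
    (0 < s → ∀ F : Finset ℤ,
      ∑ z ∈ F, |heat m r s (z + 1) - heat m r s z| * Real.exp (b * |(z : ℝ)|) ≤ C / √s) ∧
    (0 < s → ∀ F : Finset ℤ, ∑ z ∈ F, |heat m r s (z + 2) - 2 * heat m r s (z + 1) + heat m r s z|
      * Real.exp (b * |(z : ℝ)|) ≤ C / s) ∧
    (0 < s → ∀ z, heat m r s z * Real.exp (b * |(z : ℝ)|) ≤ C / √s)

theorem lop_reflect (f : ℤ → ℝ) (x y : ℤ) : lop m r (fun y => f (x - y)) y = lop m r f (x - y) := by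
  unfold lop
  congr 1
  refine Finset.sum_congr rfl fun k _ => ?_
  change r k * (f (x - (y + k)) + f (x - (y - k)) - 2 * f (x - y)) = _
  rw [← sub_sub, ← sub_add]
  ring

theorem lop_sub (f g : ℤ → ℝ) (y : ℤ) :
    lop m r (fun y => f y - g y) y = lop m r f y - lop m r g y := by
  unfold lop
  rw [← mul_sub, ← Finset.sum_sub_distrib]
  congr 1
  refine Finset.sum_congr rfl fun k _ => ?_
  ring

theorem exp_mul_abs_reflect_le {b : ℝ} (hb : 0 ≤ b) (x y : ℤ) :
    Real.exp (b * |(y : ℝ)|) ≤ Real.exp (b * |(x : ℝ)|) * Real.exp (b * |((x - y : ℤ) : ℝ)|) := by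
  rw [← Real.exp_add, ← mul_add, Real.exp_le_exp]
  refine mul_le_mul_of_nonneg_left ?_ hb
  push_cast
  calc |(y : ℝ)| = |((x : ℝ) - (x - y))| := by ring_nf
    _ ≤ _ := abs_sub _ _

theorem sum_reflect_mul_exp_le {b : ℝ} (hb : 0 ≤ b) {f : ℤ → ℝ} {α : ℝ} (hf : ∀ y, 0 ≤ f y)
    (hα : ∀ F : Finset ℤ, ∑ y ∈ F, f y * Real.exp (b * |(y : ℝ)|) ≤ α) (x : ℤ) (F : Finset ℤ) :
    ∑ y ∈ F, f (x - y) * Real.exp (b * |(y : ℝ)|) ≤ Real.exp (b * |(x : ℝ)|) * α := by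
  have h1 := hα (F.map (Equiv.subLeft x).toEmbedding)
  rw [Finset.sum_map] at h1
  refine le_trans ?_ (mul_le_mul_of_nonneg_left h1 (Real.exp_pos _).le)
  rw [Finset.mul_sum]
  refine Finset.sum_le_sum fun y _ => ?_
  change f (x - y) * _ ≤ Real.exp (b * |(x : ℝ)|) * (f (x - y) * Real.exp (b * |((x - y : ℤ) : ℝ)|))
  calc _ ≤ f (x - y) * (Real.exp (b * |(x : ℝ)|) * Real.exp (b * |((x - y : ℤ) : ℝ)|)) :=
        mul_le_mul_of_nonneg_left (exp_mul_abs_reflect_le hb x y) (hf _)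
    _ = _ := by ring

/-- Telescoping over `d` unit steps; the intermediate points lie between `x` and `x + d`, where
`|·|` is at most `|x| + |x + d|`. -/
theorem sum_increment_mul_exp_le {b : ℝ} (hb : 0 ≤ b) {f : ℤ → ℝ} {γ : ℝ} (hγ0 : 0 ≤ γ)
    (hγ : ∀ F : Finset ℤ, ∑ z ∈ F, |f (z + 1) - f z| * Real.exp (b * |(z : ℝ)|) ≤ γ) (x : ℤ) (d : ℕ)
    (F : Finset ℤ) :
    ∑ y ∈ F, |f (x + d - y) - f (x - y)| * Real.exp (b * |(y : ℝ)|)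
      ≤ d * (Real.exp (b * (|(x : ℝ)| + |(x : ℝ) + d|)) * γ) := by
  have key : ∀ j : ℕ, j ≤ d → ∑ y ∈ F, |f (x + j - y) - f (x - y)| * Real.exp (b * |(y : ℝ)|)
      ≤ j * (Real.exp (b * (|(x : ℝ)| + |(x : ℝ) + d|)) * γ) := by
    intro j
    induction j with
    | zero => intro _; simp
    | succ j ih =>
      intro hj
      have h1 := ih (by omega)
      have h2 := sum_reflect_mul_exp_le hb (fun y => abs_nonneg (f (y + 1) - f y)) hγ (x + j) F
      have h3 : Real.exp (b * |((x + j : ℤ) : ℝ)|) * γ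
          ≤ Real.exp (b * (|(x : ℝ)| + |(x : ℝ) + d|)) * γ := by
        refine mul_le_mul_of_nonneg_right (Real.exp_le_exp.mpr (mul_le_mul_of_nonneg_left ?_ hb)) hγ0
        push_cast
        have hj' : (j : ℝ) ≤ d := by exact_mod_cast (by omega : j ≤ d)
        have hj0 : (0 : ℝ) ≤ j := Nat.cast_nonneg j
        refine abs_le.mpr ⟨?_, ?_⟩
        · linarith [neg_abs_le (x : ℝ), abs_nonneg ((x : ℝ) + d)]
        · linarith [le_abs_self ((x : ℝ) + d), abs_nonneg (x : ℝ)]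
      calc _ ≤ ∑ y ∈ F, (|f (x + j - y) - f (x - y)| * Real.exp (b * |(y : ℝ)|)
            + |f (x + j - y + 1) - f (x + j - y)| * Real.exp (b * |(y : ℝ)|)) := by
            refine Finset.sum_le_sum fun y _ => ?_
            rw [← add_mul, show x + ((j + 1 : ℕ) : ℤ) - y = x + j - y + 1 by push_cast; ring]
            refine mul_le_mul_of_nonneg_right ?_ (Real.exp_pos _).le
            rw [add_comm |f (x + j - y) - f (x - y)|]
            exact abs_sub_le _ _ _
        _ ≤ _ := by
            rw [Finset.sum_add_distrib]
            push_cast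
            linarith
  exact key d le_rfl

/-- Interpolation between a trivial bound and a Lipschitz bound, applied below with `q = d / √τ`. -/
theorem le_mul_rpow_of_le {S p q v : ℝ} (hp : 0 ≤ p) (hq : 0 ≤ q) (hv : 0 ≤ v) (hv1 : v ≤ 1)
    (h1 : S ≤ p) (h2 : S ≤ p * q) : S ≤ p * q ^ v := by
  rcases le_total q 1 with h | h
  · refine h2.trans (mul_le_mul_of_nonneg_left ?_ hp)
    rcases hq.eq_or_lt with rfl | hq0
    · exact Real.rpow_nonneg le_rfl v
    · calc q = q ^ (1 : ℝ) := (Real.rpow_one q).symm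
        _ ≤ q ^ v := Real.rpow_le_rpow_of_exponent_ge hq0 h hv1
  · exact h1.trans (le_mul_of_one_le_right hp (Real.one_le_rpow h hv))

theorem one_div_sqrt_eq {τ : ℝ} (hτ : 0 ≤ τ) : 1 / √τ = τ ^ (-(1 / 2 : ℝ)) := by
  rw [Real.rpow_neg hτ, Real.sqrt_eq_rpow, one_div]

theorem sum_sq_le_mul {ι : Type*} (F : Finset ι) {f : ι → ℝ} {s α : ℝ} (hs : ∀ y, |f y| ≤ s) (hs0 : 0 ≤ s)
    (h : ∑ y ∈ F, |f y| ≤ α) : ∑ y ∈ F, f y ^ 2 ≤ s * α := by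
  calc ∑ y ∈ F, f y ^ 2 ≤ ∑ y ∈ F, s * |f y| := Finset.sum_le_sum fun y _ => by
        rw [← sq_abs, sq]; exact mul_le_mul_of_nonneg_right (hs y) (abs_nonneg _)
    _ ≤ _ := by rw [← Finset.mul_sum]; exact mul_le_mul_of_nonneg_left h hs0

theorem heat_heat_eq (hr : ∀ k ∈ Finset.Icc 1 m, 0 < r k) (hr1 : ∑ k ∈ Finset.Icc 1 m, r k = 1) {L τ h : ℝ}
    (hτ : 0 ≤ τ) (hh : 0 ≤ h) (hL : τ + h ≤ L) (x y : ℤ) :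
    |heat m r τ (x - y) - heat m r (τ + h) (x - y) + h * lop m r (fun y => heat m r (τ + h) (x - y)) y|
      ≤ (4 + 12 * Real.exp (2 * L) + 8 * L * Real.exp (2 * L)) * h ^ 2 := by
  rw [lop_reflect]
  have hhL : h ≤ L := by linarith
  have hL0 : 0 ≤ L := hh.trans hhL
  refine (abs_heat_backward_le hr hr1 hτ hh (x - y)).trans ?_
  gcongr

/-- The kernel of the heat semigroup, seen from a fixed point. -/
theorem HeatBounds.kernelBound_point (hr : ∀ k ∈ Finset.Icc 1 m, 0 < r k)
    (hr1 : ∑ k ∈ Finset.Icc 1 m, r k = 1) {K C : ℝ} (hC : HeatBounds m r K C) {b L : ℝ} (hb : 0 ≤ b)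
    (hbK : b ≤ K) (hLK : L * b ^ 2 ≤ K) (x : ℤ) :
    KernelBound m r b L 0 (C * Real.exp (b * |(x : ℝ)|)) (C * Real.exp (b * |(x : ℝ)|))
      (fun τ y => heat m r τ (x - y)) := by
  have hsb : ∀ τ, τ ≤ L → τ * b ^ 2 ≤ K := fun τ h =>
    (mul_le_mul_of_nonneg_right h (sq_nonneg b)).trans hLK
  have hsum : ∀ τ, 0 ≤ τ → τ ≤ L → ∀ F : Finset ℤ,
      ∑ y ∈ F, |heat m r τ (x - y)| * Real.exp (b * |(y : ℝ)|) ≤ C * Real.exp (b * |(x : ℝ)|) := by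
    intro τ h0 hL F
    simp only [abs_of_nonneg (heat_nonneg hr h0 _)]
    rw [mul_comm]
    exact sum_reflect_mul_exp_le hb (heat_nonneg hr h0) (hC τ b h0 hb hbK (hsb τ hL)).1 x F
  refine ⟨⟨2, fun τ h0 _ y => ⟨?_, ?_⟩⟩,
    ⟨4 + 12 * Real.exp (2 * L) + 8 * L * Real.exp (2 * L), fun τ h h0 hh hL y =>
      heat_heat_eq hr hr1 h0 hh hL x y⟩, hsum, fun τ h0 hL F => ?_, fun τ h0 hL F => ?_, fun τ h0 hL F => ?_⟩
  · rw [abs_of_nonneg (heat_nonneg hr h0 _)]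
    exact (heat_le_one hr hr1 h0 _).trans one_le_two
  · rw [lop_reflect]; exact abs_lop_heat_le hr hr1 h0 _
  · simpa using hsum τ h0.le hL F
  · have h1 := (hC τ b h0.le hb hbK (hsb τ hL)).2.1 h0
    have h2 := sum_reflect_mul_exp_le hb (fun z => abs_nonneg (heat m r τ (z + 1) - heat m r τ z)) h1 x F
    rw [zero_div, add_zero, ← one_div_sqrt_eq h0.le]
    refine (le_of_eq (Finset.sum_congr rfl fun y _ => ?_)).trans (h2.trans (le_of_eq (by ring)))
    rw [abs_sub_comm, show x - (y - 1) = x - y + 1 by ring]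
  · have h1 := (hC τ b h0.le hb hbK (hsb τ hL)).2.2.2 h0
    rw [add_zero, ← one_div_sqrt_eq h0.le]
    have h2 : ∀ y : ℤ, |heat m r τ (x - y) * Real.exp (b * |(y : ℝ)|)|
        ≤ Real.exp (b * |(x : ℝ)|) * (C / √τ) := by
      intro y
      have hp := heat_nonneg hr h0.le (x - y)
      rw [abs_of_nonneg (mul_nonneg hp (Real.exp_pos _).le)]
      calc _ ≤ heat m r τ (x - y) * (Real.exp (b * |(x : ℝ)|) * Real.exp (b * |((x - y : ℤ) : ℝ)|)) :=
            mul_le_mul_of_nonneg_left (exp_mul_abs_reflect_le hb x y) hp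
        _ = Real.exp (b * |(x : ℝ)|) * (heat m r τ (x - y) * Real.exp (b * |((x - y : ℤ) : ℝ)|)) := by ring
        _ ≤ _ := mul_le_mul_of_nonneg_left (h1 _) (Real.exp_pos _).le
    refine (sum_sq_le_mul F h2 ((abs_nonneg _).trans (h2 0)) (α := C * Real.exp (b * |(x : ℝ)|)) ?_).trans
      (le_of_eq (by ring))
    refine (le_of_eq (Finset.sum_congr rfl fun y _ => ?_)).trans (hsum τ h0.le hL F)
    rw [abs_mul, Real.abs_exp]

/-- The difference of the heat kernels seen from two points. -/
theorem HeatBounds.kernelBound_sub (hr : ∀ k ∈ Finset.Icc 1 m, 0 < r k)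
    (hr1 : ∑ k ∈ Finset.Icc 1 m, r k = 1) {K C : ℝ} (hC0 : 0 ≤ C) (hC : HeatBounds m r K C) {b L : ℝ}
    (hb : 0 ≤ b) (hbK : b ≤ K) (hLK : L * b ^ 2 ≤ K) {v : ℝ} (hv : 0 ≤ v) (hv2 : v < 1 / 2) (x : ℤ) (d : ℕ) :
    KernelBound m r b L v (2 * C * Real.exp (b * (|(x : ℝ)| + |(x : ℝ) + d|)) * (d : ℝ) ^ v)
      (2 * C * Real.exp (b * (|(x : ℝ)| + |(x : ℝ) + d|)))
      (fun τ y => heat m r τ (x + d - y) - heat m r τ (x - y)) := by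
  have hp1 := hC.kernelBound_point hr hr1 hb hbK hLK x
  have hp2 := hC.kernelBound_point hr hr1 hb hbK hLK (x + d)
  set w := Real.exp (b * (|(x : ℝ)| + |(x : ℝ) + d|)) with hw
  have hw0 : 0 < w := Real.exp_pos _
  have hw1 : Real.exp (b * |(x : ℝ)|) ≤ w := by
    rw [hw, Real.exp_le_exp]
    exact mul_le_mul_of_nonneg_left (le_add_of_nonneg_right (abs_nonneg _)) hb
  have hw2 : Real.exp (b * |((x + d : ℤ) : ℝ)|) ≤ w := by
    rw [hw, Real.exp_le_exp]
    push_cast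
    exact mul_le_mul_of_nonneg_left (le_add_of_nonneg_left (abs_nonneg _)) hb
  have hsb : ∀ τ, τ ≤ L → τ * b ^ 2 ≤ K := fun τ h =>
    (mul_le_mul_of_nonneg_right h (sq_nonneg b)).trans hLK
  have hadd : ∀ (f g : ℤ → ℝ) (F : Finset ℤ) (B : ℝ),
      ∑ y ∈ F, |f y| * Real.exp (b * |(y : ℝ)|) ≤ B * Real.exp (b * |((x + d : ℤ) : ℝ)|) →
      ∑ y ∈ F, |g y| * Real.exp (b * |(y : ℝ)|) ≤ B * Real.exp (b * |(x : ℝ)|) → 0 ≤ B →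
      ∑ y ∈ F, |f y - g y| * Real.exp (b * |(y : ℝ)|) ≤ 2 * B * w := by
    intro f g F B h1 h2 hB
    have e1 := mul_le_mul_of_nonneg_left hw1 hB
    have e2 := mul_le_mul_of_nonneg_left hw2 hB
    calc _ ≤ ∑ y ∈ F, (|f y| * Real.exp (b * |(y : ℝ)|) + |g y| * Real.exp (b * |(y : ℝ)|)) :=
          Finset.sum_le_sum fun y _ => by
            rw [← add_mul]; exact mul_le_mul_of_nonneg_right (abs_sub _ _) (Real.exp_pos _).le
      _ ≤ _ := by rw [Finset.sum_add_distrib]; linarith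
  have hsum : ∀ τ, 0 ≤ τ → τ ≤ L → ∀ F : Finset ℤ,
      ∑ y ∈ F, |heat m r τ (x + d - y) - heat m r τ (x - y)| * Real.exp (b * |(y : ℝ)|) ≤ 2 * C * w :=
    fun τ h0 hL F => hadd _ _ F C (hp2.sum_le τ h0 hL F) (hp1.sum_le τ h0 hL F) hC0
  have hpow : ∀ {τ : ℝ}, 0 < τ → ∀ e : ℝ, ((d : ℝ) * τ ^ (-(1 / 2 : ℝ))) ^ e
      = (d : ℝ) ^ e * τ ^ (-(e / 2)) := by
    intro τ h0 e
    rw [Real.mul_rpow (Nat.cast_nonneg d) (Real.rpow_nonneg h0.le _), ← Real.rpow_mul h0.le]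
    ring_nf
  -- The exponent `e` is left free because two values are needed: `v` for the sums and `2 v` for the
  -- squares.
  have hinterp : ∀ τ, 0 < τ → τ ≤ L → ∀ e : ℝ, 0 ≤ e → e ≤ 1 → ∀ F : Finset ℤ,
      ∑ y ∈ F, |heat m r τ (x + d - y) - heat m r τ (x - y)| * Real.exp (b * |(y : ℝ)|)
        ≤ 2 * C * w * ((d : ℝ) ^ e * τ ^ (-(e / 2))) := by
    intro τ h0 hL e he0 he1 F
    have h1 := sum_increment_mul_exp_le hb (by positivity : 0 ≤ C / √τ)
      ((hC τ b h0.le hb hbK (hsb τ hL)).2.1 h0) x d F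
    rw [← hpow h0]
    refine le_mul_rpow_of_le (by positivity) (by positivity) he0 he1 (hsum τ h0.le hL F) (h1.trans ?_)
    rw [← one_div_sqrt_eq h0.le]
    calc _ = 1 * (C * w * (d * (1 / √τ))) := by rw [hw]; ring
      _ ≤ 2 * (C * w * (d * (1 / √τ))) := by gcongr; norm_num
      _ = _ := by ring
  obtain ⟨K₂, hK₂⟩ : ∃ K₂ : ℝ, K₂ = 4 + 12 * Real.exp (2 * L) + 8 * L * Real.exp (2 * L) := ⟨_, rfl⟩
  refine ⟨⟨4, fun τ h0 _ y => ⟨?_, ?_⟩⟩, ⟨K₂ + K₂, fun τ h h0 hh hL y => ?_⟩, hsum, fun τ h0 hL F => ?_,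
    fun τ h0 hL F => ?_, fun τ h0 hL F => ?_⟩
  · have h1 := heat_le_one hr hr1 h0 (x + d - y)
    have h2 := heat_nonneg hr h0 (x + d - y)
    have h3 := heat_le_one hr hr1 h0 (x - y)
    have h4 := heat_nonneg hr h0 (x - y)
    exact abs_le.mpr ⟨by linarith, by linarith⟩
  · rw [lop_sub, lop_reflect, lop_reflect]
    have h1 := abs_lop_heat_le hr hr1 h0 (x + d - y)
    have h2 := abs_lop_heat_le hr hr1 h0 (x - y)
    exact (abs_sub _ _).trans (by linarith)
  · have h1 := heat_heat_eq hr hr1 h0 hh hL (x + d) y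
    have h2 := heat_heat_eq hr hr1 h0 hh hL x y
    rw [← hK₂] at h1 h2
    rw [lop_sub, add_mul]
    refine le_trans (le_of_eq ?_) (abs_sub_le_add h1 h2)
    congr 1
    ring
  · exact (hinterp τ h0 hL v hv (by linarith) F).trans (le_of_eq (by ring))
  -- The gradient of the kernel difference is an increment of `f` over `d` sites. Telescoping bounds
  -- it through second differences by `d / τ`, the triangle inequality by `τ^(-1/2)`, and
  -- interpolation does the rest.
  · set f : ℤ → ℝ := fun z => heat m r τ z - heat m r τ (z + 1) with hf
    have h1 : ∑ y ∈ F, |f (x + d - y) - f (x - y)| * Real.exp (b * |(y : ℝ)|)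
        ≤ d * (w * (C / τ)) := by
      refine sum_increment_mul_exp_le hb (by positivity : 0 ≤ C / τ) (fun F => ?_) x d F
      refine (le_of_eq (Finset.sum_congr rfl fun z _ => ?_)).trans
        ((hC τ b h0.le hb hbK (hsb τ hL)).2.2.1 h0 F)
      rw [hf, ← abs_neg]
      congr 2
      change -(heat m r τ (z + 1) - heat m r τ (z + 1 + 1) - (heat m r τ z - heat m r τ (z + 1))) = _
      rw [show z + 1 + 1 = z + 2 by ring]
      ring
    have h2 : ∑ y ∈ F, |f (x + d - y) - f (x - y)| * Real.exp (b * |(y : ℝ)|)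
        ≤ 2 * (C * τ ^ (-(1 / 2 : ℝ))) * w := by
      have a1 := hp1.gradient_decay τ h0 hL F
      have a2 := hp2.gradient_decay τ h0 hL F
      rw [zero_div, add_zero] at a1 a2
      refine hadd (fun y => f (x + d - y)) (fun y => f (x - y)) F _ ?_ ?_ (by positivity)
      · refine le_trans (le_of_eq (Finset.sum_congr rfl fun y _ => ?_)) (a2.trans (le_of_eq (by ring)))
        rw [hf, show x + d - (y - 1) = x + d - y + 1 by ring]
      · refine le_trans (le_of_eq (Finset.sum_congr rfl fun y _ => ?_)) (a1.trans (le_of_eq (by ring)))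
        rw [hf, show x - (y - 1) = x - y + 1 by ring]
    have h3 : ∑ y ∈ F, |f (x + d - y) - f (x - y)| * Real.exp (b * |(y : ℝ)|)
        ≤ 2 * (C * τ ^ (-(1 / 2 : ℝ))) * w * ((d : ℝ) * τ ^ (-(1 / 2 : ℝ))) ^ v := by
      refine le_mul_rpow_of_le (by positivity) (by positivity) hv (by linarith) h2 (h1.trans ?_)
      have e : 1 / τ = τ ^ (-(1 / 2 : ℝ)) * τ ^ (-(1 / 2 : ℝ)) := by
        rw [← Real.rpow_add h0]; norm_num [Real.rpow_neg_one]
      calc _ = 1 * (C * w * d * (1 / τ)) := by ring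
        _ ≤ 2 * (C * w * d * (1 / τ)) := by gcongr; norm_num
        _ = _ := by rw [e]; ring
    rw [hpow h0] at h3
    refine (le_of_eq (Finset.sum_congr rfl fun y _ => ?_)).trans (h3.trans (le_of_eq ?_))
    · rw [hf]
      congr 2
      rw [show x - (y - 1) = x - y + 1 by ring, show x + d - (y - 1) = x + d - y + 1 by ring]
      ring
    · rw [neg_add, Real.rpow_add h0]; ring
  · have hsup : ∀ y : ℤ, |(heat m r τ (x + d - y) - heat m r τ (x - y)) * Real.exp (b * |(y : ℝ)|)|
        ≤ 2 * C * w * τ ^ (-(1 / 2 : ℝ)) := by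
      intro y
      have h1 := (hC τ b h0.le hb hbK (hsb τ hL)).2.2.2 h0
      have h2 : ∀ x' : ℤ, Real.exp (b * |(x' : ℝ)|) ≤ w →
          heat m r τ (x' - y) * Real.exp (b * |(y : ℝ)|) ≤ w * (C / √τ) := by
        intro x' hx'
        have hp := heat_nonneg hr h0.le (x' - y)
        calc _ ≤ heat m r τ (x' - y) * (Real.exp (b * |(x' : ℝ)|) * Real.exp (b * |((x' - y : ℤ) : ℝ)|)) :=
              mul_le_mul_of_nonneg_left (exp_mul_abs_reflect_le hb x' y) hp
          _ = Real.exp (b * |(x' : ℝ)|) * (heat m r τ (x' - y) * Real.exp (b * |((x' - y : ℤ) : ℝ)|)) := by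
              ring
          _ ≤ w * (C / √τ) := mul_le_mul hx' (h1 _) (by positivity) hw0.le
      have a1 := h2 (x + d) hw2
      have a2 := h2 x hw1
      have a3 : 0 ≤ heat m r τ (x + d - y) * Real.exp (b * |(y : ℝ)|) :=
        mul_nonneg (heat_nonneg hr h0.le _) (Real.exp_pos _).le
      have a4 : 0 ≤ heat m r τ (x - y) * Real.exp (b * |(y : ℝ)|) :=
        mul_nonneg (heat_nonneg hr h0.le _) (Real.exp_pos _).le
      have e : 2 * C * w * τ ^ (-(1 / 2 : ℝ)) = 2 * (w * (C / √τ)) := by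
        rw [← one_div_sqrt_eq h0.le]; ring
      rw [sub_mul, e]
      exact abs_le.mpr ⟨by linarith, by linarith⟩
    -- The sum of squares is at most supremum times sum: the supremum gives `τ^(-1/2)` and the sum,
    -- at the exponent `2 v ≤ 1`, gives `d^(2v) τ^(-v)`.
    have h1 := hinterp τ h0 hL (2 * v) (by linarith) (by linarith) F
    refine (sum_sq_le_mul F hsup (by positivity)
      ((le_of_eq (Finset.sum_congr rfl fun y _ => ?_)).trans h1)).trans (le_of_eq ?_)
    · rw [abs_mul, Real.abs_exp]
    · have e1 : (d : ℝ) ^ (2 * v) = ((d : ℝ) ^ v) ^ 2 := by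
        rw [← Real.rpow_natCast, ← Real.rpow_mul (Nat.cast_nonneg d)]; congr 1; push_cast; ring
      rw [e1, neg_add, Real.rpow_add h0, mul_div_cancel_left₀ v (two_ne_zero)]
      ring

end HeatKernelBounds

/-! ### From integrals of even powers to norms and back. -/

section Norms

variable {Ω : Type*} {mΩ : MeasurableSpace Ω} {P : Measure Ω}

theorem eLpNorm_le_ofReal {p : ℕ} (hp : p ≠ 0) (hpe : Even p) {f : Ω → ℝ} (hf : MemLp f p P) {c : ℝ}
    (hc : 0 ≤ c) (h : ∫ ω, f ω ^ p ∂P ≤ c ^ p) : eLpNorm f p P ≤ ENNReal.ofReal c := by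
  rw [hf.eLpNorm_eq_integral_rpow_norm (by simpa using hp) (by simp)]
  refine ENNReal.ofReal_le_ofReal ?_
  simp only [ENNReal.toReal_natCast, Real.rpow_natCast, Real.norm_eq_abs, hpe.pow_abs]
  refine (Real.rpow_le_rpow (integral_nonneg fun ω => hpe.pow_nonneg _) h (by positivity)).trans ?_
  rw [Real.pow_rpow_inv_natCast hc hp]

theorem integral_pow_le_of_eLpNorm_le {p : ℕ} (hp : p ≠ 0) (hpe : Even p) {f : Ω → ℝ}
    (hf : AEStronglyMeasurable f P) {c : ℝ} (hc : 0 ≤ c) (h : eLpNorm f p P ≤ ENNReal.ofReal c) :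
    MemLp f p P ∧ ∫ ω, f ω ^ p ∂P ≤ c ^ p := by
  have hm : MemLp f p P := ⟨hf, h.trans_lt ENNReal.ofReal_lt_top⟩
  refine ⟨hm, ?_⟩
  rw [hm.eLpNorm_eq_integral_rpow_norm (by simpa using hp) (by simp),
    ENNReal.ofReal_le_ofReal_iff hc] at h
  simp only [ENNReal.toReal_natCast, Real.norm_eq_abs, Real.rpow_natCast, hpe.pow_abs] at h
  have h0 : 0 ≤ ∫ ω, f ω ^ p ∂P := integral_nonneg fun ω => hpe.pow_nonneg _
  have := pow_le_pow_left₀ (by positivity) h p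
  rwa [Real.rpow_inv_natCast_pow h0 hp] at this

theorem eLpNorm_sum_mul_le {ι : Type*} (F : Finset ι) {p : ℝ≥0∞} (hp : 1 ≤ p) {g c : ι → ℝ}
    {X : ι → Ω → ℝ} (hX : ∀ y ∈ F, AEStronglyMeasurable (X y) P)
    (h : ∀ y ∈ F, eLpNorm (X y) p P ≤ ENNReal.ofReal (c y)) (hc : ∀ y ∈ F, 0 ≤ c y) :
    eLpNorm (fun ω => ∑ y ∈ F, g y * X y ω) p P ≤ ENNReal.ofReal (∑ y ∈ F, |g y| * c y) := by
  have e : (fun ω => ∑ y ∈ F, g y * X y ω) = ∑ y ∈ F, g y • X y := by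
    funext ω; rw [Finset.sum_apply]; rfl
  rw [e, ENNReal.ofReal_sum_of_nonneg fun y hy => mul_nonneg (abs_nonneg _) (hc y hy)]
  refine (eLpNorm_sum_le (fun y hy => (hX y hy).const_smul (g y)) hp).trans
    (Finset.sum_le_sum fun y hy => ?_)
  rw [eLpNorm_const_smul, ENNReal.ofReal_mul (abs_nonneg _), ← Real.enorm_eq_ofReal_abs]
  exact mul_le_mul_right (h y hy) _

end Norms

/-! ### Moment bounds in macroscopic units. -/

section Scaled

variable {Ω : Type*} {mΩ : MeasurableSpace Ω} {P : Measure Ω} {ℱ : Filtration ℝ≥0 mΩ} {m : ℕ}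
  {rate : ℤ → ℝ≥0} {Q : jumps m × ℤ → ℝ≥0 → Ω → ℕ} {η : ℝ≥0 → Ω → ℤ → Bool} {r : ℕ → ℝ}

/-- The weakly asymmetric regime: the exclusion process at the scale `ε`, with the bounds of the
drift and of the jumps of the exponential of its height. -/
structure WeaklyAsymmetric (P : Measure Ω) (ℱ : Filtration ℝ≥0 mΩ) (rate : ℤ → ℝ≥0)
    (Q : jumps m × ℤ → ℝ≥0 → Ω → ℕ) (η : ℝ≥0 → Ω → ℤ → Bool) (r : ℕ → ℝ) (ε θ ν C J : ℝ) : Prop where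
  process : IsExclusionProcess P ℱ m rate Q η
  drift : DriftBound m rate r θ ε ν C
  pos : 0 < ε
  lt_one : ε < 1
  theta_nonneg : 0 ≤ θ
  jump_le : 2 * θ * Real.exp (2 * θ) ≤ J * √ε

/-- The constant in the moment bound for solutions of the heat equation. -/
def scaledConst (m i : ℕ) (C J T v : ℝ) : ℝ :=
  2 * ((4 * (2 * i + 2) * (8 * C * (T + 1))) ^ (2 * i + 2)
    + (4 * (varConst m i * J ^ 2 + 1) * (1 / 2 - v)⁻¹) ^ (i + 1)
    + varConst m i * J ^ (2 * i + 2) * (1 / 2 - v)⁻¹)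

theorem scaledConst_nonneg (m i : ℕ) {C J T v : ℝ} (hC : 0 ≤ C) (hJ : 0 ≤ J) (hT : 0 ≤ T)
    (hv : v < 1 / 2) : 0 ≤ scaledConst m i C J T v := by
  have := varConst_nonneg m i
  have : 0 < 1 / 2 - v := by linarith
  unfold scaledConst
  positivity

theorem rpow_le_add_one {S T e : ℝ} (hS : 0 ≤ S) (hST : S ≤ T) (he : 0 ≤ e) (he1 : e ≤ 1) :
    S ^ e ≤ T + 1 := by
  rcases le_total S 1 with h | h
  · exact (Real.rpow_le_one hS h he).trans (by linarith)
  · calc S ^ e ≤ S ^ (1 : ℝ) := Real.rpow_le_rpow_of_exponent_le h he1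
      _ ≤ _ := by rw [Real.rpow_one]; linarith

/-- Trades powers of the microscopic time `L` for powers of the macroscopic time `ε² L`. -/
theorem scale_rpow {ε L : ℝ} (hε : 0 < ε) (hL : 0 ≤ L) (a e : ℝ) :
    ε ^ a * L ^ e = ε ^ (a - 2 * e) * (ε ^ 2 * L) ^ e := by
  rw [Real.mul_rpow (sq_nonneg ε) hL, ← Real.rpow_natCast ε 2, ← Real.rpow_mul hε.le, ← mul_assoc,
    ← Real.rpow_add hε]
  congr 2
  push_cast; ring

variable [IsProbabilityMeasure P]

-- In macroscopic units drift and variation are governed by one quantity, `R = A M ε^v (ε² L)^(1/4 -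
-- v/2)`. The term with `√ε A M₀` is the trace of the jumps; it is negligible only because it
-- carries positive powers of `ε`.
set_option maxHeartbeats 1000000 in
theorem WeaklyAsymmetric.moment_kernel_le {ε θ ν C J : ℝ} (h : WeaklyAsymmetric P ℱ rate Q η r ε θ ν C J)
    (hr : ∀ k ∈ Finset.Icc 1 m, 0 < r k)
    (hr1 : ∑ k ∈ Finset.Icc 1 m, r k = 1) (hC : 0 ≤ C) (hJ0 : 0 ≤ J) (i : ℕ) {t₀ t₁ : ℝ≥0} (ht : t₀ ≤ t₁)
    {T : ℝ} (hT : ε ^ 2 * ((t₁ : ℝ) - t₀) ≤ T)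
    {Y : Ω → ℝ} (hYm : AEStronglyMeasurable[ℱ t₀] Y P) (hY : MemLp Y (2 * i + 2 : ℕ) P)
    {A b : ℝ} (hA : 0 < A) (hb : 0 ≤ b)
    (hi : ∀ s, t₀ ≤ s → s ≤ t₁ → ∀ y : ℤ, Integrable (fun ω => grown θ ν Q η s y ω ^ (2 * i + 2)) P)
    (hZ : ∀ s, t₀ ≤ s → s ≤ t₁ → ∀ y : ℤ,
      ∫ ω, grown θ ν Q η s y ω ^ (2 * i + 2) ∂P ≤ (A * Real.exp (b * |(y : ℝ)|)) ^ (2 * i + 2))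
    {v M M₀ : ℝ} (hv : 0 ≤ v) (hv2 : v < 1 / 2) (hM : 0 ≤ M) {G : ℝ → ℤ → ℝ}
    (hG : KernelBound m r b ((t₁ : ℝ) - t₀) v M M₀ G) {X : Ω → ℝ}
    (hX : ∀ᶠ n : ℕ in atTop, ∀ ω, pairing (2 * n + m + 1) (fun y => cutoff n y * G 0 y)
      (fun y => grown θ ν Q η t₁ y ω) = X ω) {I : ℝ} {I' : ℕ → ℝ} (hI' : Tendsto I' atTop (𝓝 I))
    (hI : ∀ᶠ n : ℕ in atTop, ∫ ω, (pairing (2 * n + m + 1)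
      (fun y => cutoff n y * G ((t₁ : ℝ) - t₀) y) (fun y => grown θ ν Q η t₀ y ω) - Y ω) ^ (2 * i + 2) ∂P
        ≤ I' n ^ (2 * i + 2)) :
    ∫ ω, (X ω - Y ω) ^ (2 * i + 2) ∂P ≤ 2 * I ^ (2 * i + 2) + scaledConst m i C J T v
      * ((A * M * ε ^ v * (ε ^ 2 * ((t₁ : ℝ) - t₀)) ^ (1 / 4 - v / 2)) ^ (2 * i + 2)
        + (√ε * A * M₀) ^ (2 * i) * (A * M * ε ^ v * (ε ^ 2 * ((t₁ : ℝ) - t₀)) ^ (1 / 4 - v / 2)) ^ 2) := by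
  have key := h.drift.moment_kernel_le h.process hr hr1 h.pos.le hC h.theta_nonneg hJ0 h.jump_le i ht
    hYm hY hA hb hi hZ hv hv2 hM hG hX hI' hI
  have hε := h.pos
  have hL0 : 0 ≤ (t₁ : ℝ) - t₀ := sub_nonneg.mpr ht
  set L : ℝ := (t₁ : ℝ) - t₀ with hL
  set S := ε ^ 2 * L with hS
  have hS0 : 0 ≤ S := by positivity
  have hT0 : 0 ≤ T := hS0.trans hT
  set ψ := S ^ (1 / 4 - v / 2) with hψ
  have hψ0 : 0 ≤ ψ := by positivity
  set V := varConst m i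
  have hV : 0 ≤ V := varConst_nonneg m i
  have hM₀ : 0 ≤ M₀ := by simpa using hG.sum_le 0 le_rfl hL0 ∅
  have hv3 : 0 < 1 / 2 - v := by linarith
  -- The drift has higher powers of the macroscopic time than the variation; the excess is bounded
  -- by `T + 1`.
  have hsplit : ∀ e, 0 ≤ e → e ≤ 1 → S ^ (1 / 4 - v / 2 + e) ≤ ψ * (T + 1) := by
    intro e he he1
    rw [Real.rpow_add_of_nonneg hS0 (by linarith) he]
    exact mul_le_mul_of_nonneg_left (rpow_le_add_one hS0 hT he he1) hψ0
  have b1 : ε * (M * (L ^ (1 - (1 / 2 + v / 2)) / (1 - (1 / 2 + v / 2))))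
      ≤ 4 * (M * ε ^ v * (ψ * (T + 1))) := by
    have e1 := scale_rpow hε hL0 1 (1 - (1 / 2 + v / 2))
    rw [Real.rpow_one, ← hS, show 1 - 2 * (1 - (1 / 2 + v / 2)) = v by ring,
      show 1 - (1 / 2 + v / 2) = 1 / 4 - v / 2 + 1 / 4 by ring] at e1
    have e2 := hsplit (1 / 4) (by norm_num) (by norm_num)
    have e3 : (1 - (1 / 2 + v / 2))⁻¹ ≤ 4 := by
      rw [inv_le_comm₀ (by linarith) (by norm_num)]; linarith
    have e4 : 0 ≤ (1 - (1 / 2 + v / 2))⁻¹ := inv_nonneg.mpr (by linarith)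
    calc _ = (1 - (1 / 2 + v / 2))⁻¹ * (M * (ε * L ^ (1 / 4 - v / 2 + 1 / 4))) := by
          rw [show 1 / 4 - v / 2 + 1 / 4 = 1 - (1 / 2 + v / 2) by ring, div_eq_mul_inv]; ring
      _ = (1 - (1 / 2 + v / 2))⁻¹ * (M * ε ^ v * S ^ (1 / 4 - v / 2 + 1 / 4)) := by rw [e1]; ring
      _ ≤ _ := by gcongr
  have b2 : ε ^ 2 * (M * (L ^ (1 - v / 2) / (1 - v / 2))) ≤ 4 * (M * ε ^ v * (ψ * (T + 1))) := by
    have e1 := scale_rpow hε hL0 2 (1 - v / 2)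
    rw [Real.rpow_two, ← hS, show 2 - 2 * (1 - v / 2) = v by ring,
      show 1 - v / 2 = 1 / 4 - v / 2 + 3 / 4 by ring] at e1
    have e2 := hsplit (3 / 4) (by norm_num) (by norm_num)
    have e3 : (1 - v / 2)⁻¹ ≤ 4 := by
      rw [inv_le_comm₀ (by linarith) (by norm_num)]; linarith
    have e4 : 0 ≤ (1 - v / 2)⁻¹ := inv_nonneg.mpr (by linarith)
    calc _ = (1 - v / 2)⁻¹ * (M * (ε ^ 2 * L ^ (1 / 4 - v / 2 + 3 / 4))) := by
          rw [show 1 / 4 - v / 2 + 3 / 4 = 1 - v / 2 by ring, div_eq_mul_inv]; ring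
      _ = (1 - v / 2)⁻¹ * (M * ε ^ v * S ^ (1 / 4 - v / 2 + 3 / 4)) := by rw [e1]; ring
      _ ≤ _ := by gcongr
  -- The variation scales exactly like `R²`: `ε L^(1/2 - v) = ε^(2v) (ε² L)^(1/2 - v)`.
  have b3 : ε * (A ^ 2 * (M ^ 2 * (L ^ (1 - (1 / 2 + v)) / (1 - (1 / 2 + v)))))
      = (1 / 2 - v)⁻¹ * (A * M * ε ^ v * ψ) ^ 2 := by
    have e1 := scale_rpow hε hL0 1 (1 / 2 - v)
    rw [Real.rpow_one, ← hS, show 1 - 2 * (1 / 2 - v) = v + v by ring,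
      show 1 / 2 - v = (1 / 4 - v / 2) + (1 / 4 - v / 2) by ring, Real.rpow_add hε,
      Real.rpow_add_of_nonneg hS0 (by linarith) (by linarith), ← hψ] at e1
    calc _ = (1 / 2 - v)⁻¹ * (A ^ 2 * M ^ 2 * (ε * L ^ ((1 / 4 - v / 2) + (1 / 4 - v / 2)))) := by
          rw [show (1 / 4 - v / 2) + (1 / 4 - v / 2) = 1 / 2 - v by ring,
            show 1 - (1 / 2 + v) = 1 / 2 - v by ring, div_eq_mul_inv]; ring
      _ = _ := by rw [e1]; ring
  have b4 : A * (C * (ε * (M * (L ^ (1 - (1 / 2 + v / 2)) / (1 - (1 / 2 + v / 2))))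
      + ε ^ 2 * (M * (L ^ (1 - v / 2) / (1 - v / 2))))) ≤ 8 * C * (T + 1) * (A * M * ε ^ v * ψ) := by
    calc _ ≤ A * (C * (4 * (M * ε ^ v * (ψ * (T + 1))) + 4 * (M * ε ^ v * (ψ * (T + 1))))) := by gcongr
      _ = _ := by ring
  have hB0 : 0 ≤ A * (C * (ε * (M * (L ^ (1 - (1 / 2 + v / 2)) / (1 - (1 / 2 + v / 2))))
      + ε ^ 2 * (M * (L ^ (1 - v / 2) / (1 - v / 2))))) := by
    have : 0 < 1 - (1 / 2 + v / 2) := by linarith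
    have : 0 < 1 - v / 2 := by linarith
    positivity
  rw [b3] at key
  set R := A * M * ε ^ v * ψ with hR
  have hR0 : 0 ≤ R := by positivity
  set N := (√ε * A * M₀) ^ (2 * i) with hN
  have hN0 : 0 ≤ N := by positivity
  have b5 : (ε * (A ^ 2 * M₀ ^ 2)) ^ i = N := by
    rw [hN, pow_mul]
    congr 1
    rw [mul_pow, mul_pow, Real.sq_sqrt hε.le]; ring
  rw [b5] at key
  have hk : ∀ x : ℝ, 0 ≤ x → ∀ n, 0 ≤ x ^ n := fun x hx n => pow_nonneg hx n
  have hv4 : 0 ≤ (1 / 2 - v)⁻¹ := inv_nonneg.mpr hv3.le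
  have c1 : (4 * (2 * i + 2) * (A * (C * (ε * (M * (L ^ (1 - (1 / 2 + v / 2)) / (1 - (1 / 2 + v / 2))))
      + ε ^ 2 * (M * (L ^ (1 - v / 2) / (1 - v / 2))))))) ^ (2 * i + 2)
      ≤ (4 * (2 * i + 2) * (8 * C * (T + 1))) ^ (2 * i + 2) * R ^ (2 * i + 2) := by
    rw [← mul_pow]
    refine pow_le_pow_left₀ (by positivity) ?_ _
    rw [mul_assoc (4 * (2 * (i : ℝ) + 2))]
    gcongr
  have c2 : (4 * (V * J ^ 2 + 1) * ((1 / 2 - v)⁻¹ * R ^ 2)) ^ (i + 1)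
      = (4 * (V * J ^ 2 + 1) * (1 / 2 - v)⁻¹) ^ (i + 1) * R ^ (2 * i + 2) := by
    rw [← mul_assoc, mul_pow, ← pow_mul]; ring_nf
  rw [c2] at key
  refine key.trans ?_
  unfold scaledConst
  set k₁ := (4 * (2 * (i : ℝ) + 2) * (8 * C * (T + 1))) ^ (2 * i + 2) with hk₁
  set k₂ := (4 * (V * J ^ 2 + 1) * (1 / 2 - v)⁻¹) ^ (i + 1) with hk₂
  set k₃ := V * J ^ (2 * i + 2) * (1 / 2 - v)⁻¹ with hk₃
  have hk₁0 : 0 ≤ k₁ := by positivity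
  have hk₂0 : 0 ≤ k₂ := by positivity
  have hk₃0 : 0 ≤ k₃ := by positivity
  have hRp : 0 ≤ R ^ (2 * i + 2) := by positivity
  have hNR : 0 ≤ N * R ^ 2 := by positivity
  have c3 : V * J ^ (2 * i + 2) * N * ((1 / 2 - v)⁻¹ * R ^ 2) = k₃ * (N * R ^ 2) := by rw [hk₃]; ring
  rw [c3]
  nlinarith [mul_nonneg hk₃0 hRp, mul_nonneg hk₁0 hNR, mul_nonneg hk₂0 hNR]

theorem pairing_cutoff_heat_zero (r : ℕ → ℝ) {n : ℕ} {x : ℤ} (hx : |x| ≤ n) (E : ℤ → ℝ) :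
    pairing (2 * n + m + 1) (fun y => cutoff n y * heat m r 0 (x - y)) E = E x := by
  unfold pairing
  rw [Finset.sum_eq_single x]
  · change cutoff n x * heat m r 0 (x - x) * E x = _
    rw [cutoff_eq_one hx, sub_self, heat_zero, if_pos rfl, one_mul, one_mul]
  · intro y _ hy
    change cutoff n y * heat m r 0 (x - y) * E y = _
    rw [heat_zero, if_neg (sub_ne_zero.mpr hy.symm), mul_zero, zero_mul]
  · intro hy
    exfalso
    apply hy
    rw [abs_le] at hx
    rw [Finset.mem_Icc]
    push_cast
    omega

theorem eventually_natCast_ge (x : ℤ) : ∀ᶠ n : ℕ in atTop, |x| ≤ n := by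
  filter_upwards [eventually_ge_atTop x.natAbs] with n hn
  rw [Int.abs_eq_natAbs]
  exact_mod_cast hn

end Scaled

/-! ### The weighted moment bound. -/

section WeightedBound

variable {m : ℕ} {r : ℕ → ℝ}

theorem HeatBounds.of_exists (hr : ∀ k ∈ Finset.Icc 1 m, 0 < r k) (hr1 : ∑ k ∈ Finset.Icc 1 m, r k = 1)
    {K : ℝ} (hK : 0 ≤ K) : ∃ C : ℝ, 1 ≤ C ∧ HeatBounds m r K C := exists_heat_bounds hr hr1 hK

variable {Ω : Type*} {mΩ : MeasurableSpace Ω} {P : Measure Ω} {ℱ : Filtration ℝ≥0 mΩ}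
  {rate : ℤ → ℝ≥0} {Q : jumps m × ℤ → ℝ≥0 → Ω → ℕ} {η : ℝ≥0 → Ω → ℤ → Bool} {ε θ ν C J : ℝ}

theorem WeaklyAsymmetric.aestronglyMeasurable (h : WeaklyAsymmetric P ℱ rate Q η r ε θ ν C J) (t : ℝ≥0)
    (y : ℤ) : AEStronglyMeasurable (grown θ ν Q η t y) P :=
  (h.process.aestronglyMeasurable_grown θ ν t y).mono (ℱ.le t)

/-- A linear functional of the field is bounded by the weighted norm of its kernel. -/
theorem WeaklyAsymmetric.integral_pairing_pow_le (h : WeaklyAsymmetric P ℱ rate Q η r ε θ ν C J) {i : ℕ}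
    {t : ℝ≥0} {A b M : ℝ} (hA : 0 ≤ A)
    (h0 : ∀ y : ℤ, eLpNorm (grown θ ν Q η t y) (2 * i + 2 : ℕ) P
      ≤ ENNReal.ofReal (A * Real.exp (b * |(y : ℝ)|))) {g : ℤ → ℝ}
    (hg : ∀ F : Finset ℤ, ∑ y ∈ F, |g y| * Real.exp (b * |(y : ℝ)|) ≤ M) (N : ℕ) :
    ∫ ω, (pairing N g fun y => grown θ ν Q η t y ω) ^ (2 * i + 2) ∂P ≤ (A * M) ^ (2 * i + 2) := by
  have hM : 0 ≤ M := by simpa using hg ∅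
  have h1 := eLpNorm_sum_mul_le (Finset.Icc (-(N : ℤ)) N) (p := (2 * i + 2 : ℕ))
    (by exact_mod_cast (by omega : 1 ≤ 2 * i + 2)) (g := g)
    (fun y _ => h.aestronglyMeasurable t y) (fun y _ => h0 y) (fun y _ => by positivity)
  refine (integral_pow_le_of_eLpNorm_le (by omega) ⟨i + 1, by omega⟩ ?_ (by positivity) (h1.trans
    (ENNReal.ofReal_le_ofReal ?_))).2
  · exact Finset.aestronglyMeasurable_fun_sum _ fun y _ => (h.aestronglyMeasurable t y).const_mul _
  · rw [mul_comm A]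
    refine le_trans (le_of_eq ?_) (mul_le_mul_of_nonneg_right (hg (Finset.Icc (-(N : ℤ)) N)) hA)
    rw [Finset.sum_mul]
    exact Finset.sum_congr rfl fun y _ => by ring

variable [IsProbabilityMeasure P]

/-- Its exponential factor involves the microscopic time and is useless on the diffusive scale; the
lemma provides integrability and the finite starting bound of the bootstrap. -/
theorem WeaklyAsymmetric.integrable_of_le (h : WeaklyAsymmetric P ℱ rate Q η r ε θ ν C J) {i : ℕ}
    {t₀ : ℝ≥0} {c : ℤ → ℝ} (hc : ∀ y, 0 ≤ c y)
    (h0 : ∀ y, eLpNorm (grown θ ν Q η t₀ y) (2 * i + 2 : ℕ) P ≤ ENNReal.ofReal (c y))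
    {s : ℝ≥0} (hs : t₀ ≤ s) (y : ℤ) : Integrable (fun ω => grown θ ν Q η s y ω ^ (2 * i + 2)) P ∧
      ∫ ω, grown θ ν Q η s y ω ^ (2 * i + 2) ∂P ≤ c y ^ (2 * i + 2)
        * Real.exp (((Fintype.card (jumps m) : ℝ) * (2 * m + 1) * (Real.exp (2 * θ * (2 * i + 2 : ℕ)) - 1)
          + (2 * i + 2 : ℕ) * |ν|) * (s - t₀)) := by
  obtain ⟨hm, hle⟩ := integral_pow_le_of_eLpNorm_le (by omega) ⟨i + 1, by omega⟩
    (h.aestronglyMeasurable t₀ y) (hc y) (h0 y)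
  have hi : Integrable (fun ω => grown θ ν Q η t₀ y ω ^ (2 * i + 2)) P := by
    have := (integrable_pow_iff_memLp (p := 2 * i + 2) (h.aestronglyMeasurable t₀ y) (by omega)).mpr hm
    simpa only [abs_of_pos (grown_pos _ _ _ _ _)] using this
  obtain ⟨h1, h2⟩ := h.process.grown_moment_le h.drift.rate_le h.theta_nonneg ν hs y (2 * i + 2) hi
  exact ⟨h1, h2.trans (mul_le_mul_of_nonneg_right hle (Real.exp_pos _).le)⟩

theorem sum_cutoff_mul_le {b M : ℝ} {g : ℤ → ℝ}
    (hg : ∀ F : Finset ℤ, ∑ y ∈ F, |g y| * Real.exp (b * |(y : ℝ)|) ≤ M) (n : ℕ) (F : Finset ℤ) :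
    ∑ y ∈ F, |cutoff n y * g y| * Real.exp (b * |(y : ℝ)|) ≤ M := by
  refine (Finset.sum_le_sum fun y _ => mul_le_mul_of_nonneg_right ?_ (Real.exp_pos _).le).trans (hg F)
  rw [abs_mul]
  exact mul_le_of_le_one_left (abs_nonneg _) (abs_cutoff_le_one n y)

set_option maxHeartbeats 1000000 in
/-- The weighted moments grow by at most a constant factor over a short macroscopic time. -/
theorem exists_short_time_bound (hr : ∀ k ∈ Finset.Icc 1 m, 0 < r k)
    (hr1 : ∑ k ∈ Finset.Icc 1 m, r k = 1) (hC : 0 ≤ C) (hJ : 0 ≤ J) (i : ℕ) {a : ℝ} (ha : 0 ≤ a) :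
    ∃ δ κ : ℝ, 0 < δ ∧ 1 ≤ κ ∧ ∀ {Ω : Type w} {mΩ : MeasurableSpace Ω} {P : Measure Ω}
      {ℱ : Filtration ℝ≥0 mΩ} {rate : ℤ → ℝ≥0} {Q : jumps m × ℤ → ℝ≥0 → Ω → ℕ} {η : ℝ≥0 → Ω → ℤ → Bool}
      {ε θ ν : ℝ} [IsProbabilityMeasure P], WeaklyAsymmetric P ℱ rate Q η r ε θ ν C J →
      ∀ A : ℝ, 0 < A → ∀ t₀ t₁ : ℝ≥0, t₀ ≤ t₁ → ε ^ 2 * ((t₁ : ℝ) - t₀) ≤ δ →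
      (∀ y : ℤ, eLpNorm (grown θ ν Q η t₀ y) (2 * i + 2 : ℕ) P
        ≤ ENNReal.ofReal (A * Real.exp (a * ε * |(y : ℝ)|))) →
      ∀ y : ℤ, eLpNorm (grown θ ν Q η t₁ y) (2 * i + 2 : ℕ) P
        ≤ ENNReal.ofReal (κ * A * Real.exp (a * ε * |(y : ℝ)|)) := by
  obtain ⟨H, hH1, hH⟩ := HeatBounds.of_exists hr hr1 (by positivity : 0 ≤ a + a ^ 2)
  have hH0 : 0 ≤ H := by linarith
  set k := 2 * scaledConst m i C J 1 0 * H ^ (2 * i + 2) with hk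
  have hk0 : 0 ≤ k := by
    have := scaledConst_nonneg m i (T := 1) (v := 0) hC hJ zero_le_one (by norm_num)
    positivity
  -- The smallest macroscopic times gain `(δ^(1/4))² = √δ`, and this choice gives `k √δ ≤ 1/2`. Also
  -- `δ ≤ 1`, so `scaledConst` may be taken at time `1`.
  set δ : ℝ := (1 / (2 * k + 1)) ^ 2 with hδ
  have hq1 : 1 / (2 * k + 1) ≤ 1 := by rw [div_le_one (by linarith)]; linarith
  have hq0 : 0 < 1 / (2 * k + 1) := by positivity
  have hδ1 : δ ≤ 1 := pow_le_one₀ hq0.le hq1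
  have hδs : √δ = 1 / (2 * k + 1) := Real.sqrt_sq hq0.le
  have hδk : k * √δ ≤ 1 / 2 := by
    rw [hδs, mul_one_div, div_le_iff₀ (by linarith)]; linarith
  refine ⟨δ, 4 * H, by positivity, by linarith, ?_⟩
  intro Ω mΩ P ℱ rate Q η ε θ ν _ h A hA t₀ t₁ ht hS h0 x₀
  have hε := h.pos
  have hε1 := h.lt_one
  set b := a * ε with hb
  have hb0 : 0 ≤ b := by positivity
  set p := 2 * i + 2 with hp
  have hpe : Even p := ⟨i + 1, by omega⟩
  have hp0 : p ≠ 0 := by omega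
  have hmom := fun (s : ℝ≥0) (hs : t₀ ≤ s) (y : ℤ) =>
    h.integrable_of_le (c := fun y : ℤ => A * Real.exp (b * |(y : ℝ)|)) (fun y => by positivity) h0 hs y
  -- The bootstrap runs over all times of the interval and all sites at once, since the bound at one
  -- site uses the moments at all others.
  set F : {s : ℝ≥0 // t₀ ≤ s ∧ s ≤ t₁} × ℤ → ℝ := fun z =>
    (∫ ω, grown θ ν Q η z.1 z.2 ω ^ p ∂P) / Real.exp (b * |(z.2 : ℝ)|) ^ p with hF
  have hbound := le_two_mul_of_self_improving (F := F) (c := 2 * (A * H) ^ p)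
    (A₀ := A ^ p * Real.exp (((Fintype.card (jumps m) : ℝ) * (2 * m + 1)
      * (Real.exp (2 * θ * p) - 1) + p * |ν|) * (t₁ - t₀))) (by positivity) ?_ ?_ (⟨t₁, ht, le_rfl⟩, x₀)
  · rw [hF, div_le_iff₀ (by positivity)] at hbound
    have hmem : MemLp (grown θ ν Q η t₁ x₀) p P := by
      refine (integrable_pow_iff_memLp (h.aestronglyMeasurable t₁ x₀) hp0).mp ?_
      simpa only [abs_of_pos (grown_pos _ _ _ _ _)] using (hmom t₁ ht x₀).1
    refine eLpNorm_le_ofReal hp0 hpe hmem (by positivity) (hbound.trans ?_)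
    have h4 : (4 : ℝ) ≤ 4 ^ p := le_self_pow₀ (by norm_num) hp0
    calc _ = 4 * ((A * H) ^ p * Real.exp (b * |(x₀ : ℝ)|) ^ p) := by ring
      _ ≤ 4 ^ p * ((A * H) ^ p * Real.exp (b * |(x₀ : ℝ)|) ^ p) := by gcongr
      _ = _ := by rw [← mul_pow, ← mul_pow]; ring_nf
  · rintro ⟨⟨s, hs0, hs1⟩, y⟩
    rw [hF, div_le_iff₀ (by positivity)]
    refine (hmom s hs0 y).2.trans ?_
    rw [mul_pow, mul_right_comm]
    have h2 : 0 ≤ Real.exp (2 * θ * p) - 1 := by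
      have := h.theta_nonneg
      linarith [Real.add_one_le_exp (2 * θ * p), (by positivity : 0 ≤ 2 * θ * p)]
    gcongr
  · rintro 𝒜 h𝒜 hle ⟨⟨s, hs0, hs1⟩, x⟩
    -- With `B^p = 𝒜`, the assumed bound takes the form `(B e^(b|y|))^p` that `moment_kernel_le`
    -- expects.
    set B := 𝒜 ^ ((p : ℝ)⁻¹) with hB
    have hB0 : 0 < B := Real.rpow_pos_of_pos h𝒜 _
    have hBp : B ^ p = 𝒜 := Real.rpow_inv_natCast_pow h𝒜.le hp0
    have hs1' : (s : ℝ) ≤ t₁ := by exact_mod_cast hs1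
    have hL0 : 0 ≤ (s : ℝ) - t₀ := sub_nonneg.mpr hs0
    have hSs : ε ^ 2 * ((s : ℝ) - t₀) ≤ δ :=
      (mul_le_mul_of_nonneg_left (by linarith) (sq_nonneg ε)).trans hS
    have hbK : b ≤ a + a ^ 2 := by rw [hb]; nlinarith
    have hLK : ((s : ℝ) - t₀) * b ^ 2 ≤ a + a ^ 2 := by
      calc ((s : ℝ) - t₀) * b ^ 2 = a ^ 2 * (ε ^ 2 * ((s : ℝ) - t₀)) := by rw [hb]; ring
        _ ≤ a ^ 2 * 1 := by gcongr; exact hSs.trans hδ1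
        _ ≤ _ := by linarith
    have hG := hH.kernelBound_point hr hr1 hb0 hbK hLK x
    set w := Real.exp (b * |(x : ℝ)|) with hw
    have hw0 : 0 < w := Real.exp_pos _
    have key := h.moment_kernel_le hr hr1 hC hJ i hs0 (hSs.trans hδ1) (Y := fun _ => 0)
      aestronglyMeasurable_const MemLp.zero' hB0 hb0 (fun u hu0 _ y => (hmom u hu0 y).1)
      (fun u hu0 hu1 y => by
        have := hle (⟨u, hu0, hu1.trans hs1⟩, y)
        rw [hF, div_le_iff₀ (by positivity)] at this
        rw [mul_pow, hBp]; exact this)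
      le_rfl (by norm_num) (by positivity) hG (X := grown θ ν Q η s x)
      (by filter_upwards [eventually_natCast_ge x] with n hn ω; exact pairing_cutoff_heat_zero r hn _)
      (tendsto_const_nhds (x := A * (H * w)))
      (Eventually.of_forall fun n => by
        simp only [sub_zero]
        exact h.integral_pairing_pow_le hA.le h0 (sum_cutoff_mul_le (hG.sum_le _ hL0 le_rfl) n) _)
    simp only [sub_zero, zero_div, Real.rpow_zero, mul_one] at key
    rw [hF, div_le_iff₀ (by positivity)]
    refine key.trans ?_
    set ψ := (ε ^ 2 * ((s : ℝ) - t₀)) ^ (1 / 4 : ℝ) with hψ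
    have hψ0 : 0 ≤ ψ := by positivity
    have hψ1 : ψ ≤ 1 := Real.rpow_le_one (by positivity) (hSs.trans hδ1) (by norm_num)
    have hψ2 : ψ ^ 2 ≤ √δ := by
      rw [hψ, ← Real.rpow_natCast, ← Real.rpow_mul (by positivity), Real.sqrt_eq_rpow]
      norm_num
      exact Real.rpow_le_rpow (by positivity) hSs (by norm_num)
    have e1 : (B * (H * w) * ψ) ^ (2 * i + 2) ≤ (B * (H * w)) ^ p * √δ := by
      rw [mul_pow]
      refine mul_le_mul_of_nonneg_left ?_ (by positivity)
      exact (pow_le_pow_of_le_one hψ0 hψ1 (by omega)).trans hψ2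
    have hεs : √ε ≤ 1 := Real.sqrt_le_one.mpr hε1.le
    have e2 : (√ε * B * (H * w)) ^ (2 * i) * (B * (H * w) * ψ) ^ 2 ≤ (B * (H * w)) ^ p * √δ := by
      calc _ ≤ (1 * B * (H * w)) ^ (2 * i) * (B * (H * w) * ψ) ^ 2 := by gcongr
        _ = (B * (H * w)) ^ p * ψ ^ 2 := by rw [hp]; ring
        _ ≤ _ := by gcongr
    have hsc := scaledConst_nonneg m i (T := 1) (v := 0) hC hJ zero_le_one (by norm_num)
    calc _ ≤ 2 * (A * (H * w)) ^ p + scaledConst m i C J 1 0 * ((B * (H * w)) ^ p * √δ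
          + (B * (H * w)) ^ p * √δ) := by gcongr
      _ = (2 * (A * H) ^ p + k * √δ * B ^ p) * w ^ p := by rw [hk]; ring
      _ ≤ (2 * (A * H) ^ p + 1 / 2 * B ^ p) * w ^ p := by gcongr
      _ = _ := by rw [hBp]; ring

/-- The weighted moments grow by at most a constant factor over a macroscopic time. -/
theorem exists_weighted_bound (hr : ∀ k ∈ Finset.Icc 1 m, 0 < r k)
    (hr1 : ∑ k ∈ Finset.Icc 1 m, r k = 1) (hC : 0 ≤ C) (hJ : 0 ≤ J) (i : ℕ) {a : ℝ} (ha : 0 ≤ a) (T : ℝ) :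
    ∃ κ : ℝ, 1 ≤ κ ∧ ∀ {Ω : Type w} {mΩ : MeasurableSpace Ω} {P : Measure Ω}
      {ℱ : Filtration ℝ≥0 mΩ} {rate : ℤ → ℝ≥0} {Q : jumps m × ℤ → ℝ≥0 → Ω → ℕ} {η : ℝ≥0 → Ω → ℤ → Bool}
      {ε θ ν : ℝ} [IsProbabilityMeasure P], WeaklyAsymmetric P ℱ rate Q η r ε θ ν C J →
      ∀ A : ℝ, 0 < A →
      (∀ y : ℤ, eLpNorm (grown θ ν Q η 0 y) (2 * i + 2 : ℕ) P
        ≤ ENNReal.ofReal (A * Real.exp (a * ε * |(y : ℝ)|))) →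
      ∀ t : ℝ≥0, ε ^ 2 * (t : ℝ) ≤ T → ∀ y : ℤ, eLpNorm (grown θ ν Q η t y) (2 * i + 2 : ℕ) P
        ≤ ENNReal.ofReal (κ * A * Real.exp (a * ε * |(y : ℝ)|)) := by
  obtain ⟨δ, κ, hδ, hκ, hstep⟩ := exists_short_time_bound.{w} hr hr1 hC hJ i ha
  obtain ⟨N, hN⟩ := exists_nat_ge (T / δ)
  refine ⟨κ ^ N, one_le_pow₀ hκ, ?_⟩
  intro Ω mΩ P ℱ rate Q η ε θ ν _ h A hA h0 t ht
  have hε := h.pos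
  have key : ∀ n : ℕ, ∀ t : ℝ≥0, ε ^ 2 * (t : ℝ) ≤ n * δ → ∀ y : ℤ,
      eLpNorm (grown θ ν Q η t y) (2 * i + 2 : ℕ) P
        ≤ ENNReal.ofReal (κ ^ n * A * Real.exp (a * ε * |(y : ℝ)|)) := by
    intro n
    induction n with
    | zero =>
      intro t ht y
      have : t = 0 := by
        have h1 : ε ^ 2 * (t : ℝ) ≤ 0 := by simpa using ht
        have h2 : 0 < ε ^ 2 := by positivity
        have h3 : (t : ℝ) ≤ 0 := nonpos_of_mul_nonpos_right h1 h2
        exact le_antisymm (by exact_mod_cast h3) zero_le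
      rw [this, pow_zero, one_mul]
      exact h0 y
    | succ n ih =>
      intro t ht y
      -- Truncated subtraction: `u = 0` if less than one interval has elapsed.
      set u : ℝ≥0 := t - (δ / ε ^ 2).toNNReal with hu
      have hd : ((δ / ε ^ 2).toNNReal : ℝ) = δ / ε ^ 2 := Real.coe_toNNReal _ (by positivity)
      have hu1 : (u : ℝ) = max ((t : ℝ) - δ / ε ^ 2) 0 := by rw [hu, NNReal.coe_sub_def, hd]
      have e : ε ^ 2 * (δ / ε ^ 2) = δ := by field_simp
      have h1 : ε ^ 2 * (u : ℝ) ≤ n * δ := by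
        rw [hu1]
        rcases le_total ((t : ℝ) - δ / ε ^ 2) 0 with h | h
        · rw [max_eq_right h, mul_zero]; positivity
        · rw [max_eq_left h, mul_sub, e]; push_cast at ht; linarith
      have h2 : ε ^ 2 * ((t : ℝ) - u) ≤ δ := by
        rw [← e]
        refine mul_le_mul_of_nonneg_left ?_ (sq_nonneg ε)
        rw [hu1]
        linarith [le_max_left ((t : ℝ) - δ / ε ^ 2) 0]
      have := hstep h (κ ^ n * A) (by positivity) u t tsub_le_self h2 (ih u h1) y
      rwa [← mul_assoc κ, ← pow_succ'] at this
  exact key N t (ht.trans (by rwa [div_le_iff₀ hδ] at hN))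

end WeightedBound

/-! ### Increments in space. -/

section Increments

variable {m : ℕ} {r : ℕ → ℝ}

theorem two_mul_pow_add_le {p : ℕ} (hp : p ≠ 0) {x y s : ℝ} (hx : 0 ≤ x) (hy : 0 ≤ y) (hs : 0 ≤ s) :
    2 * x ^ p + s * (y ^ p + y ^ p) ≤ (2 * x + (2 * s + 1) * y) ^ p := by
  have h1 : (2 : ℝ) ≤ 2 ^ p := le_self_pow₀ (by norm_num) hp
  have h2 : 2 * s + 1 ≤ (2 * s + 1) ^ p := le_self_pow₀ (by linarith) hp
  calc 2 * x ^ p + s * (y ^ p + y ^ p) ≤ 2 ^ p * x ^ p + (2 * s + 1) ^ p * y ^ p := by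
        have a1 := mul_le_mul_of_nonneg_right h1 (pow_nonneg hx p)
        have a2 := mul_le_mul_of_nonneg_right h2 (pow_nonneg hy p)
        have a3 := pow_nonneg hy p
        linarith
    _ = (2 * x) ^ p + ((2 * s + 1) * y) ^ p := by rw [mul_pow, mul_pow]
    _ ≤ _ := pow_add_pow_le (by positivity) (by positivity) hp

theorem pairing_cutoff_sub (N n : ℕ) (f g E : ℤ → ℝ) :
    pairing N (fun y => cutoff n y * (f y - g y)) E
      = pairing N (fun y => cutoff n y * f y) E - pairing N (fun y => cutoff n y * g y) E := by
  unfold pairing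
  rw [← Finset.sum_sub_distrib]
  exact Finset.sum_congr rfl fun y _ => by ring

/-- In the variable `z = x - y` the kernel no longer depends on `x`, so the difference of two such
pairings falls on the field instead of the kernel. -/
theorem pairing_cutoff_reflect {n : ℕ} (hn : 0 < n) (f E : ℤ → ℝ) {x : ℤ} {N : ℕ} (hN : 2 * (n : ℤ) + |x| ≤ N) :
    pairing (2 * n + m + 1) (fun y => cutoff n y * f (x - y)) E
      = ∑ z ∈ Finset.Icc (-(N : ℤ)) N, f z * (cutoff n (x - z) * E (x - z)) := by
  have e1 : ∑' y, cutoff n y * f (x - y) * E y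
      = pairing (2 * n + m + 1) (fun y => cutoff n y * f (x - y)) E :=
    tsum_eq_sum fun y hy => by
      rw [Finset.mem_Icc, ← abs_le] at hy
      rw [cutoff_eq_zero hn (by push_cast at hy; omega), zero_mul, zero_mul]
  have e2 : ∑' z, f z * (cutoff n (x - z) * E (x - z))
      = ∑ z ∈ Finset.Icc (-(N : ℤ)) N, f z * (cutoff n (x - z) * E (x - z)) :=
    tsum_eq_sum fun z hz => by
      rw [Finset.mem_Icc, ← abs_le] at hz
      have := abs_sub_abs_le_abs_sub z x
      rw [abs_sub_comm z x] at this
      rw [cutoff_eq_zero hn (by omega), zero_mul, mul_zero]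
  rw [← e1, ← e2, ← (Equiv.subLeft x).tsum_eq]
  refine tsum_congr fun z => ?_
  simp only [Equiv.subLeft_apply, sub_sub_cancel]
  ring

theorem eLpNorm_mul_add_mul_le {Ω : Type*} {mΩ : MeasurableSpace Ω} {P : Measure Ω} {p : ℝ≥0∞} (hp : 1 ≤ p)
    {f g : Ω → ℝ} (hf : AEStronglyMeasurable f P) (hg : AEStronglyMeasurable g P) {c d : ℝ}
    (hc : 0 ≤ c) (hd : 0 ≤ d) (hfc : eLpNorm f p P ≤ ENNReal.ofReal c) (hgd : eLpNorm g p P ≤ ENNReal.ofReal d)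
    (α β : ℝ) : eLpNorm (fun ω => α * f ω + β * g ω) p P ≤ ENNReal.ofReal (|α| * c + |β| * d) := by
  have h := eLpNorm_sum_mul_le (P := P) (Finset.univ : Finset (Fin 2)) hp (g := ![α, β]) (c := ![c, d])
    (X := ![f, g]) (fun y _ => by fin_cases y <;> assumption) (fun y _ => by fin_cases y <;> assumption)
    (fun y _ => by fin_cases y <;> assumption)
  simpa [Fin.sum_univ_two] using h

set_option maxHeartbeats 1000000 in
/-- Spatial increments keep the Hölder regularity of the initial condition. -/
theorem exists_spatial_increment_bound (hr : ∀ k ∈ Finset.Icc 1 m, 0 < r k)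
    (hr1 : ∑ k ∈ Finset.Icc 1 m, r k = 1) {C J : ℝ} (hC : 0 ≤ C) (hJ : 0 ≤ J) (i : ℕ) {a : ℝ} (ha : 0 ≤ a)
    {T : ℝ} (hT : 0 ≤ T) {v : ℝ} (hv : 0 ≤ v) (hv2 : v < 1 / 2) :
    ∃ κ : ℝ, 0 ≤ κ ∧ ∀ {Ω : Type w} {mΩ : MeasurableSpace Ω} {P : Measure Ω}
      {ℱ : Filtration ℝ≥0 mΩ} {rate : ℤ → ℝ≥0} {Q : jumps m × ℤ → ℝ≥0 → Ω → ℕ} {η : ℝ≥0 → Ω → ℤ → Bool}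
      {ε θ ν : ℝ} [IsProbabilityMeasure P], WeaklyAsymmetric P ℱ rate Q η r ε θ ν C J →
      ∀ A : ℝ, 0 < A → ∀ B : ℝ, 0 ≤ B →
      (∀ y : ℤ, eLpNorm (grown θ ν Q η 0 y) (2 * i + 2 : ℕ) P
        ≤ ENNReal.ofReal (A * Real.exp (a * ε * |(y : ℝ)|))) →
      (∀ x y : ℤ, eLpNorm (fun ω => grown θ ν Q η 0 x ω - grown θ ν Q η 0 y ω) (2 * i + 2 : ℕ) P
        ≤ ENNReal.ofReal (B * (ε * |(x : ℝ) - y|) ^ v * Real.exp (a * ε * (|(x : ℝ)| + |(y : ℝ)|)))) →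
      ∀ t : ℝ≥0, ε ^ 2 * (t : ℝ) ≤ T → ∀ x y : ℤ,
        eLpNorm (fun ω => grown θ ν Q η t x ω - grown θ ν Q η t y ω) (2 * i + 2 : ℕ) P
        ≤ ENNReal.ofReal (κ * (A + B) * (ε * |(x : ℝ) - y|) ^ v
          * Real.exp (a * ε * (|(x : ℝ)| + |(y : ℝ)|))) := by
  -- The initial term needs the tilt `2 b`, as both `|x + d - z|` and `|x - z|` contribute `|z|` to
  -- the weight; hence `2 a` and `4 a² T`.
  obtain ⟨H, hH1, hH⟩ := HeatBounds.of_exists hr hr1 (by positivity : 0 ≤ 2 * a + 4 * a ^ 2 * T)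
  have hH0 : 0 ≤ H := by linarith
  obtain ⟨κ₁, hκ₁, hest⟩ := exists_weighted_bound.{w} hr hr1 hC hJ i ha T
  set sc := scaledConst m i C J T v with hsc
  have hsc0 : 0 ≤ sc := scaledConst_nonneg m i hC hJ hT hv2
  refine ⟨2 * H + (2 * sc + 1) * (2 * H * κ₁ * (T + 1)), by positivity, ?_⟩
  intro Ω mΩ P ℱ rate Q η ε θ ν _ h A hA B hB h0 hincr t ht
  have hε := h.pos
  have hε1 := h.lt_one
  set b := a * ε with hb
  have hb0 : 0 ≤ b := by positivity
  set p := 2 * i + 2 with hp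
  have hpe : Even p := ⟨i + 1, by omega⟩
  have hp0 : p ≠ 0 := by omega
  have hp1 : (1 : ℝ≥0∞) ≤ p := by exact_mod_cast (by omega : 1 ≤ 2 * i + 2)
  have hZ := hest h A hA h0
  have hba : b ≤ a := by rw [hb]; nlinarith
  have hb2 : (t : ℝ) * b ^ 2 ≤ a ^ 2 * T := by
    calc (t : ℝ) * b ^ 2 = a ^ 2 * (ε ^ 2 * t) := by rw [hb]; ring
      _ ≤ _ := by gcongr
  have haT : 0 ≤ a ^ 2 * T := by positivity
  have hL : ((t : ℝ) - ((0 : ℝ≥0) : ℝ)) = t := by simp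
  -- The two points are written as `x` and `x + d` with `d ≥ 1`; the other order follows by
  -- symmetry.
  have main : ∀ (x : ℤ) (d : ℕ), 1 ≤ d →
      eLpNorm (fun ω => grown θ ν Q η t (x + d) ω - grown θ ν Q η t x ω) p P
        ≤ ENNReal.ofReal ((2 * H + (2 * sc + 1) * (2 * H * κ₁ * (T + 1))) * (A + B) * (ε * d) ^ v
          * Real.exp (b * (|(x : ℝ)| + |(x : ℝ) + d|))) := by
    intro x d hd
    have hd1 : (1 : ℝ) ≤ d := by exact_mod_cast hd
    set w := Real.exp (b * (|(x : ℝ)| + |(x : ℝ) + d|)) with hw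
    have hw0 : 0 < w := Real.exp_pos _
    have hG := hH.kernelBound_sub hr hr1 hH0 (L := (t : ℝ) - ((0 : ℝ≥0) : ℝ)) hb0
      (by linarith : b ≤ 2 * a + 4 * a ^ 2 * T) (by rw [hL]; nlinarith) hv hv2 x d
    set e := (ε * d) ^ v with he
    have he0 : 0 ≤ e := by positivity
    have hfac : ε ^ v * (d : ℝ) ^ v = e := (Real.mul_rpow hε.le (Nat.cast_nonneg d)).symm
    have hmom := fun (s : ℝ≥0) (hs : (0 : ℝ≥0) ≤ s) (y : ℤ) =>
      h.integrable_of_le (c := fun y : ℤ => A * Real.exp (b * |(y : ℝ)|)) (fun y => by positivity) h0 hs y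
    have hp2 : ∀ F : Finset ℤ, ∑ z ∈ F, heat m r t z * Real.exp (2 * b * |(z : ℝ)|) ≤ H :=
      (hH t (2 * b) (NNReal.coe_nonneg t) (by positivity) (by linarith) (by nlinarith)).1
    -- After translation the initial term is an average of initial increments over the distance `d`.
    -- The two cutoffs differ by at most `d / n`, and this mismatch disappears in the limit.
    have hinit : ∀ n : ℕ, 0 < n → ∫ ω, (pairing (2 * n + m + 1) (fun y => cutoff n y
        * (heat m r ((t : ℝ) - ((0 : ℝ≥0) : ℝ)) (x + d - y) - heat m r ((t : ℝ) - ((0 : ℝ≥0) : ℝ)) (x - y)))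
        (fun y => grown θ ν Q η 0 y ω) - (fun _ => (0 : ℝ)) ω) ^ p ∂P
        ≤ ((B * e + d * A * (1 / (n : ℝ))) * w * H) ^ p := by
      intro n hn
      have hn0 : (0 : ℝ) < n := by exact_mod_cast hn
      simp only [hL, sub_zero]
      set N : ℕ := 2 * n + x.natAbs + d with hN
      have hrefl : ∀ ω, pairing (2 * n + m + 1) (fun y => cutoff n y
          * (heat m r t (x + d - y) - heat m r t (x - y))) (fun y => grown θ ν Q η 0 y ω)
          = ∑ z ∈ Finset.Icc (-(N : ℤ)) N, heat m r t z
            * (cutoff n (x + d - z) * (grown θ ν Q η 0 (x + d - z) ω - grown θ ν Q η 0 (x - z) ω)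
              + (cutoff n (x + d - z) - cutoff n (x - z)) * grown θ ν Q η 0 (x - z) ω) := by
        intro ω
        rw [pairing_cutoff_sub, pairing_cutoff_reflect hn _ _ (N := N) (x := x + d)
          (by
            have h1 := abs_add_le x (d : ℤ)
            rw [Nat.abs_cast] at h1
            rw [hN]; push_cast; linarith),
          pairing_cutoff_reflect hn _ _ (N := N) (x := x) (by rw [Int.abs_eq_natAbs x]; push_cast [hN]; omega),
          ← Finset.sum_sub_distrib]
        exact Finset.sum_congr rfl fun z _ => by ring
      simp only [hrefl]
      have hmeas : ∀ z : ℤ, AEStronglyMeasurable (fun ω => cutoff n (x + d - z)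
          * (grown θ ν Q η 0 (x + d - z) ω - grown θ ν Q η 0 (x - z) ω)
            + (cutoff n (x + d - z) - cutoff n (x - z)) * grown θ ν Q η 0 (x - z) ω) P := fun z =>
        (((h.aestronglyMeasurable 0 (x + d - z)).sub (h.aestronglyMeasurable 0 (x - z))).const_mul _).add
          ((h.aestronglyMeasurable 0 (x - z)).const_mul _)
      have hterm : ∀ z : ℤ, eLpNorm (fun ω => cutoff n (x + d - z)
          * (grown θ ν Q η 0 (x + d - z) ω - grown θ ν Q η 0 (x - z) ω)
            + (cutoff n (x + d - z) - cutoff n (x - z)) * grown θ ν Q η 0 (x - z) ω) p P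
          ≤ ENNReal.ofReal ((B * e + d * A * (1 / (n : ℝ))) * w * Real.exp (2 * b * |(z : ℝ)|)) := by
        intro z
        refine (eLpNorm_mul_add_mul_le hp1
          ((h.aestronglyMeasurable 0 (x + d - z)).sub (h.aestronglyMeasurable 0 (x - z)))
          (h.aestronglyMeasurable 0 (x - z)) (by positivity) (by positivity)
          (hincr (x + d - z) (x - z)) (h0 (x - z)) _ _).trans (ENNReal.ofReal_le_ofReal ?_)
        have hcut := abs_cutoff_sub_le n (x + d - z) (x - z)
        push_cast at hcut ⊢
        rw [show (x : ℝ) + d - z - (x - z) = d by ring, Nat.abs_cast] at hcut ⊢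
        rw [← he]
        have hz1 : |(x : ℝ) - z| ≤ |(x : ℝ)| + |(z : ℝ)| := abs_sub _ _
        have hz2 : |(x : ℝ) + d - z| ≤ |(x : ℝ) + d| + |(z : ℝ)| := abs_sub _ _
        have hw1 : Real.exp (b * (|(x : ℝ) + d - z| + |(x : ℝ) - z|)) ≤ w * Real.exp (2 * b * |(z : ℝ)|) := by
          rw [hw, ← Real.exp_add, Real.exp_le_exp]
          nlinarith
        have hw2 : Real.exp (b * |(x : ℝ) - z|) ≤ w * Real.exp (2 * b * |(z : ℝ)|) := by
          refine le_trans (Real.exp_le_exp.mpr ?_) hw1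
          exact mul_le_mul_of_nonneg_left (le_add_of_nonneg_left (abs_nonneg _)) hb0
        calc _ ≤ 1 * (B * e * (w * Real.exp (2 * b * |(z : ℝ)|)))
              + d / n * (A * (w * Real.exp (2 * b * |(z : ℝ)|))) := by
              have := abs_cutoff_le_one n (x + d - z)
              gcongr
          _ = _ := by ring
      have hs := eLpNorm_sum_mul_le (Finset.Icc (-(N : ℤ)) N) hp1 (g := heat m r t)
        (fun z _ => hmeas z) (fun z _ => hterm z) (fun z _ => by positivity)
      refine (integral_pow_le_of_eLpNorm_le hp0 hpe
        (Finset.aestronglyMeasurable_fun_sum _ fun z _ => (hmeas z).const_mul _) (by positivity)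
        (hs.trans (ENNReal.ofReal_le_ofReal ?_))).2
      have h2 := mul_le_mul_of_nonneg_left (hp2 (Finset.Icc (-(N : ℤ)) N))
        (by positivity : 0 ≤ (B * e + d * A * (1 / (n : ℝ))) * w)
      refine le_trans (le_of_eq ?_) h2
      rw [Finset.mul_sum]
      refine Finset.sum_congr rfl fun z _ => ?_
      rw [abs_of_nonneg (heat_nonneg hr (NNReal.coe_nonneg t) z)]
      ring
    have hlim : Tendsto (fun n : ℕ => (B * e + d * A * (1 / (n : ℝ))) * w * H) atTop (𝓝 (B * e * w * H)) := by
      have hinv : Tendsto (fun n : ℕ => 1 / (n : ℝ)) atTop (𝓝 0) := tendsto_one_div_atTop_nhds_zero_nat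
      simpa using (((hinv.const_mul (d * A)).const_add (B * e)).mul_const w).mul_const H
    have key := h.moment_kernel_le hr hr1 hC hJ i (zero_le : (0 : ℝ≥0) ≤ t) (T := T) (by rw [hL]; exact ht)
      (Y := fun _ => 0) aestronglyMeasurable_const MemLp.zero' (A := κ₁ * A) (by positivity) hb0
      (fun s hs _ y => (hmom s hs y).1)
      (fun s hs hst y => (integral_pow_le_of_eLpNorm_le hp0 hpe (h.aestronglyMeasurable s y)
        (by positivity) (hZ s ((mul_le_mul_of_nonneg_left (by exact_mod_cast hst) (sq_nonneg ε)).trans ht) y)).2)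
      hv hv2 (by positivity) hG (X := fun ω => grown θ ν Q η t (x + d) ω - grown θ ν Q η t x ω)
      (by
        filter_upwards [eventually_natCast_ge x, eventually_natCast_ge (x + d)] with n hn1 hn2 ω
        rw [pairing_cutoff_sub, pairing_cutoff_heat_zero r hn2, pairing_cutoff_heat_zero r hn1])
      hlim (by filter_upwards [eventually_gt_atTop 0] with n hn; exact hinit n hn)
    simp only [sub_zero, hL, ← hsc] at key
    have hψ := rpow_le_add_one (e := 1 / 4 - v / 2) (by positivity) ht (by linarith) (by linarith)
    -- The jump term is absorbed into the Hölder factor because `d ≥ 1` and `v < 1/2`.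
    have hεe : √ε ≤ e := by
      rw [← hfac, Real.sqrt_eq_rpow]
      calc ε ^ (1 / 2 : ℝ) ≤ ε ^ v := Real.rpow_le_rpow_of_exponent_ge hε hε1.le hv2.le
        _ ≤ _ := le_mul_of_one_le_right (by positivity) (Real.one_le_rpow hd1 hv)
    set R := 2 * H * κ₁ * (T + 1) * A * e * w with hR
    have c1 : κ₁ * A * (2 * H * w * (d : ℝ) ^ v) * ε ^ v * (ε ^ 2 * (t : ℝ)) ^ (1 / 4 - v / 2) ≤ R := by
      calc _ = 2 * H * κ₁ * (ε ^ 2 * (t : ℝ)) ^ (1 / 4 - v / 2) * A * (ε ^ v * (d : ℝ) ^ v) * w := by ring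
        _ ≤ 2 * H * κ₁ * (T + 1) * A * (ε ^ v * (d : ℝ) ^ v) * w := by gcongr
        _ = R := by rw [hfac]
    have c2 : √ε * (κ₁ * A) * (2 * H * w) ≤ R := by
      calc _ ≤ e * (κ₁ * A) * (2 * H * w) := by gcongr
        _ = 2 * H * κ₁ * 1 * A * e * w := by ring
        _ ≤ _ := by rw [hR]; gcongr; linarith
    have hmemb : MemLp (fun ω => grown θ ν Q η t (x + d) ω - grown θ ν Q η t x ω) p P := by
      refine MemLp.sub ⟨h.aestronglyMeasurable _ _, ?_⟩ ⟨h.aestronglyMeasurable _ _, ?_⟩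
      · exact (hZ t ht _).trans_lt ENNReal.ofReal_lt_top
      · exact (hZ t ht _).trans_lt ENNReal.ofReal_lt_top
    refine eLpNorm_le_ofReal hp0 hpe hmemb (by positivity) (key.trans ?_)
    calc _ ≤ 2 * (B * e * w * H) ^ p + sc * (R ^ p + R ^ p) := by
          have d1 : (κ₁ * A * (2 * H * w * (d : ℝ) ^ v) * ε ^ v * (ε ^ 2 * (t : ℝ)) ^ (1 / 4 - v / 2))
              ^ (2 * i + 2) ≤ R ^ p := pow_le_pow_left₀ (by positivity) c1 _
          have d2 : (√ε * (κ₁ * A) * (2 * H * w)) ^ (2 * i)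
              * (κ₁ * A * (2 * H * w * (d : ℝ) ^ v) * ε ^ v * (ε ^ 2 * (t : ℝ)) ^ (1 / 4 - v / 2)) ^ 2
              ≤ R ^ p := by
            rw [hp, pow_add]
            gcongr
          gcongr
      _ ≤ (2 * (B * e * w * H) + (2 * sc + 1) * R) ^ p :=
          two_mul_pow_add_le hp0 (by positivity) (by positivity) hsc0
      _ ≤ _ := by
          refine pow_le_pow_left₀ (by positivity) ?_ _
          have hz : 0 ≤ 2 * H * A * e * w + (2 * sc + 1) * (2 * H * κ₁ * (T + 1)) * B * e * w := by positivity
          rw [hR]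
          linarith
  intro x y
  rcases lt_trichotomy x y with hxy | rfl | hxy
  · obtain ⟨d, hd⟩ := Int.eq_ofNat_of_zero_le (sub_nonneg.mpr hxy.le)
    obtain rfl : y = x + d := by linarith
    have := main x d (by omega)
    rw [← eLpNorm_neg] at this
    convert this using 2
    · funext ω; simp
    · push_cast
      rw [show (x : ℝ) - (x + d) = -d by ring, abs_neg, Nat.abs_cast]
  · simp
  · obtain ⟨d, hd⟩ := Int.eq_ofNat_of_zero_le (sub_nonneg.mpr hxy.le)
    obtain rfl : x = y + d := by linarith
    have := main y d (by omega)
    convert this using 2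
    push_cast
    rw [show (y : ℝ) + d - y = d by ring, Nat.abs_cast, add_comm |(y : ℝ) + d|]

end Increments

/-! ### Increments in time. -/

section TimeIncrements

variable {m : ℕ} {r : ℕ → ℝ}

theorem tendsto_sum_cutoff_heat (hr : ∀ k ∈ Finset.Icc 1 m, 0 < r k)
    (hr1 : ∑ k ∈ Finset.Icc 1 m, r k = 1) {s : ℝ} (hs : 0 ≤ s) (x : ℤ) :
    Tendsto (fun n : ℕ => ∑ y ∈ Finset.Icc (-((2 * n + m + 1 : ℕ) : ℤ)) (2 * n + m + 1 : ℕ),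
      cutoff n y * heat m r s (x - y)) atTop (𝓝 1) := by
  have h1 : HasSum (fun y => heat m r s (x - y)) 1 :=
    (Equiv.subLeft x).hasSum_iff.mpr (hasSum_heat hr hr1 hs)
  have h2 : Tendsto (fun n : ℕ => ∑' y, cutoff n y * heat m r s (x - y)) atTop
      (𝓝 (∑' y, heat m r s (x - y))) := by
    refine tendsto_tsum_of_dominated_convergence h1.summable (fun y => ?_) (Eventually.of_forall fun n y => ?_)
    · refine tendsto_const_nhds.congr' ?_
      filter_upwards [eventually_natCast_ge y] with n hn
      rw [cutoff_eq_one hn, one_mul]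
    · have := heat_nonneg hr hs (x - y)
      rw [Real.norm_of_nonneg (mul_nonneg (cutoff_nonneg n y) this)]
      exact mul_le_of_le_one_left this (cutoff_le_one n y)
  rw [h1.tsum_eq] at h2
  refine h2.congr' ?_
  filter_upwards [eventually_gt_atTop 0] with n hn
  refine tsum_eq_sum fun y hy => ?_
  rw [Finset.mem_Icc, ← abs_le] at hy
  rw [cutoff_eq_zero hn (by push_cast at hy; omega), zero_mul]

/-- A Hölder factor `|y|^v` costs `τ^(v/2)` and a tilt `1 / √τ`, which is admissible on the
diffusive scale. -/
theorem rpow_abs_le_mul_exp {τ v y : ℝ} (hτ : 0 < τ) (hy : 0 ≤ y) (hv0 : 0 ≤ v) (hv1 : v ≤ 1) :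
    y ^ v ≤ τ ^ (v / 2) * Real.exp (y * (1 / √τ)) := by
  have hs : 0 < √τ := Real.sqrt_pos.mpr hτ
  have e : τ ^ (v / 2) = √τ ^ v := by
    rw [Real.sqrt_eq_rpow, ← Real.rpow_mul hτ.le]; ring_nf
  have h0 : 0 ≤ y / √τ := by positivity
  have h1 : (y / √τ) ^ v ≤ Real.exp (y / √τ) :=
    (rpow_le_add_one h0 le_rfl hv0 hv1).trans (Real.add_one_le_exp _)
  rw [Real.div_rpow hy hs.le, div_le_iff₀ (by positivity)] at h1
  rw [e, mul_one_div]
  linarith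

set_option maxHeartbeats 1000000 in
/-- Temporal increments of the field. -/
theorem exists_temporal_increment_bound (hr : ∀ k ∈ Finset.Icc 1 m, 0 < r k)
    (hr1 : ∑ k ∈ Finset.Icc 1 m, r k = 1) {C J : ℝ} (hC : 0 ≤ C) (hJ : 0 ≤ J) (i : ℕ) {a : ℝ} (ha : 0 ≤ a)
    {T : ℝ} (hT : 0 ≤ T) {v : ℝ} (hv : 0 ≤ v) (hv2 : v < 1 / 2) :
    ∃ κ : ℝ, 0 ≤ κ ∧ ∀ {Ω : Type w} {mΩ : MeasurableSpace Ω} {P : Measure Ω}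
      {ℱ : Filtration ℝ≥0 mΩ} {rate : ℤ → ℝ≥0} {Q : jumps m × ℤ → ℝ≥0 → Ω → ℕ} {η : ℝ≥0 → Ω → ℤ → Bool}
      {ε θ ν : ℝ} [IsProbabilityMeasure P], WeaklyAsymmetric P ℱ rate Q η r ε θ ν C J →
      ∀ A : ℝ, 0 < A → ∀ B : ℝ, 0 ≤ B →
      (∀ y : ℤ, eLpNorm (grown θ ν Q η 0 y) (2 * i + 2 : ℕ) P
        ≤ ENNReal.ofReal (A * Real.exp (a * ε * |(y : ℝ)|))) →
      (∀ x y : ℤ, eLpNorm (fun ω => grown θ ν Q η 0 x ω - grown θ ν Q η 0 y ω) (2 * i + 2 : ℕ) P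
        ≤ ENNReal.ofReal (B * (ε * |(x : ℝ) - y|) ^ v * Real.exp (a * ε * (|(x : ℝ)| + |(y : ℝ)|)))) →
      ∀ s t : ℝ≥0, s ≤ t → ε ^ 2 * (t : ℝ) ≤ T → ∀ x : ℤ,
        eLpNorm (fun ω => grown θ ν Q η t x ω - grown θ ν Q η s x ω) (2 * i + 2 : ℕ) P
        ≤ ENNReal.ofReal (κ * (A + B) * (ε ^ v * max 1 (((t : ℝ) - s) ^ (v / 2)))
          * Real.exp (2 * (a * ε) * |(x : ℝ)|)) := by
  -- Covers the tilt `b + q` with `q ≤ 1` and `L q² ≤ 1`: `L (b + q)² ≤ 2 a² T + 2`.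
  obtain ⟨H, hH1, hH⟩ := HeatBounds.of_exists hr hr1 (by positivity : 0 ≤ a + 1 + (2 * a ^ 2 * T + 2))
  have hH0 : 0 ≤ H := by linarith
  obtain ⟨κ₁, hκ₁, hest⟩ := exists_weighted_bound.{w} hr hr1 hC hJ i ha T
  obtain ⟨κ₂, hκ₂, hspace⟩ := exists_spatial_increment_bound.{w} hr hr1 hC hJ i ha hT hv hv2
  set sc := scaledConst m i C J T 0 with hsc
  have hsc0 : 0 ≤ sc := scaledConst_nonneg m i hC hJ hT (by norm_num)
  refine ⟨2 * (κ₂ * H) + (2 * sc + 1) * (H * κ₁ * (T + 1)), by positivity, ?_⟩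
  intro Ω mΩ P ℱ rate Q η ε θ ν _ h A hA B hB h0 hincr s t hst ht x
  have hε := h.pos
  have hε1 := h.lt_one
  set b := a * ε with hb
  have hb0 : 0 ≤ b := by positivity
  set p := 2 * i + 2 with hp
  have hpe : Even p := ⟨i + 1, by omega⟩
  have hp0 : p ≠ 0 := by omega
  have hp1 : (1 : ℝ≥0∞) ≤ p := by exact_mod_cast (by omega : 1 ≤ 2 * i + 2)
  have hmono : ∀ u : ℝ≥0, u ≤ t → ε ^ 2 * (u : ℝ) ≤ T := fun u hu =>
    (mul_le_mul_of_nonneg_left (by exact_mod_cast hu) (sq_nonneg ε)).trans ht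
  have hZ := hest h A hA h0
  have hΔ := hspace h A hA B hB h0 hincr s (hmono s hst)
  set L : ℝ := (t : ℝ) - s with hL
  have hL0 : 0 ≤ L := sub_nonneg.mpr hst
  have hLT : ε ^ 2 * L ≤ T :=
    (mul_le_mul_of_nonneg_left (by rw [hL]; linarith [NNReal.coe_nonneg s]) (sq_nonneg ε)).trans ht
  have hba : b ≤ a := by rw [hb]; nlinarith
  have hb2 : L * b ^ 2 ≤ a ^ 2 * T := by
    calc L * b ^ 2 = a ^ 2 * (ε ^ 2 * L) := by rw [hb]; ring
      _ ≤ _ := by gcongr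
  have haT : 0 ≤ a ^ 2 * T := by positivity
  -- For time differences below one the tilt `1 / √L` would be unbounded. This maximum is the origin
  -- of the `1 ∨ ·` in the final bound.
  set τ := max 1 L with hτ
  have hτ1 : 1 ≤ τ := le_max_left _ _
  have hτ0 : 0 < τ := by linarith
  set q := 1 / √τ with hq
  have hq0 : 0 ≤ q := by positivity
  have hq1 : q ≤ 1 := by
    rw [hq, div_le_one (Real.sqrt_pos.mpr hτ0)]; exact Real.one_le_sqrt.mpr hτ1
  have hLq : L * q ^ 2 ≤ 1 := by
    rw [hq, div_pow, one_pow, Real.sq_sqrt hτ0.le, mul_one_div, div_le_one hτ0]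
    exact le_max_right _ _
  have hτv : τ ^ (v / 2) = max 1 (L ^ (v / 2)) := by
    rcases le_total 1 L with h | h
    · rw [hτ, max_eq_right h, max_eq_right (Real.one_le_rpow h (by linarith))]
    · rw [hτ, max_eq_left h, Real.one_rpow, max_eq_left (Real.rpow_le_one hL0 h (by linarith))]
  set Ξ := ε ^ v * max 1 (L ^ (v / 2)) with hΞ
  have hΞ0 : 0 ≤ Ξ := by positivity
  set W := Real.exp (2 * b * |(x : ℝ)|) with hW
  have hwW : Real.exp (b * |(x : ℝ)|) ≤ W := by
    rw [hW, Real.exp_le_exp]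
    nlinarith [mul_nonneg hb0 (abs_nonneg (x : ℝ))]
  have hG := hH.kernelBound_point hr hr1 (L := L) hb0
    (by linarith : b ≤ a + 1 + (2 * a ^ 2 * T + 2)) (by linarith) x
  have hheat : ∀ F : Finset ℤ, ∑ z ∈ F, heat m r L z * Real.exp ((b + q) * |(z : ℝ)|) ≤ H := by
    refine (hH L (b + q) hL0 (by positivity) (by linarith) ?_).1
    have : L * (b + q) ^ 2 ≤ 2 * (L * b ^ 2) + 2 * (L * q ^ 2) := by
      nlinarith [mul_nonneg hL0 (sq_nonneg (b - q))]
    linarith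
  have hmom := fun (u : ℝ≥0) (hu : (0 : ℝ≥0) ≤ u) (y : ℤ) =>
    h.integrable_of_le (c := fun y : ℤ => A * Real.exp (b * |(y : ℝ)|)) (fun y => by positivity) h0 hu y
  have hmemZ : ∀ u, u ≤ t → MemLp (grown θ ν Q η u x) p P := fun u hu =>
    ⟨h.aestronglyMeasurable _ _, (hZ u (hmono u hu) _).trans_lt ENNReal.ofReal_lt_top⟩
  -- The heat kernel average of `Z_s` minus `Z_s(x)` is the average of the spatial increments at
  -- time `s`, up to the mass `1 - σ` lost by the cutoff, which vanishes in the limit.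
  have hinit : ∀ n : ℕ, ∫ ω, (pairing (2 * n + m + 1) (fun y => cutoff n y * heat m r L (x - y))
      (fun y => grown θ ν Q η s y ω) - grown θ ν Q η s x ω) ^ p ∂P
      ≤ (κ₂ * (A + B) * Ξ * W * H + |1 - ∑ y ∈ Finset.Icc (-((2 * n + m + 1 : ℕ) : ℤ)) (2 * n + m + 1 : ℕ),
        cutoff n y * heat m r L (x - y)| * (κ₁ * A * Real.exp (b * |(x : ℝ)|))) ^ p := by
    intro n
    set S := Finset.Icc (-((2 * n + m + 1 : ℕ) : ℤ)) (2 * n + m + 1 : ℕ) with hS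
    set σ := ∑ y ∈ S, cutoff n y * heat m r L (x - y) with hσ
    have hid : ∀ ω, pairing (2 * n + m + 1) (fun y => cutoff n y * heat m r L (x - y))
        (fun y => grown θ ν Q η s y ω) - grown θ ν Q η s x ω
        = 1 * (∑ y ∈ S, cutoff n y * heat m r L (x - y) * (grown θ ν Q η s y ω - grown θ ν Q η s x ω))
          + (-(1 - σ)) * grown θ ν Q η s x ω := by
      intro ω
      unfold pairing
      simp only [mul_sub, Finset.sum_sub_distrib, ← Finset.sum_mul, ← hσ]
      ring
    simp only [hid]
    have hm : ∀ y, AEStronglyMeasurable (fun ω => grown θ ν Q η s y ω - grown θ ν Q η s x ω) P := fun y =>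
      (h.aestronglyMeasurable s y).sub (h.aestronglyMeasurable s x)
    have hm2 : AEStronglyMeasurable (fun ω => ∑ y ∈ S, cutoff n y * heat m r L (x - y)
        * (grown θ ν Q η s y ω - grown θ ν Q η s x ω)) P :=
      Finset.aestronglyMeasurable_fun_sum _ fun y _ => (hm y).const_mul _
    have hs1 := eLpNorm_sum_mul_le S hp1 (g := fun y => cutoff n y * heat m r L (x - y))
      (fun y _ => hm y) (fun y _ => hΔ y x) (fun y _ => by positivity)
    have hs2 : ∑ y ∈ S, |cutoff n y * heat m r L (x - y)| * (κ₂ * (A + B) * (ε * |(y : ℝ) - x|) ^ v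
        * Real.exp (b * (|(y : ℝ)| + |(x : ℝ)|))) ≤ κ₂ * (A + B) * Ξ * W * H := by
      have h1 := hheat (S.map (Equiv.subLeft x).toEmbedding)
      rw [Finset.sum_map] at h1
      refine le_trans ?_ (mul_le_mul_of_nonneg_left h1 (by positivity))
      rw [Finset.mul_sum]
      refine Finset.sum_le_sum fun y _ => ?_
      change _ ≤ κ₂ * (A + B) * Ξ * W
        * (heat m r L (x - y) * Real.exp ((b + q) * |((x - y : ℤ) : ℝ)|))
      have hp := heat_nonneg hr hL0 (x - y)
      rw [abs_mul, abs_of_nonneg hp, Real.mul_rpow hε.le (abs_nonneg _), abs_sub_comm (y : ℝ)]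
      have a1 := rpow_abs_le_mul_exp hτ0 (abs_nonneg ((x : ℝ) - y)) hv (by linarith)
      have a2 : Real.exp (b * (|(y : ℝ)| + |(x : ℝ)|)) ≤ W * Real.exp (b * |(x : ℝ) - y|) := by
        have a3 : |(y : ℝ)| ≤ |(x : ℝ)| + |(x : ℝ) - y| := by
          calc |(y : ℝ)| = |(x : ℝ) - (x - y)| := by ring_nf
            _ ≤ _ := abs_sub _ _
        rw [hW, ← Real.exp_add, Real.exp_le_exp]
        nlinarith
      have a4 := abs_cutoff_le_one n y
      have e1 : Real.exp ((b + q) * |((x - y : ℤ) : ℝ)|)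
          = Real.exp (|(x : ℝ) - y| * q) * Real.exp (b * |(x : ℝ) - y|) := by
        rw [← Real.exp_add]; push_cast; ring_nf
      calc _ ≤ 1 * heat m r L (x - y) * (κ₂ * (A + B) * (ε ^ v * (τ ^ (v / 2)
            * Real.exp (|(x : ℝ) - y| * q))) * (W * Real.exp (b * |(x : ℝ) - y|))) := by gcongr
        _ = _ := by rw [e1, hΞ, ← hτv]; ring
    have hs3 := eLpNorm_mul_add_mul_le hp1 hm2 (h.aestronglyMeasurable s x) (by positivity) (by positivity)
      (hs1.trans (ENNReal.ofReal_le_ofReal hs2)) (hZ s (hmono s hst) x) 1 (-(1 - σ))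
    rw [abs_one, one_mul, abs_neg] at hs3
    exact (integral_pow_le_of_eLpNorm_le hp0 hpe
      ((hm2.const_mul _).add ((h.aestronglyMeasurable s x).const_mul _)) (by positivity) hs3).2
  have hlim : Tendsto (fun n : ℕ => κ₂ * (A + B) * Ξ * W * H
      + |1 - ∑ y ∈ Finset.Icc (-((2 * n + m + 1 : ℕ) : ℤ)) (2 * n + m + 1 : ℕ),
        cutoff n y * heat m r L (x - y)| * (κ₁ * A * Real.exp (b * |(x : ℝ)|))) atTop
      (𝓝 (κ₂ * (A + B) * Ξ * W * H)) := by
    have h1 := ((tendsto_sum_cutoff_heat hr hr1 hL0 x).const_sub 1).abs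
    rw [sub_self, abs_zero] at h1
    simpa using (h1.mul_const (κ₁ * A * Real.exp (b * |(x : ℝ)|))).const_add (κ₂ * (A + B) * Ξ * W * H)
  have key := h.moment_kernel_le hr hr1 hC hJ i hst (T := T) hLT
    (h.process.aestronglyMeasurable_grown θ ν s x) (hmemZ s hst) (A := κ₁ * A) (by positivity) hb0
    (fun u _ _ y => (hmom u zero_le y).1)
    (fun u _ hut y => (integral_pow_le_of_eLpNorm_le hp0 hpe (h.aestronglyMeasurable u y)
      (by positivity) (hZ u (hmono u hut) y)).2)
    le_rfl (by norm_num) (by positivity) hG (X := grown θ ν Q η t x)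
    (by filter_upwards [eventually_natCast_ge x] with n hn ω; exact pairing_cutoff_heat_zero r hn _)
    hlim (Eventually.of_forall hinit)
  simp only [sub_zero, zero_div, Real.rpow_zero, mul_one, ← hsc] at key
  -- Here `1/4 ≥ v/2`, so the natural exponent of the noise is at least as good as the required one.
  have hψ : (ε ^ 2 * L) ^ (1 / 4 : ℝ) ≤ (T + 1) * Ξ := by
    have e1 : (ε ^ 2 * L) ^ (v / 2) = ε ^ v * L ^ (v / 2) := by
      rw [Real.mul_rpow (sq_nonneg ε) hL0, ← Real.rpow_natCast ε 2, ← Real.rpow_mul hε.le]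
      congr 2
      push_cast; ring
    have e2 : (ε ^ 2 * L) ^ (1 / 4 : ℝ) = (ε ^ 2 * L) ^ (1 / 4 - v / 2) * (ε ^ 2 * L) ^ (v / 2) := by
      rw [← Real.rpow_add_of_nonneg (by positivity) (by linarith) (by linarith)]; ring_nf
    rw [e2, e1]
    have := rpow_le_add_one (e := 1 / 4 - v / 2) (by positivity) hLT (by linarith) (by linarith)
    refine mul_le_mul this ?_ (by positivity) (by positivity)
    exact mul_le_mul_of_nonneg_left (le_max_right _ _) (by positivity)
  have hεΞ : √ε ≤ Ξ := by
    rw [Real.sqrt_eq_rpow]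
    calc ε ^ (1 / 2 : ℝ) ≤ ε ^ v := Real.rpow_le_rpow_of_exponent_ge hε hε1.le hv2.le
      _ ≤ _ := le_mul_of_one_le_right (by positivity) (le_max_left _ _)
  set R := H * κ₁ * (T + 1) * A * Ξ * W with hR
  have c1 : κ₁ * A * (H * Real.exp (b * |(x : ℝ)|)) * (ε ^ 2 * L) ^ (1 / 4 : ℝ) ≤ R := by
    calc _ ≤ κ₁ * A * (H * W) * ((T + 1) * Ξ) := by gcongr
      _ = R := by rw [hR]; ring
  have c2 : √ε * (κ₁ * A) * (H * Real.exp (b * |(x : ℝ)|)) ≤ R := by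
    calc _ ≤ Ξ * (κ₁ * A) * (H * W) := by gcongr
      _ = H * κ₁ * 1 * A * Ξ * W := by ring
      _ ≤ _ := by rw [hR]; gcongr; linarith
  refine eLpNorm_le_ofReal hp0 hpe ((hmemZ t le_rfl).sub (hmemZ s hst)) (by positivity) (key.trans ?_)
  calc _ ≤ 2 * (κ₂ * (A + B) * Ξ * W * H) ^ p + sc * (R ^ p + R ^ p) := by
        have d1 : (κ₁ * A * (H * Real.exp (b * |(x : ℝ)|)) * (ε ^ 2 * L) ^ (1 / 4 : ℝ))
            ^ (2 * i + 2) ≤ R ^ p := pow_le_pow_left₀ (by positivity) c1 _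
        have d2 : (√ε * (κ₁ * A) * (H * Real.exp (b * |(x : ℝ)|))) ^ (2 * i)
            * (κ₁ * A * (H * Real.exp (b * |(x : ℝ)|)) * (ε ^ 2 * L) ^ (1 / 4 : ℝ)) ^ 2 ≤ R ^ p := by
          rw [hp, pow_add]
          gcongr
        gcongr
    _ ≤ (2 * (κ₂ * (A + B) * Ξ * W * H) + (2 * sc + 1) * R) ^ p :=
        two_mul_pow_add_le hp0 (by positivity) (by positivity) hsc0
    _ ≤ _ := by
        refine pow_le_pow_left₀ (by positivity) ?_ _
        have hz : 0 ≤ (2 * sc + 1) * (H * κ₁ * (T + 1)) * B * Ξ * W := by positivity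
        rw [hR]
        linarith

end TimeIncrements

/-! ### Norms with infinite values, and the weakly asymmetric regime. -/

section Main

variable {Ω : Type*} {mΩ : MeasurableSpace Ω} {P : Measure Ω}

theorem ofReal_exp_neg_mul (E : ℝ≥0∞) (c : ℝ) :
    E * ENNReal.ofReal (Real.exp (-c)) * ENNReal.ofReal (Real.exp c) = E := by
  rw [mul_assoc, ← ENNReal.ofReal_mul (Real.exp_pos _).le, ← Real.exp_add, neg_add_cancel, Real.exp_zero,
    ENNReal.ofReal_one, mul_one]

theorem eLpNorm_le_weightedNorm (ε a : ℝ) (l : ℝ≥0∞) (f : ℤ → Ω → ℝ)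
    (h : weightedNorm P ε a l f ≠ ⊤) (x : ℤ) : eLpNorm (f x) l P
      ≤ ENNReal.ofReal ((weightedNorm P ε a l f).toReal * Real.exp (a * ε * |(x : ℝ)|)) := by
  rw [ENNReal.ofReal_mul ENNReal.toReal_nonneg, ENNReal.ofReal_toReal h,
    ← ofReal_exp_neg_mul (eLpNorm (f x) l P) (a * ε * |(x : ℝ)|)]
  exact mul_le_mul_left (le_iSup (fun x : ℤ => eLpNorm (f x) l P
    * ENNReal.ofReal (Real.exp (-(a * ε * |(x : ℝ)|)))) x) _

theorem weightedNorm_le {ε a A : ℝ} (hA : 0 ≤ A) {l : ℝ≥0∞} {f : ℤ → Ω → ℝ}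
    (h : ∀ x : ℤ, eLpNorm (f x) l P ≤ ENNReal.ofReal (A * Real.exp (a * ε * |(x : ℝ)|))) :
    weightedNorm P ε a l f ≤ ENNReal.ofReal A := by
  refine iSup_le fun x => (mul_le_mul_left (h x) _).trans (le_of_eq ?_)
  rw [← ENNReal.ofReal_mul (by positivity), mul_assoc, ← Real.exp_add, add_neg_cancel, Real.exp_zero, mul_one]

theorem eLpNorm_sub_le_holderNorm {ε : ℝ} (hε : 0 < ε) (a : ℝ) (l : ℝ≥0∞) {v : ℝ} (f : ℤ → Ω → ℝ)
    (h : holderNorm P ε a l v f ≠ ⊤) (x y : ℤ) : eLpNorm (fun ω => f x ω - f y ω) l P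
      ≤ ENNReal.ofReal ((holderNorm P ε a l v f).toReal * (ε * |(x : ℝ) - y|) ^ v
        * Real.exp (a * ε * (|(x : ℝ)| + |(y : ℝ)|))) := by
  rcases eq_or_ne x y with rfl | hxy
  · simp
  have h0 : 0 < |(x : ℝ) - y| := abs_pos.mpr (sub_ne_zero.mpr (by exact_mod_cast hxy))
  have e1 : |ε * ((x : ℝ) - y)| = ε * |(x : ℝ) - y| := by rw [abs_mul, abs_of_pos hε]
  have h1 : ENNReal.ofReal ((ε * |(x : ℝ) - y|) ^ (-v)) * eLpNorm (f x - f y) l P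
      * ENNReal.ofReal (Real.exp (-(a * ε * (|(x : ℝ)| + |(y : ℝ)|)))) ≤ holderNorm P ε a l v f := by
    rw [← e1]
    exact le_iSup₂_of_le x y (le_iSup_of_le hxy le_rfl)
  have e2 : ENNReal.ofReal ((ε * |(x : ℝ) - y|) ^ v) * ENNReal.ofReal ((ε * |(x : ℝ) - y|) ^ (-v)) = 1 := by
    rw [← ENNReal.ofReal_mul (by positivity), ← Real.rpow_add (by positivity), add_neg_cancel,
      Real.rpow_zero, ENNReal.ofReal_one]
  rw [mul_assoc, ENNReal.ofReal_mul ENNReal.toReal_nonneg, ENNReal.ofReal_toReal h,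
    ENNReal.ofReal_mul (by positivity)]
  change eLpNorm (f x - f y) l P ≤ _
  calc eLpNorm (f x - f y) l P = (ENNReal.ofReal ((ε * |(x : ℝ) - y|) ^ v)
        * ENNReal.ofReal ((ε * |(x : ℝ) - y|) ^ (-v))) * (eLpNorm (f x - f y) l P
        * ENNReal.ofReal (Real.exp (-(a * ε * (|(x : ℝ)| + |(y : ℝ)|))))
        * ENNReal.ofReal (Real.exp (a * ε * (|(x : ℝ)| + |(y : ℝ)|)))) := by
        rw [e2, one_mul, ofReal_exp_neg_mul]
    _ = (ENNReal.ofReal ((ε * |(x : ℝ) - y|) ^ (-v)) * eLpNorm (f x - f y) l P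
        * ENNReal.ofReal (Real.exp (-(a * ε * (|(x : ℝ)| + |(y : ℝ)|)))))
        * (ENNReal.ofReal ((ε * |(x : ℝ) - y|) ^ v)
        * ENNReal.ofReal (Real.exp (a * ε * (|(x : ℝ)| + |(y : ℝ)|)))) := by ring
    _ ≤ _ := mul_le_mul_left h1 _

/-- If one of the norms is infinite, the right side is infinite; this needs all the factors in front
to be positive, as `0 * ⊤ = 0`. -/
theorem le_of_finite_norms {E N N' : ℝ≥0∞} {κ X Y : ℝ} {C : ℝ≥0} (hC : 0 < C) (hκ : κ ≤ C) (hX : 0 < X)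
    (hY : 0 < Y) (h : N ≠ ⊤ → N' ≠ ⊤ → E ≤ ENNReal.ofReal (κ * (N.toReal + N'.toReal) * X * Y)) :
    E ≤ C * ENNReal.ofReal X * ENNReal.ofReal Y * (N + N') := by
  by_cases hN : N + N' = ⊤
  · rw [hN, ENNReal.mul_top]
    · exact le_top
    · exact mul_ne_zero (mul_ne_zero (by simpa using hC.ne') (by simpa using hX)) (by simpa using hY)
  rw [ENNReal.add_eq_top, not_or] at hN
  refine (h hN.1 hN.2).trans ?_
  rw [← ENNReal.ofReal_toReal hN.1, ← ENNReal.ofReal_toReal hN.2, ENNReal.toReal_ofReal (by positivity),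
    ENNReal.toReal_ofReal (by positivity), ← ENNReal.ofReal_add (by positivity) (by positivity),
    ← ENNReal.ofReal_coe_nnreal, ← ENNReal.ofReal_mul (by positivity), ← ENNReal.ofReal_mul (by positivity),
    ← ENNReal.ofReal_mul (by positivity)]
  refine ENNReal.ofReal_le_ofReal ?_
  have : 0 ≤ N.toReal + N'.toReal := by positivity
  calc _ ≤ (C : ℝ) * (N.toReal + N'.toReal) * X * Y := by gcongr
    _ = _ := by ring

/-- The field is strictly positive, so its norm can serve as the constant `A > 0` of the estimates
above. -/
theorem weightedNorm_pos [IsProbabilityMeasure P] {m : ℕ} {ℱ : Filtration ℝ≥0 mΩ} {rate : ℤ → ℝ≥0}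
    {Q : jumps m × ℤ → ℝ≥0 → Ω → ℕ} {η : ℝ≥0 → Ω → ℤ → Bool} {r : ℕ → ℝ} {ε θ ν C J : ℝ}
    (h : WeaklyAsymmetric P ℱ rate Q η r ε θ ν C J) (a : ℝ) {p : ℕ} (hp : p ≠ 0)
    (hfin : weightedNorm P ε a p (grown θ ν Q η 0) ≠ ⊤) :
    0 < (weightedNorm P ε a p (grown θ ν Q η 0)).toReal := by
  refine ENNReal.toReal_nonneg.lt_of_ne fun h0 => ?_
  have h1 := eLpNorm_le_weightedNorm ε a p (grown θ ν Q η 0) hfin 0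
  rw [← h0, zero_mul, ENNReal.ofReal_zero, nonpos_iff_eq_zero,
    eLpNorm_eq_zero_iff (h.aestronglyMeasurable 0 0) (by simpa using hp)] at h1
  obtain ⟨ω, hω⟩ := h1.exists
  exact (grown_pos θ ν 0 0 ω).ne' hω

/-- The assumptions on the rates put the process into the weakly asymmetric regime. -/
theorem exists_weaklyAsymmetric {m : ℕ} (hm : m ≤ 3) {lam : ℝ} (hlam : 0 < lam)
    {r : ℕ → ℝ} (hr : ∀ k ∈ Finset.Icc 1 m, 0 < r k) (hr1 : ∑ k ∈ Finset.Icc 1 m, r k = 1)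
    {γ : ℝ → ℕ → ℝ} (hγ : ∀ k ∈ Finset.Icc 1 m, ∃ c : ℝ, ∀ ε ∈ Set.Ioo (0 : ℝ) 1,
      |γ ε k - gammaLimit m lam r k| ≤ c * ε) {rStar : ℕ → ℝ} {rt : ℝ → ℕ → ℝ}
    (hrt : ∀ k ∈ Finset.Icc 1 m, ∃ c : ℝ, ∀ ε ∈ Set.Ioo (0 : ℝ) 1,
      |rt ε k - (r k + ε * rStar k)| ≤ c * ε ^ (3 / 2 : ℝ)) :
    ∃ C J : ℝ, 0 ≤ C ∧ 0 ≤ J ∧ ∀ ε ∈ Set.Ioo (0 : ℝ) 1, (∀ k ∈ Finset.Icc 1 m, |γ ε k| * √ε ≤ 1) →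
      ∀ {Ω : Type w} {mΩ : MeasurableSpace Ω} {P : Measure Ω} {ℱ : Filtration ℝ≥0 mΩ}
        {Q : jumps m × ℤ → ℝ≥0 → Ω → ℕ} {η : ℝ≥0 → Ω → ℤ → Bool},
        IsExclusionProcess P ℱ m (fun k => (hopRate r (γ ε) ε k).toNNReal) Q η →
        WeaklyAsymmetric P ℱ (fun k => (hopRate r (γ ε) ε k).toNNReal) Q η r ε (lam * √ε)
          (ε * nu m lam r (γ ε) (rt ε) ε) C J := by
  choose! c hc using hγ
  choose! c' hc' using hrt
  -- A single constant that dominates all the error terms of the finitely many `k`.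
  set K := ∑ k ∈ Finset.Icc 1 m, (|c k| + |c' k| + |rStar k|) with hK
  have hK0 : 0 ≤ K := Finset.sum_nonneg fun k _ => by positivity
  have hle : ∀ k ∈ Finset.Icc 1 m, |c k| + |c' k| + |rStar k| ≤ K := fun k hk =>
    Finset.single_le_sum (f := fun k => |c k| + |c' k| + |rStar k|) (fun k _ => by positivity) hk
  obtain ⟨C, hC, hD⟩ := exists_driftBound hm hlam hr hr1 hK0
  refine ⟨C, 2 * lam * Real.exp (2 * lam), hC, by positivity, ?_⟩
  intro ε hε hpos Ω mΩ P ℱ Q η h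
  have hε0 := hε.1
  refine ⟨h, hD ε hε (γ ε) (rt ε) (fun k hk => ?_) (fun k hk => ?_) hpos, hε.1, hε.2, by positivity, ?_⟩
  · refine (hc k hk ε hε).trans (mul_le_mul_of_nonneg_right ?_ hε0.le)
    linarith [hle k hk, le_abs_self (c k), abs_nonneg (c' k), abs_nonneg (rStar k)]
  · have h1 := hc' k hk ε hε
    -- Only `r̃_k = r_k + O(ε)` is needed, so the correction `r*_k` goes into the error.
    have h2 : ε ^ (3 / 2 : ℝ) ≤ ε := by
      conv_rhs => rw [← Real.rpow_one ε]
      exact Real.rpow_le_rpow_of_exponent_ge hε0 hε.2.le (by norm_num)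
    have h3 : c' k * ε ^ (3 / 2 : ℝ) ≤ |c' k| * ε :=
      mul_le_mul (le_abs_self _) h2 (by positivity) (abs_nonneg _)
    have h4 : |ε * rStar k| = |rStar k| * ε := by rw [abs_mul, abs_of_pos hε0, mul_comm]
    calc |rt ε k - r k| = |(rt ε k - (r k + ε * rStar k)) + ε * rStar k| := by ring_nf
      _ ≤ |c' k| * ε + |rStar k| * ε := (abs_add_le _ _).trans (by linarith)
      _ ≤ K * ε := by rw [← add_mul]; exact mul_le_mul_of_nonneg_right
                        (by linarith [hle k hk, abs_nonneg (c k)]) hε0.le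
  · have hs : √ε ≤ 1 := Real.sqrt_le_one.mpr hε.2.le
    have : Real.exp (2 * (lam * √ε)) ≤ Real.exp (2 * lam) :=
      Real.exp_le_exp.mpr (by nlinarith)
    calc _ = 2 * lam * √ε * Real.exp (2 * (lam * √ε)) := by ring
      _ ≤ 2 * lam * √ε * Real.exp (2 * lam) := by gcongr
      _ = _ := by ring

end Main

end FiniteRangeExclusion

end

/-! ### The proposition. -/

open FiniteRangeExclusion in
theorem proposition3p3
    (m : ℕ) (hm : m ≤ 3)
    (lam : ℝ) (hlam : 0 < lam)
    (r : ℕ → ℝ) (hr : ∀ k ∈ Finset.Icc 1 m, 0 < r k) (hr1 : ∑ k ∈ Finset.Icc 1 m, r k = 1)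
    (γ : ℝ → ℕ → ℝ)
    (hγ : ∀ k ∈ Finset.Icc 1 m, ∃ c : ℝ, ∀ ε ∈ Set.Ioo (0 : ℝ) 1,
      |γ ε k - gammaLimit m lam r k| ≤ c * ε)
    (rStar : ℕ → ℝ) (rt : ℝ → ℕ → ℝ)
    (hrt : ∀ k ∈ Finset.Icc 1 m, ∃ c : ℝ, ∀ ε ∈ Set.Ioo (0 : ℝ) 1,
      |rt ε k - (r k + ε * rStar k)| ≤ c * ε ^ (3 / 2 : ℝ))
    (T : ℝ) (hT : 0 < T) (a : ℝ) (ha : 0 ≤ a) (j : ℕ) (hj : 1 ≤ j) :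
    (∃ C : ℝ≥0, ∀ ε ∈ Set.Ioo (0 : ℝ) 1, (∀ k ∈ Finset.Icc 1 m, |γ ε k| * √ε ≤ 1) →
      ∀ (Ω : Type w) (mΩ : MeasurableSpace Ω) (P : Measure Ω) (_ : IsProbabilityMeasure P)
        (ℱ : Filtration ℝ≥0 mΩ)
        (Q : jumps m × ℤ → ℝ≥0 → Ω → ℕ) (η : ℝ≥0 → Ω → ℤ → Bool),
        IsExclusionProcess P ℱ m (fun k => (hopRate r (γ ε) ε k).toNNReal) Q η →
        ∀ Z : ℝ≥0 → ℤ → Ω → ℝ, Z = Zfield lam ε (nu m lam r (γ ε) (rt ε) ε) Q η →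
        ∀ t : ℝ≥0, (t : ℝ) ≤ T / ε ^ 2 →
          weightedNorm P ε a (2 * (j : ℝ≥0∞)) (Z t)
            ≤ C * weightedNorm P ε a (2 * (j : ℝ≥0∞)) (Z 0)) ∧
    (∀ u ∈ Set.Ioo (0 : ℝ) 1,
      ∃ C : ℝ≥0, ∀ ε ∈ Set.Ioo (0 : ℝ) 1, (∀ k ∈ Finset.Icc 1 m, |γ ε k| * √ε ≤ 1) →
      ∀ (Ω : Type w) (mΩ : MeasurableSpace Ω) (P : Measure Ω) (_ : IsProbabilityMeasure P)
        (ℱ : Filtration ℝ≥0 mΩ)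
        (Q : jumps m × ℤ → ℝ≥0 → Ω → ℕ) (η : ℝ≥0 → Ω → ℤ → Bool),
        IsExclusionProcess P ℱ m (fun k => (hopRate r (γ ε) ε k).toNNReal) Q η →
        ∀ Z : ℝ≥0 → ℤ → Ω → ℝ, Z = Zfield lam ε (nu m lam r (γ ε) (rt ε) ε) Q η →
        (∀ t : ℝ≥0, (t : ℝ) ≤ T / ε ^ 2 → ∀ x x' : ℤ,
          eLpNorm (Z t x - Z t x') (2 * (j : ℝ≥0∞)) P
            ≤ C * ENNReal.ofReal ((ε * |(x : ℝ) - (x' : ℝ)|) ^ (u / 2))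
              * ENNReal.ofReal (Real.exp (a * ε * (|(x : ℝ)| + |(x' : ℝ)|)))
              * (weightedNorm P ε a (2 * (j : ℝ≥0∞)) (Z 0)
                + holderNorm P ε a (2 * (j : ℝ≥0∞)) (u / 2) (Z 0))) ∧
        (∀ t t' : ℝ≥0, (t : ℝ) ≤ T / ε ^ 2 → (t' : ℝ) ≤ T / ε ^ 2 → ∀ x : ℤ,
          eLpNorm (Z t x - Z t' x) (2 * (j : ℝ≥0∞)) P
            ≤ C * ENNReal.ofReal (max 1 (|(t' : ℝ) - (t : ℝ)| ^ (u / 4)))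
              * ENNReal.ofReal (ε ^ (u / 2))
              * ENNReal.ofReal (Real.exp (2 * a * ε * |(x : ℝ)|))
              * (weightedNorm P ε a (2 * (j : ℝ≥0∞)) (Z 0)
                + holderNorm P ε a (2 * (j : ℝ≥0∞)) (u / 2) (Z 0)))) := by
  obtain ⟨D, J, hD, hJ, hreg⟩ := exists_weaklyAsymmetric.{w} hm hlam hr hr1 hγ hrt
  -- The moment estimates are stated for the exponents `2 i + 2`.
  obtain ⟨i, rfl⟩ : ∃ i, j = i + 1 := ⟨j - 1, by omega⟩
  have hexp : 2 * ((i + 1 : ℕ) : ℝ≥0∞) = ((2 * i + 2 : ℕ) : ℝ≥0∞) := by push_cast; ring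
  have htime : ∀ {ε : ℝ} {t : ℝ≥0}, 0 < ε → (t : ℝ) ≤ T / ε ^ 2 → ε ^ 2 * (t : ℝ) ≤ T := by
    intro ε t hε ht
    rw [le_div_iff₀ (by positivity)] at ht
    linarith
  rw [hexp]
  refine ⟨?_, fun u hu => ?_⟩
  · obtain ⟨κ, hκ, hest⟩ := exists_weighted_bound.{w} hr hr1 hD hJ i ha T
    refine ⟨κ.toNNReal, fun ε hε hpos Ω mΩ P _ ℱ Q η hη Z hZ t ht => ?_⟩
    have h := hreg ε hε hpos hη
    rw [Zfield_eq_grown] at hZ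
    subst hZ
    set Z := grown (lam * √ε) (ε * nu m lam r (γ ε) (rt ε) ε) Q η
    by_cases htop : weightedNorm P ε a (2 * i + 2 : ℕ) (Z 0) = ⊤
    · rw [htop, ENNReal.mul_top]
      · exact le_top
      · rw [ne_eq, ENNReal.coe_eq_zero, Real.toNNReal_eq_zero]
        linarith
    have hA := weightedNorm_pos h a (by omega) htop
    have key := hest h _ hA (eLpNorm_le_weightedNorm ε a _ (Z 0) htop) t (htime hε.1 ht)
    refine (weightedNorm_le (by positivity) key).trans (le_of_eq ?_)
    rw [ENNReal.ofReal_mul (by linarith), ENNReal.ofReal_toReal htop]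
    rfl
  · obtain ⟨κ₁, hκ₁, hspace⟩ := exists_spatial_increment_bound.{w} hr hr1 hD hJ i ha hT.le
      (v := u / 2) (by linarith [hu.1]) (by linarith [hu.2])
    obtain ⟨κ₂, hκ₂, htemp⟩ := exists_temporal_increment_bound.{w} hr hr1 hD hJ i ha hT.le
      (v := u / 2) (by linarith [hu.1]) (by linarith [hu.2])
    -- The summand `1` keeps the constant positive, which matters when a norm is infinite.
    have hC : ((κ₁ + κ₂ + 1).toNNReal : ℝ) = κ₁ + κ₂ + 1 := Real.coe_toNNReal _ (by positivity)
    have hC0 : 0 < (κ₁ + κ₂ + 1).toNNReal := Real.toNNReal_pos.mpr (by positivity)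
    refine ⟨(κ₁ + κ₂ + 1).toNNReal, fun ε hε hpos Ω mΩ P _ ℱ Q η hη Z hZ => ?_⟩
    have h := hreg ε hε hpos hη
    have hε0 := hε.1
    rw [Zfield_eq_grown] at hZ
    subst hZ
    set Z := grown (lam * √ε) (ε * nu m lam r (γ ε) (rt ε) ε) Q η
    refine ⟨fun t ht x x' => ?_, fun t t' ht ht' x => ?_⟩
    -- On the diagonal the Hölder factor vanishes, so `le_of_finite_norms` does not apply, but the
    -- left side is zero.
    · rcases eq_or_ne x x' with rfl | hx
      · simp
      have hx0 : 0 < |(x : ℝ) - x'| := abs_pos.mpr (sub_ne_zero.mpr (by exact_mod_cast hx))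
      refine le_of_finite_norms hC0 (κ := κ₁) (by rw [hC]; linarith) (by positivity) (by positivity)
        fun hN hN' => ?_
      exact hspace h _ (weightedNorm_pos h a (by omega) hN) _ ENNReal.toReal_nonneg
        (eLpNorm_le_weightedNorm ε a _ (Z 0) hN) (eLpNorm_sub_le_holderNorm hε0 a _ (Z 0) hN') t
        (htime hε0 ht) x x'
    · have hmax : 0 < max 1 (|(t' : ℝ) - t| ^ (u / 4)) := lt_max_of_lt_left one_pos
      rw [mul_assoc ((κ₁ + κ₂ + 1).toNNReal : ℝ≥0∞), ← ENNReal.ofReal_mul hmax.le]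
      refine le_of_finite_norms hC0 (κ := κ₂) (by rw [hC]; linarith) (by positivity) (by positivity)
        fun hN hN' => ?_
      have key := htemp h _ (weightedNorm_pos h a (by omega) hN) _ ENNReal.toReal_nonneg
        (eLpNorm_le_weightedNorm ε a _ (Z 0) hN) (eLpNorm_sub_le_holderNorm hε0 a _ (Z 0) hN')
      rw [show u / 2 / 2 = u / 4 by ring] at key
      rw [mul_comm (max 1 _), mul_assoc 2 a ε]
      rcases le_total t t' with htt | htt
      · have := key t t' htt (htime hε0 ht') x
        rw [← eLpNorm_neg] at this
        rw [abs_of_nonneg (sub_nonneg.mpr (by exact_mod_cast htt))]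
        convert this using 2
        funext ω
        simp [Z]
      · rw [abs_sub_comm, abs_of_nonneg (sub_nonneg.mpr (by exact_mod_cast htt))]
        exact key t' t htt (htime hε0 ht) x
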